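/- Let $T,L>0$, $\mathbb T^3=(\mathbb R/L\mathbb Z)^3$, and identify functions (distributions) on $(0,T)\times\mathbb T^3$ with $x$-periodic ones on $(0,T)\times\mathbb R^3$. Let $b$ be a weak (distributional) solution on $(0,T)\times\mathbb T^3$ of the EMHD equations $$b_t+\nabla\times[(\nabla\times b)\times b]=0,\qquad \operatorname{div} b=0,$$ with current $j=\nabla\times b$, where $b$, $j$ and $j\times b$ are locally integrable. Let $A$ be a magnetic vector potential of $b$, i.e. $\nabla\times A=b$, $\operatorname{div}A=0$, such that for some $\pi\in L^1_{loc}((0,T)\times\mathbb T^3)$ $$A_t+(\nabla\times b)\times b+\nabla\pi=0$$ in the sense of distributions. Assume that $$j\in L^\infty(0,T;L^{3/2}(\mathbb T^3))\quad\text{and}\quad A\in C((0,T)\times\mathbb T^3).$$ Write $\delta b(\ell)=b(t,x+\ell)-b(t,x)$, let $\varphi\in C_c^\infty(\mathbb R^3)$ be nonnegative with unit integral, and let $\varphi_\varepsilon(x)=\varepsilon^{-3}\varphi(x/\varepsilon)$. Then the functions $$D_{mh}(b,\varepsilon)=-\tfrac12\int\nabla\varphi_\varepsilon(\ell)\cdot\delta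 b(\ell)\,|\delta b(\ell)|^2\,d\ell$$ are locally integrable and converge in the sense of distributions, as $\varepsilon\to0^+$, to a distribution $D_{mh}(b)$, which does not depend on the choice of $\varphi$. The distribution $\operatorname{div}(b\otimes b)$ is a locally integrable function, all products below are locally integrable, and $D_{mh}(b)$ satisfies the local balance of magnetic helicity $$\partial_t(b\cdot A)+\operatorname{div}\big([\operatorname{div}(b\otimes b)]\times A\big)+\operatorname{div}\big[(\pi-\tfrac12|b|^2)\,b\big]+\operatorname{div}\big(b|b|^2\big)=D_{mh}(b)$$ in the sense of distributions. Moreover, the locally integrable functions $$S(b,b,b;\lambda)=\frac1\lambda\int_{|\zeta|=1}\zeta\cdot\delta b(\lambda\zeta)\,|\delta b(\lambda\zeta)|^2\,\frac{d\sigma(\zeta)}{4\pi}$$ converge in the sense of distributions as $\lambda\to0^+$, and $S(b,b,b):=-\lim_{\lambda\to0}S(b,b,b;\lambda)$ satisfies $$S(b,b,b)=-\tfrac23\,D_{mh}(b)=-\tfrac43\cdot\tfrac12D_{mh}(b).$$ -/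

import Mathlib

open MeasureTheory Set Filter Topology TopologicalSpace
open scoped ENNReal NNReal Distributions LineDeriv

noncomputable section

namespace EMHD

/-- Three-dimensional Euclidean space. -/
abbrev E3 : Type := EuclideanSpace ℝ (Fin 3)

/-! ### Fields on `(0,T) × 𝕋³`

The torus is `𝕋³ = (ℝ / L ℤ)³` with an arbitrary period `L > 0`. Functions on `(0,T) × 𝕋³` are
functions `f (t, x)` that are `L`-periodic in every coordinate of `x`; distributions on
`(0,T) × 𝕋³` are handled as distributions on `(0,T) × ℝ³`, periodic in `x`. -/

/-- The open set `(0,T) × ℝ³` of space-time. -/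
def spaceTime (T : ℝ) : Opens (ℝ × E3) :=
  ⟨Ioo 0 T ×ˢ univ, isOpen_Ioo.prod isOpen_univ⟩

/-- The `i`-th vector of the standard basis of `ℝ³`. -/
def e (i : Fin 3) : E3 := EuclideanSpace.single i 1

/-- `L`-periodicity in space: `f` is a function on `(0,T) × (ℝ / L ℤ)³`. -/
def SpacePeriodic {F : Type*} (T L : ℝ) (f : ℝ × E3 → F) : Prop :=
  ∀ t ∈ Ioo 0 T, ∀ (x : E3) (i : Fin 3), f (t, x + L • e i) = f (t, x)

/-- The fundamental cell `[0,L)³` of the torus. -/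
def cell (L : ℝ) : Set E3 := {x | ∀ i, x i ∈ Ico 0 L}

/-- `f ∈ L^∞(0,T; L^p(𝕋³))`. -/
def MemLinftyLp {F : Type*} [NormedAddCommGroup F] (T L : ℝ) (p : ℝ≥0∞)
    (f : ℝ × E3 → F) : Prop :=
  AEStronglyMeasurable f (volume.restrict (spaceTime T : Set (ℝ × E3))) ∧
    ∃ C : ℝ≥0, ∀ᵐ t ∂(volume.restrict (Ioo 0 T)),
      eLpNorm (fun x => f (t, x)) p (volume.restrict (cell L)) ≤ C

/-- `f` is locally integrable on `(0,T) × 𝕋³`. -/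
abbrev LocInt {F : Type*} [NormedAddCommGroup F] (T : ℝ) (f : ℝ × E3 → F) : Prop :=
  LocallyIntegrableOn f (spaceTime T : Set (ℝ × E3)) volume

/-- The cross product of vectors of `ℝ³`. -/
def cross (u v : E3) : E3 := WithLp.toLp 2 (crossProduct (WithLp.ofLp u) (WithLp.ofLp v))

/-! ### Distributions on space-time -/

/-- Real distributions on `(0,T) × ℝ³`. -/
abbrev SpaceTimeDist (T : ℝ) : Type := 𝓓'(spaceTime T, ℝ)

/-- The distribution `ψ ↦ ∫ ψ f` given by a locally integrable function `f`
(wherever it is used below, local integrability is required alongside). -/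
def toDist (T : ℝ) (f : ℝ × E3 → ℝ) : SpaceTimeDist T :=
  TestFunction.integralAgainstBilinCLM (ContinuousLinearMap.mul ℝ ℝ) volume f

/-- The components of a locally integrable vector field, as distributions. -/
def toDistV (T : ℝ) (u : ℝ × E3 → E3) (i : Fin 3) : SpaceTimeDist T :=
  toDist T (fun z => u z i)

/-- The distributional time derivative `∂ₜ`. -/
def dt {T : ℝ} (S : SpaceTimeDist T) : SpaceTimeDist T := ∂_{((1 : ℝ), (0 : E3))} S

/-- The distributional space derivative `∂ᵢ`. -/
def dx {T : ℝ} (i : Fin 3) (S : SpaceTimeDist T) : SpaceTimeDist T := ∂_{((0 : ℝ), e i)} S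

/-- The distributional divergence `∑ᵢ ∂ᵢ Fᵢ`. -/
def div {T : ℝ} (F : Fin 3 → SpaceTimeDist T) : SpaceTimeDist T := ∑ i, dx i (F i)

/-- The distributional curl `∇ × F`. -/
def curl {T : ℝ} (F : Fin 3 → SpaceTimeDist T) : Fin 3 → SpaceTimeDist T :=
  ![dx 1 (F 2) - dx 2 (F 1), dx 2 (F 0) - dx 0 (F 2), dx 0 (F 1) - dx 1 (F 0)]

/-! ### The equations -/

/-- `b` is a weak solution on `(0,T) × 𝕋³` of
`b_t + ∇ × [(∇ × b) × b] = 0`, `div b = 0`, with current `j = ∇ × b`. -/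
structure IsWeakSolution (T L : ℝ) (b j : ℝ × E3 → E3) : Prop where
  periodic_b : SpacePeriodic T L b
  periodic_j : SpacePeriodic T L j
  locInt_b : LocInt T b
  locInt_j : LocInt T j
  locInt_hall : LocInt T (fun z => cross (j z) (b z))
  current : curl (toDistV T b) = toDistV T j
  div_free : div (toDistV T b) = 0
  equation : ∀ i, dt (toDistV T b i) + curl (toDistV T (fun z => cross (j z) (b z))) i = 0

/-- `A` is a vector potential of `b` (`∇ × A = b`, `div A = 0`) that satisfies
`A_t + j × b + ∇π = 0` on `(0,T) × 𝕋³` in the sense of distributions. -/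
structure IsVectorPotential (T L : ℝ) (b j A : ℝ × E3 → E3) (π : ℝ × E3 → ℝ) : Prop where
  periodic_A : SpacePeriodic T L A
  periodic_π : SpacePeriodic T L π
  locInt_A : LocInt T A
  locInt_π : LocInt T π
  curl_eq : curl (toDistV T A) = toDistV T b
  div_free : div (toDistV T A) = 0
  equation : ∀ i, dt (toDistV T A i) + toDistV T (fun z => cross (j z) (b z)) i
    + dx i (toDist T π) = 0

/-! ### Dissipation term and third-order structure function -/

/-- `φ` is a mollifier: a smooth nonnegative function of compact support with unit integral. -/
structure IsMollifier (φ : E3 → ℝ) : Prop where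
  smooth : ContDiff ℝ (⊤ : ℕ∞) φ
  compact : HasCompactSupport φ
  nonneg : ∀ x, 0 ≤ φ x
  integral_eq : ∫ x, φ x = 1

/-- The rescaled mollifier `φ_ε(x) = ε⁻³ φ(x / ε)`. -/
def rescale (φ : E3 → ℝ) (ε : ℝ) (x : E3) : ℝ := (ε ^ 3)⁻¹ * φ (ε⁻¹ • x)

/-- The increment `δb(ℓ) = b(t, x + ℓ) - b(t, x)` at `z = (t, x)`. -/
def incr (b : ℝ × E3 → E3) (z : ℝ × E3) (l : E3) : E3 := b (z.1, z.2 + l) - b z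

/-- `D_mh(b, ε) = -½ ∫ ∇φ_ε(ℓ) · δb(ℓ) |δb(ℓ)|² dℓ`. -/
def Dmh (φ : E3 → ℝ) (b : ℝ × E3 → E3) (ε : ℝ) (z : ℝ × E3) : ℝ :=
  -(1 / 2) * ∫ l : E3, inner ℝ (gradient (rescale φ ε) l) (incr b z l) * ‖incr b z l‖ ^ 2

/-- `S(b,b,b;r) = (1/r) ∫_{|ζ|=1} ζ · δb(rζ) |δb(rζ)|² dσ(ζ)/(4π)`, where `σ` is the surface
measure of the unit sphere. -/
def Sfun (b : ℝ × E3 → E3) (r : ℝ) (z : ℝ × E3) : ℝ :=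
  (1 / r) * ((1 / (4 * Real.pi)) *
    ∫ ζ : Metric.sphere (0 : E3) 1,
      inner ℝ (ζ : E3) (incr b z (r • (ζ : E3))) * ‖incr b z (r • (ζ : E3))‖ ^ 2
        ∂((volume : Measure E3).toSphere))

/-- Convergence in the sense of distributions, as the positive parameter tends to `0`, of a family
of locally integrable functions. -/
def TendstoDist {T : ℝ} (f : ℝ → ℝ × E3 → ℝ) (D : SpaceTimeDist T) : Prop :=
  (∀ ε > 0, LocInt T (f ε)) ∧
    ∀ ψ : 𝓓(spaceTime T, ℝ), Tendsto (fun ε => toDist T (f ε) ψ) (𝓝[>] 0) (𝓝 (D ψ))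

/-- The locally integrable field `G` is `div(b ⊗ b)`, that is `Gᵢ = ∑ₖ ∂ₖ(bₖ bᵢ)`. -/
def IsDivTensor (T : ℝ) (b G : ℝ × E3 → E3) : Prop :=
  LocInt T G ∧ (∀ i k, LocInt T (fun z => b z k * b z i)) ∧
    ∀ i, toDistV T G i = div (fun k => toDist T (fun z => b z k * b z i))

/-- The local balance of magnetic helicity, in the sense of distributions:
`∂ₜ(b·A) + div([div(b⊗b)] × A) + div((π - ½|b|²) b) + div(b|b|²) = D`. -/
def HelicityBalance (T : ℝ) (b A : ℝ × E3 → E3) (π : ℝ × E3 → ℝ) (D : SpaceTimeDist T) : Prop :=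
  LocInt T (fun z => inner ℝ (b z) (A z)) ∧
  LocInt T (fun z => (π z - ‖b z‖ ^ 2 / 2) • b z) ∧
  LocInt T (fun z => ‖b z‖ ^ 2 • b z) ∧
  ∃ G : ℝ × E3 → E3, IsDivTensor T b G ∧ LocInt T (fun z => cross (G z) (A z)) ∧
    dt (toDist T (fun z => inner ℝ (b z) (A z)))
      + div (toDistV T (fun z => cross (G z) (A z)))
      + div (toDistV T (fun z => (π z - ‖b z‖ ^ 2 / 2) • b z))
      + div (toDistV T (fun z => ‖b z‖ ^ 2 • b z)) = D

end EMHD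

end

/-! Fix a test function `ψ` and, for a space-time shift `h`, put `F_k(h) = ∫ ψ δ_h b_k |δ_h b|²`
(`Flow.cubic`). Everything rests on one fact: for shifts with small time part, the distributional
divergence of `F` in the space part of `h` is a continuous function `H` (`Flow.fluxC`), and `H(0)`
is twice the left side of the helicity balance tested against `ψ`. For a continuous field on `ℝ³`
with continuous weak divergence `H`, `-½ ∫ ∇φ_ε · F` tends to `H(0)/2` for every mollifier, while by
the divergence theorem on balls the mean flux through the sphere of radius `r`, divided by `r`,
tends to `H(0)/3` (`ContFlux.tendsto_mollifier`, `ContFlux.tendsto_sphere`). So the dissipation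
exists, does not depend on `φ`, equals the balance, and the two limits have ratio `2/3`.

The divergence of `F` is computed exactly. The cube expands into correlations of `b`, `b⊗b`, `b|b|²`
with their translates, and integration against a kernel turns translates into mollifications. Each
equation is then used in weak form against `ψ` times a mollified field, or in mollified form against
`ψ` times an unmollified one. With `N = j × b`, the Lamb form `div(b⊗b) = N + ∇|b|²/2` leaves `b ·
N_ρ + N · b_ρ`. The potential equation turns the first term into `-b · ∂ₜA_ρ - b · ∇π_ρ`, the
relation `curl A = b` turns the second into `N · curl A_ρ`, and the two cancel through the induction
equation. Only terms with a derivative on `ψ` survive (`Flow.flux_identity`,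
`Flow.integral_pd_mul_cubic`), and at zero shift the cubic ones among them cancel
(`Flow.fluxC_zero`).

These manipulations need `b ∈ L³` and a pressure in `L^{3/2}`. A Calderón–Zygmund estimate on the
torus bounds `∇b` in `L^{3/2}` by `j`. Since `b = curl A` with `A` bounded, `∫|b_l|³` is integrated
by parts into `∫ |A| |b_l| |∇b_l|` and absorbed by Young's inequality (`integral_abs_cube_le`,
`Window.exists_bound_cube`). The potential equation with `div A = 0` gives `Δπ` as a double
divergence of the Maxwell stress, so `π` minus its spatial mean is in `L^{3/2}`; the mean, a
function of time only, drops out because `div b = 0`. The Calderón–Zygmund estimate is obtained from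
the heat flow of trigonometric polynomials: a product of two Riesz transforms is a time integral of
`∂ᵢu ∂ⱼv`, and this integrand is dominated by the dissipation of the convex function `(u +
v²)^{3/2}` (`TrigPoly.abs_integral_riesz_le`).

Finally `∇|b|²/2 = Σ_l b_l ∇b_l` is integrable because `∇b ∈ L^{3/2}`, so `div(b⊗b)` is a function,
and `div(∇E × A) = -div(E b)` for `E = |b|²/2` brings the balance into the stated form
(`Flow.integral_grad_cross`, `Window.flux_eq`). All estimates are made on slabs `(α, β) × ℝ³` with
`0 < α`, `β < T`, where `A` is bounded; every test function lives in such a slab. -/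

noncomputable section

namespace EMHD

/-! ### Periodic functions on `ℝ³` and integrals over the fundamental cell -/

/-- `f` is `L`-periodic in every coordinate. -/
def Per {F : Type*} (L : ℝ) (f : E3 → F) : Prop :=
  ∀ (x : E3) (i : Fin 3), f (x + L • e i) = f x

/-- The basis `L e₁, L e₂, L e₃` of `ℝ³`. -/
def latticeBasis {L : ℝ} (hL : 0 < L) : Module.Basis (Fin 3) ℝ E3 :=
  (EuclideanSpace.basisFun (Fin 3) ℝ).toBasis.isUnitSMul (fun _ => hL.ne'.isUnit)

lemma latticeBasis_apply {L : ℝ} (hL : 0 < L) (i : Fin 3) : latticeBasis hL i = L • e i := by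
  rw [latticeBasis, Module.Basis.isUnitSMul_apply]
  simp [e]

lemma cell_eq_fundamentalDomain {L : ℝ} (hL : 0 < L) :
    cell L = ZSpan.fundamentalDomain (latticeBasis hL) := by
  ext x
  rw [ZSpan.mem_fundamentalDomain]
  have : ∀ i, (latticeBasis hL).repr x i = L⁻¹ * x i := by
    intro i
    simp [latticeBasis, Module.Basis.repr_isUnitSMul, Units.smul_def]
  simp only [this, cell, mem_ofPred_eq, mem_Ico]
  refine forall_congr' fun i => ?_
  rw [inv_mul_lt_iff₀ hL, mul_one]
  refine and_congr ?_ Iff.rfl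
  exact ⟨fun h => by positivity, fun h => by
    have := mul_nonneg hL.le h
    rwa [mul_inv_cancel_left₀ hL.ne'] at this⟩

lemma measurableSet_cell (L : ℝ) : MeasurableSet (cell L) := by
  have : cell L = ⋂ i : Fin 3, (fun x : E3 => x i) ⁻¹' Ico 0 L := by
    ext x; simp [cell]
  rw [this]
  exact MeasurableSet.iInter fun i => measurableSet_Ico.preimage (by fun_prop)

lemma cell_subset_closedBall (L : ℝ) : cell L ⊆ Metric.closedBall 0 (3 * |L|) := by
  intro x hx
  have h : ∀ i, |x i| ≤ |L| := fun i => by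
    have := hx i
    rw [abs_of_nonneg this.1]; exact this.2.le.trans (le_abs_self L)
  rw [mem_closedBall_zero_iff, EuclideanSpace.norm_eq]
  apply Real.sqrt_le_iff.2
  refine ⟨by positivity, ?_⟩
  rw [Fin.sum_univ_three]
  have h2 : ∀ i, ‖x i‖ ^ 2 ≤ |L| ^ 2 := fun i => by
    rw [Real.norm_eq_abs]; exact pow_le_pow_left₀ (abs_nonneg _) (h i) 2
  nlinarith [h2 0, h2 1, h2 2, sq_nonneg L, sq_abs L]

lemma volume_cell_lt_top (L : ℝ) : volume (cell L) < ∞ :=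
  (measure_mono (cell_subset_closedBall L)).trans_lt measure_closedBall_lt_top

lemma volume_cell_pos {L : ℝ} (hL : 0 < L) : 0 < volume (cell L) := by
  rw [cell_eq_fundamentalDomain hL]
  exact (ZSpan.measure_fundamentalDomain_ne_zero (latticeBasis hL)).bot_lt

lemma integrableOn_cell {F : Type*} [NormedAddCommGroup F] {L : ℝ} {f : E3 → F}
    (hf : Continuous f) : IntegrableOn f (cell L) :=
  (hf.continuousOn.integrableOn_compact (isCompact_closedBall 0 (3 * |L|))).mono_set
    (cell_subset_closedBall L)

lemma Per.vadd {F : Type*} {L : ℝ} (hL : 0 < L) {f : E3 → F} (hf : Per L f)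
    (g : Submodule.span ℤ (range (latticeBasis hL))) (x : E3) : f (g +ᵥ x) = f x := by
  obtain ⟨g, hg⟩ := g
  change f (g + x) = f x
  induction hg using Submodule.span_induction generalizing x with
  | mem y hy =>
    obtain ⟨i, rfl⟩ := hy
    rw [latticeBasis_apply, add_comm, hf]
  | zero => rw [zero_add]
  | add y z _ _ hy hz => rw [add_assoc, hy, hz]
  | smul a y _ hy =>
    have hn : ∀ (n : ℕ) (x : E3), f (n • y + x) = f x := by
      intro n
      induction n with
      | zero => intro x; simp
      | succ n ih => intro x; rw [succ_nsmul, add_assoc, ih, hy]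
    obtain ⟨n, rfl | rfl⟩ := a.eq_nat_or_neg
    · simpa using hn n x
    · have := hn n (-(n : ℤ) • y + x)
      rw [← this]; congr 1; simp

instance {L : ℝ} (hL : 0 < L) :
    VAddInvariantMeasure (Submodule.span ℤ (range (latticeBasis hL))) E3 volume :=
  ⟨fun c s _ => measure_preimage_add volume (c : E3) s⟩

lemma isAddFundamentalDomain_cell {L : ℝ} (hL : 0 < L) :
    IsAddFundamentalDomain (Submodule.span ℤ (range (latticeBasis hL))) (cell L) volume := by
  rw [cell_eq_fundamentalDomain hL]
  exact ZSpan.isAddFundamentalDomain _ _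

-- A translate of the cell is again a fundamental domain of the lattice, and a lattice-invariant
-- function has the same integral over any two fundamental domains.
open scoped Pointwise in
lemma lintegral_cell_shift {L : ℝ} (hL : 0 < L) {f : E3 → ℝ≥0∞} (hf : Per L f) (y : E3) :
    ∫⁻ x in cell L, f (x + y) = ∫⁻ x in cell L, f x := by
  have h1 := isAddFundamentalDomain_cell hL
  rw [h1.setLIntegral_eq (h1.vadd_of_comm y) f (hf.vadd hL)]
  have h2 := (measurePreserving_add_right (volume : Measure E3) y).setLIntegral_comp_preimage_emb
    (measurableEmbedding_addRight y) f (y +ᵥ cell L)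
  rw [← h2]
  congr 2
  ext x
  simp [mem_vadd_set_iff_neg_vadd_mem, add_comm]

open scoped Pointwise in
lemma integral_cell_shift {L : ℝ} (hL : 0 < L) {f : E3 → ℝ} (hf : Per L f) (y : E3) :
    ∫ x in cell L, f (x + y) = ∫ x in cell L, f x := by
  have h1 := isAddFundamentalDomain_cell hL
  rw [h1.setIntegral_eq (h1.vadd_of_comm y) (hf.vadd hL)]
  have h2 := (measurePreserving_add_right (volume : Measure E3) y).setIntegral_preimage_emb
    (measurableEmbedding_addRight y) f (y +ᵥ cell L)
  rw [← h2]
  congr 2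
  ext x
  simp [mem_vadd_set_iff_neg_vadd_mem, add_comm]

/-- The integral over the cell of a partial derivative of a periodic function vanishes. -/
lemma integral_cell_deriv {L : ℝ} (hL : 0 < L) {f f' : E3 → ℝ} (hf : Per L f) (i : Fin 3)
    (hd : ∀ x, HasDerivAt (fun s : ℝ => f (x + s • e i)) (f' x) 0)
    (hc : Continuous f') (hfc : Continuous f) (hf' : Per L f') :
    ∫ x in cell L, f' x = 0 := by
  have hd' : ∀ x s, HasDerivAt (fun s : ℝ => f (x + s • e i)) (f' (x + s • e i)) s := by
    intro x s
    have h := hd (x + s • e i)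
    rw [← sub_self s] at h
    refine (h.comp_sub_const s s).congr_of_eventuallyEq (Eventually.of_forall fun r => ?_)
    simp only [add_assoc, ← add_smul, add_sub_cancel]
  -- Averaging the derivative over shifts `s ∈ [0,1]` gives a difference of `f` and its translate,
  -- whose integral over the cell vanishes; by Fubini and translation invariance the average has the
  -- same integral as `f'`. No boundary terms on the cell have to be handled.
  have h1 : ∀ x, ∫ s in (0 : ℝ)..1, f' (x + s • e i) = f (x + (1 : ℝ) • e i) - f x := by
    intro x
    rw [intervalIntegral.integral_eq_sub_of_hasDerivAt (fun s _ => hd' x s)]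
    · simp
    · exact (by fun_prop : Continuous fun s : ℝ => f' (x + s • e i)).intervalIntegrable _ _
  have h2 : ∫ x in cell L, (∫ s in (0 : ℝ)..1, f' (x + s • e i)) = 0 := by
    simp_rw [h1]
    rw [integral_sub (integrableOn_cell (by fun_prop)) (integrableOn_cell hfc),
      integral_cell_shift hL hf, sub_self]
  rw [← h2]
  have h3 : ∀ s : ℝ, ∫ x in cell L, f' (x + s • e i) = ∫ x in cell L, f' x :=
    fun s => integral_cell_shift hL hf' _
  have h4 := intervalIntegral_integral_swap (f := fun s x => f' (x + s • e i)) (a := 0) (b := 1)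
    (μ := volume.restrict (cell L)) ?_
  · rw [← h4]; simp [h3]
  · have : Continuous (Function.uncurry fun (s : ℝ) (x : E3) => f' (x + s • e i)) := by
      fun_prop
    rw [Measure.prod_restrict]
    refine (this.continuousOn.integrableOn_compact
      (isCompact_uIcc.prod (isCompact_closedBall (0 : E3) (3 * |L|)))).mono_set
        (prod_mono uIoc_subset_uIcc (cell_subset_closedBall L))

/-! ### Trigonometric polynomials and their heat flow -/

/-- The data of a real trigonometric polynomial `∑ₘ aₘ cos (κ kₘ · x + θₘ)` in three variables. -/
structure TrigPoly where
  /-- the number of terms -/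
  n : ℕ
  /-- the amplitudes -/
  amp : Fin n → ℝ
  /-- the phases -/
  phase : Fin n → ℝ
  /-- the frequencies -/
  freq : Fin n → Fin 3 → ℤ

namespace TrigPoly

/-- The square of the length of a frequency. -/
def nsq (k : Fin 3 → ℤ) : ℝ := ∑ i, (k i : ℝ) ^ 2

lemma nsq_nonneg (k : Fin 3 → ℤ) : 0 ≤ nsq k := Finset.sum_nonneg fun _ _ => sq_nonneg _

lemma one_le_nsq {k : Fin 3 → ℤ} (hk : k ≠ 0) : 1 ≤ nsq k := by
  obtain ⟨i, hi⟩ := Function.ne_iff.1 hk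
  have h1 : (1 : ℝ) ≤ (k i : ℝ) ^ 2 := by
    have : 0 < (k i) ^ 2 := by
      have : k i ≠ 0 := hi
      positivity
    exact_mod_cast this
  exact h1.trans (Finset.single_le_sum (f := fun i => (k i : ℝ) ^ 2) (fun _ _ => sq_nonneg _)
    (Finset.mem_univ i))

/-- The solution of the heat equation at time `t` with a trigonometric polynomial as initial
datum. -/
def eval (κ : ℝ) (p : TrigPoly) (t : ℝ) (x : E3) : ℝ :=
  ∑ m, p.amp m * Real.exp (-(κ ^ 2 * nsq (p.freq m)) * t) *
    Real.cos (κ * ∑ i, (p.freq m i : ℝ) * x i + p.phase m)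

/-- Apply the Fourier multiplier `c` and shift all the phases by `s`. -/
def op (p : TrigPoly) (c : (Fin 3 → ℤ) → ℝ) (s : ℝ) : TrigPoly :=
  ⟨p.n, fun m => p.amp m * c (p.freq m), fun m => p.phase m + s, p.freq⟩

variable {κ : ℝ} (p : TrigPoly) (c d : (Fin 3 → ℤ) → ℝ) (s r t : ℝ) (x : E3)

lemma eval_op : (p.op c s).eval κ t x = ∑ m, p.amp m * c (p.freq m) *
    Real.exp (-(κ ^ 2 * nsq (p.freq m)) * t) *
    Real.cos (κ * ∑ i, (p.freq m i : ℝ) * x i + (p.phase m + s)) := rfl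

/-- Derivatives, time evolution, inverse Laplacian and Riesz transforms are all of the form `op`, so
identities between operators reduce to identities between symbols and phases. -/
lemma op_op : (p.op c s).op d r = p.op (fun k => c k * d k) (s + r) := by
  simp only [op, mul_assoc, add_assoc]

lemma eval_op_one_zero : (p.op (fun _ => 1) 0).eval κ t x = p.eval κ t x := by
  rw [eval_op]; simp [eval]

lemma eval_op_add_pi : (p.op c (s + Real.pi)).eval κ t x = -(p.op c s).eval κ t x := by
  simp only [eval_op, ← Finset.sum_neg_distrib]
  refine Finset.sum_congr rfl fun m _ => ?_
  rw [← add_assoc, ← add_assoc, ← add_assoc, Real.cos_add_pi]; ring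

lemma eval_op_neg : (p.op (fun k => -c k) s).eval κ t x = -(p.op c s).eval κ t x := by
  simp only [eval_op, ← Finset.sum_neg_distrib]
  exact Finset.sum_congr rfl fun m _ => by ring

lemma sum_eval_op (c : Fin 3 → (Fin 3 → ℤ) → ℝ) :
    ∑ i, (p.op (c i) s).eval κ t x = (p.op (fun k => ∑ i, c i k) s).eval κ t x := by
  simp only [eval_op]
  rw [Finset.sum_comm]
  refine Finset.sum_congr rfl fun m _ => ?_
  simp only [Finset.mul_sum, Finset.sum_mul]

lemma continuous_eval : Continuous fun z : ℝ × E3 => p.eval κ z.1 z.2 := by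
  unfold eval; fun_prop

@[fun_prop]
lemma continuous_eval' : Continuous fun x : E3 => p.eval κ t x := by
  unfold eval; fun_prop

lemma hasDerivAt_time :
    HasDerivAt (fun t => p.eval κ t x) ((p.op (fun k => -(κ ^ 2 * nsq k)) 0).eval κ t x) t := by
  rw [eval_op]
  unfold eval
  refine HasDerivAt.fun_sum fun m _ => ?_
  have h := ((((hasDerivAt_id t).const_mul (-(κ ^ 2 * nsq (p.freq m)))).exp).const_mul
    (p.amp m)).mul_const (Real.cos (κ * ∑ i, (p.freq m i : ℝ) * x i + p.phase m))
  refine h.congr_deriv ?_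
  simp only [id, add_zero]; ring

lemma hasDerivAt_space (i : Fin 3) :
    HasDerivAt (fun r : ℝ => p.eval κ t (x + r • e i))
      ((p.op (fun k => κ * k i) (Real.pi / 2)).eval κ t x) 0 := by
  rw [eval_op]
  unfold eval
  refine HasDerivAt.fun_sum fun m _ => ?_
  have h0 : ∀ r : ℝ, κ * ∑ j, (p.freq m j : ℝ) * (x + r • e i) j + p.phase m
      = r * (κ * p.freq m i) + (κ * ∑ j, (p.freq m j : ℝ) * x j + p.phase m) := by
    intro r
    have : ∑ j, (p.freq m j : ℝ) * (x + r • e i) j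
        = ∑ j, (p.freq m j : ℝ) * x j + r * p.freq m i := by
      simp only [PiLp.add_apply, PiLp.smul_apply, e, EuclideanSpace.single, PiLp.single_apply, smul_eq_mul,
        mul_add, Finset.sum_add_distrib]
      simp [mul_comm]
    rw [this]; ring
  simp_rw [h0]
  have h := ((((hasDerivAt_id (0 : ℝ)).mul_const (κ * p.freq m i)).add_const
    (κ * ∑ j, (p.freq m j : ℝ) * x j + p.phase m)).cos).const_mul
      (p.amp m * Real.exp (-(κ ^ 2 * nsq (p.freq m)) * t))
  refine h.congr_deriv ?_
  simp only [id, zero_mul, zero_add, one_mul]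
  rw [← add_assoc (κ * ∑ j, (p.freq m j : ℝ) * x j) _ _, Real.cos_add_pi_div_two]; ring

lemma per_eval {L : ℝ} (hL : 0 < L) (hκ : κ = 2 * Real.pi / L) : Per L (p.eval κ t) := by
  intro x i
  unfold eval
  refine Finset.sum_congr rfl fun m _ => ?_
  have h0 : κ * ∑ j, (p.freq m j : ℝ) * (x + L • e i) j + p.phase m
      = (κ * ∑ j, (p.freq m j : ℝ) * x j + p.phase m) + p.freq m i * (2 * Real.pi) := by
    have : ∑ j, (p.freq m j : ℝ) * (x + L • e i) j
        = ∑ j, (p.freq m j : ℝ) * x j + L * p.freq m i := by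
      simp only [PiLp.add_apply, PiLp.smul_apply, e, EuclideanSpace.single, PiLp.single_apply, smul_eq_mul,
        mul_add, Finset.sum_add_distrib]
      simp [mul_comm]
    rw [this, hκ]; field_simp; ring
  rw [h0, Real.cos_add_int_mul_two_pi]

/-- A trigonometric polynomial without constant term decays under the heat flow. -/
lemma abs_eval_op_le (hc : c 0 = 0) (ht : 0 ≤ t) :
    |(p.op c s).eval κ t x| ≤ (∑ m, |p.amp m * c (p.freq m)|) * Real.exp (-κ ^ 2 * t) := by
  rw [eval_op, Finset.sum_mul]
  refine (Finset.abs_sum_le_sum_abs _ _).trans (Finset.sum_le_sum fun m _ => ?_)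
  rw [abs_mul, abs_mul, Real.abs_exp, mul_assoc]
  by_cases hk : p.freq m = 0
  · simp [hk, hc]
  refine mul_le_mul_of_nonneg_left ?_ (abs_nonneg _)
  refine (mul_le_of_le_one_right (Real.exp_nonneg _) (Real.abs_cos_le_one _)).trans ?_
  rw [Real.exp_le_exp]
  nlinarith [mul_nonneg (mul_nonneg (sq_nonneg κ) (sub_nonneg.2 (one_le_nsq hk))) ht]

/-- This is the real part of `e^{iα}` times the Gaussian characteristic function. -/
lemma integral_cos_stdGaussian (v : E3) (α : ℝ) :
    ∫ z, Real.cos (inner ℝ z v + α) ∂(ProbabilityTheory.stdGaussian E3)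
      = Real.exp (-‖v‖ ^ 2 / 2) * Real.cos α := by
  have h := ProbabilityTheory.charFun_stdGaussian v
  rw [charFun_apply] at h
  have h1 : ∀ z : E3, Real.cos (inner ℝ z v + α)
      = (Complex.exp (α * Complex.I) * Complex.exp (inner ℝ z v * Complex.I)).re := by
    intro z
    rw [← Complex.exp_add, ← add_mul, ← Complex.ofReal_add, Complex.exp_ofReal_mul_I_re, add_comm]
  have hi : Integrable (fun z : E3 => Complex.exp (α * Complex.I) *
      Complex.exp (inner ℝ z v * Complex.I)) (ProbabilityTheory.stdGaussian E3) := by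
    refine Integrable.of_bound (C := 1) (by fun_prop) (Eventually.of_forall fun z => ?_)
    rw [norm_mul, Complex.norm_exp_ofReal_mul_I, Complex.norm_exp_ofReal_mul_I, one_mul]
  simp_rw [h1]
  have h2 := integral_re hi
  simp only [RCLike.re_to_complex] at h2
  rw [h2, integral_const_mul, h]
  have : Complex.exp (-(‖v‖ : ℂ) ^ 2 / 2) = ((Real.exp (-‖v‖ ^ 2 / 2) : ℝ) : ℂ) := by
    push_cast; rfl
  rw [this, mul_comm, Complex.re_ofReal_mul, Complex.exp_ofReal_mul_I_re]

/-- The heat kernel at time `t` is the law of `√(2t)` times a standard Gaussian, so each cosine is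
multiplied by its decay factor. Written as an average, the flow visibly preserves positivity. -/
lemma eval_eq_integral_gaussian (ht : 0 ≤ t) :
    p.eval κ t x = ∫ z, p.eval κ 0 (x + Real.sqrt (2 * t) • z)
      ∂(ProbabilityTheory.stdGaussian E3) := by
  unfold eval
  rw [integral_finsetSum]
  · refine Finset.sum_congr rfl fun m _ => ?_
    rw [integral_const_mul, mul_zero, Real.exp_zero, mul_one, mul_assoc]
    congr 1
    set v : E3 := (κ * Real.sqrt (2 * t)) • WithLp.toLp 2 (fun i => (p.freq m i : ℝ)) with hv
    have h0 : ∀ z : E3, κ * ∑ j, (p.freq m j : ℝ) * (x + Real.sqrt (2 * t) • z) j + p.phase m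
        = inner ℝ z v + (κ * ∑ j, (p.freq m j : ℝ) * x j + p.phase m) := by
      intro z
      rw [hv, inner_smul_right, PiLp.inner_apply]
      simp only [PiLp.add_apply, PiLp.smul_apply, smul_eq_mul, mul_add, Finset.sum_add_distrib,
        RCLike.inner_apply, conj_trivial]
      simp only [Fin.sum_univ_three]; ring
    simp_rw [h0]
    rw [integral_cos_stdGaussian]
    congr 2
    have h1 : ‖v‖ ^ 2 = κ ^ 2 * (2 * t) * nsq (p.freq m) := by
      rw [hv, norm_smul, mul_pow, EuclideanSpace.norm_sq_eq]
      simp only [Real.norm_eq_abs, sq_abs, mul_pow, Real.sq_sqrt (by positivity : 0 ≤ 2 * t), nsq]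
    rw [h1]; ring
  · intro m _
    refine Integrable.const_mul ?_ _
    refine Integrable.of_bound (C := 1) (by fun_prop) (Eventually.of_forall fun z => ?_)
    exact Real.abs_cos_le_one _

/-- The heat flow is positive. -/
lemma eval_pos (h : ∀ x, 0 < p.eval κ 0 x) (ht : 0 ≤ t) : 0 < p.eval κ t x := by
  rw [p.eval_eq_integral_gaussian t x ht]
  have hi : Integrable (fun z : E3 => p.eval κ 0 (x + Real.sqrt (2 * t) • z))
      (ProbabilityTheory.stdGaussian E3) := by
    refine Integrable.of_bound (C := ∑ m, |p.amp m|) (by fun_prop) (Eventually.of_forall fun z => ?_)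
    unfold eval
    refine (Finset.abs_sum_le_sum_abs _ _).trans (Finset.sum_le_sum fun m _ => ?_)
    simp only [mul_zero, Real.exp_zero, mul_one, abs_mul]
    exact mul_le_of_le_one_right (abs_nonneg _) (Real.abs_cos_le_one _)
  rw [integral_pos_iff_support_of_nonneg (fun z => (h _).le) hi]
  have : Function.support (fun z : E3 => p.eval κ 0 (x + Real.sqrt (2 * t) • z)) = univ := by
    ext z; simp [(h _).ne']
  rw [this]; simp

end TrigPoly

/-! ### Density of the trigonometric polynomials -/

lemma Per.add_int {F : Type*} {L : ℝ} (hL : 0 < L) {f : E3 → F} (hf : Per L f) (x : E3)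
    (n : Fin 3 → ℤ) : f (WithLp.toLp 2 (fun i => x i + L * n i)) = f x := by
  have hm : ∑ i, n i • latticeBasis hL i ∈ Submodule.span ℤ (range (latticeBasis hL)) :=
    Submodule.sum_mem _ fun i _ => Submodule.smul_mem _ _ (Submodule.subset_span ⟨i, rfl⟩)
  rw [← hf.vadd hL ⟨_, hm⟩ x]
  change _ = f (∑ i, n i • latticeBasis hL i + x)
  congr 1
  ext j
  simp only [latticeBasis_apply, PiLp.add_apply,
    Fin.sum_univ_three]
  fin_cases j <;> simp [e, mul_comm, add_comm]

/-- The projection of `ℝ³` onto the torus. -/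
def toTorus (L : ℝ) (x : E3) : UnitAddTorus (Fin 3) := fun i => ((x i / L : ℝ) : UnitAddCircle)

lemma isOpenQuotientMap_coe : IsOpenQuotientMap
    (Pi.map fun (_ : Fin 3) (r : ℝ) => (r : UnitAddCircle)) :=
  IsOpenQuotientMap.piMap fun _ => QuotientAddGroup.isOpenQuotientMap_mk

/-- Choosing representatives gives a function on the torus; it is continuous because its pullback
along the open quotient map is. The values are complex because the density of characters is a
statement over `ℂ`. -/
lemma exists_torus_lift {L : ℝ} (hL : 0 < L) {g : E3 → ℝ} (hg : Continuous g) (hp : Per L g) :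
    ∃ G : C(UnitAddTorus (Fin 3), ℂ), ∀ x, G (toTorus L x) = g x := by
  let r : UnitAddTorus (Fin 3) → E3 := fun y => WithLp.toLp 2 (fun i => L * (y i).out)
  have hr : ∀ u : Fin 3 → ℝ, g (r (fun i => (u i : UnitAddCircle)))
      = g (WithLp.toLp 2 (fun i => L * u i)) := by
    intro u
    have h1 : ∀ i, ∃ n : ℤ, (QuotientAddGroup.mk (u i) : UnitAddCircle).out = u i + n := by
      intro i
      obtain ⟨h, hh⟩ := QuotientAddGroup.mk_out_eq_add (AddSubgroup.zmultiples (1 : ℝ)) (u i)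
      obtain ⟨n, hn⟩ := AddSubgroup.mem_zmultiples_iff.1 h.2
      refine ⟨n, ?_⟩
      rw [hh, ← hn]; simp
    choose n hn using h1
    rw [← hp.add_int hL (WithLp.toLp 2 (fun i => L * u i)) n]
    congr 1
    ext i
    change L * (QuotientAddGroup.mk (u i) : UnitAddCircle).out = L * u i + L * n i
    rw [hn]; ring
  refine ⟨⟨fun y => (g (r y) : ℂ), ?_⟩, fun x => ?_⟩
  · rw [isOpenQuotientMap_coe.isQuotientMap.continuous_iff]
    have : (fun y => (g (r y) : ℂ)) ∘ (Pi.map fun (_ : Fin 3) (r : ℝ) => (r : UnitAddCircle))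
        = fun u => (g (WithLp.toLp 2 (fun i => L * u i)) : ℂ) := by
      ext u; exact congrArg _ (hr u)
    rw [this]
    fun_prop
  · change ((g (r (toTorus L x)) : ℝ) : ℂ) = g x
    rw [show toTorus L x = fun i => ((x i / L : ℝ) : UnitAddCircle) from rfl, hr]
    congr 2
    ext i
    simp only
    field_simp

/-- The modulus and argument of a Fourier coefficient become the amplitude and phase of a real term.
Real parts suffice when the function to be approximated is real. -/
lemma re_smul_mFourier (L : ℝ) (c : ℂ) (k : Fin 3 → ℤ) (x : E3) :
    (c * UnitAddTorus.mFourier k (toTorus L x)).re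
      = ‖c‖ * Real.cos (2 * Real.pi / L * ∑ i, (k i : ℝ) * x i + c.arg) := by
  have h1 : UnitAddTorus.mFourier k (toTorus L x)
      = Complex.exp ((2 * Real.pi / L * ∑ i, (k i : ℝ) * x i : ℝ) * Complex.I) := by
    change ∏ i, fourier (k i) ((x i / L : ℝ) : UnitAddCircle) = _
    simp_rw [fourier_coe_apply]
    rw [← Complex.exp_sum]
    congr 1
    push_cast
    simp only [Fin.sum_univ_three]; ring
  conv_lhs => rw [← Complex.norm_mul_exp_arg_mul_I c, h1]
  rw [mul_assoc, ← Complex.exp_add, ← add_mul, ← Complex.ofReal_add, Complex.re_ofReal_mul,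
    Complex.exp_ofReal_mul_I_re, add_comm]

/-- Trigonometric polynomials are uniformly dense in the continuous periodic functions. -/
lemma exists_trigPoly_close {L : ℝ} (hL : 0 < L) {g : E3 → ℝ} (hg : Continuous g)
    (hp : Per L g) {η : ℝ} (hη : 0 < η) :
    ∃ p : TrigPoly, ∀ x, |p.eval (2 * Real.pi / L) 0 x - g x| < η := by
  obtain ⟨G, hG⟩ := exists_torus_lift hL hg hp
  have h1 : G ∈ (Submodule.span ℂ (range (UnitAddTorus.mFourier (d := Fin 3)))).topologicalClosure :=
    by rw [UnitAddTorus.span_mFourier_closure_eq_top]; trivial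
  obtain ⟨s, hs, hd⟩ := Metric.mem_closure_iff.1 h1 η hη
  obtain ⟨c, rfl⟩ := Finsupp.mem_span_range_iff_exists_finsupp.1 hs
  let E := c.support.equivFin.symm
  refine ⟨⟨c.support.card, fun m => ‖c (E m)‖, fun m => (c (E m)).arg, fun m => E m⟩, fun x => ?_⟩
  have h2 : TrigPoly.eval (2 * Real.pi / L)
      ⟨c.support.card, fun m => ‖c (E m)‖, fun m => (c (E m)).arg, fun m => E m⟩ 0 x
      = ((c.sum fun i a => a • UnitAddTorus.mFourier i) (toTorus L x)).re := by
    unfold TrigPoly.eval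
    simp only [mul_zero, Real.exp_zero, mul_one]
    rw [Finsupp.sum, ContinuousMap.sum_apply, Complex.re_sum]
    simp only [ContinuousMap.smul_apply, smul_eq_mul, re_smul_mFourier]
    rw [← Finset.sum_coe_sort c.support]
    exact E.sum_comp (fun k : c.support => ‖c k‖ * Real.cos (2 * Real.pi / L *
      ∑ i, ((k : Fin 3 → ℤ) i : ℝ) * x i + (c k).arg))
  rw [h2]
  have h3 : ((G (toTorus L x)).re : ℝ) = g x := by rw [hG, Complex.ofReal_re]
  rw [← h3, ← Complex.sub_re]
  refine (Complex.abs_re_le_norm _).trans_lt ?_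
  rw [dist_comm, dist_eq_norm] at hd
  refine (ContinuousMap.norm_coe_le_norm ((c.sum fun i a => a • UnitAddTorus.mFourier i) - G)
    (toTorus L x)).trans_lt hd

/-! ### The heat flow and the Bellman function `(u + v²)^{3/2}` -/

/-- Integration by parts on the torus. -/
lemma integral_cell_by_parts {L : ℝ} (hL : 0 < L) {f f' g g' : E3 → ℝ} (i : Fin 3)
    (hf : Per L f) (hf' : Per L f') (hg : Per L g) (hg' : Per L g')
    (cf : Continuous f) (cf' : Continuous f') (cg : Continuous g) (cg' : Continuous g')
    (hdf : ∀ x, HasDerivAt (fun s : ℝ => f (x + s • e i)) (f' x) 0)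
    (hdg : ∀ x, HasDerivAt (fun s : ℝ => g (x + s • e i)) (g' x) 0) :
    ∫ x in cell L, f' x * g x = -∫ x in cell L, f x * g' x := by
  have h := integral_cell_deriv hL (f := fun x => f x * g x)
    (f' := fun x => f' x * g x + f x * g' x) (fun x j => by simp only [hf x j, hg x j]) i
    (fun x => ((hdf x).fun_mul (hdg x)).congr_deriv (by simp)) (by fun_prop) (by fun_prop)
    (fun x j => by simp only [hf x j, hg x j, hf' x j, hg' x j])
  rw [integral_add (integrableOn_cell (by fun_prop)) (integrableOn_cell (by fun_prop))] at h
  linarith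

lemma integrable_uIoc_prod_cell {F : ℝ × E3 → ℝ} (hF : Continuous F) (a b L : ℝ) :
    Integrable F ((volume.restrict (uIoc a b)).prod (volume.restrict (cell L))) := by
  rw [Measure.prod_restrict]
  exact (hF.continuousOn.integrableOn_compact
      (isCompact_uIcc.prod (isCompact_closedBall (0 : E3) (3 * |L|)))).mono_set
        (prod_mono uIoc_subset_uIcc (cell_subset_closedBall L))

lemma intervalIntegrable_integral_cell {F : ℝ × E3 → ℝ} (hF : Continuous F) (a b L : ℝ) :
    IntervalIntegrable (fun t => ∫ x in cell L, F (t, x)) volume a b := by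
  rw [intervalIntegrable_iff]
  exact (integrable_uIoc_prod_cell hF a b L).integral_prod_left

/-- The evolution of the integral over the cell of a function of space and time. -/
lemma integral_cell_sub_eq {F F' : ℝ × E3 → ℝ} (hF : Continuous F) (hF' : Continuous F') {τ : ℝ}
    (hτ : 0 ≤ τ) (L : ℝ)
    (hd : ∀ t x, 0 ≤ t → HasDerivAt (fun t => F (t, x)) (F' (t, x)) t) :
    (∫ x in cell L, F (τ, x)) - ∫ x in cell L, F (0, x)
      = ∫ t in (0 : ℝ)..τ, ∫ x in cell L, F' (t, x) := by
  have h1 : ∀ x, ∫ t in (0 : ℝ)..τ, F' (t, x) = F (τ, x) - F (0, x) := by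
    intro x
    rw [intervalIntegral.integral_eq_sub_of_hasDerivAt (fun t ht => hd t x ?_)]
    · exact (by fun_prop : Continuous fun t : ℝ => F' (t, x)).intervalIntegrable _ _
    · rw [uIcc_of_le hτ] at ht; exact ht.1
  rw [intervalIntegral_integral_swap (f := fun t x => F' (t, x))
    (integrable_uIoc_prod_cell hF' 0 τ L)]
  simp_rw [h1]
  rw [integral_sub (integrableOn_cell (by fun_prop)) (integrableOn_cell (by fun_prop))]

/-! ### Dissipation of the Bellman function and the bilinear estimate for Riesz transforms. -/

namespace TrigPoly

variable {κ L : ℝ}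

/-- The partial derivative of a trigonometric polynomial. -/
def D (κ : ℝ) (i : Fin 3) (p : TrigPoly) : TrigPoly := p.op (fun k => κ * k i) (Real.pi / 2)

/-- The time derivative of the heat flow of a trigonometric polynomial. -/
def Dt (κ : ℝ) (p : TrigPoly) : TrigPoly := p.op (fun k => -(κ ^ 2 * nsq k)) 0

/-- The two quarter-period phase shifts add up to half a period, which is the minus sign. -/
lemma eval_DD (p : TrigPoly) (i j : Fin 3) (t : ℝ) (x : E3) :
    ((p.D κ i).D κ j).eval κ t x = -(p.op (fun k => κ ^ 2 * (k i * k j)) 0).eval κ t x := by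
  rw [D, D, op_op, ← eval_op_add_pi]
  congr 2
  · ext k; ring
  · ring

lemma eval_Dt (p : TrigPoly) (t : ℝ) (x : E3) :
    (p.Dt κ).eval κ t x = ∑ i, ((p.D κ i).D κ i).eval κ t x := by
  simp only [eval_DD, ← eval_op_neg]
  rw [sum_eval_op, Dt]
  congr 2
  ext k
  simp only [nsq, Fin.sum_univ_three]; ring

/-- The energy identity for the Bellman function at a fixed time. -/
lemma integral_mul_le_dissipation (hL : 0 < L) (hκ : κ = 2 * Real.pi / L) (p r : TrigPoly)
    (i j : Fin 3) {t : ℝ} (hp : ∀ x, 0 < p.eval κ t x) :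
    ∫ x in cell L, |(p.D κ i).eval κ t x * (r.D κ j).eval κ t x| ≤
      -∫ x in cell L, 3 / 2 * Real.sqrt (p.eval κ t x + r.eval κ t x ^ 2) *
        ((p.Dt κ).eval κ t x + 2 * r.eval κ t x * (r.Dt κ).eval κ t x) := by
  set U := p.eval κ t with hU
  set V := r.eval κ t with hV
  set w : E3 → ℝ := fun x => U x + V x ^ 2 with hw
  set w1 : Fin 3 → E3 → ℝ := fun l x => (p.D κ l).eval κ t x + 2 * V x * (r.D κ l).eval κ t x
    with hw1
  set w2 : Fin 3 → E3 → ℝ := fun l x => ((p.D κ l).D κ l).eval κ t x +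
    2 * ((r.D κ l).eval κ t x * (r.D κ l).eval κ t x + V x * ((r.D κ l).D κ l).eval κ t x) with hw2
  have wpos : ∀ x, 0 < w x := fun x => add_pos_of_pos_of_nonneg (hp x) (sq_nonneg _)
  have spos : ∀ x, 0 < Real.sqrt (w x) := fun x => Real.sqrt_pos.2 (wpos x)
  have sne : ∀ x, Real.sqrt (w x) ≠ 0 := fun x => (spos x).ne'
  have cU : Continuous U := p.continuous_eval' t
  have cV : Continuous V := r.continuous_eval' t
  have cw : Continuous w := by fun_prop
  have cw1 : ∀ l, Continuous (w1 l) := fun l => by fun_prop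
  have cw2 : ∀ l, Continuous (w2 l) := fun l => by fun_prop
  have perU := p.per_eval t hL hκ
  have perV := r.per_eval t hL hκ
  have hperw : Per L w := fun x l => by simp only [hw, hU, hV, perU x l, perV x l]
  have hperw1 : ∀ m, Per L (w1 m) := fun m x l => by
    simp only [hw1, hV, perV x l, (p.D κ m).per_eval t hL hκ x l,
      (r.D κ m).per_eval t hL hκ x l]
  have hperw2 : ∀ m, Per L (w2 m) := fun m x l => by
    simp only [hw2, hV, perV x l, ((p.D κ m).D κ m).per_eval t hL hκ x l,
      (r.D κ m).per_eval t hL hκ x l, ((r.D κ m).D κ m).per_eval t hL hκ x l]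
  have hdw : ∀ l x, HasDerivAt (fun s : ℝ => w (x + s • e l)) (w1 l x) 0 := fun l x => by
    have h1 := p.hasDerivAt_space (κ := κ) t x l
    have h2 := r.hasDerivAt_space (κ := κ) t x l
    refine (h1.add (h2.pow 2)).congr_deriv ?_
    simp [hw1, hV, D]
  have hdw1 : ∀ l x, HasDerivAt (fun s : ℝ => w1 l (x + s • e l)) (w2 l x) 0 := fun l x => by
    have h1 := (p.D κ l).hasDerivAt_space (κ := κ) t x l
    have h2 := (r.D κ l).hasDerivAt_space (κ := κ) t x l
    have h3 := r.hasDerivAt_space (κ := κ) t x l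
    refine (h1.add ((h3.const_mul 2).mul h2)).congr_deriv ?_
    simp only [hw2, hV, D, zero_smul, add_zero]; ring
  -- The integrand is `∂_l(√w ∂_l w)` with `w = u + v²`. Adding this null integral exposes the
  -- Hessian of the Bellman function as a sum of squares.
  have key : ∀ l, ∫ x in cell L, (w1 l x / (2 * Real.sqrt (w x)) * w1 l x
      + Real.sqrt (w x) * w2 l x) = 0 := by
    intro l
    refine integral_cell_deriv hL (f := fun x => Real.sqrt (w x) * w1 l x) (fun x m => by
      simp only [hperw x m, hperw1 l x m]) l (fun x => ?_) ?_ (by fun_prop) (fun x m => by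
      simp only [hperw x m, hperw1 l x m, hperw2 l x m])
    · refine (((hdw l x).sqrt (by simpa using (wpos x).ne')).mul (hdw1 l x)).congr_deriv ?_
      simp
    · refine Continuous.add (Continuous.mul (Continuous.div (cw1 l) (by fun_prop) fun x => ?_)
        (cw1 l)) (by fun_prop)
      exact mul_ne_zero two_ne_zero (sne x)
  have cdiv : ∀ l, Continuous fun x => w1 l x / (2 * Real.sqrt (w x)) * w1 l x
      + Real.sqrt (w x) * w2 l x := fun l =>
    Continuous.add (Continuous.mul (Continuous.div (cw1 l) (by fun_prop) fun x =>
      mul_ne_zero two_ne_zero (sne x)) (cw1 l)) (by fun_prop)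
  have hsum : ∫ x in cell L, (3 / 2 * ∑ l, (w1 l x / (2 * Real.sqrt (w x)) * w1 l x
      + Real.sqrt (w x) * w2 l x)) = 0 := by
    rw [integral_const_mul, integral_finsetSum _ fun l _ => integrableOn_cell (cdiv l)]
    simp [key]
  rw [← zero_sub, ← hsum, ← integral_sub]
  rotate_left
  · exact integrableOn_cell (continuous_const.mul (continuous_finsetSum _ fun l _ => cdiv l))
  · exact integrableOn_cell (by fun_prop)
  refine integral_mono (integrableOn_cell (by fun_prop)) (integrableOn_cell ?_) fun x => ?_
  · exact (continuous_const.mul (continuous_finsetSum _ fun l _ => cdiv l)).sub (by fun_prop)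
  simp only
  rw [eval_Dt, eval_Dt]
  have hs2 : Real.sqrt (w x) ^ 2 = w x := Real.sq_sqrt (wpos x).le
  have hVs : |V x| ≤ Real.sqrt (w x) := by
    rw [← Real.sqrt_sq_eq_abs]
    exact Real.sqrt_le_sqrt (by simp only [hw]; linarith [hp x])
  set s := Real.sqrt (w x) with hs
  have hspos : 0 < s := spos x
  -- Since `Δw = Δu + 2vΔv + 2|∇v|²`, subtracting the time derivative of `w^{3/2}` from `(3/2)
  -- div(√w ∇w)` leaves `(3/4)|∇w|²/√w + 3√w |∇v|²`.
  have e1 : 3 / 2 * ∑ l, (w1 l x / (2 * s) * w1 l x + s * w2 l x) -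
      3 / 2 * s * (∑ l, ((p.D κ l).D κ l).eval κ t x +
        2 * V x * ∑ l, ((r.D κ l).D κ l).eval κ t x)
      = ∑ l, (3 / 4 * (w1 l x ^ 2 / s) + 3 * s * ((r.D κ l).eval κ t x) ^ 2) := by
    simp only [hw2, Fin.sum_univ_three]
    field_simp
    ring
  rw [e1]
  have hnn : ∀ l, 0 ≤ w1 l x ^ 2 / s := fun l => by positivity
  have hnn2 : ∀ l, 0 ≤ s * ((r.D κ l).eval κ t x) ^ 2 := fun l => by positivity
  have l1 : w1 i x ^ 2 / s ≤ ∑ l, w1 l x ^ 2 / s :=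
    Finset.single_le_sum (f := fun l => w1 l x ^ 2 / s) (fun l _ => hnn l) (Finset.mem_univ i)
  have l2 : ∀ m, s * ((r.D κ m).eval κ t x) ^ 2 ≤ ∑ l, s * ((r.D κ l).eval κ t x) ^ 2 := fun m =>
    Finset.single_le_sum (f := fun l => s * ((r.D κ l).eval κ t x) ^ 2) (fun l _ => hnn2 l)
      (Finset.mem_univ m)
  have e2 : ∑ l, (3 / 4 * (w1 l x ^ 2 / s) + 3 * s * ((r.D κ l).eval κ t x) ^ 2)
      = 3 / 4 * (∑ l, w1 l x ^ 2 / s) + 3 * ∑ l, s * ((r.D κ l).eval κ t x) ^ 2 := by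
    rw [Finset.sum_add_distrib, Finset.mul_sum, Finset.mul_sum]
    simp only [mul_assoc]
  rw [e2]
  -- The product `∂ᵢu ∂ⱼv` is controlled by the squares through `∂ᵢu = ∂ᵢw - 2v ∂ᵢv`: Young's
  -- inequality with weight `√w` treats both parts, the second one because `|v| ≤ √w`.
  have hUi : (p.D κ i).eval κ t x = w1 i x - 2 * V x * (r.D κ i).eval κ t x := by
    simp only [hw1]; ring
  set a := (r.D κ i).eval κ t x
  set c := (r.D κ j).eval κ t x
  set d := w1 i x
  have m1 : |d * c| ≤ 1 / 2 * (d ^ 2 / s) + 1 / 2 * (s * c ^ 2) := by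
    rw [abs_mul]
    have : d ^ 2 / s = (|d| / s) ^ 2 * s := by rw [div_pow, sq_abs]; field_simp
    have h4 : |d| = (|d| / s) * s := by field_simp
    rw [this, ← sq_abs c, h4]
    rw [mul_div_assoc, div_self hspos.ne', mul_one]
    nlinarith [mul_nonneg hspos.le (sq_nonneg (|d| / s - |c|))]
  have m2 : |2 * V x * a * c| ≤ s * a ^ 2 + s * c ^ 2 := by
    rw [abs_mul, abs_mul, abs_mul, abs_two, ← sq_abs a, ← sq_abs c]
    have h5 : |V x| * (|a| * |c|) ≤ s * (|a| * |c|) :=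
      mul_le_mul_of_nonneg_right hVs (by positivity)
    nlinarith [mul_nonneg hspos.le (sq_nonneg (|a| - |c|))]
  rw [hUi, sub_mul]
  have m3 := abs_sub (d * c) (2 * V x * a * c)
  have := l2 i
  have := l2 j
  have h0 : 0 ≤ ∑ l, w1 l x ^ 2 / s := Finset.sum_nonneg fun l _ => hnn l
  linarith [hnn2 i, hnn2 j]

/-- The bilinear embedding for the heat flow. -/
lemma integral_integral_mul_le (hL : 0 < L) (hκ : κ = 2 * Real.pi / L) (p r : TrigPoly)
    (i j : Fin 3) (hp : ∀ x, 0 < p.eval κ 0 x) {τ : ℝ} (hτ : 0 ≤ τ) :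
    ∫ t in (0 : ℝ)..τ, ∫ x in cell L, |(p.D κ i).eval κ t x * (r.D κ j).eval κ t x| ≤
      ∫ x in cell L, (p.eval κ 0 x + r.eval κ 0 x ^ 2) *
        Real.sqrt (p.eval κ 0 x + r.eval κ 0 x ^ 2) := by
  have cp := p.continuous_eval (κ := κ)
  have cr := r.continuous_eval (κ := κ)
  have cpt := (p.Dt κ).continuous_eval (κ := κ)
  have crt := (r.Dt κ).continuous_eval (κ := κ)
  have cpi := (p.D κ i).continuous_eval (κ := κ)
  have crj := (r.D κ j).continuous_eval (κ := κ)
  have hpt : ∀ t x, 0 ≤ t → 0 < p.eval κ t x := fun t x ht => p.eval_pos t x hp ht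
  have h1 := integral_cell_sub_eq (L := L)
    (F := fun z => (p.eval κ z.1 z.2 + r.eval κ z.1 z.2 ^ 2) *
      Real.sqrt (p.eval κ z.1 z.2 + r.eval κ z.1 z.2 ^ 2))
    (F' := fun z => 3 / 2 * Real.sqrt (p.eval κ z.1 z.2 + r.eval κ z.1 z.2 ^ 2) *
        ((p.Dt κ).eval κ z.1 z.2 + 2 * r.eval κ z.1 z.2 * (r.Dt κ).eval κ z.1 z.2))
    (by fun_prop) (by fun_prop) hτ (fun t x ht => by
      have hw : 0 < p.eval κ t x + r.eval κ t x ^ 2 :=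
        add_pos_of_pos_of_nonneg (hpt t x ht) (sq_nonneg _)
      have hd := (p.hasDerivAt_time (κ := κ) t x).add ((r.hasDerivAt_time (κ := κ) t x).pow 2)
      refine (hd.mul (hd.sqrt hw.ne')).congr_deriv ?_
      have hs := Real.sqrt_pos.2 hw
      have hs2 : Real.sqrt (p.eval κ t x + r.eval κ t x ^ 2) ^ 2 = _ := Real.sq_sqrt hw.le
      simp only [Pi.add_apply, Pi.pow_apply, Dt]
      set s := Real.sqrt (p.eval κ t x + r.eval κ t x ^ 2)
      rw [← hs2]
      field_simp
      ring)
  have h2 : ∫ t in (0 : ℝ)..τ, ∫ x in cell L, |(p.D κ i).eval κ t x * (r.D κ j).eval κ t x| ≤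
      ∫ t in (0 : ℝ)..τ, -∫ x in cell L, 3 / 2 *
        Real.sqrt (p.eval κ t x + r.eval κ t x ^ 2) *
        ((p.Dt κ).eval κ t x + 2 * r.eval κ t x * (r.Dt κ).eval κ t x) := by
    refine intervalIntegral.integral_mono_on hτ
      (intervalIntegrable_integral_cell
        (F := fun z => |(p.D κ i).eval κ z.1 z.2 * (r.D κ j).eval κ z.1 z.2|) (by fun_prop) 0 τ L)
      (intervalIntegrable_integral_cell
        (F := fun z => 3 / 2 * Real.sqrt (p.eval κ z.1 z.2 + r.eval κ z.1 z.2 ^ 2) *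
        ((p.Dt κ).eval κ z.1 z.2 + 2 * r.eval κ z.1 z.2 * (r.Dt κ).eval κ z.1 z.2))
        (by fun_prop) 0 τ L).neg fun t ht => ?_
    exact integral_mul_le_dissipation hL hκ p r i j fun x => hpt t x ht.1
  rw [intervalIntegral.integral_neg, ← h1] at h2
  -- Integrated in time, the dissipation is the initial value minus the final value of the Bellman
  -- integral; the final value is nonnegative and can be dropped.
  have h3 : 0 ≤ ∫ x in cell L, (p.eval κ τ x + r.eval κ τ x ^ 2) *
      Real.sqrt (p.eval κ τ x + r.eval κ τ x ^ 2) :=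
    integral_nonneg fun x => mul_nonneg
      (add_nonneg (hpt τ x hτ).le (sq_nonneg _)) (Real.sqrt_nonneg _)
  linarith

lemma integral_Dt_mul (hL : 0 < L) (hκ : κ = 2 * Real.pi / L) (p r : TrigPoly) (t : ℝ) :
    ∫ x in cell L, (p.Dt κ).eval κ t x * r.eval κ t x
      = -∑ l, ∫ x in cell L, (p.D κ l).eval κ t x * (r.D κ l).eval κ t x := by
  simp_rw [eval_Dt, Finset.sum_mul]
  rw [integral_finsetSum _ fun l _ => integrableOn_cell (by fun_prop), ← Finset.sum_neg_distrib]
  refine Finset.sum_congr rfl fun l _ => ?_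
  exact integral_cell_by_parts hL l ((p.D κ l).per_eval t hL hκ)
    (((p.D κ l).D κ l).per_eval t hL hκ) (r.per_eval t hL hκ) ((r.D κ l).per_eval t hL hκ)
    (by fun_prop) (by fun_prop) (by fun_prop) (by fun_prop)
    (fun x => (p.D κ l).hasDerivAt_space t x l) (fun x => r.hasDerivAt_space t x l)

lemma abs_eval_le (p : TrigPoly) {t : ℝ} (ht : 0 ≤ t) (x : E3) :
    |p.eval κ t x| ≤ ∑ m, |p.amp m| := by
  unfold eval
  refine (Finset.abs_sum_le_sum_abs _ _).trans (Finset.sum_le_sum fun m _ => ?_)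
  rw [abs_mul, abs_mul, Real.abs_exp, mul_assoc]
  refine mul_le_of_le_one_right (abs_nonneg _) (mul_le_one₀ ?_ (abs_nonneg _)
    (Real.abs_cos_le_one _))
  rw [Real.exp_le_one_iff]
  nlinarith [mul_nonneg (mul_nonneg (sq_nonneg κ) (nsq_nonneg (p.freq m))) ht]

/-- The multiplier `kᵢ kⱼ / |k|²`, a product of two Riesz transforms. -/
def rieszSymbol (i j : Fin 3) (k : Fin 3 → ℤ) : ℝ := k i * k j / nsq k

/-- The bilinear estimate for the product of two Riesz transforms of trigonometric polynomials. -/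
lemma abs_integral_riesz_le (hL : 0 < L) (hκ : κ = 2 * Real.pi / L) (p r : TrigPoly)
    (i j : Fin 3) (hp : ∀ x, 0 < p.eval κ 0 x) :
    |∫ x in cell L, p.eval κ 0 x * (r.op (rieszSymbol i j) 0).eval κ 0 x| ≤
      2 * ∫ x in cell L, (p.eval κ 0 x + r.eval κ 0 x ^ 2) *
        Real.sqrt (p.eval κ 0 x + r.eval κ 0 x ^ 2) := by
  set Z := r.op (rieszSymbol i j) 0 with hZ
  set W := ∫ x in cell L, (p.eval κ 0 x + r.eval κ 0 x ^ 2) *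
        Real.sqrt (p.eval κ 0 x + r.eval κ 0 x ^ 2)
  have hκ0 : 0 < κ := by rw [hκ]; positivity
  have cp := p.continuous_eval (κ := κ)
  have cZ := Z.continuous_eval (κ := κ)
  have cpt := (p.Dt κ).continuous_eval (κ := κ)
  have cZt := (Z.Dt κ).continuous_eval (κ := κ)
  have cpi := (p.D κ i).continuous_eval (κ := κ)
  have crj := (r.D κ j).continuous_eval (κ := κ)
  -- Applying the Laplacian to the Riesz transforms of `r` cancels the factor `|k|²`, so `∂ₜZ = ∂ᵢ∂ⱼ
  -- r`. At `k = 0` both symbols vanish because of the convention `0 / 0 = 0`.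
  have hZt : ∀ t x, (Z.Dt κ).eval κ t x = ((r.D κ j).D κ i).eval κ t x := by
    intro t x
    rw [eval_DD, ← eval_op_neg, Dt, hZ, op_op]
    congr 2
    · ext k
      by_cases hk : k = 0
      · simp [hk, rieszSymbol]
      · have := (zero_lt_one.trans_le (one_le_nsq hk)).ne'
        simp only [rieszSymbol]
        field_simp
    · simp
  -- By symmetry of the Laplacian both halves of `d/dt ∫ pZ` are equal, and each is `∫ p ∂ᵢ∂ⱼr = -∫
  -- ∂ᵢp ∂ⱼr`.
  have hslice : ∀ t, ∫ x in cell L, ((p.Dt κ).eval κ t x * Z.eval κ t x +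
      p.eval κ t x * (Z.Dt κ).eval κ t x)
      = -(2 * ∫ x in cell L, (p.D κ i).eval κ t x * (r.D κ j).eval κ t x) := by
    intro t
    rw [integral_add (integrableOn_cell (by fun_prop)) (integrableOn_cell (by fun_prop))]
    have e1 := integral_Dt_mul hL hκ p Z t
    have e2 := integral_Dt_mul hL hκ Z p t
    simp only [mul_comm (eval κ (D κ _ Z) t _)] at e2
    simp only [mul_comm (eval κ (Dt κ Z) t _)] at e2
    rw [e1, ← e2]
    simp_rw [hZt]
    have := integral_cell_by_parts hL i ((r.D κ j).per_eval t hL hκ)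
      (((r.D κ j).D κ i).per_eval t hL hκ) (p.per_eval t hL hκ) ((p.D κ i).per_eval t hL hκ)
      (by fun_prop) (by fun_prop) (by fun_prop) (by fun_prop)
      (fun x => (r.D κ j).hasDerivAt_space t x i) (fun x => p.hasDerivAt_space t x i)
    simp only [mul_comm _ (p.eval κ t _), mul_comm _ ((p.D κ i).eval κ t _)] at this
    linarith
  set B := (∑ m, |p.amp m|) * (∑ m, |r.amp m * rieszSymbol i j (r.freq m)|) *
    volume.real (cell L) with hB
  have main : ∀ τ : ℝ, 0 ≤ τ → |∫ x in cell L, p.eval κ 0 x * Z.eval κ 0 x| ≤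
      2 * W + B * Real.exp (-κ ^ 2 * τ) := by
    intro τ hτ
    have h1 := integral_cell_sub_eq (L := L) (F := fun z => p.eval κ z.1 z.2 * Z.eval κ z.1 z.2)
      (F' := fun z => (p.Dt κ).eval κ z.1 z.2 * Z.eval κ z.1 z.2 +
        p.eval κ z.1 z.2 * (Z.Dt κ).eval κ z.1 z.2) (by fun_prop) (by fun_prop) hτ
      (fun t x _ => (p.hasDerivAt_time t x).mul (Z.hasDerivAt_time t x))
    simp only [hslice] at h1
    rw [intervalIntegral.integral_neg, intervalIntegral.integral_const_mul] at h1
    have h2 : |∫ t in (0 : ℝ)..τ, ∫ x in cell L, (p.D κ i).eval κ t x * (r.D κ j).eval κ t x|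
        ≤ W := by
      refine (intervalIntegral.abs_integral_le_integral_abs hτ).trans
        (le_trans ?_ (integral_integral_mul_le hL hκ p r i j hp hτ))
      refine intervalIntegral.integral_mono_on hτ
        (intervalIntegrable_integral_cell
          (F := fun z => (p.D κ i).eval κ z.1 z.2 * (r.D κ j).eval κ z.1 z.2)
          (by fun_prop) 0 τ L).abs
        (intervalIntegrable_integral_cell
          (F := fun z => |(p.D κ i).eval κ z.1 z.2 * (r.D κ j).eval κ z.1 z.2|)
          (by fun_prop) 0 τ L) fun t _ => abs_integral_le_integral_abs
    -- `Z` has no constant term, since the Riesz symbol vanishes at `0`. It therefore decays at rate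
    -- `κ²`, and the contribution of the final time disappears as `τ → ∞`.
    have h3 : |∫ x in cell L, p.eval κ τ x * Z.eval κ τ x| ≤ B * Real.exp (-κ ^ 2 * τ) := by
      rw [← Real.norm_eq_abs]
      refine (norm_setIntegral_le_of_norm_le_const (C := (∑ m, |p.amp m|) *
        ((∑ m, |r.amp m * rieszSymbol i j (r.freq m)|) * Real.exp (-κ ^ 2 * τ)))
        (volume_cell_lt_top L) fun x _ => ?_).trans (le_of_eq (by rw [hB]; ring))
      rw [Real.norm_eq_abs, abs_mul]
      exact mul_le_mul (p.abs_eval_le hτ x)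
        (r.abs_eval_op_le _ 0 τ x (by simp [rieszSymbol]) hτ) (abs_nonneg _)
        (Finset.sum_nonneg fun _ _ => abs_nonneg _)
    have h4 : ∫ x in cell L, p.eval κ 0 x * Z.eval κ 0 x
        = (∫ x in cell L, p.eval κ τ x * Z.eval κ τ x) + 2 * ∫ t in (0 : ℝ)..τ,
          ∫ x in cell L, (p.D κ i).eval κ t x * (r.D κ j).eval κ t x := by linarith
    rw [h4]
    refine (abs_add_le _ _).trans ?_
    rw [abs_mul, abs_two]; linarith
  have hlim : Tendsto (fun τ : ℝ => 2 * W + B * Real.exp (-κ ^ 2 * τ)) atTop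
      (𝓝 (2 * W + B * 0)) := by
    refine tendsto_const_nhds.add (tendsto_const_nhds.mul ?_)
    refine Real.tendsto_exp_atBot.comp ?_
    exact tendsto_id.const_mul_atTop_of_neg (by nlinarith [pow_pos hκ0 2])
  rw [mul_zero, add_zero] at hlim
  exact ge_of_tendsto hlim ((eventually_ge_atTop 0).mono main)

end TrigPoly

/-! ### Calderón–Zygmund estimates in `L^{3/2}` of the torus -/

/-- The function `|q|^{3/2}`. -/
def pw (q : ℝ) : ℝ := |q| * Real.sqrt |q|

@[fun_prop]
lemma continuous_pw : Continuous pw := by unfold pw; fun_prop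

lemma pw_nonneg (q : ℝ) : 0 ≤ pw q := mul_nonneg (abs_nonneg _) (Real.sqrt_nonneg _)

lemma pw_neg (q : ℝ) : pw (-q) = pw q := by simp [pw]

@[simp] lemma pw_zero : pw 0 = 0 := by simp [pw]

/-- The sum is at most twice the larger summand, and `2^{3/2} ≤ 3`. This splits the Bellman function
into the conjugate powers `3/2` and `3`. -/
lemma pw_add_sq_le (a g : ℝ) :
    (|a| + g ^ 2) * Real.sqrt (|a| + g ^ 2) ≤ 3 * (pw a + |g| ^ 3) := by
  have h8 : Real.sqrt 2 ≤ 3 / 2 := by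
    rw [Real.sqrt_le_iff]; norm_num
  have h0 : ∀ m : ℝ, 0 ≤ m → 2 * m * Real.sqrt (2 * m) ≤ 3 * (m * Real.sqrt m) := by
    intro m hm
    rw [Real.sqrt_mul zero_le_two]
    nlinarith [mul_nonneg hm (Real.sqrt_nonneg m)]
  have hg : g ^ 2 * Real.sqrt (g ^ 2) = |g| ^ 3 := by
    rw [Real.sqrt_sq_eq_abs, ← sq_abs]; ring
  have hmono : ∀ x y : ℝ, 0 ≤ x → x ≤ y → x * Real.sqrt x ≤ y * Real.sqrt y := fun x y hx hxy =>
    mul_le_mul hxy (Real.sqrt_le_sqrt hxy) (Real.sqrt_nonneg _) (hx.trans hxy)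
  have hn1 : 0 ≤ |g| ^ 3 := by positivity
  have hn2 := pw_nonneg a
  rcases le_total (|a|) (g ^ 2) with h | h
  · have := hmono (|a| + g ^ 2) (2 * g ^ 2) (by positivity) (by linarith)
    have := h0 (g ^ 2) (by positivity)
    linarith
  · have := hmono (|a| + g ^ 2) (2 * |a|) (by positivity) (by linarith)
    have := h0 (|a|) (by positivity)
    rw [← pw] at this
    linarith

/-- Integrals over the cell pass to the limit under uniform approximation. -/
lemma tendsto_integral_cell {L : ℝ} {f : ℕ → E3 → ℝ} {g : E3 → ℝ} {C : ℝ}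
    (hf : ∀ n, Continuous (f n)) (hC : ∀ n, ∀ x ∈ cell L, |f n x| ≤ C)
    (hl : ∀ x, Tendsto (fun n => f n x) atTop (𝓝 (g x))) :
    Tendsto (fun n => ∫ x in cell L, f n x) atTop (𝓝 (∫ x in cell L, g x)) := by
  have : IsFiniteMeasure (volume.restrict (cell L)) :=
    ⟨by rw [Measure.restrict_apply_univ]; exact volume_cell_lt_top L⟩
  refine tendsto_integral_of_dominated_convergence (fun _ => C)
    (fun n => (hf n).aestronglyMeasurable) (integrable_const C) (fun n => ?_)
    (Eventually.of_forall hl)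
  rw [ae_restrict_iff' (measurableSet_cell L)]
  exact Eventually.of_forall fun x hx => hC n x hx

lemma exists_bound_cell (L : ℝ) {f : E3 → ℝ} (hf : Continuous f) :
    ∃ C, 0 ≤ C ∧ ∀ x ∈ cell L, |f x| ≤ C := by
  obtain ⟨C, hC⟩ := (isCompact_closedBall (0 : E3) (3 * |L|)).exists_bound_of_continuousOn
    hf.continuousOn
  refine ⟨max C 0, le_max_right _ _, fun x hx => ?_⟩
  exact (hC x (cell_subset_closedBall L hx)).trans (le_max_left _ _)

/-! ### From the bilinear estimate to the elliptic estimate, by approximation and duality. -/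

section CZ

variable {κ L : ℝ}

/-- A sequence of trigonometric polynomials approximating a periodic function uniformly. -/
lemma exists_trigPoly_seq (hL : 0 < L) (hκ : κ = 2 * Real.pi / L) {g : E3 → ℝ}
    (hg : Continuous g) (hp : Per L g) (c : ℝ) :
    ∃ p : ℕ → TrigPoly, ∀ n x,
      |(p n).eval κ 0 x - (g x + c * (1 / ((n : ℝ) + 1)))| < 1 / ((n : ℝ) + 1) := by
  have h : ∀ n : ℕ, ∃ p : TrigPoly, ∀ x,
      |p.eval κ 0 x - (g x + c * (1 / ((n : ℝ) + 1)))| < 1 / ((n : ℝ) + 1) := fun n => by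
    rw [hκ]
    exact exists_trigPoly_close hL (by fun_prop) (fun x i => by simp only [hp x i])
      Nat.one_div_pos_of_nat
  choose p hp using h
  exact ⟨p, hp⟩

lemma trigPoly_seq_tendsto {g : E3 → ℝ} {c : ℝ} {p : ℕ → TrigPoly}
    (hp : ∀ n x, |(p n).eval κ 0 x - (g x + c * (1 / ((n : ℝ) + 1)))| < 1 / ((n : ℝ) + 1))
    (x : E3) : Tendsto (fun n => (p n).eval κ 0 x) atTop (𝓝 (g x)) := by
  have h1 : Tendsto (fun n : ℕ => 1 / ((n : ℝ) + 1)) atTop (𝓝 0) :=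
    tendsto_one_div_add_atTop_nhds_zero_nat
  have h2 : Tendsto (fun n => (p n).eval κ 0 x - (g x + c * (1 / ((n : ℝ) + 1)))) atTop (𝓝 0) :=
    squeeze_zero_norm (fun n => (hp n x).le) h1
  have h3 := h2.add ((tendsto_const_nhds (x := g x)).add (h1.const_mul c))
  simpa using h3

lemma trigPoly_seq_bound {g : E3 → ℝ} {c C : ℝ} {p : ℕ → TrigPoly}
    (hp : ∀ n x, |(p n).eval κ 0 x - (g x + c * (1 / ((n : ℝ) + 1)))| < 1 / ((n : ℝ) + 1))
    (n : ℕ) {x : E3} (hg : |g x| ≤ C) : |(p n).eval κ 0 x| ≤ C + |c| + 1 := by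
  have h1 : 1 / ((n : ℝ) + 1) ≤ 1 := by
    rw [div_le_one (by positivity)]; linarith [(Nat.cast_nonneg n : (0 : ℝ) ≤ n)]
  have h0 : 0 ≤ 1 / ((n : ℝ) + 1) := by positivity
  have h2 := hp n x
  have h3 : |c * (1 / ((n : ℝ) + 1))| ≤ |c| := by
    rw [abs_mul, abs_of_nonneg h0]; exact mul_le_of_le_one_right (abs_nonneg c) h1
  have h4 := abs_add_le ((p n).eval κ 0 x - (g x + c * (1 / ((n : ℝ) + 1))))
    (g x + c * (1 / ((n : ℝ) + 1)))
  rw [sub_add_cancel] at h4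
  have := abs_add_le (g x) (c * (1 / ((n : ℝ) + 1)))
  linarith

lemma abs_integral_riesz_le_of_nonneg (hL : 0 < L) (hκ : κ = 2 * Real.pi / L) {S : E3 → ℝ}
    (hS : Continuous S) (hp : Per L S) (h0 : ∀ x, 0 ≤ S x) (r : TrigPoly) (i j : Fin 3) :
    |∫ x in cell L, S x * (r.op (TrigPoly.rieszSymbol i j) 0).eval κ 0 x| ≤
      2 * ∫ x in cell L, (S x + r.eval κ 0 x ^ 2) * Real.sqrt (S x + r.eval κ 0 x ^ 2) := by
  -- The offset `2/(n+1)` exceeds the approximation error `1/(n+1)`, so the approximants of a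
  -- nonnegative function are strictly positive, as the bilinear estimate requires.
  obtain ⟨p, hpn⟩ := exists_trigPoly_seq hL hκ hS hp 2
  obtain ⟨C, hC0, hC⟩ := exists_bound_cell L hS
  set Z := r.op (TrigPoly.rieszSymbol i j) 0
  obtain ⟨CZ, hZ0, hCZ⟩ := exists_bound_cell L (Z.continuous_eval' (κ := κ) 0)
  obtain ⟨Cr, hr0, hCr⟩ := exists_bound_cell L (r.continuous_eval' (κ := κ) 0)
  have hb : ∀ n, ∀ x ∈ cell L, |(p n).eval κ 0 x| ≤ C + 3 := fun n x hx =>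
    (trigPoly_seq_bound hpn n (hC x hx)).trans (by norm_num; linarith)
  have hpos : ∀ n x, 0 < (p n).eval κ 0 x := fun n x => by
    have h1 := abs_lt.1 (hpn n x)
    have h2 : 0 < 1 / ((n : ℝ) + 1) := by positivity
    linarith [h0 x]
  have l1 : Tendsto (fun n => ∫ x in cell L, (p n).eval κ 0 x * Z.eval κ 0 x) atTop
      (𝓝 (∫ x in cell L, S x * Z.eval κ 0 x)) :=
    tendsto_integral_cell (C := (C + 3) * CZ) (fun n => by fun_prop) (fun n x hx => by
      rw [abs_mul]
      exact mul_le_mul (hb n x hx) (hCZ x hx) (abs_nonneg _) (by linarith))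
      fun x => (trigPoly_seq_tendsto hpn x).mul_const _
  have l2 : Tendsto (fun n => ∫ x in cell L, ((p n).eval κ 0 x + r.eval κ 0 x ^ 2) *
      Real.sqrt ((p n).eval κ 0 x + r.eval κ 0 x ^ 2)) atTop
      (𝓝 (∫ x in cell L, (S x + r.eval κ 0 x ^ 2) * Real.sqrt (S x + r.eval κ 0 x ^ 2))) := by
    refine tendsto_integral_cell (C := (C + 3 + Cr ^ 2) * Real.sqrt (C + 3 + Cr ^ 2))
      (fun n => by fun_prop) (fun n x hx => ?_) fun x => ?_
    · have h1 : 0 ≤ (p n).eval κ 0 x + r.eval κ 0 x ^ 2 := by have := hpos n x; positivity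
      have h2 : (p n).eval κ 0 x + r.eval κ 0 x ^ 2 ≤ C + 3 + Cr ^ 2 := by
        have := (abs_le.1 (hb n x hx)).2
        have := sq_le_sq' (abs_le.1 (hCr x hx)).1 (abs_le.1 (hCr x hx)).2
        linarith
      rw [abs_of_nonneg (mul_nonneg h1 (Real.sqrt_nonneg _))]
      exact mul_le_mul h2 (Real.sqrt_le_sqrt h2) (Real.sqrt_nonneg _) (by positivity)
    · have h1 := (trigPoly_seq_tendsto hpn x).add_const (r.eval κ 0 x ^ 2)
      exact h1.mul h1.sqrt
  exact le_of_tendsto_of_tendsto' l1.abs (l2.const_mul 2)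
    fun n => TrigPoly.abs_integral_riesz_le hL hκ (p n) r i j (hpos n)

/-- Splitting `S` into positive and negative parts removes the sign condition. The constant is `2 ·
2 · 3`: two parts, the bilinear constant, and the constant of `pw_add_sq_le`. -/
lemma abs_integral_riesz_le_pw (hL : 0 < L) (hκ : κ = 2 * Real.pi / L) {S : E3 → ℝ}
    (hS : Continuous S) (hp : Per L S) (r : TrigPoly) (i j : Fin 3) :
    |∫ x in cell L, S x * (r.op (TrigPoly.rieszSymbol i j) 0).eval κ 0 x| ≤
      12 * ((∫ x in cell L, pw (S x)) + ∫ x in cell L, |r.eval κ 0 x| ^ 3) := by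
  set Z := r.op (TrigPoly.rieszSymbol i j) 0
  have h1 := abs_integral_riesz_le_of_nonneg hL hκ (S := fun x => max (S x) 0) (by fun_prop)
    (fun x i => by simp only [hp x i]) (fun x => le_max_right _ _) r i j
  have h2 := abs_integral_riesz_le_of_nonneg hL hκ (S := fun x => max (-S x) 0) (by fun_prop)
    (fun x i => by simp only [hp x i]) (fun x => le_max_right _ _) r i j
  have e1 : ∫ x in cell L, S x * Z.eval κ 0 x = (∫ x in cell L, max (S x) 0 * Z.eval κ 0 x) -
      ∫ x in cell L, max (-S x) 0 * Z.eval κ 0 x := by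
    rw [← integral_sub (integrableOn_cell (by fun_prop)) (integrableOn_cell (by fun_prop))]
    refine integral_congr_ae (Eventually.of_forall fun x => ?_)
    simp only
    rw [← sub_mul]
    rcases le_total 0 (S x) with h | h
    · rw [max_eq_left h, max_eq_right (by linarith)]; ring
    · rw [max_eq_right h, max_eq_left (by linarith)]; ring
  have hm : ∀ s : E3 → ℝ, Continuous s → (∀ x, 0 ≤ s x) → (∀ x, s x ≤ |S x|) →
      2 * ∫ x in cell L, (s x + r.eval κ 0 x ^ 2) * Real.sqrt (s x + r.eval κ 0 x ^ 2) ≤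
      6 * ((∫ x in cell L, pw (S x)) + ∫ x in cell L, |r.eval κ 0 x| ^ 3) := by
    intro s hs hs0 hsS
    rw [← integral_add (integrableOn_cell (by fun_prop)) (integrableOn_cell (by fun_prop)),
      ← integral_const_mul, ← integral_const_mul]
    refine integral_mono (integrableOn_cell (by fun_prop)) (integrableOn_cell (by fun_prop))
      fun x => ?_
    have h3 := pw_add_sq_le (S x) (r.eval κ 0 x)
    have h4 : s x + r.eval κ 0 x ^ 2 ≤ |S x| + r.eval κ 0 x ^ 2 := by linarith [hsS x]
    have h5 := mul_le_mul h4 (Real.sqrt_le_sqrt h4) (Real.sqrt_nonneg _) (by positivity)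
    simp only
    linarith
  have h3 := hm _ (by fun_prop) (fun x => le_max_right (S x) 0)
    (fun x => max_le (le_abs_self _) (abs_nonneg _))
  have h4 := hm _ (by fun_prop) (fun x => le_max_right (-S x) 0)
    (fun x => max_le (neg_le_abs _) (abs_nonneg _))
  rw [e1]
  refine (abs_sub _ _).trans ?_
  linarith

/-- Duality estimate for a weak solution of `Δq = ∑ᵢⱼ ∂ᵢ∂ⱼSᵢⱼ`. -/
lemma abs_integral_mul_trigPoly_le (hL : 0 < L) (hκ : κ = 2 * Real.pi / L) {q : E3 → ℝ}
    {S : Fin 3 → Fin 3 → E3 → ℝ} (hq : Continuous q) (hq0 : ∫ x in cell L, q x = 0)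
    (hS : ∀ i j, Continuous (S i j)) (hSp : ∀ i j, Per L (S i j))
    (heq : ∀ p : TrigPoly, ∫ x in cell L, q x * (p.Dt κ).eval κ 0 x
      = ∑ i, ∑ j, ∫ x in cell L, S i j x * ((p.D κ i).D κ j).eval κ 0 x) (r : TrigPoly) :
    |∫ x in cell L, q x * r.eval κ 0 x| ≤ 12 * (∑ i, ∑ j, ∫ x in cell L, pw (S i j x)) +
      108 * ∫ x in cell L, |r.eval κ 0 x| ^ 3 := by
  have hκ0 : 0 < κ := by rw [hκ]; positivity
  -- The test polynomial is `(-Δ)⁻¹ r`. The division convention makes its zero mode vanish, so `Δp`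
  -- is `-r` up to the mean of `r`, and that mean is invisible to `q`, which has zero integral.
  set p := r.op (fun k => 1 / (κ ^ 2 * TrigPoly.nsq k)) 0
  have hp := heq p
  have e1 : ∀ x, (p.Dt κ).eval κ 0 x
      = -(r.eval κ 0 x - (r.op (fun k => if k = 0 then 1 else 0) 0).eval κ 0 x) := by
    intro x
    have : p.Dt κ = r.op (fun k => -(1 + -if k = 0 then 1 else 0)) 0 := by
      rw [TrigPoly.Dt, TrigPoly.op_op, add_zero]
      congr 1
      ext k
      by_cases hk : k = 0
      · simp [hk, TrigPoly.nsq]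
      · have := (zero_lt_one.trans_le (TrigPoly.one_le_nsq hk)).ne'
        simp only [hk, if_false]
        field_simp
        norm_num
    rw [this, TrigPoly.eval_op_neg, ← TrigPoly.eval_op_one_zero r]
    congr 1
    simp only [TrigPoly.eval_op, ← Finset.sum_sub_distrib]
    refine Finset.sum_congr rfl fun m _ => ?_
    split_ifs <;> ring
  have e2 : ∀ x, (r.op (fun k => if k = 0 then 1 else 0) 0).eval κ 0 x
      = (r.op (fun k => if k = 0 then 1 else 0) 0).eval κ 0 0 := by
    intro x
    simp only [TrigPoly.eval_op]
    refine Finset.sum_congr rfl fun m _ => ?_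
    split_ifs with hk
    · simp [hk]
    · simp
  have e3 : ∫ x in cell L, q x * (p.Dt κ).eval κ 0 x = -∫ x in cell L, q x * r.eval κ 0 x := by
    have : ∀ x, q x * (p.Dt κ).eval κ 0 x = -(q x * r.eval κ 0 x) +
        q x * (r.op (fun k => if k = 0 then 1 else 0) 0).eval κ 0 0 := by
      intro x; rw [e1, e2]; ring
    simp_rw [this]
    rw [integral_add (integrableOn_cell (by fun_prop)) (integrableOn_cell (by fun_prop)),
      integral_mul_const, hq0, zero_mul, add_zero, integral_neg]
  have e4 : ∀ i j x, ((p.D κ i).D κ j).eval κ 0 x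
      = -(r.op (TrigPoly.rieszSymbol i j) 0).eval κ 0 x := by
    intro i j x
    rw [TrigPoly.eval_DD, TrigPoly.op_op, add_zero]
    congr 3
    ext k
    by_cases hk : k = 0
    · simp [hk, TrigPoly.rieszSymbol]
    · have := (zero_lt_one.trans_le (TrigPoly.one_le_nsq hk)).ne'
      simp only [TrigPoly.rieszSymbol]
      field_simp
  have e5 : ∫ x in cell L, q x * r.eval κ 0 x = ∑ i, ∑ j,
      ∫ x in cell L, S i j x * (r.op (TrigPoly.rieszSymbol i j) 0).eval κ 0 x := by
    rw [e3] at hp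
    simp_rw [e4, mul_neg, integral_neg, Finset.sum_neg_distrib] at hp
    exact neg_injective hp
  rw [e5]
  calc |∑ i, ∑ j, ∫ x in cell L, S i j x * (r.op (TrigPoly.rieszSymbol i j) 0).eval κ 0 x|
      ≤ ∑ i, ∑ j, |∫ x in cell L, S i j x * (r.op (TrigPoly.rieszSymbol i j) 0).eval κ 0 x| :=
        (Finset.abs_sum_le_sum_abs _ _).trans
          (Finset.sum_le_sum fun i _ => Finset.abs_sum_le_sum_abs _ _)
    _ ≤ ∑ i : Fin 3, ∑ j : Fin 3, 12 * ((∫ x in cell L, pw (S i j x)) +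
          ∫ x in cell L, |r.eval κ 0 x| ^ 3) :=
        Finset.sum_le_sum fun i _ => Finset.sum_le_sum fun j _ =>
          abs_integral_riesz_le_pw hL hκ (hS i j) (hSp i j) r i j
    _ = _ := by simp only [Fin.sum_univ_three]; ring

/-- **Calderón–Zygmund estimate** in `L^{3/2}` of the torus for `Δq = ∑ᵢⱼ ∂ᵢ∂ⱼSᵢⱼ`. -/
lemma integral_pw_le (hL : 0 < L) (hκ : κ = 2 * Real.pi / L) {q : E3 → ℝ}
    {S : Fin 3 → Fin 3 → E3 → ℝ} (hq : Continuous q) (hqp : Per L q)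
    (hq0 : ∫ x in cell L, q x = 0)
    (hS : ∀ i j, Continuous (S i j)) (hSp : ∀ i j, Per L (S i j))
    (heq : ∀ p : TrigPoly, ∫ x in cell L, q x * (p.Dt κ).eval κ 0 x
      = ∑ i, ∑ j, ∫ x in cell L, S i j x * ((p.D κ i).D κ j).eval κ 0 x) :
    ∫ x in cell L, pw (q x) ≤ 400 * ∑ i, ∑ j, ∫ x in cell L, pw (S i j x) := by
  -- The dual function is a small multiple of `sgn(q) |q|^{1/2}`, so `q g` and `|g|³` are both
  -- multiples of `|q|^{3/2}`. The factor `1/20` makes `108/8000` smaller than `1/20`, so the cubic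
  -- term is absorbed; `12 / (1/20 - 108/8000)` is less than `400`.
  set g : E3 → ℝ := fun x => 1 / 20 * (Real.sqrt (max (q x) 0) - Real.sqrt (max (-q x) 0)) with hg
  have cg : Continuous g := by fun_prop
  have pg : Per L g := fun x i => by simp only [hg, hqp x i]
  obtain ⟨r, hr⟩ := exists_trigPoly_seq hL hκ cg pg 0
  obtain ⟨C, hC0, hC⟩ := exists_bound_cell L cg
  obtain ⟨Cq, hCq0, hCq⟩ := exists_bound_cell L hq
  have hb : ∀ n, ∀ x ∈ cell L, |(r n).eval κ 0 x| ≤ C + 1 := fun n x hx =>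
    (trigPoly_seq_bound hr n (hC x hx)).trans (by norm_num)
  have l1 : Tendsto (fun n => ∫ x in cell L, q x * (r n).eval κ 0 x) atTop
      (𝓝 (∫ x in cell L, q x * g x)) :=
    tendsto_integral_cell (C := Cq * (C + 1)) (fun n => by fun_prop) (fun n x hx => by
      rw [abs_mul]
      exact mul_le_mul (hCq x hx) (hb n x hx) (abs_nonneg _) hCq0)
      fun x => (trigPoly_seq_tendsto hr x).const_mul _
  have l2 : Tendsto (fun n => ∫ x in cell L, |(r n).eval κ 0 x| ^ 3) atTop
      (𝓝 (∫ x in cell L, |g x| ^ 3)) :=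
    tendsto_integral_cell (C := (C + 1) ^ 3) (fun n => by fun_prop) (fun n x hx => by
      rw [abs_pow, abs_abs]
      exact pow_le_pow_left₀ (abs_nonneg _) (hb n x hx) 3)
      fun x => (trigPoly_seq_tendsto hr x).abs.pow 3
  have h1 := le_of_tendsto_of_tendsto' l1.abs ((l2.const_mul 108).const_add
    (12 * (∑ i, ∑ j, ∫ x in cell L, pw (S i j x))))
    fun n => abs_integral_mul_trigPoly_le hL hκ hq hq0 hS hSp heq (r n)
  have e0 : ∀ x, q x * g x = 1 / 20 * pw (q x) ∧ |g x| ^ 3 = 1 / 8000 * pw (q x) := by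
    intro x
    simp only [hg, pw]
    rcases le_total 0 (q x) with h | h
    · rw [max_eq_left h, max_eq_right (by linarith : -q x ≤ 0), Real.sqrt_zero, sub_zero,
        abs_of_nonneg h, abs_of_nonneg (by positivity)]
      refine ⟨by ring, ?_⟩
      have := Real.sq_sqrt h
      calc _ = 1 / 8000 * (Real.sqrt (q x) ^ 2 * Real.sqrt (q x)) := by ring
        _ = _ := by rw [this]
    · rw [max_eq_right h, max_eq_left (by linarith : 0 ≤ -q x), Real.sqrt_zero, zero_sub,
        abs_of_nonpos h, mul_neg, abs_neg, abs_of_nonneg (by positivity)]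
      refine ⟨by ring, ?_⟩
      have := Real.sq_sqrt (by linarith : 0 ≤ -q x)
      calc _ = 1 / 8000 * (Real.sqrt (-q x) ^ 2 * Real.sqrt (-q x)) := by ring
        _ = _ := by rw [this]
  simp_rw [(e0 _).1, (e0 _).2, integral_const_mul] at h1
  have h2 : 0 ≤ ∫ x in cell L, pw (q x) := integral_nonneg fun x => pw_nonneg _
  rw [abs_of_nonneg (by positivity)] at h1
  have h3 : 0 ≤ ∑ i, ∑ j, ∫ x in cell L, pw (S i j x) := Finset.sum_nonneg fun i _ =>
    Finset.sum_nonneg fun j _ => integral_nonneg fun x => pw_nonneg _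
  linarith

/-- The gradient of a solenoidal field is controlled by its curl in `L^{3/2}` of the torus. -/
lemma integral_pw_gradient_le (hL : 0 < L) {v : Fin 3 → E3 → ℝ} {dv : Fin 3 → Fin 3 → E3 → ℝ}
    (cv : ∀ l, Continuous (v l)) (pv : ∀ l, Per L (v l))
    (cdv : ∀ i l, Continuous (dv i l)) (pdv : ∀ i l, Per L (dv i l))
    (hd : ∀ i l x, HasDerivAt (fun s : ℝ => v l (x + s • e i)) (dv i l x) 0)
    (hdiv : ∀ x, ∑ l, dv l l x = 0) (i l : Fin 3) :
    ∫ x in cell L, pw (dv i l x) ≤ 400 * ∑ m, ∫ x in cell L, pw (dv m l x - dv l m x) := by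
  set κ := 2 * Real.pi / L with hκ
  have ibp : ∀ (p : TrigPoly) (m k : Fin 3), ∫ x in cell L, dv m k x * p.eval κ 0 x
      = -∫ x in cell L, v k x * (p.D κ m).eval κ 0 x := fun p m k =>
    integral_cell_by_parts hL m (pv k) (pdv m k) (p.per_eval 0 hL hκ) ((p.D κ m).per_eval 0 hL hκ)
      (cv k) (cdv m k) (by fun_prop) (by fun_prop) (hd m k) (fun x => p.hasDerivAt_space 0 x m)
  have comm : ∀ (p : TrigPoly) (a b : Fin 3) (x : E3),
      ((p.D κ a).D κ b).eval κ 0 x = ((p.D κ b).D κ a).eval κ 0 x := by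
    intro p a b x
    rw [TrigPoly.eval_DD, TrigPoly.eval_DD]
    simp only [mul_comm]
  -- For solenoidal `v`, `Δ∂ᵢv_l = Σ_m ∂_m∂ᵢ(∂_m v_l - ∂_l v_m)`, because the subtracted part is
  -- `∂ᵢ∂_l div v`. The stress therefore has only the column `k = i`, filled with entries of the
  -- curl.
  have h := integral_pw_le hL hκ (q := dv i l)
    (S := fun m k x => if k = i then dv m l x - dv l m x else 0) (cdv i l) (pdv i l)
    (integral_cell_deriv hL (pv l) i (hd i l) (cdv i l) (cv l) (pdv i l))
    (fun m k => by split_ifs <;> fun_prop) (fun m k x a => by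
      simp only [pdv m l x a, pdv l m x a]) (fun p => ?_)
  · refine h.trans (le_of_eq ?_)
    congr 1
    refine Finset.sum_congr rfl fun m _ => ?_
    rw [Finset.sum_eq_single i (fun k _ hk => by simp [hk]) (by simp)]
    simp
  · have e0 : ∀ m, ∑ k, ∫ x in cell L, (if k = i then dv m l x - dv l m x else 0) *
        ((p.D κ m).D κ k).eval κ 0 x = ∫ x in cell L, (dv m l x - dv l m x) *
        ((p.D κ m).D κ i).eval κ 0 x := fun m => by
      rw [Finset.sum_eq_single i (fun k _ hk => by simp [hk]) (by simp)]
      simp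
    simp_rw [e0, sub_mul]
    have e1 : ∀ m, ∫ x in cell L, (dv m l x * ((p.D κ m).D κ i).eval κ 0 x -
        dv l m x * ((p.D κ m).D κ i).eval κ 0 x) =
        (∫ x in cell L, dv m l x * ((p.D κ i).D κ m).eval κ 0 x) -
        ∫ x in cell L, dv m m x * ((p.D κ i).D κ l).eval κ 0 x := by
      intro m
      rw [integral_sub (integrableOn_cell (by fun_prop)) (integrableOn_cell (by fun_prop))]
      congr 1
      · simp_rw [comm p m i]
      · simp_rw [comm p m i]
        rw [ibp ((p.D κ i).D κ m) l m, ibp ((p.D κ i).D κ l) m m]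
        simp_rw [comm (p.D κ i) m l]
    simp_rw [e1, Finset.sum_sub_distrib]
    have e2 : ∑ m, ∫ x in cell L, dv m m x * ((p.D κ i).D κ l).eval κ 0 x = 0 := by
      rw [← integral_finsetSum _ fun m _ => integrableOn_cell (by fun_prop)]
      simp_rw [← Finset.sum_mul, hdiv]
      simp
    rw [e2, sub_zero]
    simp_rw [TrigPoly.eval_Dt, Finset.mul_sum]
    rw [integral_finsetSum _ fun m _ => integrableOn_cell (by fun_prop)]
    refine Finset.sum_congr rfl fun m _ => ?_
    rw [ibp ((p.D κ m).D κ m) i l, ibp ((p.D κ i).D κ m) m l]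
    congr 1
    refine integral_congr_ae (Eventually.of_forall fun x => ?_)
    simp only
    congr 1
    rw [comm]
    simp only [TrigPoly.D, TrigPoly.op_op]
    congr 2
    · ext k; ring

end CZ

/-! ### The cube of a curl -/

lemma hasDerivAt_mul_abs (s : ℝ) : HasDerivAt (fun s : ℝ => s * |s|) (2 * |s|) s := by
  rcases eq_or_ne s 0 with rfl | hs
  · have h : HasDerivAt (fun s : ℝ => s * |s|) 0 0 := by
      rw [hasDerivAt_iff_isLittleO_nhds_zero]
      simp only [zero_add, abs_zero, mul_zero, sub_zero, smul_zero]
      have : (fun h : ℝ => h) =O[𝓝 0] fun h : ℝ => h := Asymptotics.isBigO_refl _ _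
      have h2 : (fun h : ℝ => |h|) =o[𝓝 0] fun _ : ℝ => (1 : ℝ) := by
        rw [Asymptotics.isLittleO_one_iff]
        simpa using (continuous_abs (G := ℝ)).tendsto 0
      simpa using this.mul_isLittleO h2
    simpa using h
  · refine ((hasDerivAt_id s).mul (hasDerivAt_abs hs)).congr_deriv ?_
    rcases lt_or_gt_of_ne hs with h | h
    · simp [h, abs_of_neg h]; ring
    · simp [h, abs_of_pos h]; ring

/-- Compare `a` with `3√y`: below, the left side is at most `6 y^{3/2}`; above, it is at most `(2/9)
a³`. -/
lemma two_mul_mul_le_young (a y : ℝ) (ha : 0 ≤ a) (hy : 0 ≤ y) :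
    2 * a * y ≤ 1 / 4 * a ^ 3 + 6 * (y * Real.sqrt y) := by
  have hs := Real.sq_sqrt hy
  set s := Real.sqrt y
  have hs0 : 0 ≤ s := Real.sqrt_nonneg y
  rw [← hs]
  rcases le_total a (3 * s) with h | h
  · nlinarith [mul_nonneg (sub_nonneg.2 h) (sq_nonneg s), pow_nonneg ha 3]
  · have : 9 * s ^ 2 ≤ a ^ 2 := by nlinarith
    nlinarith [mul_nonneg (sub_nonneg.2 this) ha, pow_nonneg hs0 3]

/-- A component `v = ∂ᵢf - ∂ⱼg` of the curl of a bounded field is in `L³` as soon as its gradient is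
in `L^{3/2}`. -/
lemma integral_abs_cube_le {L : ℝ} (hL : 0 < L) {f g f' g' v vi vj : E3 → ℝ} {M : ℝ} (i j : Fin 3)
    (hf : Per L f) (hf' : Per L f') (hg : Per L g) (hg' : Per L g')
    (hvi : Per L vi) (hvj : Per L vj)
    (cf : Continuous f) (cf' : Continuous f') (cg : Continuous g) (cg' : Continuous g')
    (cvi : Continuous vi) (cvj : Continuous vj)
    (hdf : ∀ x, HasDerivAt (fun s : ℝ => f (x + s • e i)) (f' x) 0)
    (hdg : ∀ x, HasDerivAt (fun s : ℝ => g (x + s • e j)) (g' x) 0)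
    (hdvi : ∀ x, HasDerivAt (fun s : ℝ => v (x + s • e i)) (vi x) 0)
    (hdvj : ∀ x, HasDerivAt (fun s : ℝ => v (x + s • e j)) (vj x) 0)
    (hv : ∀ x, v x = f' x - g' x) (hfM : ∀ x, |f x| ≤ M) (hgM : ∀ x, |g x| ≤ M) :
    ∫ x in cell L, |v x| ^ 3 ≤
      12 * pw M * ((∫ x in cell L, pw (vi x)) + ∫ x in cell L, pw (vj x)) := by
  have hM : 0 ≤ M := (abs_nonneg _).trans (hfM 0)
  have pv : Per L v := fun x k => by simp only [hv, hf' x k, hg' x k]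
  have cv : Continuous v := by rw [show v = fun x => f' x - g' x from funext hv]; fun_prop
  have hder : ∀ (k : Fin 3) (vk : E3 → ℝ),
      (∀ x, HasDerivAt (fun s : ℝ => v (x + s • e k)) (vk x) 0) → ∀ x,
      HasDerivAt (fun s : ℝ => v (x + s • e k) * |v (x + s • e k)|) (2 * |v x| * vk x) 0 := by
    intro k vk h x
    have h1 := (hasDerivAt_mul_abs (v (x + (0 : ℝ) • e k))).comp 0 (h x)
    exact h1.congr_deriv (by simp)
  -- The cube is `|v|³ = (∂ᵢf - ∂ⱼg) v|v|`. Integration by parts puts the derivative on the `C¹`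
  -- function `v|v|`, which costs `2|v||∇v|`, and leaves the bounded potentials undifferentiated.
  have e1 := integral_cell_by_parts hL i hf hf' (g := fun x => v x * |v x|)
    (g' := fun x => 2 * |v x| * vi x) (fun x k => by simp only [pv x k])
    (fun x k => by simp only [pv x k, hvi x k]) cf cf' (by fun_prop) (by fun_prop) hdf
    (hder i vi hdvi)
  have e2 := integral_cell_by_parts hL j hg hg' (g := fun x => v x * |v x|)
    (g' := fun x => 2 * |v x| * vj x) (fun x k => by simp only [pv x k])
    (fun x k => by simp only [pv x k, hvj x k]) cg cg' (by fun_prop) (by fun_prop) hdg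
    (hder j vj hdvj)
  have e3 : ∫ x in cell L, |v x| ^ 3 = (∫ x in cell L, f' x * (v x * |v x|)) -
      ∫ x in cell L, g' x * (v x * |v x|) := by
    rw [← integral_sub (integrableOn_cell (by fun_prop)) (integrableOn_cell (by fun_prop))]
    refine integral_congr_ae (Eventually.of_forall fun x => ?_)
    simp only
    rw [← sub_mul, ← hv, ← mul_assoc, ← sq, ← sq_abs]; ring
  rw [e1, e2] at e3
  have e4 : ∫ x in cell L, |v x| ^ 3 = ∫ x in cell L, (g x * (2 * |v x| * vj x) -
      f x * (2 * |v x| * vi x)) := by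
    rw [integral_sub (integrableOn_cell (by fun_prop)) (integrableOn_cell (by fun_prop)), e3]
    ring
  have e5 : ∫ x in cell L, (g x * (2 * |v x| * vj x) - f x * (2 * |v x| * vi x)) ≤
      ∫ x in cell L, (1 / 2 * |v x| ^ 3 + 6 * pw M * (pw (vi x) + pw (vj x))) := by
    refine integral_mono (integrableOn_cell (by fun_prop)) (integrableOn_cell (by fun_prop))
      fun x => ?_
    -- Each of the two terms costs a quarter of `|v|³`, so half of the left side remains after
    -- absorption; this is why `6` becomes `12`.
    have hy : ∀ (h w : ℝ), |h| ≤ M →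
        h * (2 * |v x| * w) ≤ 1 / 4 * |v x| ^ 3 + 6 * (pw M * pw w) := by
      intro h w hh
      have h1 := two_mul_mul_le_young (|v x|) (M * |w|) (abs_nonneg _) (by positivity)
      have h2 : pw M * pw w = M * |w| * Real.sqrt (M * |w|) := by
        rw [pw, pw, abs_of_nonneg hM, Real.sqrt_mul hM]; ring
      rw [h2]
      refine le_trans ?_ h1
      calc h * (2 * |v x| * w) ≤ |h * (2 * |v x| * w)| := le_abs_self _
        _ = |h| * (2 * |v x| * |w|) := by rw [abs_mul, abs_mul, abs_mul, abs_abs, abs_two]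
        _ ≤ M * (2 * |v x| * |w|) := mul_le_mul_of_nonneg_right hh (by positivity)
        _ = _ := by ring
    have h1 := hy (g x) (vj x) (hgM x)
    have h2 := hy (-f x) (vi x) (by rw [abs_neg]; exact hfM x)
    simp only
    linarith
  rw [integral_add (integrableOn_cell (by fun_prop)) (integrableOn_cell (by fun_prop)),
    integral_const_mul, integral_const_mul,
    integral_add (integrableOn_cell (by fun_prop)) (integrableOn_cell (by fun_prop))] at e5
  linarith

/-! ### Calculus on space-time and smearing by a smooth kernel -/

/-- Space-time. -/
abbrev Z : Type := ℝ × E3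

instance : (volume : Measure Z).IsAddHaarMeasure :=
  inferInstanceAs ((volume : Measure ℝ).prod (volume : Measure E3)).IsAddHaarMeasure

/-- The partial derivative in the direction `v`. -/
def pd (v : Z) (f : Z → ℝ) (z : Z) : ℝ := fderiv ℝ f z v

/-- The time direction. -/
def tv : Z := (1, 0)

/-- The `i`-th space direction. -/
def xv (i : Fin 3) : Z := (0, e i)

/-- `f` is smooth. -/
abbrev Smooth (f : Z → ℝ) : Prop := ContDiff ℝ (⊤ : ℕ∞) f

lemma Smooth.differentiable' {f : Z → ℝ} (hf : Smooth f) : Differentiable ℝ f :=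
  hf.differentiable (by simp)

lemma Smooth.pd {f : Z → ℝ} (hf : Smooth f) (v : Z) : Smooth (pd v f) :=
  (hf.fderiv_right (m := (⊤ : ℕ∞)) (by simp)).clm_apply contDiff_const

lemma pd_add {f g : Z → ℝ} (v : Z) (hf : Smooth f) (hg : Smooth g) (z : Z) :
    pd v (fun z => f z + g z) z = pd v f z + pd v g z := by
  simp only [pd]
  rw [fderiv_fun_add (hf.differentiable' z) (hg.differentiable' z)]; rfl

lemma pd_sub {f g : Z → ℝ} (v : Z) (hf : Smooth f) (hg : Smooth g) (z : Z) :
    pd v (fun z => f z - g z) z = pd v f z - pd v g z := by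
  simp only [pd]
  rw [fderiv_fun_sub (hf.differentiable' z) (hg.differentiable' z)]; rfl

lemma pd_mul {f g : Z → ℝ} (v : Z) (hf : Smooth f) (hg : Smooth g) (z : Z) :
    pd v (fun z => f z * g z) z = pd v f z * g z + f z * pd v g z := by
  simp only [pd]
  rw [fderiv_fun_mul (hf.differentiable' z) (hg.differentiable' z)]
  simp only [add_apply, smul_apply, smul_eq_mul]; ring

lemma pd_comm {f : Z → ℝ} (hf : Smooth f) (v w : Z) (z : Z) :
    pd v (pd w f) z = pd w (pd v f) z := by
  have hd : DifferentiableAt ℝ (fderiv ℝ f) z :=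
    (hf.fderiv_right (m := (⊤ : ℕ∞)) (by simp)).differentiable (by simp) z
  have h1 : ∀ a b : Z, pd a (pd b f) z = fderiv ℝ (fderiv ℝ f) z a b := by
    intro a b
    simp only [pd]
    have : fderiv ℝ (fun z => fderiv ℝ f z b) z = (fderiv ℝ (fderiv ℝ f) z).flip b := by
      rw [fderiv_clm_apply hd (differentiableAt_const b), fderiv_fun_const]
      simp
    change fderiv ℝ (fun z => fderiv ℝ f z b) z a = _
    rw [this]; rfl
  rw [h1, h1]
  have hs : IsSymmSndFDerivAt ℝ f z :=
    hf.contDiffAt.isSymmSndFDerivAt (by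
      rw [minSmoothness_of_isRCLikeNormedField]; exact WithTop.coe_le_coe.2 le_top)
  exact hs v w

lemma hasDerivAt_slice {f : Z → ℝ} (hf : Smooth f) (t : ℝ) (x : E3) (i : Fin 3) :
    HasDerivAt (fun s : ℝ => f (t, x + s • e i)) (pd (xv i) f (t, x)) 0 := by
  have h1 : HasFDerivAt f (fderiv ℝ f (t, x)) ((t, x) + (0 : ℝ) • xv i) := by
    rw [zero_smul, add_zero]; exact (hf.differentiable' _).hasFDerivAt
  have h2 : HasDerivAt (fun s : ℝ => (t, x) + s • xv i) (xv i) 0 := by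
    simpa using ((hasDerivAt_id (0 : ℝ)).smul_const (xv i)).const_add (t, x)
  have h3 := h1.comp_hasDerivAt 0 h2
  refine h3.congr_of_eventuallyEq (Eventually.of_forall fun s => ?_)
  simp [xv]

/-- `ψ` is a test function supported in `W`. -/
structure IsTest (W : Set Z) (ψ : Z → ℝ) : Prop where
  smooth : Smooth ψ
  compact : HasCompactSupport ψ
  supp : tsupport ψ ⊆ W

lemma tsupport_pd_subset (v : Z) (f : Z → ℝ) : tsupport (pd v f) ⊆ tsupport f := by
  refine (closure_mono ?_).trans (closure_closure.subset.trans subset_rfl)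
  intro z hz
  by_contra h
  apply hz
  have := (image_eq_zero_of_notMem_tsupport fun h' => h (tsupport_fderiv_subset ℝ h') :
    fderiv ℝ f z = 0)
  simp [pd, this]

lemma hasCompactSupport_pd {f : Z → ℝ} (v : Z) (hf : HasCompactSupport f) :
    HasCompactSupport (pd v f) :=
  hf.of_isClosed_subset (isClosed_tsupport _) (tsupport_pd_subset v f)

lemma IsTest.pd {W : Set Z} {ψ : Z → ℝ} (h : IsTest W ψ) (v : Z) : IsTest W (pd v ψ) :=
  ⟨h.smooth.pd v, hasCompactSupport_pd v h.compact, (tsupport_pd_subset v ψ).trans h.supp⟩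

lemma IsTest.mul {W : Set Z} {ψ f : Z → ℝ} (h : IsTest W ψ) (hf : Smooth f) :
    IsTest W (fun z => ψ z * f z) :=
  ⟨h.smooth.mul hf, h.compact.mul_right, (tsupport_mul_subset_left).trans h.supp⟩

lemma IsTest.mono {W W' : Set Z} {ψ : Z → ℝ} (h : IsTest W ψ) (hW : W ⊆ W') : IsTest W' ψ :=
  ⟨h.smooth, h.compact, h.supp.trans hW⟩

lemma integrable_mul_test {f ψ : Z → ℝ} (hf : LocallyIntegrable f) (hψ : Continuous ψ)
    (hc : HasCompactSupport ψ) : Integrable (fun z => f z * ψ z) := by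
  have := hf.integrable_smul_left_of_hasCompactSupport hψ hc
  simpa only [smul_eq_mul, mul_comm] using this

lemma integral_pd_eq_zero {ψ : Z → ℝ} (v : Z) (h : Smooth ψ) (hc : HasCompactSupport ψ) :
    ∫ z, pd v ψ z = 0 := by
  have hi := (h.pd v).continuous.integrable_of_hasCompactSupport (μ := volume)
    (hasCompactSupport_pd v hc)
  have h1 := integral_mul_fderiv_eq_neg_fderiv_mul_of_integrable (μ := (volume : Measure Z))
    (f := fun _ : Z => (1 : ℝ)) (g := ψ) (v := v) (by simp)
    (hi.congr (Eventually.of_forall fun x => (one_mul _).symm))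
    (by simpa using h.continuous.integrable_of_hasCompactSupport hc)
    (fun x _ => differentiableAt_const _) (fun x _ => h.differentiable' x)
  simpa [pd] using h1

/-- The convolution of `f` with a kernel `ρ`. -/
def smear (ρ f : Z → ℝ) : Z → ℝ := convolution ρ f (ContinuousLinearMap.lsmul ℝ ℝ) volume

lemma smear_apply (ρ f : Z → ℝ) (z : Z) : smear ρ f z = ∫ h, ρ h * f (z - h) := rfl

lemma smear_apply' (ρ f : Z → ℝ) (z : Z) : smear ρ f z = ∫ y, ρ (z - y) * f y := by
  rw [smear, convolution_lsmul_swap]; rfl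

lemma smooth_smear {ρ f : Z → ℝ} (hρ : Smooth ρ) (hc : HasCompactSupport ρ)
    (hf : LocallyIntegrable f) : Smooth (smear ρ f) :=
  hc.contDiff_convolution_left _ hρ hf

lemma integrable_smear {ρ f : Z → ℝ} (hρ : Continuous ρ) (hc : HasCompactSupport ρ)
    (hf : LocallyIntegrable f) (z : Z) : Integrable (fun h => ρ h * f (z - h)) :=
  (hc.convolutionExists_left (ContinuousLinearMap.lsmul ℝ ℝ) hρ hf z)

lemma pd_smear {ρ f : Z → ℝ} (hρ : Smooth ρ) (hc : HasCompactSupport ρ)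
    (hf : LocallyIntegrable f) (v : Z) (z : Z) :
    pd v (smear ρ f) z = smear (pd v ρ) f z := by
  have h := hc.hasFDerivAt_convolution_left (ContinuousLinearMap.lsmul ℝ ℝ)
    (hρ.of_le (by simp)) hf z
  rw [pd, smear, h.fderiv, convolution, smear, convolution]
  have hi := (hc.fderiv ℝ).convolutionExists_left
    ((ContinuousLinearMap.lsmul ℝ ℝ : ℝ →L[ℝ] ℝ →L[ℝ] ℝ).precompL Z)
    (hρ.fderiv_right (m := (⊤ : ℕ∞)) (by simp)).continuous hf z
  rw [ContinuousLinearMap.integral_apply hi]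
  rfl

lemma smear_const_mul (ρ f : Z → ℝ) (c : ℝ) (z : Z) :
    smear ρ (fun z => c * f z) z = c * smear ρ f z := by
  simp only [smear_apply, mul_left_comm _ c, integral_const_mul]

lemma smear_sub {ρ f g : Z → ℝ} (hρ : Continuous ρ) (hc : HasCompactSupport ρ)
    (hf : LocallyIntegrable f) (hg : LocallyIntegrable g) (z : Z) :
    smear ρ (fun z => f z - g z) z = smear ρ f z - smear ρ g z := by
  simp only [smear_apply, mul_sub]
  exact integral_sub (integrable_smear hρ hc hf z) (integrable_smear hρ hc hg z)

/-- The kernel seen from the point `z`, as a test function. -/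
lemma isTest_reflect {W : Set Z} {ρ : Z → ℝ} (hρ : Smooth ρ) (hc : HasCompactSupport ρ) {z : Z}
    (hz : ∀ h ∈ tsupport ρ, z - h ∈ W) : IsTest W (fun y => ρ (z - y)) := by
  refine ⟨hρ.comp (contDiff_const.sub contDiff_id), ?_, ?_⟩
  · exact hc.comp_homeomorph (Homeomorph.subLeft z)
  · intro y hy
    have : z - y ∈ tsupport ρ := by
      have := tsupport_comp_subset_preimage ρ (f := fun y => z - y) (by fun_prop) hy
      exact this
    simpa using hz _ this

lemma pd_reflect {ρ : Z → ℝ} (hρ : Smooth ρ) (v z y : Z) :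
    pd v (fun y => ρ (z - y)) y = -pd v ρ (z - y) := by
  have h1 : HasFDerivAt (fun y : Z => z - y) (-ContinuousLinearMap.id ℝ Z) y := by
    simpa using (hasFDerivAt_id y).const_sub z
  have h2 := (hρ.differentiable' (z - y)).hasFDerivAt.comp y h1
  change fderiv ℝ (ρ ∘ fun y => z - y) y v = _
  rw [h2.fderiv]
  simp [pd]

lemma integral_mul_reflect (ρ f : Z → ℝ) (z : Z) : ∫ y, f y * ρ (z - y) = smear ρ f z := by
  simp only [smear_apply', mul_comm]

lemma integral_mul_pd_reflect {ρ f : Z → ℝ} (hρ : Smooth ρ) (hc : HasCompactSupport ρ)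
    (hf : LocallyIntegrable f) (v z : Z) :
    ∫ y, f y * pd v (fun y => ρ (z - y)) y = -pd v (smear ρ f) z := by
  rw [pd_smear hρ hc hf, smear_apply', ← integral_neg]
  refine integral_congr_ae (Eventually.of_forall fun y => ?_)
  simp only [pd_reflect hρ]; ring

/-! ### Continuity of translations and convergence of mollifications -/

lemma measurePreserving_add (h : Z) :
    MeasurePreserving (fun z : Z => z + h) volume volume := measurePreserving_add_right volume h

/-- Translations are continuous in `Lᵖ`. -/
lemma tendsto_eLpNorm_translate {p : ℝ≥0∞} (hp1 : 1 ≤ p) (hp : p ≠ ∞) {f : Z → ℝ}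
    (hf : MemLp f p volume) (h₀ : Z) :
    Tendsto (fun h => eLpNorm (fun z => f (z + h) - f (z + h₀)) p volume) (𝓝 h₀) (𝓝 0) := by
  have : Fact (1 ≤ p) := ⟨hp1⟩
  let g : Z → C(Z, Z) := fun h => ⟨fun z => z + h, by fun_prop⟩
  have hg : Continuous g := ContinuousMap.continuous_of_continuous_uncurry _
    (by simp only [g, ContinuousMap.coe_mk]; fun_prop)
  have hc := (continuous_const (y := hf.toLp f)).compMeasurePreservingLp hg
    (fun h => measurePreserving_add h) hp
  have ht := hc.tendsto h₀
  simp only [Lp.toLp_compMeasurePreserving] at ht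
  rw [Lp.tendsto_Lp_iff_tendsto_eLpNorm''] at ht
  exact ht

/-- Jensen's inequality for a probability density. -/
lemma enorm_integral_mul_rpow_le {ρ u : Z → ℝ} (hρ : Continuous ρ) (h0 : ∀ z, 0 ≤ ρ z)
    (h1 : ∫ z, ρ z = 1) (hu : AEStronglyMeasurable u volume) {q : ℝ} (hq : 1 ≤ q) :
    ‖∫ h, ρ h * u h‖ₑ ^ q ≤ ∫⁻ h, ENNReal.ofReal (ρ h) * ‖u h‖ₑ ^ q := by
  have hq0 : 0 < q := zero_lt_one.trans_le hq
  have hm : Measurable fun z => ENNReal.ofReal (ρ z) := hρ.measurable.ennreal_ofReal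
  set ν : Measure Z := volume.withDensity fun z => ENNReal.ofReal (ρ z) with hν
  have hi : Integrable ρ := by
    by_contra h
    rw [integral_undef h] at h1
    exact zero_ne_one h1
  have : IsProbabilityMeasure ν := ⟨by
    rw [hν, withDensity_apply _ MeasurableSet.univ, Measure.restrict_univ,
      ← ofReal_integral_eq_lintegral_ofReal hi (Eventually.of_forall h0), h1, ENNReal.ofReal_one]⟩
  have hac : ν ≪ volume := withDensity_absolutelyContinuous _ _
  have h2 := eLpNorm'_le_eLpNorm'_of_exponent_le zero_lt_one hq ν (hu.mono_ac hac)
  simp only [eLpNorm', ENNReal.rpow_one, div_one] at h2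
  have h3 : ‖∫ h, ρ h * u h‖ₑ ≤ ∫⁻ h, ‖u h‖ₑ ∂ν := by
    refine (enorm_integral_le_lintegral_enorm _).trans (le_of_eq ?_)
    rw [hν, lintegral_withDensity_eq_lintegral_mul₀ hm.aemeasurable hu.enorm]
    refine lintegral_congr fun h => ?_
    rw [enorm_mul, Pi.mul_apply, Real.enorm_eq_ofReal (h0 h)]
  calc ‖∫ h, ρ h * u h‖ₑ ^ q ≤ ((∫⁻ h, ‖u h‖ₑ ^ q ∂ν) ^ (1 / q)) ^ q :=
        ENNReal.rpow_le_rpow (h3.trans h2) hq0.le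
    _ = ∫⁻ h, ‖u h‖ₑ ^ q ∂ν := by
        rw [← ENNReal.rpow_mul, one_div_mul_cancel hq0.ne', ENNReal.rpow_one]
    _ = _ := by
        rw [hν, lintegral_withDensity_eq_lintegral_mul₀ hm.aemeasurable (hu.enorm.pow_const q)]
        rfl

/-- A sequence of smooth bumps shrinking to the origin of space-time. -/
def bump (n : ℕ) : ContDiffBump (0 : Z) where
  rIn := 1 / (2 * ((n : ℝ) + 1))
  rOut := 1 / ((n : ℝ) + 1)
  rIn_pos := by positivity
  rIn_lt_rOut := by
    rw [one_div_lt_one_div (by positivity) (by positivity)]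
    linarith [(Nat.cast_nonneg n : (0 : ℝ) ≤ n)]

/-- The standard sequence of mollifiers. -/
def moll (n : ℕ) : Z → ℝ := (bump n).normed volume

lemma smooth_moll (n : ℕ) : Smooth (moll n) := (bump n).contDiff_normed

lemma hasCompactSupport_moll (n : ℕ) : HasCompactSupport (moll n) :=
  (bump n).hasCompactSupport_normed

lemma moll_nonneg (n : ℕ) (z : Z) : 0 ≤ moll n z := (bump n).nonneg_normed z

lemma integral_moll (n : ℕ) : ∫ z, moll n z = 1 := (bump n).integral_normed

lemma tsupport_moll (n : ℕ) : tsupport (moll n) = Metric.closedBall 0 (1 / ((n : ℝ) + 1)) :=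
  (bump n).tsupport_normed_eq

lemma norm_le_of_moll_ne_zero {n : ℕ} {z : Z} (h : moll n z ≠ 0) : ‖z‖ ≤ 1 / ((n : ℝ) + 1) := by
  have : z ∈ tsupport (moll n) := subset_tsupport _ h
  rwa [tsupport_moll, mem_closedBall_zero_iff] at this

lemma ae_tendsto_smear_moll {f : Z → ℝ} (hf : LocallyIntegrable f) :
    ∀ᵐ z : Z, Tendsto (fun n => smear (moll n) f z) atTop (𝓝 (f z)) := by
  -- Lebesgue differentiation needs a bounded ratio of outer to inner radius; here the ratio is
  -- exactly `2`.
  refine ContDiffBump.ae_convolution_tendsto_right_of_locallyIntegrable (φ := bump) (K := 2)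
    tendsto_one_div_add_atTop_nhds_zero_nat (Eventually.of_forall fun n => ?_) hf
  simp only [bump]
  refine le_of_eq ?_
  field_simp

/-- The mollifications of a function of `Lᵖ` converge in `Lᵖ`. -/
lemma tendsto_eLpNorm_smear_sub {p : ℝ≥0∞} (hp1 : 1 ≤ p) (hp : p ≠ ∞) {f : Z → ℝ}
    (hf : MemLp f p volume) :
    Tendsto (fun n => eLpNorm (fun z => smear (moll n) f z - f z) p volume) atTop (𝓝 0) := by
  have hloc : LocallyIntegrable f := hf.locallyIntegrable hp1
  have hp0 : p ≠ 0 := (zero_lt_one.trans_le hp1).ne'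
  set q := p.toReal with hq
  have hq1 : 1 ≤ q := by
    rw [hq, ← ENNReal.toReal_one]; exact ENNReal.toReal_mono hp hp1
  have hq0 : 0 < q := zero_lt_one.trans_le hq1
  rw [ENNReal.tendsto_nhds_zero]
  intro ε hε
  have ht := tendsto_eLpNorm_translate hp1 hp hf 0
  rw [ENNReal.tendsto_nhds_zero] at ht
  obtain ⟨r, hr, hball⟩ := Metric.eventually_nhds_iff.1 (ht ε hε)
  have hn : ∀ᶠ n : ℕ in atTop, 1 / ((n : ℝ) + 1) < r :=
    tendsto_one_div_add_atTop_nhds_zero_nat.eventually_lt_const hr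
  filter_upwards [hn] with n hn
  -- The error is an average of `f(z - h) - f(z)` against a probability density. Jensen and Tonelli
  -- then reduce it to continuity of translations in `Lᵖ`.
  have hrepr : ∀ z, smear (moll n) f z - f z = ∫ h, moll n h * (f (z - h) - f z) := by
    intro z
    simp only [mul_sub]
    rw [integral_sub (integrable_smear (smooth_moll n).continuous (hasCompactSupport_moll n) hloc z)
      (((smooth_moll n).continuous.integrable_of_hasCompactSupport
        (hasCompactSupport_moll n)).mul_const _), integral_mul_const, integral_moll, one_mul,
      smear_apply]
  have hmeas : AEMeasurable (fun w : Z × Z => ENNReal.ofReal (moll n w.2) *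
      ‖f (w.1 - w.2) - f w.1‖ₑ ^ q) (volume.prod volume) := by
    have hfm := hf.1
    have m1 : AEStronglyMeasurable (fun w : Z × Z => f (w.1 - w.2)) (volume.prod volume) :=
      hfm.comp_quasiMeasurePreserving (quasiMeasurePreserving_sub_of_right_invariant volume volume)
    have m2 : AEStronglyMeasurable (fun w : Z × Z => f w.1) (volume.prod volume) := hfm.comp_fst
    exact ((smooth_moll n).continuous.measurable.comp measurable_snd).ennreal_ofReal.aemeasurable.mul
      ((m1.sub m2).enorm.pow_const q)
  have key : ∫⁻ z, ‖smear (moll n) f z - f z‖ₑ ^ q ≤ ε ^ q := by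
    calc ∫⁻ z, ‖smear (moll n) f z - f z‖ₑ ^ q
        ≤ ∫⁻ z, ∫⁻ h, ENNReal.ofReal (moll n h) * ‖f (z - h) - f z‖ₑ ^ q := by
          refine lintegral_mono fun z => ?_
          rw [hrepr]
          refine enorm_integral_mul_rpow_le (smooth_moll n).continuous (moll_nonneg n)
            (integral_moll n) ?_ hq1
          exact (hf.1.comp_measurePreserving (Measure.measurePreserving_sub_left volume z)).sub
            aestronglyMeasurable_const
      _ = ∫⁻ h, ∫⁻ z, ENNReal.ofReal (moll n h) * ‖f (z - h) - f z‖ₑ ^ q :=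
          lintegral_lintegral_swap hmeas
      _ ≤ ∫⁻ h, ENNReal.ofReal (moll n h) * ε ^ q := by
          refine lintegral_mono fun h => ?_
          by_cases h0 : moll n h = 0
          · simp [h0]
          rw [lintegral_const_mul' _ _ ENNReal.ofReal_ne_top]
          refine mul_le_mul_right ?_ _
          have h2 := hball (y := -h) (by
            rw [dist_zero_right, norm_neg]
            exact (norm_le_of_moll_ne_zero h0).trans_lt hn)
          rw [eLpNorm_eq_lintegral_rpow_enorm_toReal hp0 hp, ← hq] at h2
          simp only [add_zero, ← sub_eq_add_neg] at h2
          have h3 := ENNReal.rpow_le_rpow h2 hq0.le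
          rwa [← ENNReal.rpow_mul, one_div_mul_cancel hq0.ne', ENNReal.rpow_one] at h3
      _ = ε ^ q := by
          rw [lintegral_mul_const _ (smooth_moll n).continuous.measurable.ennreal_ofReal,
            ← ofReal_integral_eq_lintegral_ofReal
              ((smooth_moll n).continuous.integrable_of_hasCompactSupport
              (hasCompactSupport_moll n)) (Eventually.of_forall (moll_nonneg n)), integral_moll,
            ENNReal.ofReal_one, one_mul]
  rw [eLpNorm_eq_lintegral_rpow_enorm_toReal hp0 hp, ← hq]
  calc _ ≤ (ε ^ q) ^ (1 / q) := ENNReal.rpow_le_rpow key (by positivity)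
    _ = ε := by rw [← ENNReal.rpow_mul, mul_one_div_cancel hq0.ne', ENNReal.rpow_one]

/-! ### Slabs, periodicity in space, and slice-wise bounds -/

/-- The slab `(α, β) × ℝ³`. -/
def slab (α β : ℝ) : Set Z := Ioo α β ×ˢ univ

lemma mem_slab {α β : ℝ} {z : Z} : z ∈ slab α β ↔ z.1 ∈ Ioo α β := by simp [slab]

lemma isOpen_slab (α β : ℝ) : IsOpen (slab α β) := isOpen_Ioo.prod isOpen_univ

lemma measurableSet_slab (α β : ℝ) : MeasurableSet (slab α β) := (isOpen_slab α β).measurableSet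

/-- `f` is `L`-periodic in space. -/
def SPer (L : ℝ) (f : Z → ℝ) : Prop := ∀ (z : Z) (k : Fin 3), f (z + L • xv k) = f z

lemma SPer.slice {L : ℝ} {f : Z → ℝ} (hf : SPer L f) (t : ℝ) : Per L fun x => f (t, x) := by
  intro x k
  have := hf (t, x) k
  simpa [xv] using this

lemma SPer.smear {L : ℝ} {f : Z → ℝ} (hf : SPer L f) (ρ : Z → ℝ) : SPer L (smear ρ f) := by
  intro z k
  simp only [smear_apply]
  refine integral_congr_ae (Eventually.of_forall fun h => ?_)
  simp only
  rw [add_sub_right_comm, hf]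

lemma SPer.pd {L : ℝ} {f : Z → ℝ} (hf : SPer L f) (v : Z) : SPer L (pd v f) := by
  intro z k
  have : (fun y => f (y + L • xv k)) = f := funext fun y => hf y k
  simp only [EMHD.pd]
  conv_rhs => rw [← this]
  rw [fderiv_comp_add_right]

lemma lintegral_biUnion_finset_le {ι α : Type*} [MeasurableSpace α] {μ : Measure α}
    (s : Finset ι) (t : ι → Set α) (f : α → ℝ≥0∞) :
    ∫⁻ x in ⋃ i ∈ s, t i, f x ∂μ ≤ ∑ i ∈ s, ∫⁻ x in t i, f x ∂μ := by
  classical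
  induction s using Finset.induction_on with
  | empty => simp
  | insert i s hi ih =>
    rw [Finset.set_biUnion_insert, Finset.sum_insert hi]
    exact (lintegral_union_le _ _ _).trans (by gcongr)

/-- A ball is covered by finitely many lattice translates of the cell, all carrying the same
integral. The number `m` does not depend on `F`, so it serves all time slices at once. -/
lemma exists_lintegral_ball_le {L : ℝ} (hL : 0 < L) (R : ℝ) : ∃ m : ℕ, ∀ F : E3 → ℝ≥0∞, Per L F →
    ∫⁻ x in Metric.ball 0 R, F x ≤ m * ∫⁻ x in cell L, F x := by
  set k : ℤ := ⌈R / L⌉ + 1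
  let s : Finset (Fin 3 → ℤ) := Fintype.piFinset fun _ => Finset.Icc (-k) k
  let v : (Fin 3 → ℤ) → E3 := fun n => WithLp.toLp 2 fun i => L * n i
  refine ⟨s.card, fun F hF => ?_⟩
  have hsub : Metric.ball (0 : E3) R ⊆ ⋃ n ∈ s, (fun x => x + -v n) ⁻¹' cell L := by
    intro x hx
    rw [mem_ball_zero_iff] at hx
    simp only [mem_iUnion]
    refine ⟨fun i => ⌊x i / L⌋, ?_, ?_⟩
    · simp only [s, Fintype.mem_piFinset, Finset.mem_Icc]
      intro i
      have h1 : |x i| ≤ R := by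
        have := PiLp.norm_apply_le x i
        rw [Real.norm_eq_abs] at this
        exact this.trans hx.le
      have h2 : |x i / L| ≤ R / L := by
        rw [abs_div, abs_of_pos hL]; exact div_le_div_of_nonneg_right h1 hL.le
      have h3 := abs_le.1 h2
      have h4 : R / L ≤ ⌈R / L⌉ := Int.le_ceil _
      constructor
      · rw [Int.le_floor]; push_cast [k]; linarith
      · have : (⌊x i / L⌋ : ℝ) ≤ ⌈R / L⌉ := (Int.floor_le _).trans (h3.2.trans h4)
        have : ⌊x i / L⌋ ≤ ⌈R / L⌉ := by exact_mod_cast this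
        omega
    · intro i
      have h1 := Int.floor_le (x i / L)
      have h2 := Int.lt_floor_add_one (x i / L)
      rw [le_div_iff₀ hL] at h1
      rw [div_lt_iff₀ hL] at h2
      simp only [v, PiLp.add_apply, PiLp.neg_apply, mem_Ico]
      constructor <;> linarith
  calc ∫⁻ x in Metric.ball 0 R, F x
      ≤ ∫⁻ x in ⋃ n ∈ s, (fun x => x + -v n) ⁻¹' cell L, F x := lintegral_mono_set hsub
    _ ≤ ∑ n ∈ s, ∫⁻ x in (fun x => x + -v n) ⁻¹' cell L, F x := lintegral_biUnion_finset_le _ _ _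
    _ = ∑ n ∈ s, ∫⁻ x in cell L, F x := by
        refine Finset.sum_congr rfl fun n _ => ?_
        rw [← lintegral_cell_shift hL hF (v n)]
        have := (measurePreserving_add_right (volume : Measure E3)
          (-v n)).setLIntegral_comp_preimage_emb (measurableEmbedding_addRight (-v n))
          (fun x => F (x + v n)) (cell L)
        rw [← this]
        simp
    _ = s.card * ∫⁻ x in cell L, F x := by rw [Finset.sum_const, nsmul_eq_mul]

lemma ball_subset_prod (R : ℝ) : Metric.ball (0 : Z) R ⊆ Ioo (-R) R ×ˢ Metric.ball 0 R := by
  intro z hz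
  rw [mem_ball_zero_iff, Prod.norm_def, max_lt_iff] at hz
  exact ⟨abs_lt.1 hz.1, by simpa using hz.2⟩

/-- A slice-wise bound for a periodic function gives a local bound in space-time. -/
lemma memLp_of_slice_bound {L : ℝ} (hL : 0 < L) {f : Z → ℝ} (hm : AEStronglyMeasurable f volume)
    (hf : SPer L f) {p : ℝ≥0∞} (hp0 : p ≠ 0) (hp : p ≠ ∞) {K : ℝ≥0∞} (hK : K ≠ ∞)
    (hb : ∀ᵐ t : ℝ, ∫⁻ x in cell L, ‖f (t, x)‖ₑ ^ p.toReal ≤ K) (R : ℝ) :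
    MemLp f p (volume.restrict (Metric.ball 0 R)) := by
  obtain ⟨m, hm'⟩ := exists_lintegral_ball_le hL R
  refine ⟨hm.restrict, ?_⟩
  rw [eLpNorm_lt_top_iff_lintegral_rpow_enorm_lt_top hp0 hp]
  have h1 : ∫⁻ z in Metric.ball (0 : Z) R, ‖f z‖ₑ ^ p.toReal
      ≤ ∫⁻ z in Ioo (-R) R ×ˢ Metric.ball 0 R, ‖f z‖ₑ ^ p.toReal :=
    lintegral_mono_set (ball_subset_prod R)
  refine h1.trans_lt ?_
  rw [Measure.volume_eq_prod, setLIntegral_prod _ (hm.enorm.pow_const _).restrict]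
  calc ∫⁻ t in Ioo (-R) R, ∫⁻ x in Metric.ball 0 R, ‖f (t, x)‖ₑ ^ p.toReal
      ≤ ∫⁻ t in Ioo (-R) R, m * K := by
        refine lintegral_mono_ae ((ae_restrict_of_ae hb).mono fun t ht => ?_)
        refine (hm' _ fun x k => ?_).trans (mul_le_mul_right ht _)
        simp only [hf.slice t x k]
    _ < ∞ := by
        rw [lintegral_const]
        exact ENNReal.mul_lt_top (ENNReal.mul_lt_top (by simp) hK.lt_top) (by simp)

lemma locallyIntegrable_of_memLp_ball {f : Z → ℝ} {p : ℝ≥0∞} (hp : 1 ≤ p)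
    (h : ∀ R, MemLp f p (volume.restrict (Metric.ball 0 R))) : LocallyIntegrable f := by
  intro z
  refine ⟨Metric.ball 0 (‖z‖ + 1), Metric.isOpen_ball.mem_nhds (by simp), ?_⟩
  have : IsFiniteMeasure ((volume : Measure Z).restrict (Metric.ball 0 (‖z‖ + 1))) :=
    ⟨by rw [Measure.restrict_apply_univ]; exact measure_ball_lt_top⟩
  exact (h _).integrable hp

lemma LocallyIntegrable.memLp_ball {f : Z → ℝ} (hf : LocallyIntegrable f) (R : ℝ) :
    MemLp f 1 (volume.restrict (Metric.ball 0 R)) :=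
  memLp_one_iff_integrable.2
    ((hf.integrableOn_isCompact (isCompact_closedBall 0 R)).mono_set Metric.ball_subset_closedBall)

/-- Local convergence of mollifications. -/
lemma tendsto_eLpNorm_smear_ball {p : ℝ≥0∞} (hp1 : 1 ≤ p) (hp : p ≠ ∞) {f : Z → ℝ}
    (hf : ∀ R, MemLp f p (volume.restrict (Metric.ball 0 R))) (R : ℝ) :
    Tendsto (fun n => eLpNorm (fun z => smear (moll n) f z - f z) p
      (volume.restrict (Metric.ball 0 R))) atTop (𝓝 0) := by
  -- The mollifiers have radius at most `1`, so on the ball of radius `R` this truncation changes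
  -- neither `f` nor its mollification.
  set F := (Metric.ball (0 : Z) (R + 2)).indicator f with hF
  have hFm : MemLp F p volume := by
    rw [hF, memLp_indicator_iff_restrict Metric.isOpen_ball.measurableSet]; exact hf _
  refine tendsto_of_tendsto_of_tendsto_of_le_of_le tendsto_const_nhds
    (tendsto_eLpNorm_smear_sub hp1 hp hFm) (fun _ => zero_le) fun n => ?_
  have heq : ∀ z ∈ Metric.ball (0 : Z) R, smear (moll n) f z - f z
      = smear (moll n) F z - F z := by
    intro z hz
    rw [mem_ball_zero_iff] at hz
    have h1 : F z = f z := indicator_of_mem (by rw [mem_ball_zero_iff]; linarith) _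
    rw [h1]
    congr 1
    simp only [smear_apply]
    refine integral_congr_ae (Eventually.of_forall fun h => ?_)
    simp only
    by_cases h0 : moll n h = 0
    · simp [h0]
    have h2 := norm_le_of_moll_ne_zero h0
    have h3 : 1 / ((n : ℝ) + 1) ≤ 1 := by
      rw [div_le_one (by positivity)]; linarith [(Nat.cast_nonneg n : (0 : ℝ) ≤ n)]
    rw [hF, indicator_of_mem]
    rw [mem_ball_zero_iff]
    linarith [norm_sub_le z h]
  calc _ = eLpNorm (fun z => smear (moll n) F z - F z) p (volume.restrict (Metric.ball 0 R)) := by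
        refine eLpNorm_congr_ae ?_
        rw [EventuallyEq, ae_restrict_iff' Metric.isOpen_ball.measurableSet]
        exact Eventually.of_forall heq
    _ ≤ _ := eLpNorm_mono_measure _ Measure.restrict_le_self

/-- Mollification does not increase slice-wise bounds. -/
lemma lintegral_cell_smear_le {L : ℝ} (hL : 0 < L) {f : Z → ℝ} (hf : LocallyIntegrable f)
    (hp : SPer L f) {q : ℝ} (hq : 1 ≤ q) {K : ℝ≥0∞}
    (hb : ∀ᵐ t : ℝ, ∫⁻ x in cell L, ‖f (t, x)‖ₑ ^ q ≤ K) (n : ℕ) (t : ℝ) :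
    ∫⁻ x in cell L, ‖smear (moll n) f (t, x)‖ₑ ^ q ≤ K := by
  have hfm := hf.aestronglyMeasurable
  have m1 : AEStronglyMeasurable (fun w : E3 × Z => f ((t, w.1) - w.2))
      ((volume.restrict (cell L)).prod volume) := by
    refine hfm.comp_quasiMeasurePreserving ⟨by fun_prop, ?_⟩
    refine Measure.AbsolutelyContinuous.mk fun s hs h0 => ?_
    rw [Measure.map_apply (by fun_prop) hs, Measure.measure_prod_null (by measurability)]
    refine Eventually.of_forall fun x => ?_
    have := (Measure.measurePreserving_sub_left (volume : Measure Z) (t, x)).measure_preimage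
      hs.nullMeasurableSet
    simp only [Pi.zero_apply]
    rw [← h0, ← this]
    rfl
  calc ∫⁻ x in cell L, ‖smear (moll n) f (t, x)‖ₑ ^ q
      ≤ ∫⁻ x in cell L, ∫⁻ h : Z, ENNReal.ofReal (moll n h) * ‖f ((t, x) - h)‖ₑ ^ q :=
        lintegral_mono fun x => enorm_integral_mul_rpow_le (smooth_moll n).continuous
          (moll_nonneg n) (integral_moll n)
          (hfm.comp_measurePreserving (Measure.measurePreserving_sub_left volume (t, x))) hq
    _ = ∫⁻ h : Z, ∫⁻ x in cell L, ENNReal.ofReal (moll n h) * ‖f ((t, x) - h)‖ₑ ^ q :=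
        lintegral_lintegral_swap
          (((smooth_moll n).continuous.measurable.comp
            measurable_snd).ennreal_ofReal.aemeasurable.mul (m1.enorm.pow_const q))
    _ ≤ ∫⁻ h : Z, ENNReal.ofReal (moll n h) * K := by
        -- The hypothesis holds for almost every time only; averaging over time shifts ignores null
        -- sets of times, so the conclusion holds for every `t`.
        have hae : ∀ᵐ h : Z, ∫⁻ x in cell L, ‖f (t - h.1, x)‖ₑ ^ q ≤ K := by
          have h1 : ∀ᵐ s : ℝ, ∫⁻ x in cell L, ‖f (t - s, x)‖ₑ ^ q ≤ K :=
            (Measure.measurePreserving_sub_left (volume : Measure ℝ) t).quasiMeasurePreserving.ae hb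
          rw [Measure.volume_eq_prod]
          exact Measure.quasiMeasurePreserving_fst.ae h1
        refine lintegral_mono_ae (hae.mono fun h hh => ?_)
        rw [lintegral_const_mul' _ _ ENNReal.ofReal_ne_top]
        refine mul_le_mul_right ?_ _
        refine le_trans (le_of_eq ?_) hh
        have := lintegral_cell_shift hL (f := fun x => ‖f (t - h.1, x)‖ₑ ^ q)
          (fun x k => by simp only [hp.slice (t - h.1) x k]) (-h.2)
        rw [← this]
        refine lintegral_congr fun x => ?_
        simp [sub_eq_add_neg, Prod.add_def]
    _ = K := by
        rw [lintegral_mul_const _ (smooth_moll n).continuous.measurable.ennreal_ofReal,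
            ← ofReal_integral_eq_lintegral_ofReal
              ((smooth_moll n).continuous.integrable_of_hasCompactSupport
              (hasCompactSupport_moll n)) (Eventually.of_forall (moll_nonneg n)), integral_moll,
            ENNReal.ofReal_one, one_mul]

/-! ### Weak equations and their mollifications -/

/-- `div f = 0` in the sense of distributions on `W`. -/
def WeakDiv (W : Set Z) (f : Fin 3 → Z → ℝ) : Prop :=
  ∀ ψ, IsTest W ψ → ∑ i, ∫ z, f i z * pd (xv i) ψ z = 0

/-- `∇ × f = g` in the sense of distributions on `W`. -/
def WeakCurl (W : Set Z) (f g : Fin 3 → Z → ℝ) : Prop :=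
  ∀ n ψ, IsTest W ψ → ∫ z, g n z * ψ z
    = (∫ z, f (n + 1) z * pd (xv (n + 2)) ψ z) - ∫ z, f (n + 2) z * pd (xv (n + 1)) ψ z

/-- `f_t + N + ∇ π = 0` in the sense of distributions on `W`. -/
def WeakPotential (W : Set Z) (f N : Fin 3 → Z → ℝ) (π : Z → ℝ) : Prop :=
  ∀ n ψ, IsTest W ψ → (∫ z, f n z * pd tv ψ z) + (∫ z, π z * pd (xv n) ψ z) = ∫ z, N n z * ψ z

/-- `f_t + ∇ × N = 0` in the sense of distributions on `W`. -/
def WeakInduction (W : Set Z) (f N : Fin 3 → Z → ℝ) : Prop :=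
  ∀ n ψ, IsTest W ψ → ∫ z, f n z * pd tv ψ z
    = (∫ z, N (n + 1) z * pd (xv (n + 2)) ψ z) - ∫ z, N (n + 2) z * pd (xv (n + 1)) ψ z

section Smear

variable {W : Set Z} {f g N : Fin 3 → Z → ℝ} {π ρ : Z → ℝ} {z : Z}

/-- Testing with the reflected kernel `y ↦ ρ(z - y)` turns the weak equation into a pointwise one
for the mollified field at `z`, provided that `z - supp ρ` stays in `W`. The kernel need not be a
mollifier. The next three lemmas rest on the same choice. -/
lemma WeakDiv.smear (h : WeakDiv W f) (hf : ∀ i, LocallyIntegrable (f i)) (hρ : Smooth ρ)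
    (hc : HasCompactSupport ρ) (hz : ∀ h ∈ tsupport ρ, z - h ∈ W) :
    ∑ i, pd (xv i) (smear ρ (f i)) z = 0 := by
  have := h _ (isTest_reflect hρ hc hz)
  simp only [integral_mul_pd_reflect hρ hc (hf _), Finset.sum_neg_distrib, neg_eq_zero] at this
  exact this

lemma WeakCurl.smear (h : WeakCurl W f g) (hf : ∀ i, LocallyIntegrable (f i)) (hρ : Smooth ρ)
    (hc : HasCompactSupport ρ) (hz : ∀ h ∈ tsupport ρ, z - h ∈ W) (n : Fin 3) :
    smear ρ (g n) z = pd (xv (n + 1)) (smear ρ (f (n + 2))) z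
      - pd (xv (n + 2)) (smear ρ (f (n + 1))) z := by
  have := h n _ (isTest_reflect hρ hc hz)
  rw [integral_mul_pd_reflect hρ hc (hf _), integral_mul_pd_reflect hρ hc (hf _),
    integral_mul_reflect] at this
  linarith

lemma WeakPotential.smear (h : WeakPotential W f N π) (hf : ∀ i, LocallyIntegrable (f i))
    (hπ : LocallyIntegrable π) (hρ : Smooth ρ)
    (hc : HasCompactSupport ρ) (hz : ∀ h ∈ tsupport ρ, z - h ∈ W) (n : Fin 3) :
    pd tv (smear ρ (f n)) z + smear ρ (N n) z + pd (xv n) (smear ρ π) z = 0 := by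
  have := h n _ (isTest_reflect hρ hc hz)
  rw [integral_mul_pd_reflect hρ hc (hf _), integral_mul_pd_reflect hρ hc hπ,
    integral_mul_reflect] at this
  linarith

end Smear

lemma abs_smear_moll_le {f : Z → ℝ} {M : ℝ} (hM : ∀ z, |f z| ≤ M) (n : ℕ) (z : Z) :
    |smear (moll n) f z| ≤ M := by
  have hi : Integrable (moll n) := (smooth_moll n).continuous.integrable_of_hasCompactSupport
    (hasCompactSupport_moll n)
  rw [smear_apply, ← Real.norm_eq_abs]
  refine (norm_integral_le_of_norm_le (hi.mul_const M) (Eventually.of_forall fun h => ?_)).trans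
    (le_of_eq ?_)
  · rw [norm_mul, Real.norm_eq_abs, Real.norm_eq_abs, abs_of_nonneg (moll_nonneg n h)]
    exact mul_le_mul_of_nonneg_left (hM _) (moll_nonneg n h)
  · rw [integral_mul_const, integral_moll, one_mul]

/-! ### The exponents `3/2` and `3` -/

lemma pw_eq_rpow (x : ℝ) : pw x = |x| ^ (3 / 2 : ℝ) := by
  rw [pw, Real.sqrt_eq_rpow]
  rcases eq_or_lt_of_le (abs_nonneg x) with h | h
  · rw [← h]; norm_num
  · rw [show (3 / 2 : ℝ) = 1 + 1 / 2 by norm_num, Real.rpow_add h, Real.rpow_one]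

lemma enorm_rpow_three_half (x : ℝ) : ‖x‖ₑ ^ (3 / 2 : ℝ) = ENNReal.ofReal (pw x) := by
  rw [pw_eq_rpow, Real.enorm_eq_ofReal_abs, ENNReal.ofReal_rpow_of_nonneg (abs_nonneg x)]
  norm_num

lemma enorm_rpow_three (x : ℝ) : ‖x‖ₑ ^ (3 : ℝ) = ENNReal.ofReal (|x| ^ 3) := by
  rw [Real.enorm_eq_ofReal_abs, ENNReal.ofReal_rpow_of_nonneg (abs_nonneg x) (by norm_num)]
  norm_cast

lemma lintegral_cell_pw (L : ℝ) {f : E3 → ℝ} (hf : Continuous f) :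
    ∫⁻ x in cell L, ‖f x‖ₑ ^ (3 / 2 : ℝ) = ENNReal.ofReal (∫ x in cell L, pw (f x)) := by
  simp only [enorm_rpow_three_half]
  exact (ofReal_integral_eq_lintegral_ofReal (integrableOn_cell (continuous_pw.comp hf))
    (Eventually.of_forall fun x => pw_nonneg _)).symm

lemma lintegral_cell_cube (L : ℝ) {f : E3 → ℝ} (hf : Continuous f) :
    ∫⁻ x in cell L, ‖f x‖ₑ ^ (3 : ℝ) = ENNReal.ofReal (∫ x in cell L, |f x| ^ 3) := by
  simp only [enorm_rpow_three]
  exact (ofReal_integral_eq_lintegral_ofReal (integrableOn_cell (by fun_prop))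
    (Eventually.of_forall fun x => by positivity)).symm

/-- A solenoidal field is controlled by its curl. -/
lemma integral_pw_gradient_le_curl {L : ℝ} (hL : 0 < L) {v : Fin 3 → E3 → ℝ}
    {dv : Fin 3 → Fin 3 → E3 → ℝ} {J : Fin 3 → E3 → ℝ}
    (cv : ∀ l, Continuous (v l)) (pv : ∀ l, Per L (v l))
    (cdv : ∀ i l, Continuous (dv i l)) (pdv : ∀ i l, Per L (dv i l))
    (hd : ∀ i l x, HasDerivAt (fun s : ℝ => v l (x + s • e i)) (dv i l x) 0)
    (hdiv : ∀ x, ∑ l, dv l l x = 0)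
    (hJ : ∀ n x, J n x = dv (n + 1) (n + 2) x - dv (n + 2) (n + 1) x) (i l : Fin 3) :
    ∫ x in cell L, pw (dv i l x) ≤ 1200 * ∑ n, ∫ x in cell L, pw (J n x) := by
  have h0 : ∀ n, 0 ≤ ∫ x in cell L, pw (J n x) := fun n =>
    integral_nonneg fun x => pw_nonneg _
  have hn : ∀ n, ∫ x in cell L, pw (J n x) ≤ ∑ n, ∫ x in cell L, pw (J n x) := fun n =>
    Finset.single_le_sum (f := fun n => ∫ x in cell L, pw (J n x)) (fun n _ => h0 n)
      (Finset.mem_univ n)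
  have hm : ∀ m, ∫ x in cell L, pw (dv m l x - dv l m x) ≤ ∑ n, ∫ x in cell L, pw (J n x) := by
    intro m
    -- Modulo `3`, every entry of the antisymmetric gradient is zero or, up to sign, one component
    -- of the curl. Each of the three entries is bounded by the full sum over `J`, whence `1200 = 3
    -- · 400`.
    have hc : m = l ∨ l = m + 1 ∨ m = l + 1 := by revert m l; decide
    rcases hc with rfl | rfl | rfl
    · simp only [sub_self, pw_zero, integral_zero]
      exact Finset.sum_nonneg fun n _ => h0 n
    · refine le_trans (le_of_eq ?_) (hn (m + 2))
      have e1 : m + 2 + 1 = m := by revert m; decide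
      have e2 : m + 2 + 2 = m + 1 := by revert m; decide
      simp only [hJ, e1, e2]
    · refine le_trans (le_of_eq ?_) (hn (l + 2))
      have e1 : l + 2 + 1 = l := by revert l; decide
      have e2 : l + 2 + 2 = l + 1 := by revert l; decide
      simp only [hJ, e1, e2]
      refine integral_congr_ae (Eventually.of_forall fun x => ?_)
      simp only
      rw [← pw_neg, neg_sub]
  refine (integral_pw_gradient_le hL cv pv cdv pdv hd hdiv i l).trans ?_
  have : ∑ m, ∫ x in cell L, pw (dv m l x - dv l m x)
      ≤ 3 * ∑ n, ∫ x in cell L, pw (J n x) := by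
    refine (Finset.sum_le_sum fun m _ => hm m).trans (le_of_eq ?_)
    simp
  linarith

/-! ### Time windows -/

/-- A solution of the EMHD equations with vector potential on the slab `(α, β) × ℝ³`, extended
outside of the slab by locally integrable functions. -/
structure Window (L α β M : ℝ) (C : ℝ≥0∞) (b j N A : Fin 3 → Z → ℝ) (π : Z → ℝ) : Prop where
  hL : 0 < L
  C_ne : C ≠ ∞
  li_b : ∀ i, LocallyIntegrable (b i)
  li_j : ∀ i, LocallyIntegrable (j i)
  li_N : ∀ i, LocallyIntegrable (N i)
  li_A : ∀ i, LocallyIntegrable (A i)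
  li_π : LocallyIntegrable π
  per_b : ∀ i, SPer L (b i)
  per_j : ∀ i, SPer L (j i)
  per_A : ∀ i, SPer L (A i)
  per_π : SPer L π
  supp_b : ∀ i, ∀ z ∉ slab α β, b i z = 0
  hN : ∀ n z, N n z = j (n + 1) z * b (n + 2) z - j (n + 2) z * b (n + 1) z
  bound_A : ∀ i z, |A i z| ≤ M
  bound_j : ∀ i, ∀ᵐ t : ℝ, ∫⁻ x in cell L, ‖j i (t, x)‖ₑ ^ (3 / 2 : ℝ) ≤ C
  div_b : WeakDiv (slab α β) b
  div_A : WeakDiv (slab α β) A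
  curl_b : WeakCurl (slab α β) b j
  curl_A : WeakCurl (slab α β) A b
  induction : WeakInduction (slab α β) b N
  potential : WeakPotential (slab α β) A N π

lemma sub_mem_slab {α β : ℝ} {n : ℕ} {t : ℝ} (h1 : α + 1 / ((n : ℝ) + 1) < t)
    (h2 : t < β - 1 / ((n : ℝ) + 1)) (x : E3) : ∀ h ∈ tsupport (moll n), (t, x) - h ∈ slab α β := by
  intro h hh
  rw [tsupport_moll, mem_closedBall_zero_iff] at hh
  have h3 : |h.1| ≤ 1 / ((n : ℝ) + 1) := (norm_fst_le h).trans hh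
  rw [abs_le] at h3
  rw [mem_slab]
  simp only [Prod.fst_sub, mem_Ioo]
  constructor <;> linarith

lemma eventually_deep {α β t : ℝ} (ht : t ∈ Ioo α β) :
    ∀ᶠ n : ℕ in atTop, α + 1 / ((n : ℝ) + 1) < t ∧ t < β - 1 / ((n : ℝ) + 1) := by
  have h := tendsto_one_div_add_atTop_nhds_zero_nat (𝕜 := ℝ)
  have h1 := h.const_add α
  have h2 := h.const_sub β
  simp only [add_zero, sub_zero] at h1 h2
  exact (h1.eventually_lt_const ht.1).and (h2.eventually_const_lt ht.2)

/-- Slice-wise bounds pass from mollifications to the limit. -/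
lemma ae_lintegral_cell_le_of_smear {L α β : ℝ} {f : Z → ℝ} (hf : LocallyIntegrable f)
    {q : ℝ} {K : ℝ≥0∞}
    (h : ∀ t ∈ Ioo α β, ∀ᶠ n in atTop, ∫⁻ x in cell L, ‖smear (moll n) f (t, x)‖ₑ ^ q ≤ K) :
    ∀ᵐ t : ℝ, t ∈ Ioo α β → ∫⁻ x in cell L, ‖f (t, x)‖ₑ ^ q ≤ K := by
  have h1 := ae_tendsto_smear_moll hf
  rw [Measure.volume_eq_prod] at h1
  filter_upwards [Measure.ae_ae_of_ae_prod h1] with t ht hI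
  calc ∫⁻ x in cell L, ‖f (t, x)‖ₑ ^ q
      = ∫⁻ x in cell L, liminf (fun n => ‖smear (moll n) f (t, x)‖ₑ ^ q) atTop := by
        refine lintegral_congr_ae (ae_restrict_of_ae (ht.mono fun x hx => ?_))
        exact (((ENNReal.continuous_rpow_const (y := q)).tendsto _).comp
          ((continuous_enorm.tendsto _).comp hx)).liminf_eq.symm
    _ ≤ liminf (fun n => ∫⁻ x in cell L, ‖smear (moll n) f (t, x)‖ₑ ^ q) atTop := by
        refine lintegral_liminf_le fun n => ?_
        have : Continuous fun x => smear (moll n) f (t, x) :=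
          (smooth_smear (smooth_moll n) (hasCompactSupport_moll n) hf).continuous.comp
            (by fun_prop)
        exact (this.measurable.enorm).pow_const q
    _ ≤ K := liminf_le_of_frequently_le' (h t hI).frequently

lemma continuous_slice {f : Z → ℝ} (hf : Smooth f) (t : ℝ) : Continuous fun x => f (t, x) :=
  hf.continuous.comp (by fun_prop)

lemma smooth_smear_moll {f : Z → ℝ} (hf : LocallyIntegrable f) (n : ℕ) :
    Smooth (smear (moll n) f) := smooth_smear (smooth_moll n) (hasCompactSupport_moll n) hf

/-! ### The uniform `L³` bound for the magnetic field. -/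

namespace Window

variable {L α β M : ℝ} {C : ℝ≥0∞} {b j N A : Fin 3 → Z → ℝ} {π : Z → ℝ}

/-- The slice-wise gradient bound for the mollified magnetic field. -/
lemma integral_pw_pd_smear_le (w : Window L α β M C b j N A π) {n : ℕ} {t : ℝ}
    (h1 : α + 1 / ((n : ℝ) + 1) < t) (h2 : t < β - 1 / ((n : ℝ) + 1)) (i l : Fin 3) :
    ∫ x in cell L, pw (pd (xv i) (smear (moll n) (b l)) (t, x)) ≤ 3600 * C.toReal := by
  have hs : ∀ l, Smooth (smear (moll n) (b l)) := fun l => smooth_smear_moll (w.li_b l) n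
  have hp := fun l => (w.per_b l).smear (moll n)
  have hj : ∀ m, ∫ x in cell L, pw (smear (moll n) (j m) (t, x)) ≤ C.toReal := by
    intro m
    have h3 := lintegral_cell_smear_le w.hL (w.li_j m) (w.per_j m) (q := 3 / 2) (by norm_num)
      (w.bound_j m) n t
    rw [lintegral_cell_pw L (continuous_slice (smooth_smear_moll (w.li_j m) n) t)] at h3
    rwa [← ENNReal.ofReal_le_iff_le_toReal w.C_ne]
  have h := integral_pw_gradient_le_curl w.hL (v := fun l x => smear (moll n) (b l) (t, x))
    (dv := fun i l x => pd (xv i) (smear (moll n) (b l)) (t, x))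
    (J := fun m x => smear (moll n) (j m) (t, x))
    (fun l => continuous_slice (hs l) t) (fun l => (hp l).slice t)
    (fun i l => continuous_slice ((hs l).pd _) t) (fun i l => ((hp l).pd _).slice t)
    (fun i l x => hasDerivAt_slice (hs l) t x i)
    (fun x => w.div_b.smear w.li_b (smooth_moll n) (hasCompactSupport_moll n)
      (sub_mem_slab h1 h2 x))
    (fun m x => w.curl_b.smear w.li_b (smooth_moll n) (hasCompactSupport_moll n)
      (sub_mem_slab h1 h2 x) m) i l
  refine h.trans ?_
  have : ∑ m, ∫ x in cell L, pw (smear (moll n) (j m) (t, x)) ≤ ∑ _m : Fin 3, C.toReal :=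
    Finset.sum_le_sum fun m _ => hj m
  simp only [Finset.sum_const, Finset.card_univ, Fintype.card_fin, nsmul_eq_mul] at this
  push_cast at this
  linarith

/-- The magnetic field is bounded in `L³`, uniformly in time. -/
lemma exists_bound_cube (w : Window L α β M C b j N A π) :
    ∃ K : ℝ≥0∞, K ≠ ∞ ∧ ∀ l, ∀ᵐ t : ℝ, ∫⁻ x in cell L, ‖b l (t, x)‖ₑ ^ (3 : ℝ) ≤ K := by
  refine ⟨ENNReal.ofReal (12 * pw M * (7200 * C.toReal)), ENNReal.ofReal_ne_top, fun l => ?_⟩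
  -- The bound is proved for mollifications, where integration by parts is legitimate, and passes to
  -- `b` by Fatou. Here `7200` counts two gradient components, each bounded by `3600 C`.
  have h := ae_lintegral_cell_le_of_smear (L := L) (α := α) (β := β) (w.li_b l) (q := 3)
    (K := ENNReal.ofReal (12 * pw M * (7200 * C.toReal))) ?_
  · filter_upwards [h] with t ht
    by_cases hI : t ∈ Ioo α β
    · exact ht hI
    · have : ∀ x, b l (t, x) = 0 := fun x => w.supp_b l _ (by rwa [mem_slab])
      simp [this]
  intro t ht
  filter_upwards [eventually_deep ht] with n hn
  have sA := fun i => smooth_smear_moll (w.li_A i) n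
  have pA := fun i => (w.per_A i).smear (moll n)
  have sb := smooth_smear_moll (w.li_b l) n
  have pb := (w.per_b l).smear (moll n)
  rw [lintegral_cell_cube L (continuous_slice sb t)]
  refine ENNReal.ofReal_le_ofReal ?_
  have h1 := integral_abs_cube_le w.hL (f := fun x => smear (moll n) (A (l + 2)) (t, x))
    (g := fun x => smear (moll n) (A (l + 1)) (t, x))
    (f' := fun x => pd (xv (l + 1)) (smear (moll n) (A (l + 2))) (t, x))
    (g' := fun x => pd (xv (l + 2)) (smear (moll n) (A (l + 1))) (t, x))
    (v := fun x => smear (moll n) (b l) (t, x))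
    (vi := fun x => pd (xv (l + 1)) (smear (moll n) (b l)) (t, x))
    (vj := fun x => pd (xv (l + 2)) (smear (moll n) (b l)) (t, x)) (M := M) (l + 1) (l + 2)
    ((pA _).slice t) (((pA _).pd _).slice t) ((pA _).slice t) (((pA _).pd _).slice t)
    ((pb.pd _).slice t) ((pb.pd _).slice t)
    (continuous_slice (sA _) t) (continuous_slice ((sA _).pd _) t)
    (continuous_slice (sA _) t) (continuous_slice ((sA _).pd _) t)
    (continuous_slice (sb.pd _) t) (continuous_slice (sb.pd _) t)
    (fun x => hasDerivAt_slice (sA _) t x _) (fun x => hasDerivAt_slice (sA _) t x _)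
    (fun x => hasDerivAt_slice sb t x _) (fun x => hasDerivAt_slice sb t x _)
    (fun x => w.curl_A.smear w.li_A (smooth_moll n) (hasCompactSupport_moll n)
      (sub_mem_slab hn.1 hn.2 x) l)
    (fun x => abs_smear_moll_le (w.bound_A _) n _) (fun x => abs_smear_moll_le (w.bound_A _) n _)
  refine h1.trans (mul_le_mul_of_nonneg_left ?_ (mul_nonneg (by norm_num) (pw_nonneg _)))
  have h2 := w.integral_pw_pd_smear_le hn.1 hn.2 (l + 1) l
  have h3 := w.integral_pw_pd_smear_le hn.1 hn.2 (l + 2) l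
  linarith

lemma memLp_b (w : Window L α β M C b j N A π) (l : Fin 3) (R : ℝ) :
    MemLp (b l) 3 (volume.restrict (Metric.ball 0 R)) := by
  obtain ⟨K, hK, h⟩ := w.exists_bound_cube
  exact memLp_of_slice_bound w.hL (w.li_b l).aestronglyMeasurable (w.per_b l) (by norm_num)
    (by norm_num) hK (by simpa using h l) R

lemma memLp_j (w : Window L α β M C b j N A π) (l : Fin 3) (R : ℝ) :
    MemLp (j l) (3 / 2) (volume.restrict (Metric.ball 0 R)) := by
  refine memLp_of_slice_bound w.hL (w.li_j l).aestronglyMeasurable (w.per_j l)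
    (by simp) (ENNReal.div_ne_top (by norm_num) (by norm_num)) w.C_ne ?_ R
  have : (3 / 2 : ℝ≥0∞).toReal = 3 / 2 := by rw [ENNReal.toReal_div]; norm_num
  rw [this]
  exact w.bound_j l

end Window

/-! ### Local Lebesgue spaces on space-time -/

/-- The exponents used throughout: `b⊗b` lies in `L^{3/2}`, while `b|b|²`, `j × b` and the pressure
flux lie in `L¹`. -/
instance : ENNReal.HolderTriple 3 3 (3 / 2) where
  inv_add_inv_eq_inv := by
    rw [ENNReal.inv_div (by simp) (by simp), ENNReal.div_eq_inv_mul, mul_two]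

instance : ENNReal.HolderTriple 3 (3 / 2) 1 where
  inv_add_inv_eq_inv := by
    rw [ENNReal.inv_div (by simp) (by simp), ← one_div, ENNReal.div_add_div_same, inv_one,
      show (1 + 2 : ℝ≥0∞) = 3 by norm_num, ENNReal.div_self (by simp) (by simp)]

instance : ENNReal.HolderTriple (3 / 2) 3 1 := ENNReal.HolderTriple.symm

lemma one_le_three_half : (1 : ℝ≥0∞) ≤ 3 / 2 := by
  rw [ENNReal.le_div_iff_mul_le (by simp) (by simp)]; norm_num

lemma three_half_ne_top : (3 / 2 : ℝ≥0∞) ≠ ∞ := ENNReal.div_ne_top (by norm_num) (by norm_num)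

lemma three_half_le_three : (3 / 2 : ℝ≥0∞) ≤ 3 := by
  rw [ENNReal.div_le_iff_le_mul (by simp) (by simp)]; norm_num

lemma eLpNorm_mul_le {X : Type*} [MeasurableSpace X] {μ : Measure X} {p q r : ℝ≥0∞}
    [ENNReal.HolderTriple p q r] {f g : X → ℝ} (hf : AEStronglyMeasurable f μ)
    (hg : AEStronglyMeasurable g μ) :
    eLpNorm (fun x => f x * g x) r μ ≤ eLpNorm f p μ * eLpNorm g q μ :=
  eLpNorm_smul_le_mul_eLpNorm (φ := f) (f := g) hg hf

lemma eLpNorm_fun_add_le {X : Type*} [MeasurableSpace X] {μ : Measure X} {p : ℝ≥0∞} {f g : X → ℝ}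
    (hf : AEStronglyMeasurable f μ) (hg : AEStronglyMeasurable g μ) (hp : 1 ≤ p) :
    eLpNorm (fun x => f x + g x) p μ ≤ eLpNorm f p μ + eLpNorm g p μ := eLpNorm_add_le hf hg hp

/-- Products converge in `Lʳ` when the factors converge in conjugate spaces. -/
lemma tendsto_eLpNorm_mul {X ι : Type*} [MeasurableSpace X] {μ : Measure X} {l : Filter ι}
    {p q r : ℝ≥0∞} [ENNReal.HolderTriple p q r] (hr : 1 ≤ r) {u v : ι → X → ℝ} {u₀ v₀ : X → ℝ}
    (hu : ∀ n, AEStronglyMeasurable (u n) μ) (hv : ∀ n, AEStronglyMeasurable (v n) μ)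
    (hu₀ : MemLp u₀ p μ) (hv₀ : MemLp v₀ q μ)
    (hul : Tendsto (fun n => eLpNorm (fun x => u n x - u₀ x) p μ) l (𝓝 0))
    (hvl : Tendsto (fun n => eLpNorm (fun x => v n x - v₀ x) q μ) l (𝓝 0)) :
    Tendsto (fun n => eLpNorm (fun x => u n x * v n x - u₀ x * v₀ x) r μ) l (𝓝 0) := by
  have key : ∀ n, eLpNorm (fun x => u n x * v n x - u₀ x * v₀ x) r μ
      ≤ eLpNorm (fun x => u n x - u₀ x) p μ * eLpNorm (fun x => v n x - v₀ x) q μ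
      + eLpNorm (fun x => u n x - u₀ x) p μ * eLpNorm v₀ q μ
      + eLpNorm u₀ p μ * eLpNorm (fun x => v n x - v₀ x) q μ := by
    intro n
    have e : (fun x => u n x * v n x - u₀ x * v₀ x) = fun x =>
        ((u n x - u₀ x) * (v n x - v₀ x) + (u n x - u₀ x) * v₀ x) + u₀ x * (v n x - v₀ x) := by
      funext x; ring
    have m1 : AEStronglyMeasurable (fun x => u n x - u₀ x) μ := (hu n).sub hu₀.1
    have m2 : AEStronglyMeasurable (fun x => v n x - v₀ x) μ := (hv n).sub hv₀.1
    have a1 : AEStronglyMeasurable (fun x => (u n x - u₀ x) * (v n x - v₀ x)) μ := m1.mul m2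
    have a2 : AEStronglyMeasurable (fun x => (u n x - u₀ x) * v₀ x) μ := m1.mul hv₀.1
    have a3 : AEStronglyMeasurable (fun x => u₀ x * (v n x - v₀ x)) μ := hu₀.1.mul m2
    rw [e]
    exact (eLpNorm_fun_add_le (a1.add a2) a3 hr).trans (add_le_add
      ((eLpNorm_fun_add_le a1 a2 hr).trans (add_le_add (eLpNorm_mul_le m1 m2)
        (eLpNorm_mul_le m1 hv₀.1))) (eLpNorm_mul_le hu₀.1 m2))
  refine tendsto_of_tendsto_of_tendsto_of_le_of_le tendsto_const_nhds ?_ (fun _ => zero_le) key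
  have t1 := ENNReal.Tendsto.mul hul (Or.inr ENNReal.zero_ne_top) hvl (Or.inr ENNReal.zero_ne_top)
  have t2 := ENNReal.Tendsto.mul_const (b := eLpNorm v₀ q μ) hul (Or.inr hv₀.2.ne)
  have t3 := ENNReal.Tendsto.const_mul (a := eLpNorm u₀ p μ) hvl (Or.inr hu₀.2.ne)
  simpa using (t1.add t2).add t3

/-- `f ∈ Lᵖ_loc`. -/
def LLp (p : ℝ≥0∞) (f : Z → ℝ) : Prop := ∀ R, MemLp f p (volume.restrict (Metric.ball (0 : Z) R))

instance (R : ℝ) : IsFiniteMeasure ((volume : Measure Z).restrict (Metric.ball 0 R)) :=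
  ⟨by rw [Measure.restrict_apply_univ]; exact measure_ball_lt_top⟩

lemma LLp.mono {p q : ℝ≥0∞} {f : Z → ℝ} (hf : LLp q f) (h : p ≤ q) : LLp p f :=
  fun R => (hf R).mono_exponent h

lemma LLp.mul {p q r : ℝ≥0∞} [ENNReal.HolderTriple p q r] {f g : Z → ℝ} (hf : LLp p f)
    (hg : LLp q g) : LLp r fun z => f z * g z := fun R => MemLp.mul (hg R) (hf R)

lemma LLp.add {p : ℝ≥0∞} {f g : Z → ℝ} (hf : LLp p f) (hg : LLp p g) :
    LLp p fun z => f z + g z := fun R => (hf R).add (hg R)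

lemma LLp.sub {p : ℝ≥0∞} {f g : Z → ℝ} (hf : LLp p f) (hg : LLp p g) :
    LLp p fun z => f z - g z := fun R => (hf R).sub (hg R)

lemma LLp.const_mul {p : ℝ≥0∞} {f : Z → ℝ} (hf : LLp p f) (c : ℝ) :
    LLp p fun z => c * f z := fun R => (hf R).const_mul c

lemma LLp.sum {ι : Type*} {p : ℝ≥0∞} (s : Finset ι) {f : ι → Z → ℝ} (hf : ∀ i, LLp p (f i)) :
    LLp p fun z => ∑ i ∈ s, f i z := fun R => memLp_finsetSum s fun i _ => hf i R

lemma LLp.locallyIntegrable {p : ℝ≥0∞} {f : Z → ℝ} (hf : LLp p f) (hp : 1 ≤ p) :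
    LocallyIntegrable f := locallyIntegrable_of_memLp_ball hp hf

lemma lLp_one {f : Z → ℝ} (hf : LocallyIntegrable f) : LLp 1 f := LocallyIntegrable.memLp_ball hf

lemma exists_bound_ball {f : Z → ℝ} (hf : Continuous f) (R : ℝ) :
    ∃ c, ∀ z ∈ Metric.ball (0 : Z) R, |f z| ≤ c := by
  obtain ⟨c, hc⟩ := (isCompact_closedBall (0 : Z) R).exists_bound_of_continuousOn hf.continuousOn
  exact ⟨c, fun z hz => hc z (Metric.ball_subset_closedBall hz)⟩

lemma lLp_of_continuous {f : Z → ℝ} (hf : Continuous f) (p : ℝ≥0∞) : LLp p f := by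
  intro R
  obtain ⟨c, hc⟩ := exists_bound_ball hf R
  refine MemLp.of_bound hf.aestronglyMeasurable c ?_
  rw [ae_restrict_iff' Metric.isOpen_ball.measurableSet]
  exact Eventually.of_forall hc

lemma LLp.aestronglyMeasurable {p : ℝ≥0∞} {f : Z → ℝ} (hf : LLp p f) :
    AEStronglyMeasurable f volume := by
  have h : (⋃ n : ℕ, Metric.ball (0 : Z) n) = univ := Metric.iUnion_ball_nat 0
  rw [← Measure.restrict_univ (μ := (volume : Measure Z)), ← h]
  exact AEStronglyMeasurable.iUnion fun n => (hf n).1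

lemma lLp_top_of_bound {f : Z → ℝ} (hf : AEStronglyMeasurable f volume) {M : ℝ}
    (hM : ∀ z, |f z| ≤ M) : LLp ∞ f := fun _ =>
  memLp_top_of_bound hf.restrict M (Eventually.of_forall hM)

/-- The translate of `f` by `h`. -/
def tr (h : Z) (f : Z → ℝ) (z : Z) : ℝ := f (z + h)

lemma eLpNorm_tr_le (p : ℝ≥0∞) {f : Z → ℝ} (hf : AEStronglyMeasurable f volume) (h : Z) (R : ℝ) :
    eLpNorm (tr h f) p (volume.restrict (Metric.ball 0 R))
      ≤ eLpNorm f p (volume.restrict (Metric.ball 0 (R + ‖h‖))) := by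
  have hmp := (measurePreserving_add h).restrict_preimage_emb
    (measurableEmbedding_addRight h) (Metric.ball (0 : Z) (R + ‖h‖))
  rw [← eLpNorm_comp_measurePreserving hf.restrict hmp]
  refine eLpNorm_mono_measure _ (Measure.restrict_mono (fun z hz => ?_) le_rfl)
  rw [mem_ball_zero_iff] at hz
  rw [mem_preimage, mem_ball_zero_iff]
  exact (norm_add_le _ _).trans_lt (by linarith)

lemma LLp.tr {p : ℝ≥0∞} {f : Z → ℝ} (hf : LLp p f) (h : Z) : LLp p (tr h f) := fun R =>
  ⟨(hf.aestronglyMeasurable.comp_measurePreserving (measurePreserving_add h)).restrict,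
    (eLpNorm_tr_le p hf.aestronglyMeasurable h R).trans_lt (hf _).2⟩

/-- `u n → u₀` in `Lᵖ_loc`. -/
structure LTo {ι : Type*} (l : Filter ι) (p : ℝ≥0∞) (u : ι → Z → ℝ) (u₀ : Z → ℝ) : Prop where
  mem : ∀ n, LLp p (u n)
  lim : LLp p u₀
  tendsto : ∀ R, Tendsto (fun n => eLpNorm (fun z => u n z - u₀ z) p
    (volume.restrict (Metric.ball 0 R))) l (𝓝 0)

section LTo

variable {ι : Type*} {l : Filter ι} {p q r : ℝ≥0∞} {u v : ι → Z → ℝ} {u₀ v₀ : Z → ℝ}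

lemma LTo.const (h : LLp p u₀) : LTo l p (fun _ => u₀) u₀ :=
  ⟨fun _ => h, h, fun R => by simpa using tendsto_const_nhds⟩

lemma LTo.mono (h : LTo l q u u₀) (hp : 1 ≤ p) (hpq : p ≤ q) (hq : q ≠ ∞) : LTo l p u u₀ := by
  refine ⟨fun n => (h.mem n).mono hpq, h.lim.mono hpq, fun R => ?_⟩
  refine tendsto_of_tendsto_of_tendsto_of_le_of_le tendsto_const_nhds ?_
    (fun _ => zero_le) fun n =>
    eLpNorm_le_eLpNorm_mul_rpow_measure_univ hpq ((h.mem n R).1.sub (h.lim R).1)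
  have h0 : 0 ≤ 1 / p.toReal - 1 / q.toReal := by
    have h1 : 0 < p.toReal :=
      ENNReal.toReal_pos (zero_lt_one.trans_le hp).ne' (ne_top_of_le_ne_top hq hpq)
    exact sub_nonneg.2 (one_div_le_one_div_of_le h1 (ENNReal.toReal_mono hq hpq))
  have := ENNReal.Tendsto.mul_const (b := ((volume : Measure Z).restrict (Metric.ball 0 R)) univ
    ^ (1 / p.toReal - 1 / q.toReal)) (h.tendsto R)
    (Or.inr (ENNReal.rpow_ne_top_of_nonneg h0 (measure_ne_top _ _)))
  simpa using this

lemma LTo.mul [ENNReal.HolderTriple p q r] (hr : 1 ≤ r) (hu : LTo l p u u₀) (hv : LTo l q v v₀) :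
    LTo l r (fun n z => u n z * v n z) fun z => u₀ z * v₀ z :=
  ⟨fun n => (hu.mem n).mul (hv.mem n), hu.lim.mul hv.lim, fun R => tendsto_eLpNorm_mul hr
    (fun n => (hu.mem n R).1) (fun n => (hv.mem n R).1) (hu.lim R) (hv.lim R) (hu.tendsto R)
    (hv.tendsto R)⟩

lemma LTo.add (hp : 1 ≤ p) (hu : LTo l p u u₀) (hv : LTo l p v v₀) :
    LTo l p (fun n z => u n z + v n z) fun z => u₀ z + v₀ z := by
  refine ⟨fun n => (hu.mem n).add (hv.mem n), hu.lim.add hv.lim, fun R => ?_⟩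
  have h := (hu.tendsto R).add (hv.tendsto R)
  rw [add_zero] at h
  refine tendsto_of_tendsto_of_tendsto_of_le_of_le tendsto_const_nhds h (fun _ => zero_le)
    fun n => ?_
  refine le_trans (le_of_eq ?_) (eLpNorm_fun_add_le ((hu.mem n).sub hu.lim R).1
    ((hv.mem n).sub hv.lim R).1 hp)
  congr 1
  funext z; ring

lemma LTo.const_mul (hu : LTo l p u u₀) (c : ℝ) :
    LTo l p (fun n z => c * u n z) fun z => c * u₀ z := by
  refine ⟨fun n => (hu.mem n).const_mul c, hu.lim.const_mul c, fun R => ?_⟩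
  have h := ENNReal.Tendsto.const_mul (a := ‖c‖ₑ) (hu.tendsto R) (Or.inr enorm_ne_top)
  rw [mul_zero] at h
  refine h.congr fun n => ?_
  rw [← eLpNorm_const_smul]
  congr 1
  funext z
  simp only [Pi.smul_apply, smul_eq_mul]; ring

lemma LTo.sub (hp : 1 ≤ p) (hu : LTo l p u u₀) (hv : LTo l p v v₀) :
    LTo l p (fun n z => u n z - v n z) fun z => u₀ z - v₀ z := by
  simpa [sub_eq_add_neg] using hu.add hp (hv.const_mul (-1))

lemma LTo.sum {κ : Type*} (hp : 1 ≤ p) (s : Finset κ) {u : κ → ι → Z → ℝ} {u₀ : κ → Z → ℝ}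
    (hu : ∀ k, LTo l p (u k) (u₀ k)) :
    LTo l p (fun n z => ∑ k ∈ s, u k n z) fun z => ∑ k ∈ s, u₀ k z := by
  classical
  induction s using Finset.induction_on with
  | empty => simpa using LTo.const (l := l) (lLp_of_continuous (continuous_const (y := (0 : ℝ))) p)
  | insert i s hi ih => simpa only [Finset.sum_insert hi] using (hu i).add hp ih

/-- Convergence in `L¹_loc` implies convergence of integrals against a continuous function of
compact support. -/
lemma LTo.integral (hu : LTo l 1 u u₀) {ψ : Z → ℝ} (hψ : Continuous ψ) (hc : HasCompactSupport ψ) :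
    Tendsto (fun n => ∫ z, u n z * ψ z) l (𝓝 (∫ z, u₀ z * ψ z)) := by
  obtain ⟨R, hR⟩ := hc.isBounded.subset_ball (0 : Z)
  have h1 := hu.mul (p := 1) (q := ∞) le_rfl (LTo.const (l := l) (lLp_of_continuous hψ ∞))
  have hset : ∀ f : Z → ℝ, ∫ z, f z * ψ z = ∫ z in Metric.ball 0 R, f z * ψ z := fun f => by
    refine (setIntegral_eq_integral_of_forall_compl_eq_zero fun z hz => ?_).symm
    rw [image_eq_zero_of_notMem_tsupport fun h => hz (hR h), mul_zero]
  simp only [hset]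
  exact tendsto_integral_of_L1' _ (memLp_one_iff_integrable.1 (h1.lim R)).1
    (Eventually.of_forall fun n => memLp_one_iff_integrable.1 (h1.mem n R)) (h1.tendsto R)

lemma LTo.smear (hp1 : 1 ≤ p) (hp : p ≠ ∞) {f : Z → ℝ} (hf : LLp p f) :
    LTo atTop p (fun n => smear (moll n) f) f :=
  ⟨fun n => lLp_of_continuous (smooth_smear_moll (hf.locallyIntegrable hp1) n).continuous p, hf,
    fun R => tendsto_eLpNorm_smear_ball hp1 hp hf R⟩

lemma LTo.tr (hp1 : 1 ≤ p) (hp : p ≠ ∞) {f : Z → ℝ} (hf : LLp p f) (h₀ : Z) :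
    LTo (𝓝 h₀) p (fun h => tr h f) (tr h₀ f) := by
  refine ⟨fun h => hf.tr h, hf.tr h₀, fun R => ?_⟩
  set F := (Metric.ball (0 : Z) (R + ‖h₀‖ + 1)).indicator f with hF
  have hFm : MemLp F p volume := by
    rw [hF, memLp_indicator_iff_restrict Metric.isOpen_ball.measurableSet]; exact hf _
  refine tendsto_of_tendsto_of_tendsto_of_le_of_le' tendsto_const_nhds
    (tendsto_eLpNorm_translate hp1 hp hFm h₀) (Eventually.of_forall fun _ => zero_le) ?_
  filter_upwards [Metric.ball_mem_nhds h₀ one_pos] with h hh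
  have hh' : ‖h‖ < ‖h₀‖ + 1 := by
    rw [Metric.mem_ball, dist_eq_norm] at hh
    have := norm_sub_norm_le h h₀
    linarith
  refine le_trans (le_of_eq ?_) (eLpNorm_mono_measure _
    (Measure.restrict_le_self (s := Metric.ball 0 R)))
  refine eLpNorm_congr_ae ?_
  rw [EventuallyEq, ae_restrict_iff' Metric.isOpen_ball.measurableSet]
  refine Eventually.of_forall fun z hz => ?_
  rw [mem_ball_zero_iff] at hz
  have h1 : F (z + h) = f (z + h) := indicator_of_mem (by
    rw [mem_ball_zero_iff]; linarith [norm_add_le z h]) _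
  have h2 : F (z + h₀) = f (z + h₀) := indicator_of_mem (by
    rw [mem_ball_zero_iff]; linarith [norm_add_le z h₀]) _
  rw [h1, h2]
  rfl

end LTo

/-! ### The Lamb form of the nonlinearity -/

/-- `div (b ⊗ b) = N + ∇ |b|² / 2` in the sense of distributions on `W`. -/
def WeakLamb (W : Set Z) (b N : Fin 3 → Z → ℝ) : Prop :=
  ∀ i ψ, IsTest W ψ → (∑ k, ∫ z, b k z * b i z * pd (xv k) ψ z) + ∫ z, N i z * ψ z
    = 1 / 2 * ∫ z, (∑ k, b k z * b k z) * pd (xv i) ψ z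

lemma WeakLamb.smear {W : Set Z} {b N : Fin 3 → Z → ℝ} {ρ : Z → ℝ} {z : Z} (h : WeakLamb W b N)
    (hbb : ∀ k i, LocallyIntegrable fun z => b k z * b i z) (hρ : Smooth ρ)
    (hc : HasCompactSupport ρ) (hz : ∀ h ∈ tsupport ρ, z - h ∈ W) (i : Fin 3) :
    ∑ k, pd (xv k) (smear ρ fun z => b k z * b i z) z
      = smear ρ (N i) z + 1 / 2 * pd (xv i) (smear ρ fun z => ∑ k, b k z * b k z) z := by
  have := h i _ (isTest_reflect hρ hc hz)
  simp only [integral_mul_pd_reflect hρ hc (hbb _ _)] at this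
  have hs : LocallyIntegrable fun z => ∑ k, b k z * b k z :=
    locallyIntegrable_finsetSum _ fun k _ => hbb k k
  rw [integral_mul_pd_reflect hρ hc hs, integral_mul_reflect, Finset.sum_neg_distrib] at this
  linarith

lemma exists_margin {W : Set Z} (hW : IsOpen W) {ψ : Z → ℝ} (hψ : IsTest W ψ) :
    ∃ η > 0, ∀ z ∈ tsupport ψ, ∀ h : Z, ‖h‖ < η → z - h ∈ W := by
  obtain ⟨η, h0, hη⟩ := hψ.compact.isCompact.exists_thickening_subset_open hW hψ.supp
  refine ⟨η, h0, fun z hz h hh => hη ?_⟩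
  rw [Metric.mem_thickening_iff]
  exact ⟨z, hz, by rw [dist_eq_norm]; simpa using hh⟩

lemma eventually_sub_mem {W : Set Z} (hW : IsOpen W) {ψ : Z → ℝ} (hψ : IsTest W ψ) :
    ∀ᶠ n : ℕ in atTop, ∀ z ∈ tsupport ψ, ∀ h ∈ tsupport (moll n), z - h ∈ W := by
  obtain ⟨η, h0, hη⟩ := exists_margin hW hψ
  have h1 := (tendsto_one_div_add_atTop_nhds_zero_nat (𝕜 := ℝ)).eventually_lt_const h0
  filter_upwards [h1] with n hn z hz h hh
  rw [tsupport_moll, mem_closedBall_zero_iff] at hh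
  exact hη z hz h (hh.trans_lt hn)

/-- Curls and cross products are written with the cyclic indices `n + 1`, `n + 2` in `Fin 3`; this
rewriting lets one computation treat all components. -/
lemma sum_fin_three_cyclic (f : Fin 3 → ℝ) (i : Fin 3) : ∑ k, f k = f i + f (i + 1) + f (i + 2) := by
  rw [Fin.sum_univ_three]
  fin_cases i
  · rfl
  · change f 0 + f 1 + f 2 = f 1 + f 2 + f 0; ring
  · change f 0 + f 1 + f 2 = f 2 + f 0 + f 1; ring

lemma fin_three_add (i : Fin 3) : i + 1 + 1 = i + 2 ∧ i + 1 + 2 = i ∧ i + 2 + 1 = i ∧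
    i + 2 + 2 = i + 1 := by revert i; decide

lemma IsTest.integrable {W : Set Z} {ψ : Z → ℝ} (h : IsTest W ψ) : Integrable ψ :=
  h.smooth.continuous.integrable_of_hasCompactSupport h.compact

lemma IsTest.integral_pd {W : Set Z} {ψ : Z → ℝ} (h : IsTest W ψ) (v : Z) : ∫ z, EMHD.pd v ψ z = 0 :=
  integral_pd_eq_zero v h.smooth h.compact

/-- The Lamb identity for smooth solenoidal fields. -/
lemma lamb_identity {W : Set Z} {B J : Fin 3 → Z → ℝ} {ψ : Z → ℝ} (hψ : IsTest W ψ)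
    (hB : ∀ i, Smooth (B i)) (hJ : ∀ i, Continuous (J i))
    (hdiv : ∀ z ∈ tsupport ψ, ∑ k, pd (xv k) (B k) z = 0)
    (hcurl : ∀ z ∈ tsupport ψ, ∀ n, J n z
      = pd (xv (n + 1)) (B (n + 2)) z - pd (xv (n + 2)) (B (n + 1)) z) (i : Fin 3) :
    (∑ k, ∫ z, B k z * B i z * pd (xv k) ψ z)
      + ∫ z, (J (i + 1) z * B (i + 2) z - J (i + 2) z * B (i + 1) z) * ψ z
      = 1 / 2 * ∫ z, (∑ k, B k z * B k z) * pd (xv i) ψ z := by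
  have hc : ∀ k, Continuous (B k) := fun k => (hB k).continuous
  have T : ∀ k m, IsTest W fun z => ψ z * (B k z * B m z) := fun k m =>
    hψ.mul ((hB k).mul (hB m))
  have li : ∀ f : Z → ℝ, Continuous f → LocallyIntegrable f := fun f hf => hf.locallyIntegrable
  have i1 : ∀ k m v, Integrable fun z => B k z * B m z * pd v ψ z := fun k m v =>
    integrable_mul_test (li _ (by fun_prop)) (hψ.pd v).smooth.continuous (hψ.pd v).compact
  have i2 : Integrable fun z =>
      (J (i + 1) z * B (i + 2) z - J (i + 2) z * B (i + 1) z) * ψ z :=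
    integrable_mul_test (li _ (by fun_prop)) hψ.smooth.continuous hψ.compact
  -- The left side is a pure divergence and integrates to zero. After expansion, `div B = 0` removes
  -- one term and `J = curl B` identifies the remainder with the cross product; both are needed only
  -- on the support of `ψ`.
  have key : ∀ z, (∑ k, pd (xv k) (fun z => ψ z * (B k z * B i z)) z)
      - 1 / 2 * ∑ k, pd (xv i) (fun z => ψ z * (B k z * B k z)) z
      = ((∑ k, B k z * B i z * pd (xv k) ψ z)
        + (J (i + 1) z * B (i + 2) z - J (i + 2) z * B (i + 1) z) * ψ z)
        - 1 / 2 * ∑ k, B k z * B k z * pd (xv i) ψ z := by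
    intro z
    simp only [pd_mul _ hψ.smooth ((hB _).mul (hB _)), pd_mul _ (hB _) (hB _)]
    by_cases hz : z ∈ tsupport ψ
    · have h1 := hdiv z hz
      have h2 := hcurl z hz (i + 1)
      have h3 := hcurl z hz (i + 2)
      obtain ⟨e1, e2, e3, e4⟩ := fin_three_add i
      rw [e1, e2] at h2
      rw [e3, e4] at h3
      rw [h2, h3]
      simp only [sum_fin_three_cyclic _ i] at h1 ⊢
      linear_combination (ψ z * B i z) * h1
    · have h0 : ψ z = 0 := image_eq_zero_of_notMem_tsupport hz
      simp only [h0, Finset.mul_sum]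
      simp [mul_comm]
  have h0 : ∫ z, ((∑ k, pd (xv k) (fun z => ψ z * (B k z * B i z)) z)
      - 1 / 2 * ∑ k, pd (xv i) (fun z => ψ z * (B k z * B k z)) z) = 0 := by
    rw [integral_sub, integral_const_mul, integral_finsetSum, integral_finsetSum]
    · simp [(T _ _).integral_pd]
    · exact fun k _ => ((T k k).pd _).integrable
    · exact fun k _ => ((T k i).pd _).integrable
    · exact integrable_finsetSum _ fun k _ => ((T k i).pd _).integrable
    · exact (integrable_finsetSum _ fun k _ => ((T k k).pd _).integrable).const_mul _
  simp only [key] at h0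
  have s1 : Integrable fun z => ∑ k, B k z * B i z * pd (xv k) ψ z :=
    integrable_finsetSum _ fun k _ => i1 k i _
  have s2 : Integrable fun z => ∑ k, B k z * B k z * pd (xv i) ψ z :=
    integrable_finsetSum _ fun k _ => i1 k k _
  have s3 : Integrable fun z => (∑ k, B k z * B i z * pd (xv k) ψ z)
      + (J (i + 1) z * B (i + 2) z - J (i + 2) z * B (i + 1) z) * ψ z := s1.add i2
  rw [integral_sub s3 (s2.const_mul _), integral_add s1 i2, integral_const_mul,
    integral_finsetSum _ fun k _ => i1 k i _] at h0
  simp only [Finset.sum_mul]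
  linarith

/-- The identity is classical for the mollified pair `(b, j)`. It passes to the limit because `b`
converges in `L³` and `j` in `L^{3/2}`, so every product converges in `L¹_loc`. -/
lemma Window.weakLamb {L α β M : ℝ} {C : ℝ≥0∞} {b j N A : Fin 3 → Z → ℝ} {π : Z → ℝ}
    (w : Window L α β M C b j N A π) : WeakLamb (slab α β) b N := by
  intro i ψ hψ
  have tb : ∀ k, LTo atTop 3 (fun n => smear (moll n) (b k)) (b k) := fun k =>
    LTo.smear (by norm_num) (by norm_num) (w.memLp_b k)
  have tb' : ∀ k, LTo atTop (3 / 2) (fun n => smear (moll n) (b k)) (b k) := fun k =>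
    (tb k).mono one_le_three_half three_half_le_three (by norm_num)
  have tj : ∀ k, LTo atTop (3 / 2) (fun n => smear (moll n) (j k)) (j k) := fun k =>
    LTo.smear one_le_three_half three_half_ne_top (w.memLp_j k)
  have tbb : ∀ k m, LTo atTop 1 (fun n z => smear (moll n) (b k) z * smear (moll n) (b m) z)
      (fun z => b k z * b m z) := fun k m => (tb k).mul le_rfl (tb' m)
  have l1 := tendsto_finsetSum Finset.univ fun k (_ : k ∈ Finset.univ) =>
    (tbb k i).integral (hψ.pd (xv k)).smooth.continuous (hψ.pd _).compact
  have l2 := (((tj (i + 1)).mul (r := 1) le_rfl (tb (i + 2))).sub le_rfl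
    ((tj (i + 2)).mul (r := 1) le_rfl (tb (i + 1)))).integral hψ.smooth.continuous hψ.compact
  have l3 := ((LTo.sum le_rfl Finset.univ fun k => tbb k k).integral
    (hψ.pd (xv i)).smooth.continuous (hψ.pd _).compact).const_mul (1 / 2)
  simp only [← w.hN] at l2
  refine tendsto_nhds_unique_of_eventuallyEq (l1.add l2) l3 ?_
  filter_upwards [eventually_sub_mem (isOpen_slab α β) hψ] with n hn
  exact lamb_identity hψ (fun k => smooth_smear_moll (w.li_b k) n)
    (fun k => (smooth_smear_moll (w.li_j k) n).continuous)
    (fun z hz => w.div_b.smear w.li_b (smooth_moll n) (hasCompactSupport_moll n) (hn z hz))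
    (fun z hz => w.curl_b.smear w.li_b (smooth_moll n) (hasCompactSupport_moll n) (hn z hz)) i

/-! ### The pressure -/

/-- Slice-wise estimate of the pressure by the stress. -/
lemma integral_pw_pressure_le {L : ℝ} (hL : 0 < L) {P : E3 → ℝ} {a dP : Fin 3 → E3 → ℝ}
    {da : Fin 3 → E3 → ℝ} {S dS : Fin 3 → Fin 3 → E3 → ℝ}
    (cP : Continuous P) (pP : Per L P) (cdP : ∀ i, Continuous (dP i)) (pdP : ∀ i, Per L (dP i))
    (ca : ∀ i, Continuous (a i)) (pa : ∀ i, Per L (a i))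
    (cda : ∀ i, Continuous (da i)) (pda : ∀ i, Per L (da i))
    (cS : ∀ i k, Continuous (S i k)) (pS : ∀ i k, Per L (S i k))
    (cdS : ∀ i k, Continuous (dS i k)) (pdS : ∀ i k, Per L (dS i k))
    (hP : ∀ i x, HasDerivAt (fun s : ℝ => P (x + s • e i)) (dP i x) 0)
    (ha : ∀ i x, HasDerivAt (fun s : ℝ => a i (x + s • e i)) (da i x) 0)
    (hS : ∀ i k x, HasDerivAt (fun s : ℝ => S i k (x + s • e k)) (dS i k x) 0)
    (hdiv : ∀ x, ∑ i, da i x = 0) (heq : ∀ i x, dP i x = -a i x + ∑ k, dS i k x) {c : ℝ}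
    (hc : ∫ x in cell L, P x - c = 0) :
    ∫ x in cell L, pw (P x - c) ≤ 400 * ∑ i, ∑ k, ∫ x in cell L, pw (S i k x) := by
  set κ := 2 * Real.pi / L with hκ
  refine integral_pw_le hL hκ (q := fun x => P x - c) (by fun_prop)
    (fun x i => by simp only [pP x i]) hc cS pS fun p => ?_
  have pe := fun q : TrigPoly => q.per_eval 0 hL hκ
  have e0 : ∀ i, ∫ x in cell L, ((p.D κ i).D κ i).eval κ 0 x = 0 := fun i =>
    integral_cell_deriv hL (pe (p.D κ i)) i (fun x => (p.D κ i).hasDerivAt_space 0 x i)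
      (by fun_prop) (by fun_prop) (pe _)
  have e1 : ∀ i, ∫ x in cell L, P x * ((p.D κ i).D κ i).eval κ 0 x
      = -∫ x in cell L, dP i x * (p.D κ i).eval κ 0 x := fun i => by
    rw [integral_cell_by_parts hL i pP (pdP i) (pe _) (pe _) cP (cdP i) (by fun_prop)
      (by fun_prop) (hP i) fun x => (p.D κ i).hasDerivAt_space 0 x i, neg_neg]
    rfl
  have e2 : ∀ i, ∫ x in cell L, a i x * (p.D κ i).eval κ 0 x
      = -∫ x in cell L, da i x * p.eval κ 0 x := fun i => by
    rw [integral_cell_by_parts hL i (pa i) (pda i) (pe _) (pe _) (ca i) (cda i) (by fun_prop)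
      (by fun_prop) (ha i) fun x => p.hasDerivAt_space 0 x i, neg_neg]
    rfl
  have e3 : ∀ i k, ∫ x in cell L, dS i k x * (p.D κ i).eval κ 0 x
      = -∫ x in cell L, S i k x * ((p.D κ i).D κ k).eval κ 0 x := fun i k =>
    integral_cell_by_parts hL k (pS i k) (pdS i k) (pe _) (pe _) (cS i k) (cdS i k) (by fun_prop)
      (by fun_prop) (hS i k) fun x => (p.D κ i).hasDerivAt_space 0 x k
  -- The divergence-free field `a`, later the time derivative of the potential, is orthogonal to
  -- gradients. Only the stress is left in the equation for `P`.
  have e4 : ∑ i, ∫ x in cell L, a i x * (p.D κ i).eval κ 0 x = 0 := by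
    simp_rw [e2]
    rw [Finset.sum_neg_distrib, ← integral_finsetSum _ fun i _ => integrableOn_cell (by fun_prop)]
    simp_rw [← Finset.sum_mul, hdiv]
    simp
  have e5 : ∀ i, ∫ x in cell L, (P x - c) * ((p.D κ i).D κ i).eval κ 0 x
      = (∫ x in cell L, a i x * (p.D κ i).eval κ 0 x)
        + ∑ k, ∫ x in cell L, S i k x * ((p.D κ i).D κ k).eval κ 0 x := by
    intro i
    simp_rw [sub_mul]
    rw [integral_sub (integrableOn_cell (by fun_prop)) (integrableOn_cell (by fun_prop)),
      integral_const_mul, e0, mul_zero, sub_zero, e1]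
    simp_rw [heq, add_mul, Finset.sum_mul]
    rw [integral_add (integrableOn_cell (by fun_prop)) (integrableOn_cell (by fun_prop)),
      integral_finsetSum _ fun k _ => integrableOn_cell (by fun_prop)]
    simp_rw [e3, neg_mul]
    rw [integral_neg, Finset.sum_neg_distrib]
    ring
  simp_rw [TrigPoly.eval_Dt, Finset.mul_sum]
  rw [integral_finsetSum _ fun i _ => integrableOn_cell (by fun_prop)]
  simp_rw [e5]
  rw [Finset.sum_add_distrib, e4, zero_add]

/-- The mean of `f (t, ·)` over the cell. -/
def cellMean (L : ℝ) (f : Z → ℝ) (t : ℝ) : ℝ :=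
  (volume.real (cell L))⁻¹ * ∫ x in cell L, f (t, x)

/-- The Maxwell stress. -/
def stress (b : Fin 3 → Z → ℝ) (i k : Fin 3) (z : Z) : ℝ :=
  (if i = k then 1 / 2 * ∑ m, b m z * b m z else 0) - b k z * b i z

/-- With `a` the largest component of `|b|`, the stress is at most `4a²`, hence its power `3/2` is
at most `8a³`; the constant `216` leaves room to spare. -/
lemma pw_stress_le (b : Fin 3 → Z → ℝ) (i k : Fin 3) (z : Z) :
    pw (stress b i k z) ≤ 216 * ∑ m, |b m z| ^ 3 := by
  obtain ⟨m₀, hm⟩ := Finite.exists_max fun m => |b m z|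
  set a := |b m₀ z| with ha
  have ha0 : 0 ≤ a := abs_nonneg _
  have h1 : ∀ k i, |b k z * b i z| ≤ a ^ 2 := fun k i => by
    rw [abs_mul, sq]; exact mul_le_mul (hm k) (hm i) (abs_nonneg _) ha0
  have h2 : |stress b i k z| ≤ 4 * a ^ 2 := by
    rw [stress]
    refine (abs_sub _ _).trans ?_
    have h3 : |if i = k then 1 / 2 * ∑ m, b m z * b m z else 0| ≤ 3 * a ^ 2 := by
      split_ifs
      · rw [abs_mul, Fin.sum_univ_three]
        have := abs_add_three (b 0 z * b 0 z) (b 1 z * b 1 z) (b 2 z * b 2 z)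
        rw [abs_of_pos (by norm_num : (0 : ℝ) < 1 / 2)]
        linarith [h1 0 0, h1 1 1, h1 2 2, sq_nonneg a]
      · rw [abs_zero]; positivity
    linarith [h1 k i]
  have h3 : pw (stress b i k z) ≤ 8 * a ^ 3 := by
    rw [pw]
    have h4 : √|stress b i k z| ≤ 2 * a := by
      rw [Real.sqrt_le_left (by positivity)]; linarith
    calc _ ≤ 4 * a ^ 2 * (2 * a) := mul_le_mul h2 h4 (Real.sqrt_nonneg _) (by positivity)
      _ = 8 * a ^ 3 := by ring
  have h4 : a ^ 3 ≤ ∑ m, |b m z| ^ 3 :=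
    Finset.single_le_sum (f := fun m => |b m z| ^ 3) (fun _ _ => by positivity) (Finset.mem_univ m₀)
  have : 0 ≤ a ^ 3 := by positivity
  linarith

/-! ### The `L^{3/2}` bound for the pressure without its mean. -/

namespace Window

variable {L α β M : ℝ} {C : ℝ≥0∞} {b j N A : Fin 3 → Z → ℝ} {π : Z → ℝ}

lemma li_mul_b (w : Window L α β M C b j N A π) (k i : Fin 3) :
    LocallyIntegrable fun z => b k z * b i z :=
  (LLp.mul (p := 3) (q := 3) (r := 3 / 2) (w.memLp_b k) (w.memLp_b i)).locallyIntegrable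
    one_le_three_half

lemma li_stress (w : Window L α β M C b j N A π) (i k : Fin 3) :
    LocallyIntegrable (stress b i k) := by
  have h := w.li_mul_b
  have hs : LocallyIntegrable fun z => ∑ m, b m z * b m z :=
    locallyIntegrable_finsetSum _ fun m _ => h m m
  unfold stress
  split_ifs
  · exact (hs.smul (1 / 2 : ℝ)).sub (h k i)
  · exact (locallyIntegrable_zero).sub (h k i)

lemma per_stress (w : Window L α β M C b j N A π) (i k : Fin 3) : SPer L (stress b i k) := by
  intro z m
  simp only [stress, w.per_b _ z m]

/-- The Lamb form says that the divergence of the Maxwell stress is `-N`. The potential equation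
then reads `∇π = -∂ₜA + div(stress)`, the form used by the pressure estimate. -/
lemma pd_smear_stress (w : Window L α β M C b j N A π) {ρ : Z → ℝ} (hρ : Smooth ρ)
    (hc : HasCompactSupport ρ) {z : Z} (hz : ∀ h ∈ tsupport ρ, z - h ∈ slab α β) (i : Fin 3) :
    ∑ k, pd (xv k) (smear ρ (stress b i k)) z = -smear ρ (N i) z := by
  have h := w.weakLamb.smear w.li_mul_b hρ hc hz i
  have hs : LocallyIntegrable fun z => ∑ m, b m z * b m z :=
    locallyIntegrable_finsetSum _ fun m _ => w.li_mul_b m m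
  have e : ∀ k, pd (xv k) (smear ρ (stress b i k)) z
      = (if i = k then 1 / 2 * pd (xv k) (smear ρ fun z => ∑ m, b m z * b m z) z else 0)
        - pd (xv k) (smear ρ fun z => b k z * b i z) z := by
    intro k
    rw [pd_smear hρ hc (w.li_stress i k), pd_smear hρ hc hs, pd_smear hρ hc (w.li_mul_b k i)]
    unfold stress
    split_ifs
    · have hs' : LocallyIntegrable fun z => 1 / 2 * ∑ m, b m z * b m z := hs.smul (1 / 2 : ℝ)
      rw [smear_sub (hρ.pd _).continuous (hasCompactSupport_pd _ hc) hs' (w.li_mul_b k i),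
        smear_const_mul]
    · rw [smear_sub (hρ.pd _).continuous (hasCompactSupport_pd _ hc) locallyIntegrable_zero
        (w.li_mul_b k i)]
      simp [smear_apply]
  simp only [e, Finset.sum_sub_distrib, h]
  simp

lemma exists_bound_stress (w : Window L α β M C b j N A π) :
    ∃ K : ℝ≥0∞, K ≠ ∞ ∧
      ∀ i k, ∀ᵐ t : ℝ, ∫⁻ x in cell L, ‖stress b i k (t, x)‖ₑ ^ (3 / 2 : ℝ) ≤ K := by
  obtain ⟨K, hK, h⟩ := w.exists_bound_cube
  refine ⟨216 * (3 * K), ENNReal.mul_ne_top (by simp) (ENNReal.mul_ne_top (by simp) hK),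
    fun i k => ?_⟩
  have hm : ∀ l, ∀ᵐ t : ℝ, AEMeasurable (fun x => b l (t, x)) (volume.restrict (cell L)) := by
    intro l
    have h1 := (w.li_b l).aestronglyMeasurable
    rw [Measure.volume_eq_prod] at h1
    filter_upwards [h1.prodMk_left] with t ht using ht.aemeasurable.restrict
  filter_upwards [ae_all_iff.2 h, ae_all_iff.2 hm] with t ht hmt
  calc ∫⁻ x in cell L, ‖stress b i k (t, x)‖ₑ ^ (3 / 2 : ℝ)
      ≤ ∫⁻ x in cell L, 216 * ∑ m, ‖b m (t, x)‖ₑ ^ (3 : ℝ) := by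
        refine lintegral_mono fun x => ?_
        simp only [enorm_rpow_three_half, enorm_rpow_three]
        rw [← ENNReal.ofReal_sum_of_nonneg (fun m _ => by positivity),
          show (216 : ℝ≥0∞) = ENNReal.ofReal 216 by norm_num,
          ← ENNReal.ofReal_mul (by norm_num)]
        exact ENNReal.ofReal_le_ofReal (pw_stress_le b i k (t, x))
    _ = 216 * ∑ m, ∫⁻ x in cell L, ‖b m (t, x)‖ₑ ^ (3 : ℝ) := by
        rw [lintegral_const_mul' _ _ (by simp), lintegral_finsetSum' _ fun m _ =>
          ((hmt m).enorm.pow_const _)]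
    _ ≤ 216 * ∑ _m : Fin 3, K := by gcongr with m; exact ht m
    _ = 216 * (3 * K) := by simp

/-- Slice-wise bound for the mollified pressure. -/
lemma exists_bound_smear_pressure (w : Window L α β M C b j N A π) :
    ∃ K : ℝ≥0∞, K ≠ ∞ ∧ ∀ t ∈ Ioo α β, ∀ᶠ n in atTop, ∫⁻ x in cell L,
      ‖smear (moll n) π (t, x) - cellMean L (smear (moll n) π) t‖ₑ ^ (3 / 2 : ℝ) ≤ K := by
  obtain ⟨K, hK, h⟩ := w.exists_bound_stress
  refine ⟨ENNReal.ofReal (400 * (9 * K.toReal)), ENNReal.ofReal_ne_top, fun t ht => ?_⟩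
  filter_upwards [eventually_deep ht] with n hn
  have hz := fun x => sub_mem_slab hn.1 hn.2 x
  have hρ := smooth_moll n
  have hc := hasCompactSupport_moll n
  have sπ := smooth_smear_moll w.li_π n
  have pπ := w.per_π.smear (moll n)
  have sA := fun i => smooth_smear_moll (w.li_A i) n
  have pA := fun i => (w.per_A i).smear (moll n)
  have sS := fun i k => smooth_smear_moll (w.li_stress i k) n
  have pS := fun i k => (w.per_stress i k).smear (moll n)
  have cπ : Continuous fun x => smear (moll n) π (t, x) - cellMean L (smear (moll n) π) t :=
    (continuous_slice sπ t).sub continuous_const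
  rw [lintegral_cell_pw L cπ]
  refine ENNReal.ofReal_le_ofReal ?_
  have hvol : volume.real (cell L) ≠ 0 :=
    (ENNReal.toReal_pos (volume_cell_pos w.hL).ne' (volume_cell_lt_top L).ne).ne'
  have hS : ∀ i k, ∫ x in cell L, pw (smear (moll n) (stress b i k) (t, x)) ≤ K.toReal := by
    intro i k
    have h3 := lintegral_cell_smear_le w.hL (w.li_stress i k) (w.per_stress i k) (q := 3 / 2)
      (by norm_num) (h i k) n t
    rw [lintegral_cell_pw L (continuous_slice (sS i k) t)] at h3
    rwa [← ENNReal.ofReal_le_iff_le_toReal hK]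
  refine (integral_pw_pressure_le w.hL (P := fun x => smear (moll n) π (t, x))
    (dP := fun i x => pd (xv i) (smear (moll n) π) (t, x))
    (a := fun i x => pd tv (smear (moll n) (A i)) (t, x))
    (da := fun i x => pd (xv i) (pd tv (smear (moll n) (A i))) (t, x))
    (S := fun i k x => smear (moll n) (stress b i k) (t, x))
    (dS := fun i k x => pd (xv k) (smear (moll n) (stress b i k)) (t, x))
    (continuous_slice sπ t) (pπ.slice t)
    (fun i => continuous_slice (sπ.pd _) t) (fun i => (pπ.pd _).slice t)
    (fun i => continuous_slice ((sA i).pd _) t) (fun i => ((pA i).pd _).slice t)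
    (fun i => continuous_slice (((sA i).pd _).pd _) t) (fun i => (((pA i).pd _).pd _).slice t)
    (fun i k => continuous_slice (sS i k) t) (fun i k => (pS i k).slice t)
    (fun i k => continuous_slice ((sS i k).pd _) t) (fun i k => ((pS i k).pd _).slice t)
    (fun i x => hasDerivAt_slice sπ t x i) (fun i x => hasDerivAt_slice ((sA i).pd _) t x i)
    (fun i k x => hasDerivAt_slice (sS i k) t x k) (fun x => ?_) (fun i x => ?_) ?_).trans ?_
  -- The time derivative of a mollification is the mollification with the kernel `∂ₜρ`, so `div A =
  -- 0` applies to it directly.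
  · have e : ∀ i, pd tv (smear (moll n) (A i)) = smear (pd tv (moll n)) (A i) := fun i =>
      funext fun z => pd_smear hρ hc (w.li_A i) tv z
    simp only [e]
    exact w.div_A.smear w.li_A (hρ.pd _) (hasCompactSupport_pd _ hc)
      fun h hh => hz x h (tsupport_pd_subset _ _ hh)
  · have h1 := w.potential.smear w.li_A w.li_π hρ hc (hz x) i
    have h2 := w.pd_smear_stress hρ hc (hz x) i
    simp only [h2]
    linarith
  · rw [integral_sub (integrableOn_cell (continuous_slice sπ t))
      (integrableOn_cell continuous_const), setIntegral_const, cellMean, smul_eq_mul]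
    field_simp
    simp
  · refine mul_le_mul_of_nonneg_left ?_ (by norm_num)
    refine (Finset.sum_le_sum fun i _ => Finset.sum_le_sum fun k _ => hS i k).trans (le_of_eq ?_)
    simp
    ring

/-- The pressure is bounded in `L^{3/2}`, uniformly in time, up to its mean. -/
lemma exists_bound_pressure (w : Window L α β M C b j N A π) :
    ∃ K : ℝ≥0∞, K ≠ ∞ ∧ ∀ᵐ t : ℝ, t ∈ Ioo α β →
      ∫⁻ x in cell L, ‖π (t, x) - cellMean L π t‖ₑ ^ (3 / 2 : ℝ) ≤ K := by
  obtain ⟨K, hK, h⟩ := w.exists_bound_smear_pressure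
  refine ⟨K, hK, ?_⟩
  set u : ℕ → ℝ → ℝ≥0∞ := fun n t => ∫⁻ x in cell L, ‖smear (moll n) π (t, x) - π (t, x)‖ₑ with hu
  have sπ := fun n => smooth_smear_moll w.li_π n
  set R : ℝ := max |α| |β| + 3 * |L| + 1 with hR
  have hsub : Ioo α β ×ˢ cell L ⊆ Metric.ball (0 : Z) R := by
    rintro ⟨t, x⟩ ⟨ht, hx⟩
    have h1 := cell_subset_closedBall L hx
    rw [mem_closedBall_zero_iff] at h1
    have h2 : |t| ≤ max |α| |β| := abs_le_max_abs_abs ht.1.le ht.2.le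
    have h3 : 0 ≤ max |α| |β| := (abs_nonneg α).trans (le_max_left _ _)
    rw [mem_ball_zero_iff, Prod.norm_def, max_lt_iff, Real.norm_eq_abs]
    constructor
    · show |t| < R
      have := abs_nonneg L
      linarith
    · show ‖x‖ < R
      linarith
  have hmeas : ∀ n, AEMeasurable (fun z : Z => ‖smear (moll n) π z - π z‖ₑ)
      ((volume.restrict (Ioo α β)).prod (volume.restrict (cell L))) := by
    intro n
    rw [Measure.prod_restrict, ← Measure.volume_eq_prod]
    exact ((sπ n).continuous.aestronglyMeasurable.sub
      w.li_π.aestronglyMeasurable).enorm.restrict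
  have hum : ∀ n, AEMeasurable (u n) (volume.restrict (Ioo α β)) := fun n =>
    (hmeas n).lintegral_prod_right'
  have hlim : Tendsto (fun n => ∫⁻ t in Ioo α β, u n t) atTop (𝓝 0) := by
    have h1 := tendsto_eLpNorm_smear_ball le_rfl (by simp) (lLp_one w.li_π) R
    refine tendsto_of_tendsto_of_tendsto_of_le_of_le tendsto_const_nhds h1 (fun _ => zero_le)
      fun n => ?_
    rw [eLpNorm_one_eq_lintegral_enorm]
    refine le_trans (le_of_eq ?_) (lintegral_mono_set hsub)
    rw [Measure.volume_eq_prod, ← Measure.prod_restrict, lintegral_prod _ (hmeas n)]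
  -- Convergence in `L¹` of space-time gives, by Fatou, only a vanishing lower limit of the slice
  -- norms for almost every time. Each such slice has its own subsequence along which both the
  -- mollifications and their spatial means converge, and Fatou is applied along it.
  have hzero : ∀ᵐ t ∂(volume.restrict (Ioo α β)), liminf (fun n => u n t) atTop = 0 := by
    have h1 : ∫⁻ t in Ioo α β, liminf (fun n => u n t) atTop = 0 :=
      le_antisymm ((lintegral_liminf_le' hum).trans hlim.liminf_eq.le) zero_le
    refine (lintegral_eq_zero_iff' ?_).1 h1
    simp only [liminf_eq_iSup_iInf_of_nat]
    exact AEMeasurable.iSup fun n => AEMeasurable.biInf _ (to_countable _) fun i _ => hum i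
  rw [ae_restrict_iff' measurableSet_Ioo] at hzero
  have h1 := ae_tendsto_smear_moll w.li_π
  rw [Measure.volume_eq_prod] at h1
  have h2 := w.li_π.aestronglyMeasurable
  rw [Measure.volume_eq_prod] at h2
  filter_upwards [hzero, Measure.ae_ae_of_ae_prod h1, h2.prodMk_left] with t ht0 ht1 ht2 ht
  have hfreq : ∀ k : ℕ, ∃ᶠ n in atTop, u n t < ((k : ℝ≥0∞) + 1)⁻¹ := fun k =>
    frequently_lt_of_liminf_lt (by isBoundedDefault) (by
      rw [ht0 ht]; exact ENNReal.inv_pos.2 (by finiteness))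
  obtain ⟨φ, hφ, hφu⟩ := extraction_forall_of_frequently hfreq
  have hu0 : Tendsto (fun k => u (φ k) t) atTop (𝓝 0) := by
    refine tendsto_of_tendsto_of_tendsto_of_le_of_le tendsto_const_nhds ?_ (fun _ => zero_le)
      fun k => (hφu k).le
    have := ENNReal.tendsto_inv_nat_nhds_zero.comp (tendsto_add_atTop_nat 1)
    refine this.congr fun k => ?_
    simp
  have hmean : Tendsto (fun k => cellMean L (smear (moll (φ k)) π) t) atTop
      (𝓝 (cellMean L π t)) :=
    (tendsto_integral_of_L1 _ ht2.restrict
      (Eventually.of_forall fun k => integrableOn_cell (continuous_slice (sπ (φ k)) t))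
      hu0).const_mul _
  calc ∫⁻ x in cell L, ‖π (t, x) - cellMean L π t‖ₑ ^ (3 / 2 : ℝ)
      = ∫⁻ x in cell L, liminf (fun k => ‖smear (moll (φ k)) π (t, x)
          - cellMean L (smear (moll (φ k)) π) t‖ₑ ^ (3 / 2 : ℝ)) atTop := by
        refine lintegral_congr_ae (ae_restrict_of_ae (ht1.mono fun x hx => ?_))
        exact (((ENNReal.continuous_rpow_const (y := 3 / 2)).tendsto _).comp
          ((continuous_enorm.tendsto _).comp
            ((hx.comp hφ.tendsto_atTop).sub hmean))).liminf_eq.symm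
    _ ≤ liminf (fun k => ∫⁻ x in cell L, ‖smear (moll (φ k)) π (t, x)
          - cellMean L (smear (moll (φ k)) π) t‖ₑ ^ (3 / 2 : ℝ)) atTop := by
        refine lintegral_liminf_le fun k => ?_
        exact (((continuous_slice (sπ (φ k)) t).sub continuous_const).measurable.enorm).pow_const _
    _ ≤ K := liminf_le_of_frequently_le' (hφ.tendsto_atTop.eventually (h t ht)).frequently

end Window

/-! ### Functions of time -/

lemma locallyIntegrable_cellMean {f : Z → ℝ} (hf : LocallyIntegrable f) (L : ℝ) :
    LocallyIntegrable (cellMean L f) := by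
  intro t
  refine ⟨Icc (t - 1) (t + 1), Icc_mem_nhds (by linarith) (by linarith), ?_⟩
  have h : IntegrableOn f (Icc (t - 1) (t + 1) ×ˢ cell L) :=
    (hf.integrableOn_isCompact (isCompact_Icc.prod (isCompact_closedBall (0 : E3) _))).mono_set
      (prod_mono subset_rfl (cell_subset_closedBall L))
  rw [IntegrableOn, Measure.volume_eq_prod, ← Measure.prod_restrict] at h
  exact h.integral_prod_left.const_mul _

lemma locallyIntegrable_fst {c : ℝ → ℝ} (hc : LocallyIntegrable c) :
    LocallyIntegrable fun z : Z => c z.1 := by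
  rintro ⟨t, x⟩
  refine ⟨Icc (t - 1) (t + 1) ×ˢ Metric.closedBall x 1,
    prod_mem_nhds (Icc_mem_nhds (by linarith) (by linarith)) (Metric.closedBall_mem_nhds x one_pos),
    ?_⟩
  rw [IntegrableOn, Measure.volume_eq_prod, ← Measure.prod_restrict]
  have : IsFiniteMeasure ((volume : Measure E3).restrict (Metric.closedBall x 1)) :=
    ⟨by rw [Measure.restrict_apply_univ]; exact measure_closedBall_lt_top⟩
  exact (hc.integrableOn_isCompact isCompact_Icc).integrable.comp_fst _

/-- A function of time times a function with slice-wise bounds is locally integrable. -/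
lemma locallyIntegrable_fst_mul {L : ℝ} (hL : 0 < L) {c : ℝ → ℝ} (hc : LocallyIntegrable c)
    {f : Z → ℝ} (hf : LocallyIntegrable f) (hp : SPer L f) {K : ℝ≥0∞} (hK : K ≠ ∞)
    (hb : ∀ᵐ t : ℝ, ∫⁻ x in cell L, ‖f (t, x)‖ₑ ≤ K) :
    LocallyIntegrable fun z : Z => c z.1 * f z := by
  have hm : AEStronglyMeasurable (fun z : Z => c z.1 * f z) volume :=
    (locallyIntegrable_fst hc).aestronglyMeasurable.mul hf.aestronglyMeasurable
  refine locallyIntegrable_of_memLp_ball le_rfl fun R => memLp_one_iff_integrable.2 ⟨hm.restrict, ?_⟩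
  obtain ⟨m, hm'⟩ := exists_lintegral_ball_le hL R
  have h1 : ∫⁻ z in Metric.ball (0 : Z) R, ‖c z.1 * f z‖ₑ
      ≤ ∫⁻ z in Ioo (-R) R ×ˢ Metric.ball 0 R, ‖c z.1 * f z‖ₑ :=
    lintegral_mono_set (ball_subset_prod R)
  refine h1.trans_lt ?_
  rw [Measure.volume_eq_prod, setLIntegral_prod _ hm.enorm.restrict]
  calc ∫⁻ t in Ioo (-R) R, ∫⁻ x in Metric.ball 0 R, ‖c t * f (t, x)‖ₑ
      ≤ ∫⁻ t in Ioo (-R) R, ‖c t‖ₑ * (m * K) := by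
        refine lintegral_mono_ae ((ae_restrict_of_ae hb).mono fun t ht => ?_)
        simp only [enorm_mul]
        rw [lintegral_const_mul' _ _ enorm_ne_top]
        refine mul_le_mul_right ((hm' (fun x => ‖f (t, x)‖ₑ) fun x k => ?_).trans
          (mul_le_mul_right ht _)) _
        simp only [hp.slice t x k]
    _ < ∞ := by
        rw [lintegral_mul_const' _ _ (ENNReal.mul_ne_top (by simp) hK)]
        exact ENNReal.mul_lt_top
          ((hc.integrableOn_isCompact isCompact_Icc).mono_set Ioo_subset_Icc_self).2
          (ENNReal.mul_lt_top (by simp) hK.lt_top)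

lemma smooth_fst {θ : ℝ → ℝ} (hθ : ContDiff ℝ (⊤ : ℕ∞) θ) : Smooth fun z : Z => θ z.1 :=
  hθ.comp contDiff_fst

lemma pd_xv_fst {θ : ℝ → ℝ} (hθ : ContDiff ℝ (⊤ : ℕ∞) θ) (i : Fin 3) (z : Z) :
    pd (xv i) (fun z : Z => θ z.1) z = 0 := by
  have h : HasFDerivAt (fun z : Z => θ z.1) _ z :=
    ((hθ.differentiable (by simp) z.1).hasFDerivAt).comp z hasFDerivAt_fst
  rw [pd, h.fderiv]
  simp [xv]

/-- If `∫ θ(t) f = 0` for all test functions `θ` of time then `∫ c(t) f = 0` for all functions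
`c` of time. -/
lemma integral_fst_mul_eq_zero {f : Z → ℝ} (hf : Integrable f)
    (h : ∀ θ : ℝ → ℝ, ContDiff ℝ (⊤ : ℕ∞) θ → HasCompactSupport θ → ∫ z : Z, θ z.1 * f z = 0)
    {c : ℝ → ℝ} (hc : Integrable fun z : Z => c z.1 * f z) : ∫ z : Z, c z.1 * f z = 0 := by
  rw [Measure.volume_eq_prod] at hf hc ⊢
  have h0 : ∀ᵐ t : ℝ, ∫ x, f (t, x) = 0 := by
    refine ae_eq_zero_of_integral_contDiff_smul_eq_zero hf.integral_prod_left.locallyIntegrable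
      fun θ hθ hcθ => ?_
    obtain ⟨B, hB⟩ := hcθ.exists_bound_of_continuous hθ.continuous
    have hi : Integrable (fun z : Z => θ z.1 * f z) (volume.prod volume) :=
      hf.bdd_mul (c := B) (hθ.continuous.comp continuous_fst).aestronglyMeasurable
        (Eventually.of_forall fun z => hB z.1)
    have h1 := h θ hθ hcθ
    rw [Measure.volume_eq_prod, integral_prod _ hi] at h1
    simpa only [integral_const_mul, smul_eq_mul] using h1
  rw [integral_prod _ hc]
  simp only [integral_const_mul]
  refine integral_eq_zero_of_ae (h0.mono fun t ht => ?_)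
  simp [ht]

/-- A solution of the EMHD equations and its potential, in the Lebesgue spaces in which the
nonlinear terms make sense. -/
structure Flow (W : Set Z) (b N A : Fin 3 → Z → ℝ) (p : Z → ℝ) : Prop where
  memb : ∀ i, LLp 3 (b i)
  memN : ∀ i, LLp 1 (N i)
  measA : ∀ i, AEStronglyMeasurable (A i) volume
  bddA : ∃ M, ∀ i z, |A i z| ≤ M
  memp : LLp (3 / 2) p
  div_b : WeakDiv W b
  curl_A : WeakCurl W A b
  lamb : WeakLamb W b N
  induction : WeakInduction W b N
  potential : WeakPotential W A N p

/-- The pressure without its spatial mean, extended by zero. -/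
def redPressure (L α β : ℝ) (π : Z → ℝ) : Z → ℝ :=
  (slab α β).indicator fun z => π z - cellMean L π z.1

namespace Window

variable {L α β M : ℝ} {C : ℝ≥0∞} {b j N A : Fin 3 → Z → ℝ} {π : Z → ℝ}

lemma memLp_redPressure (w : Window L α β M C b j N A π) : LLp (3 / 2) (redPressure L α β π) := by
  obtain ⟨K, hK, h⟩ := w.exists_bound_pressure
  refine memLp_of_slice_bound (f := redPressure L α β π) w.hL ((w.li_π.sub (locallyIntegrable_fst
    (locallyIntegrable_cellMean w.li_π L))).aestronglyMeasurable.indicator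
    (measurableSet_slab α β)) (fun z k => ?_) (by simp) three_half_ne_top hK ?_
  · have h1 : (z + L • xv k).1 = z.1 := by simp [xv]
    by_cases hz : z ∈ slab α β
    · have hz' : z + L • xv k ∈ slab α β := by rwa [mem_slab, h1, ← mem_slab]
      rw [redPressure, indicator_of_mem hz, indicator_of_mem hz', h1, w.per_π]
    · have hz' : z + L • xv k ∉ slab α β := by rwa [mem_slab, h1, ← mem_slab]
      rw [redPressure, indicator_of_notMem hz, indicator_of_notMem hz']
  · have : (3 / 2 : ℝ≥0∞).toReal = 3 / 2 := by rw [ENNReal.toReal_div]; norm_num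
    rw [this]
    filter_upwards [h] with t ht
    by_cases hI : t ∈ Ioo α β
    · refine le_trans (le_of_eq ?_) (ht hI)
      refine lintegral_congr fun x => ?_
      rw [redPressure, indicator_of_mem (by rwa [mem_slab])]
    · have : ∀ x, redPressure L α β π (t, x) = 0 := fun x =>
        indicator_of_notMem (by rwa [mem_slab]) _
      simp [this]

/-- A function of time alone has no spatial gradient, so subtracting the mean leaves the equation
unchanged. Since the mean is only locally integrable, this is checked first against smooth functions
of time. -/
lemma redPressure_potential (w : Window L α β M C b j N A π) :
    WeakPotential (slab α β) A N (redPressure L α β π) := by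
  intro n ψ hψ
  rw [← w.potential n ψ hψ]
  congr 1
  have hd := hψ.pd (xv n)
  have lc := locallyIntegrable_fst (locallyIntegrable_cellMean w.li_π L)
  have i1 := integrable_mul_test w.li_π hd.smooth.continuous hd.compact
  have i2 := integrable_mul_test lc hd.smooth.continuous hd.compact
  have h0 : ∫ z, cellMean L π z.1 * pd (xv n) ψ z = 0 := by
    refine integral_fst_mul_eq_zero hd.integrable (fun θ hθ _ => ?_) i2
    have h1 := (hψ.mul (smooth_fst hθ)).integral_pd (xv n)
    simp only [pd_mul _ hψ.smooth (smooth_fst hθ), pd_xv_fst hθ] at h1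
    simpa [mul_comm] using h1
  have h1 : ∀ z, redPressure L α β π z * pd (xv n) ψ z
      = π z * pd (xv n) ψ z - cellMean L π z.1 * pd (xv n) ψ z := by
    intro z
    by_cases hz : z ∈ slab α β
    · rw [redPressure, indicator_of_mem hz, sub_mul]
    · have : pd (xv n) ψ z = 0 := image_eq_zero_of_notMem_tsupport fun h => hz (hd.supp h)
      simp [this]
  simp only [h1]
  rw [integral_sub i1 i2, h0, sub_zero]

lemma flow (w : Window L α β M C b j N A π) :
    Flow (slab α β) b N A (redPressure L α β π) where
  memb := w.memLp_b
  memN i := lLp_one (w.li_N i)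
  measA i := (w.li_A i).aestronglyMeasurable
  bddA := ⟨M, w.bound_A⟩
  memp := w.memLp_redPressure
  div_b := w.div_b
  curl_A := w.curl_A
  lamb := w.weakLamb
  induction := w.induction
  potential := w.redPressure_potential

/-- The mean is merely `L¹` in time, so the `L³` bound of `b` uniform in time is essential here;
`|b| ≤ 1 + |b|³` turns it into a uniform slice bound in `L¹`. -/
lemma li_mean_mul_b (w : Window L α β M C b j N A π) (k : Fin 3) :
    LocallyIntegrable fun z : Z => cellMean L π z.1 * b k z := by
  obtain ⟨K, hK, h⟩ := w.exists_bound_cube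
  refine locallyIntegrable_fst_mul w.hL (locallyIntegrable_cellMean w.li_π L) (w.li_b k)
    (w.per_b k) (K := volume (cell L) + K) (ENNReal.add_ne_top.2 ⟨(volume_cell_lt_top L).ne, hK⟩) ?_
  filter_upwards [h k] with t ht
  calc ∫⁻ x in cell L, ‖b k (t, x)‖ₑ ≤ ∫⁻ x in cell L, 1 + ‖b k (t, x)‖ₑ ^ (3 : ℝ) := by
        refine lintegral_mono fun x => ?_
        rcases le_total ‖b k (t, x)‖ₑ 1 with h1 | h1
        · exact h1.trans le_self_add
        · refine le_trans ?_ le_add_self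
          calc ‖b k (t, x)‖ₑ = ‖b k (t, x)‖ₑ ^ (1 : ℝ) := (ENNReal.rpow_one _).symm
            _ ≤ _ := ENNReal.rpow_le_rpow_of_exponent_le h1 (by norm_num)
    _ = volume (cell L) + ∫⁻ x in cell L, ‖b k (t, x)‖ₑ ^ (3 : ℝ) := by
        rw [lintegral_add_left measurable_const]; simp
    _ ≤ _ := by gcongr

/-- The mean of the pressure does not contribute to the flux. -/
lemma integral_mean_mul (w : Window L α β M C b j N A π) {ψ : Z → ℝ}
    (hψ : IsTest (slab α β) ψ) :
    ∑ k, ∫ z, cellMean L π z.1 * b k z * pd (xv k) ψ z = 0 := by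
  have i1 := fun k => integrable_mul_test (w.li_b k) (hψ.pd (xv k)).smooth.continuous
    (hψ.pd (xv k)).compact
  have i2 := fun k => integrable_mul_test (w.li_mean_mul_b k) (hψ.pd (xv k)).smooth.continuous
    (hψ.pd (xv k)).compact
  rw [← integral_finsetSum _ fun k _ => i2 k]
  have h := integral_fst_mul_eq_zero (f := fun z => ∑ k, b k z * pd (xv k) ψ z)
    (integrable_finsetSum _ fun k _ => i1 k) (fun θ hθ _ => ?_) (c := cellMean L π) ?_
  · simpa only [Finset.mul_sum, mul_assoc] using h
  · have h1 := w.div_b _ (hψ.mul (smooth_fst hθ))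
    have h2 : ∀ k z, pd (xv k) (fun z : Z => ψ z * θ z.1) z = θ z.1 * pd (xv k) ψ z := by
      intro k z
      rw [pd_mul _ hψ.smooth (smooth_fst hθ), pd_xv_fst hθ]; ring
    simp only [h2] at h1
    rw [← integral_finsetSum] at h1
    · rw [← h1]
      refine integral_congr_ae (Eventually.of_forall fun z => ?_)
      simp only [Finset.mul_sum]
      exact Finset.sum_congr rfl fun k _ => by ring
    · intro k _
      have h3 : Continuous fun z : Z => θ z.1 * pd (xv k) ψ z :=
        (hθ.continuous.comp continuous_fst).mul (hψ.pd (xv k)).smooth.continuous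
      exact integrable_mul_test (w.li_b k) h3 (hψ.pd (xv k)).compact.mul_left
  · simpa only [Finset.mul_sum, mul_assoc] using integrable_finsetSum _ fun k _ => i2 k

end Window

/-! ### The flux identity -/

/-- The integral of a product of three functions. -/
def br (χ u g : Z → ℝ) : ℝ := ∫ z, χ z * u z * g z

lemma integrable_br {W : Set Z} {ψ u g : Z → ℝ} (hψ : IsTest W ψ) (hu : LocallyIntegrable u)
    (hg : Continuous g) : Integrable fun z => ψ z * u z * g z := by
  have := integrable_mul_test hu (hψ.smooth.continuous.mul hg) hψ.compact.mul_right
  refine this.congr (Eventually.of_forall fun z => ?_)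
  simp only [Pi.mul_apply]; ring

lemma integral_mul_pd_mul {W : Set Z} {ψ u g : Z → ℝ} (hψ : IsTest W ψ) (hu : LocallyIntegrable u)
    (hg : Smooth g) (v : Z) :
    ∫ z, u z * pd v (fun z => ψ z * g z) z = br (pd v ψ) u g + br ψ u (pd v g) := by
  rw [br, br, ← integral_add (integrable_br (hψ.pd v) hu hg.continuous)
    (integrable_br hψ hu (hg.pd v).continuous)]
  refine integral_congr_ae (Eventually.of_forall fun z => ?_)
  simp only [pd_mul _ hψ.smooth hg]; ring

lemma integral_mul_mul_eq_br (ψ u g : Z → ℝ) : ∫ z, u z * (ψ z * g z) = br ψ u g := by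
  rw [br]
  refine integral_congr_ae (Eventually.of_forall fun z => ?_)
  simp only; ring

lemma br_congr {ψ u g g' : Z → ℝ} (h : ∀ z ∈ tsupport ψ, g z = g' z) : br ψ u g = br ψ u g' := by
  refine integral_congr_ae (Eventually.of_forall fun z => ?_)
  by_cases hz : z ∈ tsupport ψ
  · simp only [h z hz]
  · simp [image_eq_zero_of_notMem_tsupport hz]

lemma br_add {W : Set Z} {ψ u g g' : Z → ℝ} (hψ : IsTest W ψ) (hu : LocallyIntegrable u)
    (hg : Continuous g) (hg' : Continuous g') :
    br ψ u (fun z => g z + g' z) = br ψ u g + br ψ u g' := by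
  rw [br, br, br, ← integral_add (integrable_br hψ hu hg) (integrable_br hψ hu hg')]
  simp only [mul_add]

lemma br_sub {W : Set Z} {ψ u g g' : Z → ℝ} (hψ : IsTest W ψ) (hu : LocallyIntegrable u)
    (hg : Continuous g) (hg' : Continuous g') :
    br ψ u (fun z => g z - g' z) = br ψ u g - br ψ u g' := by
  rw [br, br, br, ← integral_sub (integrable_br hψ hu hg) (integrable_br hψ hu hg')]
  simp only [mul_sub]

lemma br_const_mul (ψ u g : Z → ℝ) (c : ℝ) : br ψ u (fun z => c * g z) = c * br ψ u g := by
  rw [br, br, ← integral_const_mul]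
  refine integral_congr_ae (Eventually.of_forall fun z => ?_)
  simp only; ring

lemma br_sum {W : Set Z} {ψ u : Z → ℝ} {ι : Type*} (s : Finset ι) {g : ι → Z → ℝ}
    (hψ : IsTest W ψ) (hu : LocallyIntegrable u) (hg : ∀ k, Continuous (g k)) :
    br ψ u (fun z => ∑ k ∈ s, g k z) = ∑ k ∈ s, br ψ u (g k) := by
  simp only [br, Finset.mul_sum]
  exact integral_finsetSum _ fun k _ => integrable_br hψ hu (hg k)

lemma br_zero (ψ u : Z → ℝ) : br ψ u (fun _ => 0) = 0 := by simp [br]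

namespace Flow

variable {W : Set Z} {b N A : Fin 3 → Z → ℝ} {p : Z → ℝ}

lemma li_b (F : Flow W b N A p) (i : Fin 3) : LocallyIntegrable (b i) :=
  (F.memb i).locallyIntegrable (by norm_num)

lemma li_N (F : Flow W b N A p) (i : Fin 3) : LocallyIntegrable (N i) :=
  (F.memN i).locallyIntegrable le_rfl

lemma mem_bb (F : Flow W b N A p) (k i : Fin 3) : LLp (3 / 2) fun z => b k z * b i z :=
  (F.memb k).mul (F.memb i)

lemma mem_bbb (F : Flow W b N A p) (k i : Fin 3) : LLp 1 fun z => b k z * (b i z * b i z) :=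
  (F.memb k).mul (F.mem_bb i i)

lemma li_bb (F : Flow W b N A p) (k i : Fin 3) : LocallyIntegrable fun z => b k z * b i z :=
  (F.mem_bb k i).locallyIntegrable one_le_three_half

/-- The flux identity: `B, Q, R, G, V, P` play the role of mollifications of
`b, b ⊗ b, b |b|², N, A, p`. -/
lemma flux_identity (F : Flow W b N A p) {ψ : Z → ℝ} (hψ : IsTest W ψ) {B G V : Fin 3 → Z → ℝ}
    {Q R : Fin 3 → Fin 3 → Z → ℝ} {P : Z → ℝ} (sB : ∀ i, Smooth (B i)) (sG : ∀ i, Continuous (G i))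
    (sV : ∀ i, Smooth (V i)) (sQ : ∀ k i, Smooth (Q k i)) (sR : ∀ k i, Smooth (R k i))
    (sP : Smooth P) (h1 : ∀ z ∈ tsupport ψ, ∑ k, pd (xv k) (B k) z = 0)
    (h2 : ∀ i, ∀ z ∈ tsupport ψ, ∑ k, pd (xv k) (Q k i) z
      = G i z + 1 / 2 * ∑ m, pd (xv i) (Q m m) z)
    (h3 : ∀ i, ∀ z ∈ tsupport ψ, pd tv (V i) z + G i z + pd (xv i) P z = 0)
    (h4 : ∀ n, ∀ z ∈ tsupport ψ, B n z
      = pd (xv (n + 1)) (V (n + 2)) z - pd (xv (n + 2)) (V (n + 1)) z) :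
    ∑ k, ∑ i, (br ψ 1 (pd (xv k) (R k i)) - 2 * br ψ (b i) (pd (xv k) (Q k i))
      + br ψ (fun z => b i z * b i z) (pd (xv k) (B k)) - br ψ (b k) (pd (xv k) (Q i i))
      + 2 * br ψ (fun z => b k z * b i z) (pd (xv k) (B i)))
    = ∑ k, ∑ i, (-br (pd (xv k) ψ) 1 (R k i) + 2 * br (pd (xv k) ψ) (b k) (Q i i)
      - 2 * br (pd (xv k) ψ) (fun z => b k z * b i z) (B i)
      + br (pd (xv k) ψ) (fun z => b i z * b i z) (B k))
      - 2 * ((∑ i, br (pd tv ψ) (b i) (V i)) + (∑ k, br (pd (xv k) ψ) (b k) P)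
        + ∑ k, (br (pd (xv k) ψ) (N (k + 1)) (V (k + 2))
          - br (pd (xv k) ψ) (N (k + 2)) (V (k + 1)))) := by
  have cpd : ∀ {f : Z → ℝ} (v : Z), Smooth f → Continuous (pd v f) := fun v h => (h.pd v).continuous
  -- Each equation enters either in weak form, tested with `ψ` times a mollified field (`e1`, `e3`,
  -- `e4`, `e8`), or in mollified form, integrated against `ψ` times an unmollified field (`e2`,
  -- `e5`, `e6`, `e9`). No product of two rough fields is ever differentiated.
  have e1 : ∀ k i, br ψ 1 (pd (xv k) (R k i)) = -br (pd (xv k) ψ) 1 (R k i) := by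
    intro k i
    have h := integral_mul_pd_mul hψ (u := 1) (locallyIntegrable_const 1) (sR k i) (xv k)
    have h0 := (hψ.mul (sR k i)).integral_pd (xv k)
    simp only [Pi.one_apply, one_mul, h0] at h
    linarith
  have e2 : ∀ i, ∑ k, br ψ (fun z => b i z * b i z) (pd (xv k) (B k)) = 0 := by
    intro i
    rw [← br_sum _ hψ (F.li_bb i i) fun k => cpd _ (sB k), br_congr h1, br_zero]
  have e3 : ∀ g, Smooth g → ∑ k, (br (pd (xv k) ψ) (b k) g + br ψ (b k) (pd (xv k) g)) = 0 := by
    intro g hg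
    rw [← F.div_b _ (hψ.mul hg)]
    exact Finset.sum_congr rfl fun k _ => (integral_mul_pd_mul hψ (F.li_b k) hg _).symm
  have e4 : ∀ i, (∑ k, (br (pd (xv k) ψ) (fun z => b k z * b i z) (B i)
      + br ψ (fun z => b k z * b i z) (pd (xv k) (B i)))) + br ψ (N i) (B i)
      = 1 / 2 * ∑ m, (br (pd (xv i) ψ) (fun z => b m z * b m z) (B i)
        + br ψ (fun z => b m z * b m z) (pd (xv i) (B i))) := by
    intro i
    have h := F.lamb i _ (hψ.mul (sB i))
    simp only [integral_mul_pd_mul hψ (F.li_bb _ i) (sB i), integral_mul_mul_eq_br] at h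
    rw [h]
    congr 1
    simp only [← integral_mul_pd_mul hψ (F.li_bb _ _) (sB i), Finset.sum_mul]
    refine integral_finsetSum _ fun m _ => ?_
    exact integrable_mul_test (F.li_bb m m) ((hψ.mul (sB i)).pd _).smooth.continuous
      ((hψ.mul (sB i)).pd _).compact
  have e5 : ∀ i, ∑ k, br ψ (b i) (pd (xv k) (Q k i))
      = br ψ (b i) (G i) + 1 / 2 * ∑ m, br ψ (b i) (pd (xv i) (Q m m)) := by
    intro i
    have cs : Continuous fun z => ∑ m, pd (xv i) (Q m m) z :=
      continuous_finsetSum _ fun m _ => cpd _ (sQ m m)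
    have cs' : Continuous fun z => 1 / 2 * ∑ m, pd (xv i) (Q m m) z := continuous_const.mul cs
    rw [← br_sum _ hψ (F.li_b i) fun k => cpd _ (sQ k i), br_congr (h2 i),
      br_add hψ (F.li_b i) (sG i) cs', br_const_mul,
      br_sum _ hψ (F.li_b i) fun m => cpd _ (sQ m m)]
  have e6 : ∀ i, br ψ (b i) (pd tv (V i)) + br ψ (b i) (G i) + br ψ (b i) (pd (xv i) P) = 0 := by
    intro i
    have cs : Continuous fun z => pd tv (V i) z + G i z := (cpd _ (sV i)).add (sG i)
    rw [← br_add hψ (F.li_b i) (cpd _ (sV i)) (sG i),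
      ← br_add hψ (F.li_b i) cs (cpd _ sP), br_congr (h3 i), br_zero]
  have e8 : ∀ n, br (pd tv ψ) (b n) (V n) + br ψ (b n) (pd tv (V n))
      = br (pd (xv (n + 2)) ψ) (N (n + 1)) (V n) + br ψ (N (n + 1)) (pd (xv (n + 2)) (V n))
      - (br (pd (xv (n + 1)) ψ) (N (n + 2)) (V n)
        + br ψ (N (n + 2)) (pd (xv (n + 1)) (V n))) := by
    intro n
    have h := F.induction n _ (hψ.mul (sV n))
    simpa only [integral_mul_pd_mul hψ (F.li_b n) (sV n), integral_mul_pd_mul hψ (F.li_N _) (sV n)]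
      using h
  have e9 : ∀ m, br ψ (N m) (B m) = br ψ (N m) (pd (xv (m + 1)) (V (m + 2)))
      - br ψ (N m) (pd (xv (m + 2)) (V (m + 1))) := by
    intro m
    rw [← br_sub hψ (F.li_N m) (cpd _ (sV _)) (cpd _ (sV _)), br_congr (h4 m)]
  have e7 := e3 P sP
  have e30 := e3 _ (sQ 0 0)
  have e31 := e3 _ (sQ 1 1)
  have e32 := e3 _ (sQ 2 2)
  have e80 := e8 0
  have e81 := e8 1
  have e82 := e8 2
  have e90 := e9 0
  have e91 := e9 1
  have e92 := e9 2
  have f1 : (1 : Fin 3) + 1 = 2 := rfl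
  have f2 : (1 : Fin 3) + 2 = 0 := rfl
  have f3 : (2 : Fin 3) + 1 = 0 := rfl
  have f4 : (2 : Fin 3) + 2 = 1 := rfl
  simp only [zero_add, f1, f2, f3, f4] at e80 e81 e82 e90 e91 e92
  simp only [Fin.sum_univ_three, zero_add, f1, f2, f3, f4] at e2 e30 e31 e32 e4 e5 e7 ⊢
  -- The two Lamb identities `e5`, `e4` leave `-2(b·G + N·B)`. By `e6` and `e9` this becomes
  -- `2(b·∂ₜV + b·∇P - N·curl V)`, which `e8` and `e7` reduce to terms with derivatives on `ψ`.
  linear_combination e1 0 0 + e1 0 1 + e1 0 2 + e1 1 0 + e1 1 1 + e1 1 2 + e1 2 0 + e1 2 1 + e1 2 2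
    - 2 * (e5 0 + e5 1 + e5 2) + 2 * (e2 0 + e2 1 + e2 2) - 2 * (e30 + e31 + e32)
    + 2 * (e4 0 + e4 1 + e4 2) - 2 * (e6 0 + e6 1 + e6 2) + 2 * e7 + 2 * (e80 + e81 + e82)
    - 2 * (e90 + e91 + e92)

end Flow

/-! ### Correlations -/

/-- The correlation function `h ↦ ∫ χ(z) u(z) v(z + h) dz`. -/
def corr (χ u v : Z → ℝ) (h : Z) : ℝ := br χ u (tr h v)

section Corr

variable {W : Set Z} {χ u v Φ : Z → ℝ}

lemma corr_eq (χ u v : Z → ℝ) (h : Z) : corr χ u v h = ∫ z, u z * tr h v z * χ z := by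
  refine integral_congr_ae (Eventually.of_forall fun z => ?_)
  simp only; ring

lemma integrable_corr {p q : ℝ≥0∞} [ENNReal.HolderTriple p q 1] (hχ : IsTest W χ) (hu : LLp p u)
    (hv : LLp q v) (h : Z) : Integrable fun z => χ z * u z * v (z + h) := by
  have h1 : LLp 1 fun z => u z * tr h v z := hu.mul (hv.tr h)
  refine (integrable_mul_test (h1.locallyIntegrable le_rfl) hχ.smooth.continuous
    hχ.compact).congr (Eventually.of_forall fun z => ?_)
  simp only [tr]; ring

/-- Translations are continuous in `L^q_loc` for finite `q`, and Hölder pairs the translate of `v`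
with `u`. -/
lemma continuous_corr {p q : ℝ≥0∞} [ENNReal.HolderTriple p q 1] (hχ : IsTest W χ) (hu : LLp p u)
    (hv : LLp q v) (hq : 1 ≤ q) (hq' : q ≠ ∞) : Continuous (corr χ u v) := by
  rw [continuous_iff_continuousAt]
  intro h₀
  rw [ContinuousAt, corr_eq]
  simp only [funext (corr_eq χ u v)]
  exact ((LTo.const hu).mul le_rfl (LTo.tr hq hq' hv h₀)).integral hχ.smooth.continuous hχ.compact

/-- Here `v` is only bounded, and translation is not continuous in `L^∞`. The shift is moved onto
`χu`, which is in `L¹`, where translation is continuous. This is the case of `N`, merely integrable,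
against the cut-off potential. -/
lemma continuous_corr_of_bound (hχ : IsTest W χ) (hu : LLp 1 u)
    (hv : AEStronglyMeasurable v volume) {M : ℝ} (hM : ∀ z, |v z| ≤ M) :
    Continuous (corr χ u v) := by
  have hi : Integrable fun z => χ z * u z :=
    (integrable_mul_test (hu.locallyIntegrable le_rfl) hχ.smooth.continuous hχ.compact).congr
      (Eventually.of_forall fun z => mul_comm _ _)
  have e : ∀ h, corr χ u v h = ∫ z, v z * (χ (z + -h) * u (z + -h)) := by
    intro h
    rw [corr, br, ← integral_add_right_eq_self _ (-h)]
    refine integral_congr_ae (Eventually.of_forall fun z => ?_)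
    simp only [tr, neg_add_cancel_right]; ring
  rw [continuous_iff_continuousAt]
  intro h₀
  rw [ContinuousAt, e]
  simp only [funext e]
  have hj : ∀ h, Integrable fun z => χ (z + -h) * u (z + -h) := fun h => hi.comp_add_right (-h)
  refine tendsto_integral_of_L1' _
    ((hj h₀).bdd_mul hv (Eventually.of_forall hM)).aestronglyMeasurable
    (Eventually.of_forall fun h => (hj h).bdd_mul hv (Eventually.of_forall hM)) ?_
  have ht : Tendsto (fun h : Z => -h) (𝓝 h₀) (𝓝 (-h₀)) := tendsto_neg h₀
  have h1 := ENNReal.Tendsto.const_mul (a := ENNReal.ofReal M)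
    ((tendsto_eLpNorm_translate le_rfl (by simp) (memLp_one_iff_integrable.2 hi) (-h₀)).comp ht)
    (Or.inr ENNReal.ofReal_ne_top)
  rw [mul_zero] at h1
  refine tendsto_of_tendsto_of_tendsto_of_le_of_le tendsto_const_nhds h1 (fun _ => zero_le)
    fun h => ?_
  refine eLpNorm_le_mul_eLpNorm_of_ae_le_mul (Eventually.of_forall fun z => ?_) 1
  simp only [Pi.sub_apply, ← mul_sub, norm_mul]
  exact mul_le_mul_of_nonneg_right (hM z) (norm_nonneg _)

/-- The reflected kernel. -/
def refl (Φ : Z → ℝ) (h : Z) : ℝ := Φ (-h)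

lemma smooth_refl (h : Smooth Φ) : Smooth (refl Φ) := h.comp contDiff_neg

lemma hasCompactSupport_refl (h : HasCompactSupport Φ) : HasCompactSupport (refl Φ) :=
  h.comp_homeomorph (Homeomorph.neg Z)

lemma pd_refl (h : Smooth Φ) (w z : Z) : pd w (refl Φ) z = -refl (pd w Φ) z := by
  have := pd_reflect h w 0 z
  simp only [zero_sub] at this
  exact this

lemma tsupport_refl (h : ∀ z ∈ tsupport Φ, -z ∈ W) : ∀ z ∈ tsupport (refl Φ), z ∈ W := by
  intro z hz
  have : -z ∈ tsupport Φ :=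
    tsupport_comp_subset_preimage Φ (f := fun y : Z => -y) (by fun_prop) hz
  simpa using h _ this

lemma integral_mul_corr (hχ : IsTest W χ) (hu : LocallyIntegrable u) (hv : LocallyIntegrable v)
    (hΦ : Continuous Φ) (hc : HasCompactSupport Φ) :
    ∫ h, Φ h * corr χ u v h = br χ u (smear (refl Φ) v) := by
  have hi : Integrable fun z => χ z * u z :=
    (integrable_mul_test hu hχ.smooth.continuous hχ.compact).congr
      (Eventually.of_forall fun z => mul_comm _ _)
  obtain ⟨R₁, hR₁⟩ := hχ.compact.isBounded.subset_closedBall (0 : Z)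
  obtain ⟨R₂, hR₂⟩ := hc.isBounded.subset_closedBall (0 : Z)
  obtain ⟨B, hB⟩ := hc.exists_bound_of_continuous hΦ
  -- The supports of `χ` and `Φ` only see `v` in this ball; truncation makes it integrable, so that
  -- Fubini applies.
  set v' := (Metric.closedBall (0 : Z) (R₁ + R₂)).indicator v with hv'
  have iv : Integrable v' := (integrable_indicator_iff measurableSet_closedBall).2
    (hv.integrableOn_isCompact (isCompact_closedBall _ _))
  have i1 : Integrable (fun w : Z × Z => (χ w.1 * u w.1) * v' (w.1 + w.2))
      ((volume : Measure Z).prod volume) :=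
    (measurePreserving_prod_add (volume : Measure Z) (volume : Measure Z)).integrable_comp_of_integrable
      (hi.mul_prod iv)
  have i2 : Integrable (fun w : Z × Z => Φ w.2 * ((χ w.1 * u w.1) * v' (w.1 + w.2)))
      ((volume : Measure Z).prod volume) :=
    i1.bdd_mul (c := B) (hΦ.comp continuous_snd).aestronglyMeasurable
      (Eventually.of_forall fun w => hB w.2)
  have e : ∀ z h, Φ h * (χ z * u z * v (z + h)) = Φ h * ((χ z * u z) * v' (z + h)) := by
    intro z h
    by_cases h1 : Φ h = 0
    · simp [h1]
    by_cases h2 : χ z = 0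
    · simp [h2]
    have h3 := mem_closedBall_zero_iff.1 (hR₂ (subset_tsupport _ h1))
    have h4 := mem_closedBall_zero_iff.1 (hR₁ (subset_tsupport _ h2))
    rw [hv', indicator_of_mem]
    rw [mem_closedBall_zero_iff]
    exact (norm_add_le _ _).trans (add_le_add h4 h3)
  have hsm : ∀ z, smear (refl Φ) v z = ∫ h, Φ h * v (z + h) := by
    intro z
    rw [smear_apply, ← integral_neg_eq_self]
    simp [refl]
  calc ∫ h, Φ h * corr χ u v h
      = ∫ h, ∫ z, Φ h * ((χ z * u z) * v' (z + h)) := by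
        refine integral_congr_ae (Eventually.of_forall fun h => ?_)
        simp only [← e, integral_const_mul]; rfl
    _ = ∫ z, ∫ h, Φ h * ((χ z * u z) * v' (z + h)) := (integral_integral_swap i2).symm
    _ = br χ u (smear (refl Φ) v) := by
        refine integral_congr_ae (Eventually.of_forall fun z => ?_)
        simp only [← e, hsm, ← integral_const_mul]
        refine integral_congr_ae (Eventually.of_forall fun h => ?_)
        simp only; ring

/-- Integration against a kernel turns the translate into a mollification with the reflected kernel;
the reflection changes the sign of the derivative. -/
lemma integral_pd_mul_corr (hχ : IsTest W χ) (hu : LocallyIntegrable u) (hv : LocallyIntegrable v)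
    (hΦ : Smooth Φ) (hc : HasCompactSupport Φ) (w : Z) :
    ∫ h, pd w Φ h * corr χ u v h = -br χ u (pd w (smear (refl Φ) v)) := by
  rw [integral_mul_corr hχ hu hv (hΦ.pd w).continuous (hasCompactSupport_pd w hc), ← neg_one_mul,
    ← br_const_mul]
  congr 1
  funext z
  rw [pd_smear (smooth_refl hΦ) (hasCompactSupport_refl hc) hv]
  simp only [smear_apply, pd_refl hΦ, ← integral_const_mul]
  simp

end Corr

lemma smear_sum {ι : Type*} (s : Finset ι) {ρ : Z → ℝ} {f : ι → Z → ℝ} (hρ : Continuous ρ)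
    (hc : HasCompactSupport ρ) (hf : ∀ i, LocallyIntegrable (f i)) (z : Z) :
    smear ρ (fun z => ∑ i ∈ s, f i z) z = ∑ i ∈ s, smear ρ (f i) z := by
  simp only [smear_apply, Finset.mul_sum]
  exact integral_finsetSum _ fun i _ => integrable_smear hρ hc (hf i) z

/-- Integration against a continuous function of compact support, as a linear functional on
continuous functions. -/
def pairing {Φ : Z → ℝ} (hΦ : Continuous Φ) (hc : HasCompactSupport Φ) : C(Z, ℝ) →ₗ[ℝ] ℝ where
  toFun f := ∫ h, Φ h * f h
  map_add' f g := by
    have hi : ∀ f : C(Z, ℝ), Integrable fun h => Φ h * f h := fun f =>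
      (hΦ.mul f.continuous).integrable_of_hasCompactSupport hc.mul_right
    rw [← integral_add (hi f) (hi g)]
    simp only [ContinuousMap.add_apply, mul_add]
  map_smul' c f := by
    simp only [ContinuousMap.smul_apply, smul_eq_mul, mul_left_comm _ c, integral_const_mul,
      RingHom.id_apply]

lemma pairing_apply {Φ : Z → ℝ} (hΦ : Continuous Φ) (hc : HasCompactSupport Φ) (f : C(Z, ℝ)) :
    pairing hΦ hc f = ∫ h, Φ h * f h := rfl

namespace Flow

variable {W : Set Z} {b N A : Fin 3 → Z → ℝ} {p ψ Φ : Z → ℝ}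

lemma li_bbb (F : Flow W b N A p) (k i : Fin 3) :
    LocallyIntegrable fun z => b k z * (b i z * b i z) :=
  (F.mem_bbb k i).locallyIntegrable le_rfl

lemma li_A (F : Flow W b N A p) (i : Fin 3) : LocallyIntegrable (A i) := by
  obtain ⟨M, hM⟩ := F.bddA
  exact (lLp_top_of_bound (F.measA i) (hM i)).locallyIntegrable le_top

lemma memA (F : Flow W b N A p) (i : Fin 3) : LLp (3 / 2) (A i) := by
  obtain ⟨M, hM⟩ := F.bddA
  exact (lLp_top_of_bound (F.measA i) (hM i)).mono le_top

lemma lLp_top_one : LLp ∞ (1 : Z → ℝ) := lLp_of_continuous continuous_one ∞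

lemma cont_bbb (F : Flow W b N A p) (hψ : IsTest W ψ) (k i : Fin 3) :
    Continuous (corr ψ 1 fun z => b k z * (b i z * b i z)) :=
  continuous_corr hψ lLp_top_one (F.mem_bbb k i) le_rfl (by simp)

lemma cont_b_bb (F : Flow W b N A p) (hψ : IsTest W ψ) (m k i : Fin 3) :
    Continuous (corr ψ (b m) fun z => b k z * b i z) :=
  continuous_corr hψ (F.memb m) (F.mem_bb k i) one_le_three_half three_half_ne_top

lemma cont_bb_b (F : Flow W b N A p) (hψ : IsTest W ψ) (k i m : Fin 3) :
    Continuous (corr ψ (fun z => b k z * b i z) (b m)) :=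
  continuous_corr hψ (F.mem_bb k i) (F.memb m) (by norm_num) (by norm_num)

lemma cont_b_A (F : Flow W b N A p) (hψ : IsTest W ψ) (k i : Fin 3) :
    Continuous (corr ψ (b k) (A i)) :=
  continuous_corr hψ (F.memb k) (F.memA i) one_le_three_half three_half_ne_top

lemma cont_b_p (F : Flow W b N A p) (hψ : IsTest W ψ) (k : Fin 3) :
    Continuous (corr ψ (b k) p) :=
  continuous_corr hψ (F.memb k) F.memp one_le_three_half three_half_ne_top

lemma cont_N_A (F : Flow W b N A p) (hψ : IsTest W ψ) (k i : Fin 3) :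
    Continuous (corr ψ (N k) (A i)) := by
  obtain ⟨M, hM⟩ := F.bddA
  exact continuous_corr_of_bound hψ (F.memN k) (F.measA i) (hM i)

/-- The function `h ↦ ∫ ψ δ_h b_k |δ_h b|²`. -/
def cubic (b : Fin 3 → Z → ℝ) (ψ : Z → ℝ) (k : Fin 3) (h : Z) : ℝ :=
  ∫ z, ψ z * ((b k (z + h) - b k z) * ∑ i, (b i (z + h) - b i z) ^ 2)

/-- The last correlation does not depend on `h` and is killed by any derivative. The other five are
those on the left of the flux identity, with translates in place of mollifications. -/
lemma cubic_eq (F : Flow W b N A p) (hψ : IsTest W ψ) (k : Fin 3) (h : Z) :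
    cubic b ψ k h = ∑ i, (corr ψ 1 (fun z => b k z * (b i z * b i z)) h
      - 2 * corr ψ (b i) (fun z => b k z * b i z) h
      + corr ψ (fun z => b i z * b i z) (b k) h - corr ψ (b k) (fun z => b i z * b i z) h
      + 2 * corr ψ (fun z => b k z * b i z) (b i) h
      - corr ψ (fun z => b k z * (b i z * b i z)) 1 h) := by
  have i1 := fun i => integrable_corr hψ lLp_top_one (F.mem_bbb k i) h
  have i2 := fun i => integrable_corr hψ (F.memb i) (F.mem_bb k i) h
  have i3 := fun i => integrable_corr hψ (F.mem_bb i i) (F.memb k) h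
  have i4 := fun i => integrable_corr hψ (F.memb k) (F.mem_bb i i) h
  have i5 := fun i => integrable_corr hψ (F.mem_bb k i) (F.memb i) h
  have i6 := fun i => integrable_corr hψ (F.mem_bbb k i) lLp_top_one h
  have e : ∀ z, ψ z * ((b k (z + h) - b k z) * ∑ i, (b i (z + h) - b i z) ^ 2)
      = ∑ i, (ψ z * (1 : Z → ℝ) z * (b k (z + h) * (b i (z + h) * b i (z + h)))
      - 2 * (ψ z * b i z * (b k (z + h) * b i (z + h)))
      + ψ z * (b i z * b i z) * b k (z + h) - ψ z * b k z * (b i (z + h) * b i (z + h))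
      + 2 * (ψ z * (b k z * b i z) * b i (z + h))
      - ψ z * (b k z * (b i z * b i z)) * (1 : Z → ℝ) (z + h)) := by
    intro z
    simp only [Finset.mul_sum, Pi.one_apply]
    exact Finset.sum_congr rfl fun i _ => by ring
  simp only [cubic, e]
  rw [integral_finsetSum]
  · refine Finset.sum_congr rfl fun i _ => ?_
    rw [integral_sub, integral_add, integral_sub, integral_add, integral_sub, integral_const_mul,
      integral_const_mul]
    · rfl
    · exact i1 i
    · exact (i2 i).const_mul _
    · exact (i1 i).sub ((i2 i).const_mul _)
    · exact i3 i
    · exact ((i1 i).sub ((i2 i).const_mul _)).add (i3 i)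
    · exact i4 i
    · exact (((i1 i).sub ((i2 i).const_mul _)).add (i3 i)).sub (i4 i)
    · exact (i5 i).const_mul _
    · exact ((((i1 i).sub ((i2 i).const_mul _)).add (i3 i)).sub (i4 i)).add ((i5 i).const_mul _)
    · exact i6 i
  · intro i _
    exact ((((i1 i).sub ((i2 i).const_mul _)).add (i3 i)).sub (i4 i)).add ((i5 i).const_mul _)
      |>.sub (i6 i)

/-- `cubic` without its constant part, as a bundled continuous function. -/
def cubicC (F : Flow W b N A p) (hψ : IsTest W ψ) (k : Fin 3) : C(Z, ℝ) :=
  ∑ i, (⟨_, F.cont_bbb hψ k i⟩ - (2 : ℝ) • ⟨_, F.cont_b_bb hψ i k i⟩ + ⟨_, F.cont_bb_b hψ i i k⟩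
    - ⟨_, F.cont_b_bb hψ k i i⟩ + (2 : ℝ) • ⟨_, F.cont_bb_b hψ k i i⟩)

lemma cubic_eq_cubicC (F : Flow W b N A p) (hψ : IsTest W ψ) (k : Fin 3) (h : Z) :
    cubic b ψ k h = F.cubicC hψ k h - ∑ i, br ψ (fun z => b k z * (b i z * b i z)) 1 := by
  rw [F.cubic_eq hψ, Finset.sum_sub_distrib, cubicC]
  simp [ContinuousMap.sum_apply]
  rfl

/-- The flux whose value at `0` is twice the helicity dissipation. -/
def fluxC (F : Flow W b N A p) (hψ : IsTest W ψ) : C(Z, ℝ) :=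
  (∑ k, ∑ i, (-⟨_, F.cont_bbb (hψ.pd (xv k)) k i⟩
    + (2 : ℝ) • ⟨_, F.cont_b_bb (hψ.pd (xv k)) k i i⟩
    - (2 : ℝ) • ⟨_, F.cont_bb_b (hψ.pd (xv k)) k i i⟩ + ⟨_, F.cont_bb_b (hψ.pd (xv k)) i i k⟩))
  - (2 : ℝ) • ((∑ i, ⟨_, F.cont_b_A (hψ.pd tv) i i⟩) + (∑ k, ⟨_, F.cont_b_p (hψ.pd (xv k)) k⟩)
    + ∑ k, (⟨_, F.cont_N_A (hψ.pd (xv k)) (k + 1) (k + 2)⟩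
      - ⟨_, F.cont_N_A (hψ.pd (xv k)) (k + 2) (k + 1)⟩))

/-- The divergence of the cubic flux, tested against `Φ`. -/
lemma integral_pd_mul_cubic (F : Flow W b N A p) (hψ : IsTest W ψ) (hΦ : Smooth Φ)
    (hc : HasCompactSupport Φ) (hW : ∀ z ∈ tsupport ψ, ∀ h ∈ tsupport Φ, z + h ∈ W) :
    -∑ k, ∫ h, pd (xv k) Φ h * cubic b ψ k h = ∫ h, Φ h * F.fluxC hψ h := by
  set ρ := refl Φ with hρ'
  have hρ : Smooth ρ := smooth_refl hΦ
  have hρc : HasCompactSupport ρ := hasCompactSupport_refl hc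
  have hz : ∀ z ∈ tsupport ψ, ∀ h ∈ tsupport ρ, z - h ∈ W := by
    intro z hz
    exact tsupport_refl (W := {h | z - h ∈ W}) fun h hh => by simpa using hW z hz h hh
  -- The flux identity needs neither positivity nor normalisation of the kernel, so any test kernel
  -- `Φ` in `h` is admissible, provided `supp ψ + supp Φ` stays in `W`. This is what makes it a
  -- statement about distributions in `h`.
  have key := F.flux_identity hψ (B := fun i => smear ρ (b i)) (G := fun i => smear ρ (N i))
    (V := fun i => smear ρ (A i)) (Q := fun k i => smear ρ fun z => b k z * b i z)
    (R := fun k i => smear ρ fun z => b k z * (b i z * b i z)) (P := smear ρ p)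
    (fun i => smooth_smear hρ hρc (F.li_b i)) (fun i => (smooth_smear hρ hρc (F.li_N i)).continuous)
    (fun i => smooth_smear hρ hρc (F.li_A i)) (fun k i => smooth_smear hρ hρc (F.li_bb k i))
    (fun k i => smooth_smear hρ hρc (F.li_bbb k i))
    (smooth_smear hρ hρc (F.memp.locallyIntegrable one_le_three_half))
    (fun z h => F.div_b.smear F.li_b hρ hρc (hz z h)) (fun i z h => by
      rw [F.lamb.smear F.li_bb hρ hρc (hz z h),
        pd_smear hρ hρc (locallyIntegrable_finsetSum _ fun m _ => F.li_bb m m),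
        smear_sum _ (hρ.pd _).continuous (hasCompactSupport_pd _ hρc) fun m => F.li_bb m m]
      simp only [pd_smear hρ hρc (F.li_bb _ _)])
    (fun i z h => F.potential.smear F.li_A (F.memp.locallyIntegrable one_le_three_half) hρ hρc
      (hz z h) i)
    (fun n z h => F.curl_A.smear F.li_A hρ hρc (hz z h) n)
  have hl : ∀ k, ∫ h, pd (xv k) Φ h * cubic b ψ k h
      = pairing (hΦ.pd (xv k)).continuous (hasCompactSupport_pd _ hc) (F.cubicC hψ k) := by
    intro k
    simp only [F.cubic_eq_cubicC hψ, mul_sub]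
    rw [integral_sub, integral_mul_const, integral_pd_eq_zero _ hΦ hc, zero_mul, sub_zero]
    · rfl
    · exact ((hΦ.pd _).continuous.mul (F.cubicC hψ k).continuous).integrable_of_hasCompactSupport
        (hasCompactSupport_pd _ hc).mul_right
    · exact ((hΦ.pd _).continuous.integrable_of_hasCompactSupport
        (hasCompactSupport_pd _ hc)).mul_const _
  rw [← pairing_apply hΦ.continuous hc]
  simp only [hl, cubicC, fluxC, map_sum, map_add, map_sub, map_neg, map_smul, smul_eq_mul,
    pairing_apply, ContinuousMap.coe_mk]
  have lp := F.memp.locallyIntegrable one_le_three_half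
  have l1 : LocallyIntegrable (1 : Z → ℝ) := locallyIntegrable_const 1
  simp only [integral_pd_mul_corr hψ l1 (F.li_bbb _ _) hΦ hc,
    integral_pd_mul_corr hψ (F.li_b _) (F.li_bb _ _) hΦ hc,
    integral_pd_mul_corr hψ (F.li_bb _ _) (F.li_b _) hΦ hc,
    integral_mul_corr (hψ.pd _) l1 (F.li_bbb _ _) hΦ.continuous hc,
    integral_mul_corr (hψ.pd _) (F.li_b _) (F.li_bb _ _) hΦ.continuous hc,
    integral_mul_corr (hψ.pd _) (F.li_bb _ _) (F.li_b _) hΦ.continuous hc,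
    integral_mul_corr (hψ.pd _) (F.li_b _) (F.li_A _) hΦ.continuous hc,
    integral_mul_corr (hψ.pd _) (F.li_N _) (F.li_A _) hΦ.continuous hc,
    integral_mul_corr (hψ.pd _) (F.li_b _) lp hΦ.continuous hc]
  rw [← key, ← Finset.sum_neg_distrib]
  refine Finset.sum_congr rfl fun k _ => ?_
  rw [← Finset.sum_neg_distrib]
  refine Finset.sum_congr rfl fun i _ => ?_
  ring

end Flow

/-! ### Weak derivatives on the half line and polar coordinates -/

/-- A continuous function on the half line with vanishing weak derivative is constant. -/
lemma exists_const_of_weak_deriv_eq_zero {u : ℝ → ℝ} (hu : Continuous u)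
    (h : ∀ χ : ℝ → ℝ, ContDiff ℝ (⊤ : ℕ∞) χ → HasCompactSupport χ → tsupport χ ⊆ Ioi 0 →
      ∫ r, deriv χ r * u r = 0) : ∃ c, ∀ r > 0, u r = c := by
  let β : ContDiffBump (1 : ℝ) := ⟨1 / 4, 1 / 2, by norm_num, by norm_num⟩
  set χ₀ : ℝ → ℝ := β.normed volume with hχ₀
  have s0 : ContDiff ℝ (⊤ : ℕ∞) χ₀ := β.contDiff_normed
  have c0 : HasCompactSupport χ₀ := β.hasCompactSupport_normed
  have t0 : tsupport χ₀ ⊆ Ioi 0 := by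
    rw [hχ₀, β.tsupport_normed_eq]
    intro r hr
    rw [Metric.mem_closedBall, Real.dist_eq, abs_le] at hr
    have : β.rOut = 1 / 2 := rfl
    have h1 := hr.1
    rw [this] at h1
    rw [mem_Ioi]; linarith
  have i0 : ∫ r, χ₀ r = 1 := β.integral_normed
  have hint : ∀ {f : ℝ → ℝ}, Continuous f → HasCompactSupport f → Integrable f := fun hf hc =>
    hf.integrable_of_hasCompactSupport hc
  have hint' : ∀ {f : ℝ → ℝ}, Continuous f → HasCompactSupport f → Integrable fun r => f r * u r :=
    fun hf hc => (hf.mul hu).integrable_of_hasCompactSupport hc.mul_right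
  set c := ∫ r, χ₀ r * u r with hc
  refine ⟨c, ?_⟩
  have key : ∀ η : ℝ → ℝ, ContDiff ℝ (⊤ : ℕ∞) η → HasCompactSupport η → tsupport η ⊆ Ioi 0 →
      ∫ r, η r • (u r - c) = 0 := by
    intro η sη cη tη
    set m := ∫ r, η r with hm
    -- Subtracting a multiple of a fixed bump gives mean zero, so the antiderivative has compact
    -- support inside the half line and is an admissible test function. The constant is the mean of
    -- `u` against that bump.
    set ζ : ℝ → ℝ := fun r => η r - m * χ₀ r with hζ
    have sζ : ContDiff ℝ (⊤ : ℕ∞) ζ := sη.sub (contDiff_const.mul s0)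
    set K := tsupport η ∪ tsupport χ₀ with hK
    have cK : IsCompact K := cη.isCompact.union c0.isCompact
    have hKpos : K ⊆ Ioi 0 := union_subset tη t0
    have hζK : ∀ r, r ∉ K → ζ r = 0 := by
      intro r hr
      rw [hK, mem_union, not_or] at hr
      simp [hζ, image_eq_zero_of_notMem_tsupport hr.1, image_eq_zero_of_notMem_tsupport hr.2]
    have hne : K.Nonempty := by
      refine ⟨1, Or.inr (subset_tsupport _ ?_)⟩
      exact (β.pos_of_mem_ball (Metric.mem_ball_self β.rOut_pos) |>.ne' |> fun h => by
        simpa [hχ₀, ContDiffBump.normed, β.integral_pos.ne'] using h)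
    obtain ⟨a, haK, ha⟩ := cK.exists_isLeast hne
    obtain ⟨d, hdK, hd⟩ := cK.exists_isGreatest hne
    have ha0 : 0 < a := hKpos haK
    have iζ : ∫ r, ζ r = 0 := by
      rw [hζ, integral_sub (hint sη.continuous cη) ((hint s0.continuous c0).const_mul _),
        integral_const_mul, i0]
      simp [hm]
    set X : ℝ → ℝ := fun r => ∫ s in (0 : ℝ)..r, ζ s with hX
    have hXd : ∀ r, HasDerivAt X (ζ r) r := fun r =>
      intervalIntegral.integral_hasDerivAt_right (sζ.continuous.intervalIntegrable _ _)
        (sζ.continuous.stronglyMeasurableAtFilter _ _) sζ.continuous.continuousAt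
    have dX : deriv X = ζ := funext fun r => (hXd r).deriv
    have sX : ContDiff ℝ (⊤ : ℕ∞) X :=
      contDiff_infty_iff_deriv.2 ⟨fun r => (hXd r).differentiableAt, by rwa [dX]⟩
    have X1 : ∀ r < a, X r = 0 := by
      intro r hr
      rw [hX]
      simp only
      rw [intervalIntegral.integral_congr (g := fun _ => (0 : ℝ)), intervalIntegral.integral_zero]
      intro s hs
      refine hζK s fun hsK => ?_
      have h1 : s ≤ max 0 r := (uIcc_subset_Icc ⟨min_le_left _ _, le_max_left _ _⟩
        ⟨min_le_right _ _, le_max_right _ _⟩ hs).2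
      exact absurd (ha hsK) (not_le.2 (h1.trans_lt (max_lt ha0 hr)))
    have X2 : ∀ r, d < r → X r = 0 := by
      intro r hr
      have hr0 : 0 ≤ r := ha0.le.trans ((ha hdK).trans hr.le)
      rw [hX]
      simp only
      rw [intervalIntegral.integral_of_le hr0]
      refine Eq.trans ?_ iζ
      refine setIntegral_eq_integral_of_forall_compl_eq_zero fun s hs => hζK s fun hsK => hs ?_
      exact ⟨hKpos hsK, (hd hsK).trans hr.le⟩
    have sub : Function.support X ⊆ Icc a d := by
      intro r hr
      by_contra h'
      rw [mem_Icc, not_and_or, not_le, not_le] at h'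
      exact hr (h'.elim (X1 r) (X2 r))
    have tX : tsupport X ⊆ Icc a d := closure_minimal sub isClosed_Icc
    have h1 := h X sX (isCompact_Icc.of_isClosed_subset (isClosed_tsupport _) tX)
      (tX.trans fun r hr => ha0.trans_le hr.1)
    rw [dX] at h1
    have e1 : ∀ r, ζ r * u r = η r * u r - m * (χ₀ r * u r) := fun r => by simp only [hζ]; ring
    simp only [e1] at h1
    rw [integral_sub (hint' sη.continuous cη) ((hint' s0.continuous c0).const_mul _),
      integral_const_mul, ← hc] at h1
    simp only [smul_eq_mul, mul_sub]
    rw [integral_sub (hint' sη.continuous cη) ((hint sη.continuous cη).mul_const _),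
      integral_mul_const]
    linarith
  have hae := isOpen_Ioi.ae_eq_zero_of_integral_contDiff_smul_eq_zero
    ((hu.sub continuous_const).locallyIntegrable.locallyIntegrableOn _) key
  have heq : EqOn (fun r => u r - c) (fun _ => 0) (Ioi 0) := by
    refine Measure.eqOn_open_of_ae_eq (μ := volume) ?_ isOpen_Ioi (by fun_prop) (by fun_prop)
    rw [EventuallyEq, ae_restrict_iff' measurableSet_Ioi]
    exact hae
  intro r hr
  have := heq hr
  simp only at this
  linarith

/-- Subtracting an antiderivative of `g` leaves a continuous function with zero weak derivative on
the half line; the resulting constant is read off at `0`. -/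
lemma eq_integral_of_weak_deriv {f g : ℝ → ℝ} (hf : Continuous f) (hg : Continuous g)
    (h : ∀ χ : ℝ → ℝ, ContDiff ℝ (⊤ : ℕ∞) χ → HasCompactSupport χ → tsupport χ ⊆ Ioi 0 →
      ∫ r, (deriv χ r * f r + χ r * g r) = 0) (h0 : f 0 = 0) :
    ∀ r > 0, f r = ∫ s in (0 : ℝ)..r, g s := by
  set G : ℝ → ℝ := fun r => ∫ s in (0 : ℝ)..r, g s with hG
  have hGd : ∀ r, HasDerivAt G (g r) r := fun r =>
    intervalIntegral.integral_hasDerivAt_right (hg.intervalIntegrable _ _)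
      (hg.stronglyMeasurableAtFilter _ _) hg.continuousAt
  have cG : Continuous G := continuous_iff_continuousAt.2 fun r => (hGd r).continuousAt
  obtain ⟨c, hc⟩ := exists_const_of_weak_deriv_eq_zero (u := fun r => f r - G r) (hf.sub cG) (by
    intro χ sχ cχ tχ
    have sd : Continuous (deriv χ) := sχ.continuous_deriv (by simp)
    have i1 : Integrable fun r => deriv χ r * f r :=
      (sd.mul hf).integrable_of_hasCompactSupport cχ.deriv.mul_right
    have i2 : Integrable fun r => χ r * g r :=
      (sχ.continuous.mul hg).integrable_of_hasCompactSupport cχ.mul_right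
    have i3 : Integrable fun r => deriv χ r * G r :=
      (sd.mul cG).integrable_of_hasCompactSupport cχ.deriv.mul_right
    have i4 : Integrable fun r => χ r * G r :=
      (sχ.continuous.mul cG).integrable_of_hasCompactSupport cχ.mul_right
    have h1 := h χ sχ cχ tχ
    have h2 : ∫ r, (deriv χ r * G r + χ r * g r) = 0 :=
      integral_eq_zero_of_hasDerivAt_of_integrable (f := fun r => χ r * G r)
        (fun r => ((sχ.differentiable (by simp) r).hasDerivAt.fun_mul (hGd r))) (i3.add i2) i4
    rw [integral_add i1 i2] at h1
    rw [integral_add i3 i2] at h2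
    simp only [mul_sub]
    rw [integral_sub i1 i3]
    linarith)
  have hc0 : c = 0 := by
    have h1 : Tendsto (fun r => f r - G r) (𝓝[>] 0) (𝓝 (f 0 - G 0)) :=
      ((hf.sub cG).tendsto 0).mono_left nhdsWithin_le_nhds
    have h2 : Tendsto (fun r => f r - G r) (𝓝[>] 0) (𝓝 c) :=
      tendsto_const_nhds.congr' (eventually_mem_nhdsWithin.mono fun r hr => (hc r hr).symm)
    rw [← tendsto_nhds_unique h1 h2, h0, hG]
    simp
  intro r hr
  linarith [hc r hr]

lemma finrank_E3 : Module.finrank ℝ E3 = 3 := by simp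

/-- The surface measure of the unit sphere. -/
abbrev sphereMeasure : Measure (Metric.sphere (0 : E3) 1) := (volume : Measure E3).toSphere

lemma continuous_sphere_integral {f : E3 → ℝ} (hf : Continuous f)
    {w : Metric.sphere (0 : E3) 1 → ℝ} (hw : Continuous w) :
    Continuous fun r : ℝ => ∫ ζ, w ζ * f (r • (ζ : E3)) ∂sphereMeasure := by
  have h := continuous_parametric_integral_of_continuous (μ := sphereMeasure)
    (f := fun (r : ℝ) (ζ : Metric.sphere (0 : E3) 1) => w ζ * f (r • (ζ : E3)))
    (by fun_prop) (isCompact_univ)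
  simpa only [Measure.restrict_univ] using h

/-- Integration in polar coordinates. -/
lemma integral_polar {f : E3 → ℝ} (hf : Integrable f) :
    ∫ x, f x = ∫ r in Ioi (0 : ℝ), r ^ 2 * ∫ ζ, f (r • (ζ : E3)) ∂sphereMeasure := by
  have hmp := (volume : Measure E3).measurePreserving_homeomorphUnitSphereProd
  have hemb := (homeomorphUnitSphereProd E3).measurableEmbedding
  set g : Metric.sphere (0 : E3) 1 × Ioi (0 : ℝ) → ℝ := fun w => f (w.2.1 • (w.1 : E3)) with hg
  have hcomp : ∀ x : ({0}ᶜ : Set E3), g (homeomorphUnitSphereProd E3 x) = f x := by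
    intro x
    simp only [hg]
    congr 1
    have hx : ‖(x : E3)‖ ≠ 0 := norm_ne_zero_iff.2 x.2
    simp [smul_smul, hx]
  have hi : Integrable g (sphereMeasure.prod (.volumeIoiPow (Module.finrank ℝ E3 - 1))) := by
    rw [← hmp.integrable_comp_emb hemb]
    have : g ∘ homeomorphUnitSphereProd E3 = fun x : ({0}ᶜ : Set E3) => f x := funext hcomp
    rw [this]
    have h1 : IntegrableOn f ({0}ᶜ : Set E3) := hf.integrableOn
    rwa [integrableOn_iff_comap_subtypeVal (measurableSet_singleton _).compl] at h1
  calc ∫ x, f x = ∫ x : ({0}ᶜ : Set E3), f x ∂((volume : Measure E3).comap (↑)) := by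
        rw [integral_subtype_comap (measurableSet_singleton _).compl fun x => f x,
          restrict_compl_singleton]
    _ = ∫ w, g w ∂(sphereMeasure.prod (.volumeIoiPow (Module.finrank ℝ E3 - 1))) := by
        rw [← hmp.integral_comp hemb]
        simp only [hcomp]
    _ = ∫ r : Ioi (0 : ℝ), (∫ ζ, f (r.1 • (ζ : E3)) ∂sphereMeasure)
          ∂(.volumeIoiPow (Module.finrank ℝ E3 - 1)) := integral_prod_symm _ hi
    _ = _ := by
        simp only [Measure.volumeIoiPow, ENNReal.ofReal]
        rw [integral_withDensity_eq_integral_smul,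
          integral_subtype_comap measurableSet_Ioi fun a => Real.toNNReal (a ^ (Module.finrank ℝ E3 - 1)) •
            ∫ ζ, f (a • (ζ : E3)) ∂sphereMeasure,
          setIntegral_congr_fun measurableSet_Ioi fun x hx => ?_]
        · simp only [NNReal.smul_def, finrank_E3, smul_eq_mul]
          rw [Real.coe_toNNReal _ (pow_nonneg (le_of_lt hx) _)]
        · exact (measurable_subtype_coe.pow_const _).real_toNNReal

lemma sphereMeasure_real_univ : sphereMeasure.real univ = 4 * Real.pi := by
  rw [Measure.toSphere_real_apply_univ, measureReal_def, EuclideanSpace.volume_ball_fin_three,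
    finrank_E3]
  simp only [ENNReal.ofReal_one, one_pow, one_mul]
  rw [ENNReal.toReal_ofReal (by positivity)]
  push_cast
  ring

/-! ### Limits of the mollified and of the spherical flux -/

/-- A continuous flux `F` on `ℝ³` with continuous weak divergence `H`. -/
structure ContFlux (F : Fin 3 → E3 → ℝ) (H : E3 → ℝ) : Prop where
  contF : ∀ k, Continuous (F k)
  contH : Continuous H
  weak : ∀ φ : E3 → ℝ, ContDiff ℝ (⊤ : ℕ∞) φ → HasCompactSupport φ →
    -∑ k, ∫ l, fderiv ℝ φ l (e k) * F k l = ∫ l, φ l * H l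

namespace ContFlux

variable {F : Fin 3 → E3 → ℝ} {H : E3 → ℝ}

lemma smooth_rescale {φ : E3 → ℝ} (hφ : IsMollifier φ) (ε : ℝ) :
    ContDiff ℝ (⊤ : ℕ∞) (rescale φ ε) :=
  contDiff_const.mul (hφ.smooth.comp (contDiff_const_smul ε⁻¹))

lemma hasCompactSupport_rescale {φ : E3 → ℝ} (hφ : IsMollifier φ) {ε : ℝ} (hε : ε ≠ 0) :
    HasCompactSupport (rescale φ ε) :=
  (hφ.compact.comp_smul (inv_ne_zero hε)).mul_left

/-- Moving the derivative onto `F` gives `½ ∫ φ_ε H`, and after rescaling `½ ∫ φ(y) H(εy) dy`. Unit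
mass is all that the limit sees of `φ`, which is the independence of the mollifier. -/
lemma tendsto_mollifier (h : ContFlux F H) {φ : E3 → ℝ} (hφ : IsMollifier φ) :
    Tendsto (fun ε => -(1 / 2) * ∑ k, ∫ l, fderiv ℝ (rescale φ ε) l (e k) * F k l) (𝓝[>] 0)
      (𝓝 (H 0 / 2)) := by
  have h1 : ∀ ε > 0, -(1 / 2) * ∑ k, ∫ l, fderiv ℝ (rescale φ ε) l (e k) * F k l
      = 1 / 2 * ∫ y, φ y * H (ε • y) := by
    intro ε hε
    have h2 := h.weak _ (smooth_rescale hφ ε) (hasCompactSupport_rescale hφ hε.ne')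
    have h3 := Measure.integral_comp_smul_of_nonneg (volume : Measure E3)
      (fun l => rescale φ ε l * H l) ε (hR := hε.le)
    rw [finrank_E3, smul_eq_mul] at h3
    have h4 : ∫ y, rescale φ ε (ε • y) * H (ε • y) = (ε ^ 3)⁻¹ * ∫ y, φ y * H (ε • y) := by
      rw [← integral_const_mul]
      refine integral_congr_ae (Eventually.of_forall fun y => ?_)
      simp only [rescale, smul_smul, inv_mul_cancel₀ hε.ne', one_smul]; ring
    have h5 : ∫ y, φ y * H (ε • y) = ∫ l, rescale φ ε l * H l := by
      have : (ε ^ 3)⁻¹ ≠ 0 := inv_ne_zero (pow_ne_zero _ hε.ne')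
      rw [h4] at h3
      exact mul_left_cancel₀ this h3
    rw [h5, ← h2]; ring
  have hc : Continuous fun ε : ℝ => ∫ y in tsupport φ, φ y * H (ε • y) :=
    continuous_parametric_integral_of_continuous (f := fun (ε : ℝ) y => φ y * H (ε • y))
      ((hφ.smooth.continuous.comp continuous_snd).mul
        (h.contH.comp (continuous_fst.smul continuous_snd))) hφ.compact.isCompact
  have hset : ∀ ε : ℝ, ∫ y in tsupport φ, φ y * H (ε • y) = ∫ y, φ y * H (ε • y) := fun ε =>
    setIntegral_eq_integral_of_forall_compl_eq_zero fun y hy => by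
      rw [image_eq_zero_of_notMem_tsupport hy, zero_mul]
  simp only [hset] at hc
  have h0 : ∫ y, φ y * H ((0 : ℝ) • y) = H 0 := by
    simp only [zero_smul, integral_mul_const, hφ.integral_eq, one_mul]
  have ht := ((hc.tendsto 0).mono_left (nhdsWithin_le_nhds (s := Ioi 0))).const_mul (1 / 2)
  rw [h0] at ht
  rw [show H 0 / 2 = 1 / 2 * H 0 by ring]
  exact ht.congr' (eventually_mem_nhdsWithin.mono fun ε hε => (h1 ε hε).symm)

/-- The norm is not smooth at the origin, but `χ` vanishes near `0`. -/
lemma smooth_radial {χ : ℝ → ℝ} (hχ : ContDiff ℝ (⊤ : ℕ∞) χ) (hs : tsupport χ ⊆ Ioi 0) :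
    ContDiff ℝ (⊤ : ℕ∞) fun l : E3 => χ ‖l‖ := by
  rw [contDiff_iff_contDiffAt]
  intro l
  by_cases hl : l = 0
  · have h0 : (0 : ℝ) ∉ tsupport χ := fun h => lt_irrefl (0 : ℝ) (hs h)
    have h1 : ∀ᶠ s in 𝓝 (0 : ℝ), χ s = 0 := by
      filter_upwards [(isClosed_tsupport χ).isOpen_compl.mem_nhds h0] with s hs
      exact image_eq_zero_of_notMem_tsupport hs
    have h2 : Tendsto (fun l : E3 => ‖l‖) (𝓝 l) (𝓝 0) := by
      rw [hl]; simpa using continuous_norm.tendsto (0 : E3)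
    refine (contDiffAt_const (c := (0 : ℝ))).congr_of_eventuallyEq ?_
    filter_upwards [h2.eventually h1] with l hl using hl
  · exact hχ.contDiffAt.comp l (contDiffAt_norm ℝ hl)

lemma fderiv_radial {χ : ℝ → ℝ} (hχ : ContDiff ℝ (⊤ : ℕ∞) χ) {r : ℝ} (hr : 0 < r)
    (ζ : Metric.sphere (0 : E3) 1) (k : Fin 3) :
    fderiv ℝ (fun l : E3 => χ ‖l‖) (r • (ζ : E3)) (e k) = deriv χ r * (ζ : E3) k := by
  set l : E3 := r • (ζ : E3) with hl
  have hn : ‖l‖ = r := by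
    rw [hl, norm_smul, Real.norm_of_nonneg hr.le]; simp
  have hl0 : l ≠ 0 := by rw [← norm_ne_zero_iff, hn]; exact hr.ne'
  have h1 : HasFDerivAt (fun l : E3 => ‖l‖) (fderiv ℝ (fun l : E3 => ‖l‖) l) l :=
    ((contDiffAt_norm (n := 1) ℝ hl0).differentiableAt (by simp)).hasFDerivAt
  have h2 : HasFDerivAt (fun l : E3 => ‖l‖ ^ 2) (2 • innerSL ℝ l) l :=
    (hasStrictFDerivAt_norm_sq l).hasFDerivAt
  have h3 := (h1.pow 2).unique h2
  have h4 : fderiv ℝ (fun l : E3 => ‖l‖) l (e k) = (ζ : E3) k := by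
    have h5 := DFunLike.congr_fun h3 (e k)
    have h6 : (innerSL ℝ l) (e k) = r * (ζ : E3) k := by
      rw [innerSL_apply_apply, e, EuclideanSpace.inner_single_right]
      simp [hl]
    simp only [smul_apply, hn, smul_eq_mul, nsmul_eq_mul, h6] at h5
    have : (2 : ℝ) * r ≠ 0 := by positivity
    apply mul_left_cancel₀ this
    push_cast at h5
    simp only [pow_one] at h5
    linarith
  have hd : HasFDerivAt χ (ContinuousLinearMap.toSpanSingleton ℝ (deriv χ ‖l‖)) ‖l‖ :=
    (hχ.differentiable (by simp) _).hasDerivAt.hasFDerivAt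
  have h7 : HasFDerivAt (fun l : E3 => χ ‖l‖) _ l := hd.comp l h1
  rw [h7.fderiv, ContinuousLinearMap.comp_apply, h4, hn]
  simp [mul_comm]

/-- This is the divergence theorem on balls for a merely continuous flux. Radial test functions in
polar coordinates say that `r² S(r)` has weak derivative `r² Θ(r)`, where `S` is the spherical flux
and `Θ` the spherical integral of `H`; hence `S(r)/r = ∫₀¹ x² Θ(rx) dx`, which has a limit by
continuity. -/
lemma tendsto_sphere (h : ContFlux F H) :
    Tendsto (fun r : ℝ => 1 / r * (1 / (4 * Real.pi) *
      ∑ k, ∫ ζ, (ζ : E3) k * F k (r • (ζ : E3)) ∂sphereMeasure)) (𝓝[>] 0) (𝓝 (H 0 / 3)) := by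
  set S : ℝ → ℝ := fun r => ∑ k, ∫ ζ, (ζ : E3) k * F k (r • (ζ : E3)) ∂sphereMeasure with hS
  set Θ : ℝ → ℝ := fun r => ∫ ζ, H (r • (ζ : E3)) ∂sphereMeasure with hΘ
  have hk : ∀ k, Continuous fun ζ : Metric.sphere (0 : E3) 1 => (ζ : E3) k := fun k => by fun_prop
  have cS : Continuous S := continuous_finsetSum _ fun k _ =>
    continuous_sphere_integral (h.contF k) (hk k)
  have cΘ : Continuous Θ := by
    simpa using continuous_sphere_integral h.contH (continuous_const (y := (1 : ℝ)))
  have key := eq_integral_of_weak_deriv (f := fun r => r ^ 2 * S r) (g := fun r => r ^ 2 * Θ r)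
    (by fun_prop) (by fun_prop) (fun χ sχ cχ tχ => ?_) (by simp)
  · have h1 : ∀ r > 0, 1 / r * (1 / (4 * Real.pi) * S r)
        = 1 / (4 * Real.pi) * ∫ x in (0 : ℝ)..1, x ^ 2 * Θ (r * x) := by
      intro r hr
      have h2 := intervalIntegral.integral_comp_mul_left (a := 0) (b := 1)
        (fun s => s ^ 2 * Θ s) hr.ne'
      rw [mul_zero, mul_one, ← key r hr, smul_eq_mul] at h2
      have h3 : ∫ x in (0 : ℝ)..1, (r * x) ^ 2 * Θ (r * x)
          = r ^ 2 * ∫ x in (0 : ℝ)..1, x ^ 2 * Θ (r * x) := by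
        rw [← intervalIntegral.integral_const_mul]
        refine intervalIntegral.integral_congr fun x _ => ?_
        ring
      rw [h3] at h2
      have h4 : ∫ x in (0 : ℝ)..1, x ^ 2 * Θ (r * x) = 1 / r * S r := by
        have : r ^ 2 ≠ 0 := by positivity
        apply mul_left_cancel₀ this
        rw [h2]; field_simp
      rw [h4]; ring
    have hc : Continuous fun r : ℝ => ∫ x in (0 : ℝ)..1, x ^ 2 * Θ (r * x) :=
      intervalIntegral.continuous_parametric_intervalIntegral_of_continuous'
        (by fun_prop) 0 1
    have ht := ((hc.tendsto 0).mono_left (nhdsWithin_le_nhds (s := Ioi 0))).const_mul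
      (1 / (4 * Real.pi))
    -- The area `4π` cancels the normalisation, and the factor `1/3` is `∫₀¹ x² dx`, the dimension
    -- of space.
    have h0 : 1 / (4 * Real.pi) * ∫ x in (0 : ℝ)..1, x ^ 2 * Θ (0 * x) = H 0 / 3 := by
      have hΘ0 : Θ 0 = 4 * Real.pi * H 0 := by
        simp only [hΘ, zero_smul, integral_const, sphereMeasure_real_univ, smul_eq_mul]
      simp only [zero_mul, intervalIntegral.integral_mul_const, integral_pow, hΘ0]
      have := Real.pi_ne_zero
      field_simp
      norm_num
      ring
    rw [h0] at ht
    exact ht.congr' (eventually_mem_nhdsWithin.mono fun r hr => (h1 r hr).symm)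
  · have sφ := smooth_radial sχ tχ
    have cφ : HasCompactSupport fun l : E3 => χ ‖l‖ := by
      obtain ⟨R, hR⟩ := cχ.isBounded.subset_closedBall (0 : ℝ)
      refine HasCompactSupport.intro (isCompact_closedBall (0 : E3) R) fun l hl => ?_
      refine image_eq_zero_of_notMem_tsupport fun h' => hl ?_
      have := hR h'
      simpa using this
    have hw := h.weak _ sφ cφ
    have cd : ∀ k, Continuous fun l => fderiv ℝ (fun l : E3 => χ ‖l‖) l (e k) := fun k =>
      (sφ.continuous_fderiv (by simp)).clm_apply continuous_const
    have i1 : ∀ k, Integrable fun l => fderiv ℝ (fun l : E3 => χ ‖l‖) l (e k) * F k l := fun k =>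
      ((cd k).mul (h.contF k)).integrable_of_hasCompactSupport
        ((cφ.fderiv_apply (𝕜 := ℝ) (e k)).mul_right)
    have i2 : Integrable fun l => χ ‖l‖ * H l :=
      (sφ.continuous.mul h.contH).integrable_of_hasCompactSupport cφ.mul_right
    have sd : Continuous (deriv χ) := sχ.continuous_deriv (by simp)
    rw [integral_polar i2] at hw
    simp only [integral_polar (i1 _)] at hw
    have hn : ∀ r > 0, ∀ ζ : Metric.sphere (0 : E3) 1, ‖r • (ζ : E3)‖ = r := fun r hr ζ => by
      rw [norm_smul, Real.norm_of_nonneg (le_of_lt hr)]; simp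
    have e1 : ∀ k, ∫ r in Ioi (0 : ℝ), r ^ 2 * ∫ ζ, fderiv ℝ (fun l : E3 => χ ‖l‖)
        (r • (ζ : E3)) (e k) * F k (r • (ζ : E3)) ∂sphereMeasure
        = ∫ r, deriv χ r * (r ^ 2 * ∫ ζ, (ζ : E3) k * F k (r • (ζ : E3)) ∂sphereMeasure) := by
      intro k
      refine Eq.trans (setIntegral_congr_fun measurableSet_Ioi fun r hr => ?_)
        (setIntegral_eq_integral_of_forall_compl_eq_zero fun r hr => ?_)
      · simp only [fderiv_radial sχ hr, mul_assoc, integral_const_mul]; ring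
      · rw [image_eq_zero_of_notMem_tsupport fun h' => hr (tχ (tsupport_deriv_subset h')), zero_mul]
    have e2 : ∫ r in Ioi (0 : ℝ), r ^ 2 * ∫ ζ, χ ‖r • (ζ : E3)‖ * H (r • (ζ : E3)) ∂sphereMeasure
        = ∫ r, χ r * (r ^ 2 * Θ r) := by
      refine Eq.trans (setIntegral_congr_fun measurableSet_Ioi fun r hr => ?_)
        (setIntegral_eq_integral_of_forall_compl_eq_zero fun r hr => ?_)
      · simp only [hn r hr, integral_const_mul, hΘ]; ring
      · rw [image_eq_zero_of_notMem_tsupport fun h' => hr (tχ h'), zero_mul]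
    rw [e2] at hw
    simp only [e1] at hw
    have j1 : ∀ k, Integrable fun r =>
        deriv χ r * (r ^ 2 * ∫ ζ, (ζ : E3) k * F k (r • (ζ : E3)) ∂sphereMeasure) := fun k =>
      (sd.mul ((continuous_id.pow 2).mul
        (continuous_sphere_integral (h.contF k) (hk k)))).integrable_of_hasCompactSupport
        cχ.deriv.mul_right
    have j2 : Integrable fun r => χ r * (r ^ 2 * Θ r) :=
      (sχ.continuous.mul (by fun_prop)).integrable_of_hasCompactSupport cχ.mul_right
    rw [← integral_finsetSum _ fun k _ => j1 k] at hw
    have e3 : ∀ r, ∑ k, deriv χ r * (r ^ 2 * ∫ ζ, (ζ : E3) k * F k (r • (ζ : E3)) ∂sphereMeasure)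
        = deriv χ r * (r ^ 2 * S r) := fun r => by simp only [hS, Finset.mul_sum]
    simp only [e3] at hw
    have j3 : Integrable fun r => deriv χ r * (r ^ 2 * S r) :=
      (sd.mul (by fun_prop)).integrable_of_hasCompactSupport cχ.deriv.mul_right
    rw [integral_add j3 j2]
    linarith

end ContFlux

/-! ### Purely spatial increments -/

lemma continuous_integral_slice {w : E3 → ℝ} {G : Z → ℝ} (hw : Continuous w)
    (hc : HasCompactSupport w) (hG : Continuous G) :
    Continuous fun τ : ℝ => ∫ l, w l * G (τ, l) := by
  have h : Continuous fun τ : ℝ => ∫ l in tsupport w, w l * G (τ, l) :=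
    continuous_parametric_integral_of_continuous (f := fun (τ : ℝ) l => w l * G (τ, l))
      ((hw.comp continuous_snd).mul hG) hc.isCompact
  have e : ∀ τ : ℝ, ∫ l in tsupport w, w l * G (τ, l) = ∫ l, w l * G (τ, l) := fun τ =>
    setIntegral_eq_integral_of_forall_compl_eq_zero fun l hl => by
      rw [image_eq_zero_of_notMem_tsupport hl, zero_mul]
  simpa only [e] using h

lemma hasCompactSupport_prod_mul {θ : ℝ → ℝ} {w : E3 → ℝ} (hθ : HasCompactSupport θ)
    (hw : HasCompactSupport w) : HasCompactSupport fun z : Z => θ z.1 * w z.2 := by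
  refine HasCompactSupport.intro (hθ.isCompact.prod hw.isCompact) fun z hz => ?_
  by_cases h : z.1 ∈ tsupport θ
  · rw [image_eq_zero_of_notMem_tsupport fun h' => hz ⟨h, h'⟩, mul_zero]
  · rw [image_eq_zero_of_notMem_tsupport h, zero_mul]

lemma tsupport_prod_mul_subset (θ : ℝ → ℝ) (w : E3 → ℝ) {z : Z}
    (hz : z ∈ tsupport fun z : Z => θ z.1 * w z.2) : z.1 ∈ tsupport θ := by
  have h : Function.support (fun z : Z => θ z.1 * w z.2) ⊆ Prod.fst ⁻¹' tsupport θ := fun y hy =>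
    subset_tsupport _ (left_ne_zero_of_mul hy)
  exact closure_minimal h ((isClosed_tsupport θ).preimage continuous_fst) hz

lemma integral_prod_mul {θ : ℝ → ℝ} {w : E3 → ℝ} {G : Z → ℝ} (hθ : Continuous θ)
    (cθ : HasCompactSupport θ) (hw : Continuous w) (hc : HasCompactSupport w)
    (hG : Continuous G) :
    ∫ z : Z, θ z.1 * w z.2 * G z = ∫ τ, θ τ * ∫ l, w l * G (τ, l) := by
  have hi : Integrable fun z : Z => θ z.1 * w z.2 * G z :=
    (((hθ.comp continuous_fst).mul (hw.comp continuous_snd)).mul hG).integrable_of_hasCompactSupport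
      (hasCompactSupport_prod_mul cθ hc).mul_right
  rw [Measure.volume_eq_prod] at hi ⊢
  rw [integral_prod _ hi]
  simp only [mul_assoc, integral_const_mul]

lemma pd_xv_prod_mul {θ : ℝ → ℝ} {w : E3 → ℝ} (hθ : ContDiff ℝ (⊤ : ℕ∞) θ)
    (hw : ContDiff ℝ (⊤ : ℕ∞) w) (k : Fin 3) (z : Z) :
    pd (xv k) (fun z : Z => θ z.1 * w z.2) z = θ z.1 * fderiv ℝ w z.2 (e k) := by
  have h1 : Smooth fun z : Z => w z.2 := hw.comp contDiff_snd
  have h2 : HasFDerivAt (fun z : Z => w z.2) _ z :=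
    ((hw.differentiable (by simp) z.2).hasFDerivAt).comp z hasFDerivAt_snd
  have h3 : pd (xv k) (fun z : Z => w z.2) z = fderiv ℝ w z.2 (e k) := by
    rw [pd, h2.fderiv]; simp [xv]
  rw [pd_mul _ (smooth_fst hθ) h1, pd_xv_fst hθ, h3, zero_mul, zero_add]

namespace Flow

variable {α β : ℝ} {W : Set Z} {b N A : Fin 3 → Z → ℝ} {p ψ : Z → ℝ}

lemma continuous_cubic (F : Flow W b N A p) (hψ : IsTest W ψ) (k : Fin 3) :
    Continuous (cubic b ψ k) := by
  rw [funext fun h => F.cubic_eq_cubicC hψ k h]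
  exact (F.cubicC hψ k).continuous.sub continuous_const

/-- The identity is known for kernels in space-time shifts. Products `θ(τ) φ(l)` with `θ` supported
near `0` give it for almost every small time shift `τ`, and continuity in `τ` gives it at `τ = 0`.
Only `τ` must be small: a slab is invariant under spatial shifts, so `φ` may have any support. -/
lemma contFlux (F : Flow (slab α β) b N A p) (hψ : IsTest (slab α β) ψ) :
    ContFlux (fun k l => cubic b ψ k (0, l)) fun l => F.fluxC hψ (0, l) where
  contF k := (F.continuous_cubic hψ k).comp (by fun_prop)
  contH := (F.fluxC hψ).continuous.comp (by fun_prop)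
  weak φ sφ cφ := by
    obtain ⟨η, hη, hm⟩ := exists_margin (isOpen_slab α β) hψ
    have cd : ∀ k, Continuous fun l => fderiv ℝ φ l (e k) := fun k =>
      (sφ.continuous_fderiv (by simp)).clm_apply continuous_const
    have sd : ∀ k, HasCompactSupport fun l => fderiv ℝ φ l (e k) := fun k =>
      cφ.fderiv_apply (𝕜 := ℝ) (e k)
    set g : ℝ → ℝ := fun τ => (∑ k, ∫ l, fderiv ℝ φ l (e k) * cubic b ψ k (τ, l))
      + ∫ l, φ l * F.fluxC hψ (τ, l) with hg
    have c1 : ∀ k, Continuous fun τ : ℝ => ∫ l, fderiv ℝ φ l (e k) * cubic b ψ k (τ, l) := fun k =>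
      continuous_integral_slice (cd k) (sd k) (F.continuous_cubic hψ k)
    have c2 : Continuous fun τ : ℝ => ∫ l, φ l * F.fluxC hψ (τ, l) :=
      continuous_integral_slice sφ.continuous cφ (F.fluxC hψ).continuous
    have c3 : Continuous fun τ : ℝ => ∑ k, ∫ l, fderiv ℝ φ l (e k) * cubic b ψ k (τ, l) :=
      continuous_finsetSum _ fun k _ => c1 k
    have cg : Continuous g := c3.add c2
    have h0 : ∀ᵐ τ : ℝ, τ ∈ Ioo (-η) η → g τ = 0 := by
      refine isOpen_Ioo.ae_eq_zero_of_integral_contDiff_smul_eq_zero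
        (cg.locallyIntegrable.locallyIntegrableOn _) fun θ hθ cθ sθ => ?_
      have hΦ : Smooth fun z : Z => θ z.1 * φ z.2 :=
        (smooth_fst hθ).mul (sφ.comp contDiff_snd)
      have key := F.integral_pd_mul_cubic hψ hΦ (hasCompactSupport_prod_mul cθ cφ) (by
        intro z hz h hh
        have h1 := sθ (tsupport_prod_mul_subset θ φ hh)
        have h2 := hm z hz (-h.1, 0) (by
          rw [Prod.norm_def]
          simpa [abs_lt] using h1)
        rw [mem_slab] at h2 ⊢
        simpa using h2)
      simp only [pd_xv_prod_mul hθ sφ] at key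
      rw [integral_prod_mul hθ.continuous cθ sφ.continuous cφ (F.fluxC hψ).continuous] at key
      simp only [integral_prod_mul hθ.continuous cθ (cd _) (sd _) (F.continuous_cubic hψ _)] at key
      have i1 : ∀ k, Integrable fun τ => θ τ * ∫ l, fderiv ℝ φ l (e k) * cubic b ψ k (τ, l) :=
        fun k => (hθ.continuous.mul (c1 k)).integrable_of_hasCompactSupport cθ.mul_right
      have i2 : Integrable fun τ => θ τ * ∫ l, φ l * F.fluxC hψ (τ, l) :=
        (hθ.continuous.mul c2).integrable_of_hasCompactSupport cθ.mul_right
      have i3 : Integrable fun τ =>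
          θ τ * ∑ k, ∫ l, fderiv ℝ φ l (e k) * cubic b ψ k (τ, l) :=
        (hθ.continuous.mul c3).integrable_of_hasCompactSupport cθ.mul_right
      rw [← integral_finsetSum _ fun k _ => i1 k] at key
      simp only [hg, smul_eq_mul, mul_add]
      rw [integral_add i3 i2, ← key]
      simp only [Finset.mul_sum]
      ring
    have h1 : EqOn g 0 (Ioo (-η) η) :=
      Measure.eqOn_open_of_ae_eq (μ := volume)
        ((ae_restrict_iff' measurableSet_Ioo).2 (h0.mono fun τ h => h)) isOpen_Ioo
        cg.continuousOn continuousOn_const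
    have h2 := h1 (show (0 : ℝ) ∈ Ioo (-η) η from ⟨by linarith, hη⟩)
    simp only [hg, Pi.zero_apply] at h2
    linarith

/-- At zero shift all four cubic correlations become `∫ ∂ₖψ bₖ bᵢ²`, with coefficients `-1, 2, -2,
1` that sum to zero. -/
lemma fluxC_zero (F : Flow W b N A p) (hψ : IsTest W ψ) : F.fluxC hψ 0
    = -2 * ((∑ i, br (pd tv ψ) (b i) (A i)) + (∑ k, br (pd (xv k) ψ) (b k) p)
      + ∑ k, (br (pd (xv k) ψ) (N (k + 1)) (A (k + 2))
        - br (pd (xv k) ψ) (N (k + 2)) (A (k + 1)))) := by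
  have h0 : ∀ v : Z → ℝ, tr 0 v = v := fun v => funext fun z => by simp [tr]
  have e1 : ∀ k i, br (pd (xv k) ψ) 1 (fun z => b k z * (b i z * b i z))
      = br (pd (xv k) ψ) (b k) (fun z => b i z * b i z) := fun k i => by
    refine integral_congr_ae (Eventually.of_forall fun z => ?_)
    simp only [Pi.one_apply]; ring
  have e3 : ∀ k i, br (pd (xv k) ψ) (fun z => b k z * b i z) (b i)
      = br (pd (xv k) ψ) (b k) (fun z => b i z * b i z) := fun k i => by
    refine integral_congr_ae (Eventually.of_forall fun z => ?_)
    simp only; ring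
  have e4 : ∀ k i, br (pd (xv k) ψ) (fun z => b i z * b i z) (b k)
      = br (pd (xv k) ψ) (b k) (fun z => b i z * b i z) := fun k i => by
    refine integral_congr_ae (Eventually.of_forall fun z => ?_)
    simp only; ring
  simp only [fluxC, ContinuousMap.sub_apply, ContinuousMap.sum_apply, ContinuousMap.add_apply,
    ContinuousMap.neg_apply, ContinuousMap.smul_apply, ContinuousMap.coe_mk, corr, h0, smul_eq_mul,
    e1, e3, e4]
  have e5 : ∀ x : ℝ, -x + 2 * x - 2 * x + x = 0 := fun x => by ring
  simp only [e5, Finset.sum_const_zero]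
  ring

end Flow

/-! ### Averages of cubic increments -/

section IncrMean

variable {Y : Type*} [MeasurableSpace Y]

/-- The cubic increment `∑ₖ wₖ δbₖ |δb|²` for the spatial shift by `l`. -/
def cubicIncr (w : Fin 3 → ℝ) (b : Fin 3 → Z → ℝ) (l : E3) (z : Z) : ℝ :=
  ∑ k, w k * ((b k (z + (0, l)) - b k z) * ∑ i, (b i (z + (0, l)) - b i z) ^ 2)

variable {ν : Measure Y} [IsFiniteMeasure ν] {w : Fin 3 → Y → ℝ} {m : Y → E3} {R B : ℝ}
  {b : Fin 3 → Z → ℝ}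

/-- A shift whose size depends on the averaging parameter preserves the product measure, so
increments are in `L³` of the product and Fubini becomes available. -/
lemma measurePreserving_shift (ν : Measure Y) [IsFiniteMeasure ν] (hm : Measurable m) :
    MeasurePreserving (fun q : Y × Z => (q.1, q.2 + (0, m q.1))) (ν.prod volume)
      (ν.prod volume) := by
  refine MeasurePreserving.skew_product (g := fun y (z : Z) => z + (0, m y))
    (MeasurePreserving.id ν) ?_ (Eventually.of_forall fun y => map_add_right_eq_self _ _)
  exact measurable_snd.add (measurable_const.prodMk (hm.comp measurable_fst))

lemma integrable_cubicIncr (hw : ∀ k, Measurable (w k)) (hB : ∀ k y, |w k y| ≤ B)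
    (hm : Measurable m) (hb : ∀ i, MemLp (b i) 3 volume) :
    Integrable (fun q : Y × Z => cubicIncr (fun k => w k q.1) b (m q.1) q.2)
      (ν.prod volume) := by
  have h1 : ∀ i, MemLp (fun q : Y × Z => b i (q.2 + (0, m q.1)) - b i q.2) 3 (ν.prod volume) := by
    intro i
    have h2 : MemLp (fun q : Y × Z => b i q.2) 3 (ν.prod volume) := (hb i).comp_snd ν
    exact (h2.comp_measurePreserving (measurePreserving_shift ν hm)).sub h2
  refine integrable_finsetSum _ fun k _ => ?_
  have h2 : Integrable (fun q : Y × Z => (b k (q.2 + (0, m q.1)) - b k q.2)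
      * ∑ i, (b i (q.2 + (0, m q.1)) - b i q.2) ^ 2) (ν.prod volume) := by
    have h3 : MemLp (fun q : Y × Z => ∑ i, (b i (q.2 + (0, m q.1)) - b i q.2) ^ 2) (3 / 2)
        (ν.prod volume) := memLp_finsetSum _ fun i _ => by
      simp only [pow_two]
      exact MemLp.mul (h1 i) (h1 i)
    exact memLp_one_iff_integrable.1 (MemLp.mul h3 (h1 k))
  exact h2.bdd_mul (c := B) ((hw k).comp measurable_fst).aestronglyMeasurable
    (Eventually.of_forall fun q => hB k q.1)

/-- On a ball and for bounded shifts the increments only see `b` in a larger ball, so `b` may be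
taken globally in `L³`. -/
lemma exists_truncation (hb : ∀ i, LLp 3 (b i)) (R₀ R : ℝ) :
    ∃ b' : Fin 3 → Z → ℝ, (∀ i, MemLp (b' i) 3 volume) ∧
      ∀ z ∈ Metric.ball (0 : Z) R₀, ∀ l : E3, ‖l‖ ≤ R → ∀ w,
        cubicIncr w b l z = cubicIncr w b' l z := by
  refine ⟨fun i => (Metric.ball (0 : Z) (R₀ + max R 0)).indicator (b i), fun i =>
    (memLp_indicator_iff_restrict Metric.isOpen_ball.measurableSet).2 (hb i _),
    fun z hz l hl w => ?_⟩
  have hz' : z ∈ Metric.ball (0 : Z) (R₀ + max R 0) :=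
    Metric.ball_subset_ball (le_add_of_nonneg_right (le_max_right _ _)) hz
  have hl' : z + (0, l) ∈ Metric.ball (0 : Z) (R₀ + max R 0) := by
    rw [mem_ball_zero_iff] at hz ⊢
    have : ‖((0 : ℝ), l)‖ ≤ max R 0 := by
      rw [Prod.norm_def, norm_zero]
      exact max_le (le_max_right _ _) (hl.trans (le_max_left _ _))
    exact (norm_add_le _ _).trans_lt (add_lt_add_of_lt_of_le hz this)
  simp only [cubicIncr, indicator_of_mem hz', indicator_of_mem hl']

/-- The average of the cubic increments. -/
def incrMean (ν : Measure Y) (w : Fin 3 → Y → ℝ) (m : Y → E3) (b : Fin 3 → Z → ℝ) (z : Z) : ℝ :=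
  ∫ y, cubicIncr (fun k => w k y) b (m y) z ∂ν

/-- `D_mh(b, ε)` and `S(b,b,b; r)` are both of this form up to constants, with averages over the
support of the mollifier and over the sphere; local integrability and the exchange with `ψ` are thus
proved once. -/
lemma locallyIntegrable_incrMean (hw : ∀ k, Measurable (w k)) (hB : ∀ k y, |w k y| ≤ B)
    (hm : Measurable m) (hR : ∀ᵐ y ∂ν, ‖m y‖ ≤ R) (hb : ∀ i, LLp 3 (b i)) :
    LocallyIntegrable (incrMean ν w m b) := by
  refine locallyIntegrable_of_memLp_ball le_rfl fun R₀ => memLp_one_iff_integrable.2 ?_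
  obtain ⟨b', hb', h⟩ := exists_truncation hb R₀ R
  have h1 : Integrable (incrMean ν w m b') :=
    (integrable_cubicIncr (ν := ν) hw hB hm hb').integral_prod_right
  refine h1.integrableOn.congr_fun (fun z hz => ?_) Metric.isOpen_ball.measurableSet
  exact integral_congr_ae (hR.mono fun y hy => (h z hz _ hy _).symm)

lemma integral_mul_incrMean {W : Set Z} {N A : Fin 3 → Z → ℝ} {p ψ : Z → ℝ} (F : Flow W b N A p)
    (hψ : IsTest W ψ) (hw : ∀ k, Measurable (w k)) (hB : ∀ k y, |w k y| ≤ B)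
    (hm : Measurable m) (hR : ∀ᵐ y ∂ν, ‖m y‖ ≤ R) :
    ∫ z, ψ z * incrMean ν w m b z = ∫ y, ∑ k, w k y * Flow.cubic b ψ k (0, m y) ∂ν := by
  obtain ⟨R₀, h₀⟩ := hψ.compact.isBounded.subset_ball (0 : Z)
  obtain ⟨b', hb', h⟩ := exists_truncation F.memb R₀ R
  obtain ⟨c, hc⟩ := hψ.compact.exists_bound_of_continuous hψ.smooth.continuous
  have hi : Integrable (fun q : Y × Z => ψ q.2 * cubicIncr (fun k => w k q.1) b' (m q.1) q.2)
      (ν.prod volume) := (integrable_cubicIncr (ν := ν) hw hB hm hb').bdd_mul (c := c)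
        (hψ.smooth.continuous.measurable.comp measurable_snd).aestronglyMeasurable
        (Eventually.of_forall fun q => hc q.2)
  have e : ∀ z y, ‖m y‖ ≤ R → ψ z * cubicIncr (fun k => w k y) b (m y) z
      = ψ z * cubicIncr (fun k => w k y) b' (m y) z := by
    intro z y hy
    by_cases hz : z ∈ tsupport ψ
    · rw [h z (h₀ hz) _ hy]
    · rw [image_eq_zero_of_notMem_tsupport hz, zero_mul, zero_mul]
  calc ∫ z, ψ z * incrMean ν w m b z
      = ∫ z, ∫ y, ψ z * cubicIncr (fun k => w k y) b' (m y) z ∂ν := by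
        refine integral_congr_ae (Eventually.of_forall fun z => ?_)
        simp only [incrMean, ← integral_const_mul]
        exact integral_congr_ae (hR.mono fun y hy => e z y hy)
    _ = ∫ y, (∫ z, ψ z * cubicIncr (fun k => w k y) b' (m y) z) ∂ν :=
        (integral_integral_swap hi).symm
    _ = ∫ y, ∑ k, w k y * Flow.cubic b ψ k (0, m y) ∂ν := by
        refine integral_congr_ae (hR.mono fun y hy => ?_)
        have e2 : ∀ z, ψ z * cubicIncr (fun k => w k y) b' (m y) z
            = ∑ k, ψ z * (w k y * ((b k (z + (0, m y)) - b k z)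
              * ∑ i, (b i (z + (0, m y)) - b i z) ^ 2)) := fun z => by
          rw [← e z y hy, cubicIncr, Finset.mul_sum]
        simp only [e2]
        rw [integral_finsetSum]
        · refine Finset.sum_congr rfl fun k _ => ?_
          rw [Flow.cubic, ← integral_const_mul]
          refine integral_congr_ae (Eventually.of_forall fun z => ?_)
          simp only; ring
        · intro k _
          have h2 : LLp 1 fun z => w k y * ((b k (z + (0, m y)) - b k z)
              * ∑ i, (b i (z + (0, m y)) - b i z) ^ 2) := by
            have h1 : ∀ i, LLp 3 fun z => b i (z + (0, m y)) - b i z := fun i =>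
              ((F.memb i).tr (0, m y)).sub (F.memb i)
            have h3 : LLp (3 / 2) fun z => ∑ i, (b i (z + (0, m y)) - b i z) ^ 2 :=
              LLp.sum _ fun i => by
                simp only [pow_two]
                exact (h1 i).mul (h1 i)
            exact ((h1 k).mul h3).const_mul _
          refine (integrable_mul_test (h2.locallyIntegrable le_rfl) hψ.smooth.continuous
            hψ.compact).congr (Eventually.of_forall fun z => mul_comm _ _)

end IncrMean

/-! ### The dissipation and the structure function -/

/-- The components of a vector field, cut off outside of a set. -/
def cut (W : Set Z) (b : Z → E3) (i : Fin 3) : Z → ℝ := W.indicator fun z => b z i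

/-- Spatial shifts do not leave a slab, so cutting `b` off in time does not change its increments
there. -/
lemma cubicIncr_cut {α β : ℝ} {b : Z → E3} {z : Z} (hz : z ∈ slab α β) (w l : E3) :
    inner ℝ w (incr b z l) * ‖incr b z l‖ ^ 2
      = cubicIncr (fun k => w k) (cut (slab α β) b) l z := by
  have hz' : z + (0, l) ∈ slab α β := by
    rw [mem_slab] at hz ⊢; simpa using hz
  have e1 : (z.1, z.2 + l) = z + (0, l) := by ext <;> simp
  simp only [cubicIncr, cut, indicator_of_mem hz, indicator_of_mem hz', incr, e1,
    EuclideanSpace.norm_sq_eq, PiLp.inner_apply, PiLp.sub_apply, Finset.sum_mul, Real.norm_eq_abs,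
    sq_abs, RCLike.inner_apply, conj_trivial]
  refine Finset.sum_congr rfl fun k _ => ?_
  ring

lemma gradient_apply (f : E3 → ℝ) (l : E3) (k : Fin 3) :
    gradient f l k = fderiv ℝ f l (e k) := by
  have h := InnerProductSpace.toDual_symm_apply (𝕜 := ℝ) (x := e k) (y := fderiv ℝ f l)
  rw [← h, e, EuclideanSpace.inner_single_right]
  simp [gradient]

section Avg

variable {α β ε r : ℝ} {b : Z → E3} {φ : E3 → ℝ} {z : Z}

/-- Restricting to the support of the kernel loses nothing and makes the averaging measure finite.
-/
lemma dmh_eq (hz : z ∈ slab α β) :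
    Dmh φ b ε z = -(1 / 2) * incrMean (volume.restrict (tsupport (rescale φ ε)))
      (fun k l => fderiv ℝ (rescale φ ε) l (e k)) (fun l => l) (cut (slab α β) b) z := by
  rw [Dmh, incrMean]
  congr 1
  simp only [cubicIncr_cut hz, gradient_apply]
  refine (setIntegral_eq_integral_of_forall_compl_eq_zero fun l hl => ?_).symm
  have h0 : fderiv ℝ (rescale φ ε) l = 0 := image_eq_zero_of_notMem_tsupport fun h =>
    hl (tsupport_fderiv_subset ℝ h)
  simp [cubicIncr, h0]

lemma sfun_eq (hz : z ∈ slab α β) :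
    Sfun b r z = 1 / r * (1 / (4 * Real.pi) * incrMean sphereMeasure
      (fun k ζ => (ζ : E3) k) (fun ζ => r • (ζ : E3)) (cut (slab α β) b) z) := by
  rw [Sfun, incrMean]
  simp only [cubicIncr_cut hz]

lemma exists_bound_fderiv (hφ : IsMollifier φ) (hε : ε ≠ 0) :
    ∃ B, ∀ (k : Fin 3) l, |fderiv ℝ (rescale φ ε) l (e k)| ≤ B := by
  obtain ⟨B, hB⟩ := ((ContFlux.hasCompactSupport_rescale hφ hε).fderiv
    (𝕜 := ℝ)).exists_bound_of_continuous
    ((ContFlux.smooth_rescale hφ ε).continuous_fderiv (by simp))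
  refine ⟨B, fun k l => ?_⟩
  have h1 : ‖e k‖ = 1 := by simp [e]
  simpa [h1] using (ContinuousLinearMap.le_opNorm _ (e k)).trans
    (mul_le_mul_of_nonneg_right (hB l) (norm_nonneg (e k)))

lemma continuous_fderiv_rescale (hφ : IsMollifier φ) (ε : ℝ) (k : Fin 3) :
    Continuous fun l => fderiv ℝ (rescale φ ε) l (e k) :=
  ((ContFlux.smooth_rescale hφ ε).continuous_fderiv (by simp)).clm_apply continuous_const

lemma exists_bound_tsupport (hφ : IsMollifier φ) (hε : ε ≠ 0) :
    ∃ R, ∀ᵐ l ∂(volume : Measure E3).restrict (tsupport (rescale φ ε)), ‖l‖ ≤ R := by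
  obtain ⟨R, hR⟩ := (ContFlux.hasCompactSupport_rescale hφ
    hε).isBounded.subset_closedBall (0 : E3)
  exact ⟨R, (ae_restrict_iff' (isClosed_tsupport _).measurableSet).2
    (Eventually.of_forall fun l hl => by simpa using hR hl)⟩

lemma isFiniteMeasure_tsupport (hφ : IsMollifier φ) (hε : ε ≠ 0) :
    IsFiniteMeasure ((volume : Measure E3).restrict (tsupport (rescale φ ε))) :=
  ⟨by
    rw [Measure.restrict_apply_univ]
    exact (ContFlux.hasCompactSupport_rescale hφ hε).isCompact.measure_lt_top⟩

/-- A locally integrable function that agrees with `D_mh(b, ε)` on the slab. -/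
lemma exists_locallyIntegrable_dmh (hφ : IsMollifier φ) (hε : ε ≠ 0)
    (hb : ∀ i, LLp 3 (cut (slab α β) b i)) :
    ∃ f : Z → ℝ, LocallyIntegrable f ∧ EqOn (Dmh φ b ε) f (slab α β) := by
  have := isFiniteMeasure_tsupport hφ hε
  obtain ⟨B, hB⟩ := exists_bound_fderiv hφ hε
  obtain ⟨R, hR⟩ := exists_bound_tsupport hφ hε
  exact ⟨_, (locallyIntegrable_incrMean (m := fun l => l)
    (fun k => (continuous_fderiv_rescale hφ ε k).measurable) hB measurable_id' hR hb).smul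
    (-(1 / 2) : ℝ), fun z hz => dmh_eq hz⟩

lemma exists_locallyIntegrable_sfun (r : ℝ) (hb : ∀ i, LLp 3 (cut (slab α β) b i)) :
    ∃ f : Z → ℝ, LocallyIntegrable f ∧ EqOn (Sfun b r) f (slab α β) := by
  refine ⟨_, ((locallyIntegrable_incrMean (ν := sphereMeasure)
    (w := fun k (ζ : Metric.sphere (0 : E3) 1) => (ζ : E3) k) (m := fun ζ => r • (ζ : E3)) (B := 1)
    (R := |r|) (fun k => ?_) (fun k ζ => ?_) ?_ (Eventually.of_forall fun ζ => ?_) hb).smul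
    (1 / (4 * Real.pi))).smul (1 / r), fun z hz => sfun_eq hz⟩
  · exact Continuous.measurable (by fun_prop)
  · have := PiLp.norm_apply_le (ζ : E3) k
    simpa using this
  · exact Continuous.measurable (by fun_prop)
  · simp [norm_smul]

variable {N A : Fin 3 → Z → ℝ} {p ψ : Z → ℝ}

/-- By Fubini, testing `D_mh(b, ε)` with `ψ` gives the mollified divergence of the cubic flux at
zero time shift. -/
lemma tendsto_integral_dmh (F : Flow (slab α β) (cut (slab α β) b) N A p)
    (hψ : IsTest (slab α β) ψ) (hφ : IsMollifier φ) :
    Tendsto (fun ε => ∫ z, ψ z * Dmh φ b ε z) (𝓝[>] 0) (𝓝 (F.fluxC hψ 0 / 2)) := by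
  refine ((F.contFlux hψ).tendsto_mollifier hφ).congr' ?_
  filter_upwards [eventually_mem_nhdsWithin] with ε hε
  have hε : ε ≠ 0 := (mem_Ioi.1 hε).ne'
  have := isFiniteMeasure_tsupport hφ hε
  obtain ⟨B, hB⟩ := exists_bound_fderiv hφ hε
  obtain ⟨R, hR⟩ := exists_bound_tsupport hφ hε
  have e1 : ∀ z, ψ z * Dmh φ b ε z = -(1 / 2) * (ψ z * incrMean
      (volume.restrict (tsupport (rescale φ ε))) (fun k l => fderiv ℝ (rescale φ ε) l (e k))
      (fun l => l) (cut (slab α β) b) z) := by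
    intro z
    by_cases hz : z ∈ tsupport ψ
    · rw [dmh_eq (hψ.supp hz)]; ring
    · rw [image_eq_zero_of_notMem_tsupport hz]; ring
  simp only [e1, integral_const_mul]
  rw [integral_mul_incrMean F hψ (m := fun l => l)
    (fun k => (continuous_fderiv_rescale hφ ε k).measurable) hB measurable_id' hR, ← integral_finsetSum]
  · congr 1
    refine (setIntegral_eq_integral_of_forall_compl_eq_zero fun l hl => ?_).symm
    have h0 : fderiv ℝ (rescale φ ε) l = 0 := image_eq_zero_of_notMem_tsupport fun h =>
      hl (tsupport_fderiv_subset ℝ h)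
    simp [h0]
  · intro k _
    exact ((continuous_fderiv_rescale hφ ε k).mul
      ((F.contFlux hψ).contF k)).integrable_of_hasCompactSupport
      (((ContFlux.hasCompactSupport_rescale hφ hε).fderiv_apply (𝕜 := ℝ) (e k)).mul_right)

lemma tendsto_integral_sfun (F : Flow (slab α β) (cut (slab α β) b) N A p)
    (hψ : IsTest (slab α β) ψ) :
    Tendsto (fun r => ∫ z, ψ z * Sfun b r z) (𝓝[>] 0) (𝓝 (F.fluxC hψ 0 / 3)) := by
  refine ((F.contFlux hψ).tendsto_sphere).congr fun r => ?_
  have hc : ∀ k, Continuous fun ζ : Metric.sphere (0 : E3) 1 => (ζ : E3) k := fun k => by fun_prop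
  have hs : Continuous fun ζ : Metric.sphere (0 : E3) 1 => r • (ζ : E3) := by fun_prop
  have e1 : ∀ z, ψ z * Sfun b r z = 1 / r * (1 / (4 * Real.pi) * (ψ z * incrMean sphereMeasure
      (fun k ζ => (ζ : E3) k) (fun ζ => r • (ζ : E3)) (cut (slab α β) b) z)) := by
    intro z
    by_cases hz : z ∈ tsupport ψ
    · rw [sfun_eq (hψ.supp hz)]; ring
    · rw [image_eq_zero_of_notMem_tsupport hz]; ring
  simp only [e1, integral_const_mul]
  rw [integral_mul_incrMean F hψ (B := 1) (R := |r|) (fun k => (hc k).measurable) (fun k ζ => ?_)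
    hs.measurable (Eventually.of_forall fun ζ => ?_), ← integral_finsetSum]
  · intro k _
    exact ((hc k).mul (((F.contFlux hψ).contF k).comp hs)).integrable_of_hasCompactSupport
      (HasCompactSupport.of_compactSpace _)
  · simpa using PiLp.norm_apply_le (ζ : E3) k
  · simp [norm_smul]

end Avg

/-! ### Convergence of the gradients of the mollifications -/

/-- Cutting off in time suffices: the spatial integrals vanish at almost every time of `(α, β)`, and
outside the slab `f` is zero. -/
lemma integral_eq_zero_of_slab {α β : ℝ} {f : Z → ℝ} (hf : Integrable f)
    (hs : ∀ z ∉ slab α β, f z = 0)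
    (h : ∀ θ : ℝ → ℝ, ContDiff ℝ (⊤ : ℕ∞) θ → tsupport θ ⊆ Ioo α β → HasCompactSupport θ →
      ∫ z : Z, θ z.1 * f z = 0) : ∫ z, f z = 0 := by
  rw [Measure.volume_eq_prod] at hf ⊢
  have h0 : ∀ᵐ t : ℝ, t ∈ Ioo α β → ∫ x, f (t, x) = 0 := by
    refine isOpen_Ioo.ae_eq_zero_of_integral_contDiff_smul_eq_zero
      (hf.integral_prod_left.locallyIntegrable.locallyIntegrableOn _) fun θ hθ cθ sθ => ?_
    obtain ⟨B, hB⟩ := cθ.exists_bound_of_continuous hθ.continuous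
    have hi : Integrable (fun z : Z => θ z.1 * f z) (volume.prod volume) :=
      hf.bdd_mul (c := B) (hθ.continuous.comp continuous_fst).aestronglyMeasurable
        (Eventually.of_forall fun z => hB z.1)
    have h1 := h θ hθ sθ cθ
    rw [Measure.volume_eq_prod, integral_prod _ hi] at h1
    simpa only [integral_const_mul, smul_eq_mul] using h1
  rw [integral_prod _ hf]
  refine integral_eq_zero_of_ae (h0.mono fun t ht => ?_)
  by_cases hI : t ∈ Ioo α β
  · exact ht hI
  · have : ∀ x, f (t, x) = 0 := fun x => hs _ (by rwa [mem_slab])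
    simp [this]

lemma isTest_mul_fst {α β : ℝ} {ψ : Z → ℝ} (hψ : IsTest univ ψ) {θ : ℝ → ℝ}
    (hθ : ContDiff ℝ (⊤ : ℕ∞) θ) (sθ : tsupport θ ⊆ Ioo α β) :
    IsTest (slab α β) fun z => ψ z * θ z.1 where
  smooth := hψ.smooth.mul (smooth_fst hθ)
  compact := hψ.compact.mul_right
  supp z hz := by
    have h : Function.support (fun z : Z => ψ z * θ z.1) ⊆ Prod.fst ⁻¹' tsupport θ := fun y hy =>
      subset_tsupport _ (right_ne_zero_of_mul hy)
    rw [mem_slab]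
    exact sθ (closure_minimal h ((isClosed_tsupport θ).preimage continuous_fst) hz)

lemma pd_xv_mul_fst {ψ : Z → ℝ} (hψ : Smooth ψ) {θ : ℝ → ℝ} (hθ : ContDiff ℝ (⊤ : ℕ∞) θ)
    (k : Fin 3) (z : Z) : pd (xv k) (fun z : Z => ψ z * θ z.1) z = θ z.1 * pd (xv k) ψ z := by
  rw [pd_mul _ hψ (smooth_fst hθ), pd_xv_fst hθ]; ring

/-! ### Purely spatial equations survive extension by zero in time. -/

namespace Window

variable {L α β M : ℝ} {C : ℝ≥0∞} {b j N A : Fin 3 → Z → ℝ} {π : Z → ℝ}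

/-- The equation contains no time derivative, so the jump of the extended field at the ends of the
slab produces no boundary term. -/
lemma weakDiv_univ (w : Window L α β M C b j N A π) : WeakDiv univ b := by
  intro ψ hψ
  have i1 := fun k => integrable_mul_test (w.li_b k) (hψ.pd (xv k)).smooth.continuous
    (hψ.pd (xv k)).compact
  rw [← integral_finsetSum _ fun k _ => i1 k]
  refine integral_eq_zero_of_slab (α := α) (β := β) (integrable_finsetSum _ fun k _ => i1 k)
    (fun z hz => Finset.sum_eq_zero fun k _ => by
      simp only [w.supp_b k z hz, zero_mul]) fun θ hθ sθ _ => ?_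
  have h := w.div_b _ (isTest_mul_fst hψ hθ sθ)
  have i2 := fun k => integrable_mul_test (w.li_b k)
    ((isTest_mul_fst hψ hθ sθ).pd (xv k)).smooth.continuous
    ((isTest_mul_fst hψ hθ sθ).pd (xv k)).compact
  rw [← integral_finsetSum _ fun k _ => i2 k] at h
  rw [← h]
  refine integral_congr_ae (Eventually.of_forall fun z => ?_)
  simp only [Finset.mul_sum, pd_xv_mul_fst hψ.smooth hθ]
  exact Finset.sum_congr rfl fun k _ => by ring

lemma weakCurl_univ (w : Window L α β M C b j N A π) :
    WeakCurl univ b fun n => (slab α β).indicator (j n) := by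
  intro n ψ hψ
  have lj := (w.li_j n).indicator (measurableSet_slab α β)
  have i1 := fun k m => integrable_mul_test (w.li_b k) (hψ.pd (xv m)).smooth.continuous
    (hψ.pd (xv m)).compact
  have i2 := integrable_mul_test lj hψ.smooth.continuous hψ.compact
  have i5 : Integrable fun z => b (n + 1) z * pd (xv (n + 2)) ψ z
      - b (n + 2) z * pd (xv (n + 1)) ψ z := (i1 _ _).sub (i1 _ _)
  have key : ∫ z, ((slab α β).indicator (j n) z * ψ z - (b (n + 1) z * pd (xv (n + 2)) ψ z
      - b (n + 2) z * pd (xv (n + 1)) ψ z)) = 0 := by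
    refine integral_eq_zero_of_slab (α := α) (β := β) (i2.sub i5) (fun z hz => ?_)
      fun θ hθ sθ _ => ?_
    · simp only [w.supp_b _ z hz, indicator_of_notMem hz]
      ring
    have hT := isTest_mul_fst hψ hθ sθ
    have h := w.curl_b n _ hT
    have i3 := fun k m => integrable_mul_test (w.li_b k) (hT.pd (xv m)).smooth.continuous
      (hT.pd (xv m)).compact
    have i4 := integrable_mul_test (w.li_j n) hT.smooth.continuous hT.compact
    have i6 : Integrable fun z => b (n + 1) z * pd (xv (n + 2)) (fun z => ψ z * θ z.1) z
      - b (n + 2) z * pd (xv (n + 1)) (fun z => ψ z * θ z.1) z := (i3 _ _).sub (i3 _ _)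
    have h' := sub_eq_zero.2 h
    rw [← integral_sub (i3 _ _) (i3 _ _), ← integral_sub i4 i6] at h'
    rw [← h']
    refine integral_congr_ae (Eventually.of_forall fun z => ?_)
    simp only [pd_xv_mul_fst hψ.smooth hθ]
    by_cases hz : z ∈ slab α β
    · rw [indicator_of_mem hz]; ring
    · have : θ z.1 = 0 := image_eq_zero_of_notMem_tsupport fun h => hz (by
        rw [mem_slab]; exact sθ h)
      simp [this]
  rw [integral_sub i2 i5, integral_sub (i1 _ _) (i1 _ _)] at key
  exact sub_eq_zero.1 key

end Window

/-- A solenoidal field is controlled by its curl, locally in space-time. -/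
lemma exists_lintegral_ball_gradient_le {L : ℝ} (hL : 0 < L) (R : ℝ) :
    ∃ c : ℝ≥0∞, c ≠ ∞ ∧ ∃ R', ∀ v J : Fin 3 → Z → ℝ, (∀ l, Smooth (v l)) → (∀ n, Smooth (J n)) →
      (∀ l, SPer L (v l)) → (∀ z, ∑ l, pd (xv l) (v l) z = 0) →
      (∀ n z, J n z = pd (xv (n + 1)) (v (n + 2)) z - pd (xv (n + 2)) (v (n + 1)) z) →
      ∀ i l, ∫⁻ z in Metric.ball 0 R, ‖pd (xv i) (v l) z‖ₑ ^ (3 / 2 : ℝ)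
        ≤ c * ∑ n, ∫⁻ z in Metric.ball 0 R', ‖J n z‖ₑ ^ (3 / 2 : ℝ) := by
  obtain ⟨m, hm⟩ := exists_lintegral_ball_le hL R
  obtain ⟨R', hR'⟩ := ((Metric.isBounded_Ioo (-R) R).prod
    (Metric.isBounded_closedBall.subset (cell_subset_closedBall L))).subset_ball (0 : Z)
  refine ⟨m * 1200, ENNReal.mul_ne_top (by simp) (by simp), R',
    fun v J sv sJ pv hdiv hcurl i l => ?_⟩
  have hs : ∀ t, ∫⁻ x in cell L, ‖pd (xv i) (v l) (t, x)‖ₑ ^ (3 / 2 : ℝ)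
      ≤ 1200 * ∑ n, ∫⁻ x in cell L, ‖J n (t, x)‖ₑ ^ (3 / 2 : ℝ) := by
    intro t
    have h := integral_pw_gradient_le_curl hL (v := fun l x => v l (t, x))
      (dv := fun i l x => pd (xv i) (v l) (t, x)) (J := fun n x => J n (t, x))
      (fun l => continuous_slice (sv l) t) (fun l => (pv l).slice t)
      (fun i l => continuous_slice ((sv l).pd _) t) (fun i l => ((pv l).pd _).slice t)
      (fun i l x => hasDerivAt_slice (sv l) t x i) (fun x => hdiv _) (fun n x => hcurl n _) i l
    rw [lintegral_cell_pw L (continuous_slice ((sv l).pd _) t)]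
    simp only [lintegral_cell_pw L (continuous_slice (sJ _) t)]
    rw [← ENNReal.ofReal_sum_of_nonneg fun n _ => integral_nonneg fun x => pw_nonneg _,
      show (1200 : ℝ≥0∞) = ENNReal.ofReal 1200 by simp, ← ENNReal.ofReal_mul (by norm_num)]
    exact ENNReal.ofReal_le_ofReal h
  have m1 : ∀ {f : Z → ℝ}, Smooth f → Measurable fun z => ‖f z‖ₑ ^ (3 / 2 : ℝ) := fun h =>
    h.continuous.measurable.enorm.pow_const _
  have m2 : ∀ n, Measurable fun t => ∫⁻ x in cell L, ‖J n (t, x)‖ₑ ^ (3 / 2 : ℝ) := fun n =>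
    (m1 (sJ n)).lintegral_prod_right'
  calc ∫⁻ z in Metric.ball 0 R, ‖pd (xv i) (v l) z‖ₑ ^ (3 / 2 : ℝ)
      ≤ ∫⁻ z in Ioo (-R) R ×ˢ Metric.ball 0 R, ‖pd (xv i) (v l) z‖ₑ ^ (3 / 2 : ℝ) :=
        lintegral_mono_set (ball_subset_prod R)
    _ = ∫⁻ t in Ioo (-R) R, ∫⁻ x in Metric.ball 0 R, ‖pd (xv i) (v l) (t, x)‖ₑ ^ (3 / 2 : ℝ) := by
        rw [Measure.volume_eq_prod, setLIntegral_prod _ (m1 ((sv l).pd _)).aemeasurable]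
    _ ≤ ∫⁻ t in Ioo (-R) R, m * (1200 * ∑ n, ∫⁻ x in cell L, ‖J n (t, x)‖ₑ ^ (3 / 2 : ℝ)) := by
        refine lintegral_mono fun t => ?_
        refine (hm _ fun x k => ?_).trans (mul_le_mul_right (hs t) _)
        simp only [((pv l).pd _).slice t x k]
    _ = m * 1200 * ∑ n, ∫⁻ t in Ioo (-R) R, ∫⁻ x in cell L, ‖J n (t, x)‖ₑ ^ (3 / 2 : ℝ) := by
        simp only [← mul_assoc]
        rw [lintegral_const_mul _ (Finset.measurable_fun_sum _ fun n _ => m2 n),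
          lintegral_finsetSum _ fun n _ => m2 n]
    _ = m * 1200 * ∑ n, ∫⁻ z in Ioo (-R) R ×ˢ cell L, ‖J n z‖ₑ ^ (3 / 2 : ℝ) := by
        congr 1
        refine Finset.sum_congr rfl fun n _ => ?_
        rw [Measure.volume_eq_prod, setLIntegral_prod _ (m1 (sJ n)).aemeasurable]
    _ ≤ _ := by
        gcongr

/-- Completeness of `Lᵖ`. -/
lemma exists_tendsto_eLpNorm {X : Type*} [MeasurableSpace X] {μ : Measure X} {p : ℝ≥0∞}
    (hp : 1 ≤ p) {u : ℕ → X → ℝ} (hu : ∀ n, MemLp (u n) p μ)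
    (h : Tendsto (fun q : ℕ × ℕ => eLpNorm (fun x => u q.1 x - u q.2 x) p μ) atTop (𝓝 0)) :
    ∃ g, MemLp g p μ ∧ Tendsto (fun n => eLpNorm (fun x => u n x - g x) p μ) atTop (𝓝 0) := by
  have : Fact (1 ≤ p) := ⟨hp⟩
  have hc : CauchySeq fun n => (hu n).toLp (u n) := by
    rw [cauchySeq_iff_tendsto_dist_atTop_0]
    have e : ∀ q : ℕ × ℕ, dist ((hu q.1).toLp (u q.1)) ((hu q.2).toLp (u q.2))
        = (eLpNorm (fun x => u q.1 x - u q.2 x) p μ).toReal := fun q => by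
      rw [dist_edist, Lp.edist_toLp_toLp]; rfl
    simp only [e]
    exact (ENNReal.tendsto_toReal ENNReal.zero_ne_top).comp h
  obtain ⟨g, hg⟩ := cauchySeq_tendsto_of_complete hc
  refine ⟨g, Lp.memLp g, ?_⟩
  rw [← Lp.toLp_coeFn g (Lp.memLp g)] at hg
  exact (Lp.tendsto_Lp_iff_tendsto_eLpNorm'' _ hu _ (Lp.memLp g)).1 hg

/-! ### The gradient of the magnetic energy density -/

/-- `∇ f = q` in the sense of distributions on `W`. -/
def WeakGrad (W : Set Z) (f : Z → ℝ) (q : Fin 3 → Z → ℝ) : Prop :=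
  ∀ i ψ, IsTest W ψ → ∫ z, f z * pd (xv i) ψ z = -∫ z, q i z * ψ z

lemma lLp_indicator_ball {p : ℝ≥0∞} {R : ℝ} {f : Z → ℝ}
    (hf : MemLp f p (volume.restrict (Metric.ball 0 R))) :
    LLp p ((Metric.ball 0 R).indicator f) := fun _ =>
  ((memLp_indicator_iff_restrict Metric.isOpen_ball.measurableSet).2 hf).restrict _

lemma lTo_indicator_ball {p : ℝ≥0∞} {R : ℝ} {u : ℕ → Z → ℝ} {g : Z → ℝ}
    (hu : ∀ n, MemLp (u n) p (volume.restrict (Metric.ball 0 R)))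
    (hg : MemLp g p (volume.restrict (Metric.ball 0 R)))
    (h : Tendsto (fun n => eLpNorm (fun z => u n z - g z) p
      (volume.restrict (Metric.ball (0 : Z) R))) atTop (𝓝 0)) :
    LTo atTop p (fun n => (Metric.ball 0 R).indicator (u n)) ((Metric.ball 0 R).indicator g) := by
  refine ⟨fun n => lLp_indicator_ball (hu n), lLp_indicator_ball hg, fun R' => ?_⟩
  refine tendsto_of_tendsto_of_tendsto_of_le_of_le tendsto_const_nhds h (fun _ => zero_le)
    fun n => ?_
  have e : (fun z => (Metric.ball 0 R).indicator (u n) z - (Metric.ball 0 R).indicator g z)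
      = (Metric.ball (0 : Z) R).indicator fun z => u n z - g z := (indicator_sub _ _ _).symm
  simp only [e]
  calc _ ≤ eLpNorm ((Metric.ball (0 : Z) R).indicator fun z => u n z - g z) p volume :=
        eLpNorm_mono_measure _ Measure.restrict_le_self
    _ = _ := eLpNorm_indicator_eq_eLpNorm_restrict Metric.isOpen_ball.measurableSet

/-! ### Integrability of the gradient of the energy density. -/

namespace Window

variable {L α β M : ℝ} {C : ℝ≥0∞} {b j N A : Fin 3 → Z → ℝ} {π : Z → ℝ}

/-- Differences of mollified gradients are controlled in `L^{3/2}` by differences of mollified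
currents, which form a Cauchy sequence. The estimate integrates over whole cells at all times, and
therefore needs the equations on all of space-time. -/
lemma exists_lTo_gradient (w : Window L α β M C b j N A π) (R : ℝ) (i l : Fin 3) :
    ∃ g, LTo atTop (3 / 2)
      (fun n => (Metric.ball 0 R).indicator (pd (xv i) (smear (moll n) (b l)))) g := by
  set J : Fin 3 → Z → ℝ := fun n => (slab α β).indicator (j n) with hJ
  have lJ : ∀ n, LocallyIntegrable (J n) := fun n =>
    (w.li_j n).indicator (measurableSet_slab α β)
  have mJ : ∀ n, LLp (3 / 2) (J n) := fun n R => (w.memLp_j n R).indicator (measurableSet_slab α β)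
  have sb : ∀ n l, Smooth (smear (moll n) (b l)) := fun n l => smooth_smear_moll (w.li_b l) n
  have sJ : ∀ n l, Smooth (smear (moll n) (J l)) := fun n l => smooth_smear_moll (lJ l) n
  have hu : ∀ n, MemLp (pd (xv i) (smear (moll n) (b l))) (3 / 2)
      (volume.restrict (Metric.ball 0 R)) := fun n =>
    lLp_of_continuous ((sb n l).pd _).continuous _ R
  suffices h : Tendsto (fun q : ℕ × ℕ => eLpNorm (fun z => pd (xv i) (smear (moll q.1) (b l)) z
      - pd (xv i) (smear (moll q.2) (b l)) z) (3 / 2) (volume.restrict (Metric.ball 0 R)))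
      atTop (𝓝 0) by
    obtain ⟨g, hg, hl⟩ := exists_tendsto_eLpNorm one_le_three_half hu h
    exact ⟨_, lTo_indicator_ball hu hg hl⟩
  obtain ⟨c, hc, R', hR'⟩ := exists_lintegral_ball_gradient_le w.hL R
  have h32 : (3 / 2 : ℝ≥0∞).toReal = 3 / 2 := by rw [ENNReal.toReal_div]; norm_num
  have h0 : (3 / 2 : ℝ≥0∞) ≠ 0 := by simp
  have key : ∀ q : ℕ × ℕ, eLpNorm (fun z => pd (xv i) (smear (moll q.1) (b l)) z
      - pd (xv i) (smear (moll q.2) (b l)) z) (3 / 2) (volume.restrict (Metric.ball 0 R))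
      ≤ (c * ∑ k, eLpNorm (fun z => smear (moll q.1) (J k) z - smear (moll q.2) (J k) z) (3 / 2)
        (volume.restrict (Metric.ball 0 R')) ^ (3 / 2 : ℝ)) ^ (1 / (3 / 2) : ℝ) := by
    intro q
    rw [eLpNorm_eq_lintegral_rpow_enorm_toReal h0 three_half_ne_top, h32]
    refine ENNReal.rpow_le_rpow ?_ (by norm_num)
    have h := hR' (fun l z => smear (moll q.1) (b l) z - smear (moll q.2) (b l) z)
      (fun k z => smear (moll q.1) (J k) z - smear (moll q.2) (J k) z)
      (fun l => (sb _ l).sub (sb _ l)) (fun n => (sJ _ n).sub (sJ _ n))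
      (fun l z k => by simp only [(w.per_b l).smear _ z k])
      (fun z => by
        have h1 := w.weakDiv_univ.smear w.li_b (smooth_moll q.1) (hasCompactSupport_moll q.1)
          (z := z) fun h _ => mem_univ _
        have h2 := w.weakDiv_univ.smear w.li_b (smooth_moll q.2) (hasCompactSupport_moll q.2)
          (z := z) fun h _ => mem_univ _
        simp only [pd_sub _ (sb _ _) (sb _ _), Finset.sum_sub_distrib, h1, h2, sub_zero])
      (fun n z => by
        have h1 := w.weakCurl_univ.smear w.li_b (smooth_moll q.1) (hasCompactSupport_moll q.1)
          (z := z) (fun h _ => mem_univ _) n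
        have h2 := w.weakCurl_univ.smear w.li_b (smooth_moll q.2) (hasCompactSupport_moll q.2)
          (z := z) (fun h _ => mem_univ _) n
        simp only [pd_sub _ (sb _ _) (sb _ _), hJ, h1, h2]
        ring) i l
    simp only [pd_sub _ (sb _ _) (sb _ _)] at h
    refine h.trans (le_of_eq ?_)
    congr 1
    refine Finset.sum_congr rfl fun k _ => ?_
    rw [eLpNorm_eq_lintegral_rpow_enorm_toReal h0 three_half_ne_top, h32, ← ENNReal.rpow_mul]
    norm_num
  have h1 : ∀ k, Tendsto (fun q : ℕ × ℕ => eLpNorm (fun z => smear (moll q.1) (J k) z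
      - smear (moll q.2) (J k) z) (3 / 2) (volume.restrict (Metric.ball 0 R'))) atTop (𝓝 0) := by
    intro k
    have h2 := (LTo.smear one_le_three_half three_half_ne_top (mJ k)).tendsto R'
    have h3 := (h2.comp (tendsto_fst (g := atTop (α := ℕ)))).add (h2.comp tendsto_snd)
    rw [add_zero, prod_atTop_atTop_eq] at h3
    refine tendsto_of_tendsto_of_tendsto_of_le_of_le tendsto_const_nhds h3 (fun _ => zero_le)
      fun q => ?_
    have m1 : ∀ n, AEStronglyMeasurable (fun z => smear (moll n) (J k) z - J k z)
        (volume.restrict (Metric.ball 0 R')) := fun n =>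
      ((sJ n k).continuous.aestronglyMeasurable.restrict).sub (mJ k R').1
    have e : (fun z => smear (moll q.1) (J k) z - smear (moll q.2) (J k) z)
        = (fun z => smear (moll q.1) (J k) z - J k z) - fun z => smear (moll q.2) (J k) z - J k z := by
      funext z; simp
    rw [e]
    exact eLpNorm_sub_le (m1 _) (m1 _) one_le_three_half
  have h2 : Tendsto (fun q : ℕ × ℕ => (c * ∑ k, eLpNorm (fun z => smear (moll q.1) (J k) z
      - smear (moll q.2) (J k) z) (3 / 2)
      (volume.restrict (Metric.ball 0 R')) ^ (3 / 2 : ℝ)) ^ (1 / (3 / 2) : ℝ)) atTop (𝓝 0) := by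
    have h3 := tendsto_finsetSum Finset.univ fun k _ => (h1 k).ennrpow_const (3 / 2 : ℝ)
    have h4 := (ENNReal.Tendsto.const_mul h3 (Or.inr hc)).ennrpow_const (1 / (3 / 2) : ℝ)
    norm_num at h4 ⊢
    exact h4
  exact tendsto_of_tendsto_of_tendsto_of_le_of_le tendsto_const_nhds h2 (fun _ => zero_le) key

/-- The energy density has an integrable gradient. -/
lemma exists_weakGrad_ball (w : Window L α β M C b j N A π) (R : ℝ) :
    ∃ q : Fin 3 → Z → ℝ, (∀ i, LLp 1 (q i)) ∧
      WeakGrad (Metric.ball 0 R) (fun z => 1 / 2 * ∑ m, b m z * b m z) q := by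
  choose g hg using w.exists_lTo_gradient R
  have hb : ∀ l, LTo atTop 3 (fun n => smear (moll n) (b l)) (b l) := fun l =>
    LTo.smear (by norm_num) (by norm_num) (w.memLp_b l)
  have h1 : ∀ i, LTo atTop 1 (fun n z => ∑ l, smear (moll n) (b l) z
      * (Metric.ball 0 R).indicator (pd (xv i) (smear (moll n) (b l))) z)
      fun z => ∑ l, b l z * g i l z := fun i =>
    LTo.sum le_rfl _ fun l => (hb l).mul le_rfl (hg i l)
  have h2 : LTo atTop (3 / 2) (fun n z => 1 / 2 * ∑ m, smear (moll n) (b m) z * smear (moll n) (b m) z)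
      fun z => 1 / 2 * ∑ m, b m z * b m z :=
    (LTo.sum one_le_three_half _ fun l => (hb l).mul one_le_three_half (hb l)).const_mul _
  refine ⟨fun i z => ∑ l, b l z * g i l z, fun i => (h1 i).lim, fun i ψ hψ => ?_⟩
  have sb : ∀ n l, Smooth (smear (moll n) (b l)) := fun n l => smooth_smear_moll (w.li_b l) n
  refine tendsto_nhds_unique ((h2.mono le_rfl one_le_three_half three_half_ne_top).integral
    (hψ.pd (xv i)).smooth.continuous (hψ.pd (xv i)).compact) ?_
  refine (((h1 i).integral hψ.smooth.continuous hψ.compact).neg).congr fun n => ?_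
  set B := fun l => smear (moll n) (b l) with hB
  have sS : Smooth fun z => 1 / 2 * ∑ m, B m z * B m z :=
    contDiff_const.mul (ContDiff.sum fun m _ => (sb n m).mul (sb n m))
  have h3 := (hψ.mul sS).integral_pd (xv i)
  have e : ∀ z, pd (xv i) (fun z => 1 / 2 * ∑ m, B m z * B m z) z
      = ∑ m, B m z * pd (xv i) (B m) z := by
    intro z
    simp only [Fin.sum_univ_three]
    have s2 : ∀ m, Smooth fun z => B m z * B m z := fun m => (sb n m).mul (sb n m)
    rw [pd_mul _ contDiff_const (((s2 0).add (s2 1)).add (s2 2)),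
      pd_add _ ((s2 0).add (s2 1)) (s2 2), pd_add _ (s2 0) (s2 1)]
    simp only [pd_mul _ (sb n _) (sb n _), hB]
    simp [pd]
    ring
  simp only [pd_mul _ hψ.smooth sS, e] at h3
  have c1 : Continuous fun z => pd (xv i) ψ z * (1 / 2 * ∑ m, B m z * B m z) :=
    (hψ.pd _).smooth.continuous.mul sS.continuous
  have c2 : Continuous fun z => ψ z * ∑ m, B m z * pd (xv i) (B m) z :=
    hψ.smooth.continuous.mul (continuous_finsetSum _ fun m _ =>
      (sb n m).continuous.mul ((sb n m).pd _).continuous)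
  rw [integral_add (c1.integrable_of_hasCompactSupport (hψ.pd (xv i)).compact.mul_right)
    (c2.integrable_of_hasCompactSupport hψ.compact.mul_right)] at h3
  rw [neg_eq_iff_add_eq_zero, add_comm, ← h3]
  congr 1
  · exact integral_congr_ae (Eventually.of_forall fun z => mul_comm _ _)
  · refine integral_congr_ae (Eventually.of_forall fun z => ?_)
    simp only
    by_cases hz : z ∈ tsupport ψ
    · simp only [indicator_of_mem (hψ.supp hz), hB]; ring
    · rw [image_eq_zero_of_notMem_tsupport hz]; ring

end Window

/-- The gradient of `f`, as the pointwise limit of the gradients of mollifications. -/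
def limGrad (f : Z → ℝ) (i : Fin 3) (z : Z) : ℝ :=
  limUnder atTop fun n => smear (pd (xv i) (moll n)) f z

lemma eventually_sub_mem_of_isOpen {W : Set Z} (hW : IsOpen W) {z : Z} (hz : z ∈ W) :
    ∀ᶠ n in atTop, ∀ h ∈ tsupport (moll n), z - h ∈ W := by
  obtain ⟨η, h0, hη⟩ := Metric.isOpen_iff.1 hW z hz
  filter_upwards [(tendsto_one_div_add_atTop_nhds_zero_nat (𝕜 := ℝ)).eventually_lt_const h0]
    with n hn h hh
  rw [tsupport_moll, mem_closedBall_zero_iff] at hh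
  refine hη ?_
  rw [Metric.mem_ball, dist_eq_norm]
  simpa using hh.trans_lt hn

/-- The pointwise limit agrees with the weak gradient. -/
lemma limGrad_ae_eq {W : Set Z} (hW : IsOpen W) {f h : Z → ℝ} {q : Fin 3 → Z → ℝ}
    (hf : LocallyIntegrable f) (hq : ∀ i, LocallyIntegrable (q i)) (hfq : WeakGrad W f q)
    (hh : EqOn h f W) (i : Fin 3) : ∀ᵐ z : Z, z ∈ W → limGrad h i z = q i z := by
  filter_upwards [ae_tendsto_smear_moll (hq i)] with z hz hzW
  refine (hz.congr' ?_).limUnder_eq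
  filter_upwards [eventually_sub_mem_of_isOpen hW hzW] with n hn
  have h1 := hfq i _ (isTest_reflect (smooth_moll n) (hasCompactSupport_moll n) hn)
  rw [integral_mul_pd_reflect (smooth_moll n) (hasCompactSupport_moll n) hf,
    integral_mul_reflect, neg_inj] at h1
  rw [← h1, pd_smear (smooth_moll n) (hasCompactSupport_moll n) hf, smear_apply, smear_apply]
  refine integral_congr_ae (Eventually.of_forall fun y => ?_)
  simp only
  by_cases hy : y ∈ tsupport (moll n)
  · rw [hh (hn y hy)]
  · rw [image_eq_zero_of_notMem_tsupport fun h' => hy (tsupport_pd_subset _ _ h'), zero_mul,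
      zero_mul]

/-- The energy density of a field. -/
def energy (b : Fin 3 → Z → ℝ) (z : Z) : ℝ := 1 / 2 * ∑ m, b m z * b m z

namespace Window

variable {L α β M : ℝ} {C : ℝ≥0∞} {b j N A : Fin 3 → Z → ℝ} {π h : Z → ℝ}

lemma li_energy (w : Window L α β M C b j N A π) : LocallyIntegrable (energy b) :=
  (((LLp.sum _ fun m => (w.flow.mem_bb m m)).const_mul (1 / 2)).mono
    one_le_three_half).locallyIntegrable le_rfl

lemma limGrad_ae_eq_ball (w : Window L α β M C b j N A π) (hh : EqOn h (energy b) (slab α β))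
    {R : ℝ} {q : Fin 3 → Z → ℝ} (hq : ∀ i, LLp 1 (q i))
    (hbq : WeakGrad (Metric.ball 0 R) (energy b) q) (i : Fin 3) :
    ∀ᵐ z : Z, z ∈ slab α β ∩ Metric.ball 0 R → limGrad h i z = q i z :=
  limGrad_ae_eq ((isOpen_slab α β).inter Metric.isOpen_ball) w.li_energy
    (fun i => (hq i).locallyIntegrable le_rfl)
    (fun i ψ hψ => hbq i ψ (hψ.mono inter_subset_right)) (hh.mono inter_subset_left) i

/-- A weak gradient is at hand only on each ball and each window; the pointwise limit is one
function defined everywhere that agrees with all of them almost everywhere, which avoids gluing. -/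
lemma li_limGrad (w : Window L α β M C b j N A π) (hh : EqOn h (energy b) (slab α β))
    (i : Fin 3) : LocallyIntegrable ((slab α β).indicator (limGrad h i)) := by
  refine locallyIntegrable_of_memLp_ball le_rfl fun R => ?_
  obtain ⟨q, hq, hbq⟩ := w.exists_weakGrad_ball R
  refine ((hq i R).indicator (measurableSet_slab α β)).ae_eq ?_
  rw [EventuallyEq, ae_restrict_iff' Metric.isOpen_ball.measurableSet]
  filter_upwards [w.limGrad_ae_eq_ball hh hq hbq i] with z hz hzR
  by_cases hzs : z ∈ slab α β
  · rw [indicator_of_mem hzs, indicator_of_mem hzs, hz ⟨hzs, hzR⟩]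
  · rw [indicator_of_notMem hzs, indicator_of_notMem hzs]

lemma weakGrad_limGrad (w : Window L α β M C b j N A π) (hh : EqOn h (energy b) (slab α β)) :
    WeakGrad (slab α β) (energy b) fun i => (slab α β).indicator (limGrad h i) := by
  intro i ψ hψ
  obtain ⟨R, hR⟩ := hψ.compact.isBounded.subset_ball (0 : Z)
  obtain ⟨q, hq, hbq⟩ := w.exists_weakGrad_ball R
  rw [show ∫ z, energy b z * pd (xv i) ψ z = _ from hbq i ψ ⟨hψ.smooth, hψ.compact, hR⟩]
  congr 1
  refine integral_congr_ae ?_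
  filter_upwards [w.limGrad_ae_eq_ball hh hq hbq i] with z hz
  by_cases hzt : z ∈ tsupport ψ
  · rw [indicator_of_mem (hψ.supp hzt), hz ⟨hψ.supp hzt, hR hzt⟩]
  · rw [image_eq_zero_of_notMem_tsupport hzt, mul_zero, mul_zero]

end Window

/-- The flux `∇ (½|b|²) × A` reduces to a flux of energy. -/
lemma Flow.integral_grad_cross {W : Set Z} {b N A q : Fin 3 → Z → ℝ} {p ψ : Z → ℝ}
    (F : Flow W b N A p) (hW : IsOpen W) (hq : ∀ i, LocallyIntegrable (q i))
    (hbq : WeakGrad W (energy b) q) (hψ : IsTest W ψ) :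
    ∑ k, ((∫ z, q (k + 1) z * A (k + 2) z * pd (xv k) ψ z)
      - ∫ z, q (k + 2) z * A (k + 1) z * pd (xv k) ψ z)
      = -∑ k, ∫ z, energy b z * b k z * pd (xv k) ψ z := by
  obtain ⟨M, hM⟩ := F.bddA
  have sA : ∀ n i, Smooth (smear (moll n) (A i)) := fun n i => smooth_smear_moll (F.li_A i) n
  have hE : LLp (3 / 2) (energy b) := (LLp.sum _ fun m => F.mem_bb m m).const_mul _
  have h1 : ∀ i m k, Tendsto (fun n => ∫ z, q i z * smear (moll n) (A m) z * pd (xv k) ψ z) atTop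
      (𝓝 (∫ z, q i z * A m z * pd (xv k) ψ z)) := by
    intro i m k
    have i1 : Integrable fun z => q i z * pd (xv k) ψ z :=
      integrable_mul_test (hq i) (hψ.pd _).smooth.continuous (hψ.pd _).compact
    refine tendsto_integral_of_dominated_convergence (fun z => M * ‖q i z * pd (xv k) ψ z‖)
      (fun n => ?_) (i1.norm.const_mul M) (fun n => Eventually.of_forall fun z => ?_) ?_
    · exact ((hq i).aestronglyMeasurable.mul (sA n m).continuous.aestronglyMeasurable).mul
        (hψ.pd _).smooth.continuous.aestronglyMeasurable
    · rw [show q i z * smear (moll n) (A m) z * pd (xv k) ψ z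
        = smear (moll n) (A m) z * (q i z * pd (xv k) ψ z) by ring, norm_mul]
      exact mul_le_mul_of_nonneg_right (abs_smear_moll_le (hM m) n z) (norm_nonneg _)
    · filter_upwards [ae_tendsto_smear_moll (F.li_A m)] with z hz
      exact (hz.const_mul _).mul_const _
  have h2 : ∀ k, Tendsto (fun n => ∫ z, energy b z * smear (moll n) (b k) z * pd (xv k) ψ z) atTop
      (𝓝 (∫ z, energy b z * b k z * pd (xv k) ψ z)) := fun k =>
    ((LTo.const hE).mul le_rfl (LTo.smear (by norm_num) (by norm_num) (F.memb k))).integral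
      (hψ.pd _).smooth.continuous (hψ.pd _).compact
  refine tendsto_nhds_unique (tendsto_finsetSum _ fun k _ => (h1 _ _ k).sub (h1 _ _ k))
    ((tendsto_finsetSum Finset.univ fun k _ => h2 k).neg.congr' ?_)
  filter_upwards [eventually_sub_mem hW hψ] with n hn
  set V := fun i => smear (moll n) (A i) with hV
  have hB : ∀ k, ∀ z ∈ tsupport ψ, smear (moll n) (b k) z
      = pd (xv (k + 1)) (V (k + 2)) z - pd (xv (k + 2)) (V (k + 1)) z := fun k z hz =>
    F.curl_A.smear F.li_A (smooth_moll n) (hasCompactSupport_moll n) (hn z hz) k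
  have lE := hE.locallyIntegrable one_le_three_half
  have hT : ∀ m k, IsTest W fun z => pd (xv k) ψ z * V m z := fun m k => (hψ.pd _).mul (sA n m)
  have sV : ∀ i, Smooth (V i) := sA n
  -- With `A` mollified, the gradient can be integrated by parts, onto `∂ₖψ` and onto the potential.
  -- The terms on the potential assemble into its curl, the mollified `b`; those with second
  -- derivatives of `ψ` cancel in pairs by symmetry.
  have e1 : ∀ i m k, ∫ z, q i z * V m z * pd (xv k) ψ z
      = -((∫ z, energy b z * (pd (xv i) (pd (xv k) ψ) z * V m z))
        + ∫ z, energy b z * (pd (xv k) ψ z * pd (xv i) (V m) z)) := by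
    intro i m k
    have h3 := hbq i _ (hT m k)
    simp only [pd_mul _ (hψ.pd _).smooth (sV m), mul_add] at h3
    rw [integral_add] at h3
    · rw [h3, neg_neg]
      refine integral_congr_ae (Eventually.of_forall fun z => ?_)
      simp only; ring
    · exact integrable_mul_test lE (((hψ.pd (xv k)).pd (xv i)).mul (sA n m)).smooth.continuous
        (((hψ.pd (xv k)).pd (xv i)).mul (sA n m)).compact
    · exact integrable_mul_test lE ((hψ.pd (xv k)).mul ((sA n m).pd (xv i))).smooth.continuous
        ((hψ.pd (xv k)).mul ((sA n m).pd (xv i))).compact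
  have e2 : ∀ k, ∫ z, energy b z * smear (moll n) (b k) z * pd (xv k) ψ z
      = (∫ z, energy b z * (pd (xv k) ψ z * pd (xv (k + 1)) (V (k + 2)) z))
        - ∫ z, energy b z * (pd (xv k) ψ z * pd (xv (k + 2)) (V (k + 1)) z) := by
    intro k
    rw [← integral_sub]
    · refine integral_congr_ae (Eventually.of_forall fun z => ?_)
      beta_reduce
      by_cases hz : z ∈ tsupport (pd (xv k) ψ)
      · rw [hB k z (tsupport_pd_subset _ _ hz)]; ring
      · rw [image_eq_zero_of_notMem_tsupport hz]; ring
    · exact integrable_mul_test lE ((hψ.pd (xv k)).mul ((sA n _).pd _)).smooth.continuous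
        ((hψ.pd (xv k)).mul ((sA n _).pd _)).compact
    · exact integrable_mul_test lE ((hψ.pd (xv k)).mul ((sA n _).pd _)).smooth.continuous
        ((hψ.pd (xv k)).mul ((sA n _).pd _)).compact
  have e3 : ∀ i k m, ∫ z, energy b z * (pd (xv i) (pd (xv k) ψ) z * V m z)
      = ∫ z, energy b z * (pd (xv k) (pd (xv i) ψ) z * V m z) := fun i k m => by
    simp only [pd_comm hψ.smooth (xv i) (xv k)]
  simp only [e2]
  rw [show (∑ k, ((∫ z, q (k + 1) z * smear (moll n) (A (k + 2)) z * pd (xv k) ψ z)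
      - ∫ z, q (k + 2) z * smear (moll n) (A (k + 1)) z * pd (xv k) ψ z)) = _ from
    Finset.sum_congr rfl fun k _ => congrArg₂ _ (e1 _ _ k) (e1 _ _ k)]
  have f1 : (1 : Fin 3) + 1 = 2 := rfl
  have f2 : (1 : Fin 3) + 2 = 0 := rfl
  have f3 : (2 : Fin 3) + 1 = 0 := rfl
  have f4 : (2 : Fin 3) + 2 = 1 := rfl
  simp only [Fin.sum_univ_three, zero_add, f1, f2, f3, f4]
  linear_combination e3 1 0 2 - e3 2 0 1 + e3 2 1 0

namespace Window

variable {L α β M : ℝ} {C : ℝ≥0∞} {b j N A : Fin 3 → Z → ℝ} {π h ψ : Z → ℝ}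

lemma pressure_mul_b_eq (w : Window L α β M C b j N A π) (k : Fin 3) (z : Z) :
    π z * b k z = redPressure L α β π z * b k z + cellMean L π z.1 * b k z := by
  by_cases hz : z ∈ slab α β
  · rw [redPressure, indicator_of_mem hz]; ring
  · rw [w.supp_b k z hz]; ring

lemma li_redPressure_mul_b (w : Window L α β M C b j N A π) (k : Fin 3) :
    LocallyIntegrable fun z => redPressure L α β π z * b k z :=
  LLp.locallyIntegrable (p := 1) (LLp.mul w.flow.memp (w.flow.memb k)) le_rfl

lemma li_pressure_mul_b (w : Window L α β M C b j N A π) (k : Fin 3) :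
    LocallyIntegrable fun z => π z * b k z := by
  simp only [w.pressure_mul_b_eq k]
  exact (w.li_redPressure_mul_b k).add (w.li_mean_mul_b k)

lemma lLp_energy (w : Window L α β M C b j N A π) : LLp (3 / 2) (energy b) :=
  (LLp.sum _ fun m => w.flow.mem_bb m m).const_mul _

lemma li_energy_mul_b (w : Window L α β M C b j N A π) (k : Fin 3) :
    LocallyIntegrable fun z => energy b z * b k z :=
  LLp.locallyIntegrable (p := 1) (LLp.mul w.lLp_energy (w.flow.memb k)) le_rfl

lemma li_mul_A (w : Window L α β M C b j N A π) {f : Z → ℝ} (hf : LocallyIntegrable f)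
    (i : Fin 3) : LocallyIntegrable fun z => f z * A i z :=
  LLp.locallyIntegrable (p := 1)
    ((lLp_one hf).mul (lLp_top_of_bound (w.flow.measA i) (w.bound_A i))) le_rfl

/-- The value of the flux at the origin in terms of the terms of the helicity balance. -/
lemma flux_eq (w : Window L α β M C b j N A π) (hh : EqOn h (energy b) (slab α β))
    (hψ : IsTest (slab α β) ψ) {G : Fin 3 → Z → ℝ}
    (hG : ∀ i, G i = fun z => N i z + (slab α β).indicator (limGrad h i) z) :
    w.flow.fluxC hψ 0 = -2 * ((∫ z, (∑ i, b i z * A i z) * pd tv ψ z)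
      + (∑ k, ∫ z, (G (k + 1) z * A (k + 2) z - G (k + 2) z * A (k + 1) z) * pd (xv k) ψ z)
      + (∑ k, ∫ z, ((π z - energy b z) * b k z) * pd (xv k) ψ z)
      + ∑ k, ∫ z, (2 * energy b z * b k z) * pd (xv k) ψ z) := by
  set q : Fin 3 → Z → ℝ := fun i => (slab α β).indicator (limGrad h i) with hq
  have lq : ∀ i, LocallyIntegrable (q i) := w.li_limGrad hh
  have it : ∀ {f : Z → ℝ} (v : Z), LocallyIntegrable f → Integrable fun z => f z * pd v ψ z :=
    fun v hf => integrable_mul_test hf (hψ.pd v).smooth.continuous (hψ.pd v).compact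
  have e0 : ∀ (v : Z) (u g : Z → ℝ), br (pd v ψ) u g = ∫ z, u z * g z * pd v ψ z :=
    fun v u g => integral_congr_ae (Eventually.of_forall fun z => by simp only; ring)
  have e1 : ∫ z, (∑ i, b i z * A i z) * pd tv ψ z = ∑ i, ∫ z, b i z * A i z * pd tv ψ z := by
    rw [← integral_finsetSum _ fun i _ => it _ (w.li_mul_A (w.li_b i) i)]
    simp only [Finset.sum_mul]
  have e2 : ∀ k, ∫ z, (G (k + 1) z * A (k + 2) z - G (k + 2) z * A (k + 1) z) * pd (xv k) ψ z
      = ((∫ z, N (k + 1) z * A (k + 2) z * pd (xv k) ψ z)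
        - ∫ z, N (k + 2) z * A (k + 1) z * pd (xv k) ψ z)
      + ((∫ z, q (k + 1) z * A (k + 2) z * pd (xv k) ψ z)
        - ∫ z, q (k + 2) z * A (k + 1) z * pd (xv k) ψ z) := by
    intro k
    have i1 := fun i m => it (xv k) (w.li_mul_A (w.li_N i) m)
    have i2 := fun i m => it (xv k) (w.li_mul_A (lq i) m)
    have i3 : Integrable fun z => N (k + 1) z * A (k + 2) z * pd (xv k) ψ z
      - N (k + 2) z * A (k + 1) z * pd (xv k) ψ z := (i1 _ _).sub (i1 _ _)
    have i4 : Integrable fun z => q (k + 1) z * A (k + 2) z * pd (xv k) ψ z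
      - q (k + 2) z * A (k + 1) z * pd (xv k) ψ z := (i2 _ _).sub (i2 _ _)
    rw [← integral_sub (i1 _ _) (i1 _ _), ← integral_sub (i2 _ _) (i2 _ _), ← integral_add i3 i4]
    refine integral_congr_ae (Eventually.of_forall fun z => ?_)
    simp only [hG, hq]; ring
  have e3 : ∀ k, ∫ z, ((π z - energy b z) * b k z) * pd (xv k) ψ z
      = (∫ z, redPressure L α β π z * b k z * pd (xv k) ψ z)
        + (∫ z, cellMean L π z.1 * b k z * pd (xv k) ψ z)
        - ∫ z, energy b z * b k z * pd (xv k) ψ z := by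
    intro k
    have i1 := it (xv k) (w.li_redPressure_mul_b k)
    have i2 := it (xv k) (w.li_mean_mul_b k)
    have i3 := it (xv k) (w.li_energy_mul_b k)
    have i4 : Integrable fun z => redPressure L α β π z * b k z * pd (xv k) ψ z
      + cellMean L π z.1 * b k z * pd (xv k) ψ z := i1.add i2
    rw [← integral_add i1 i2, ← integral_sub i4 i3]
    refine integral_congr_ae (Eventually.of_forall fun z => ?_)
    simp only [sub_mul, w.pressure_mul_b_eq k]; ring
  have e4 : ∀ k, ∫ z, (2 * energy b z * b k z) * pd (xv k) ψ z
      = 2 * ∫ z, energy b z * b k z * pd (xv k) ψ z := by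
    intro k
    rw [← integral_const_mul]
    exact integral_congr_ae (Eventually.of_forall fun z => by simp only; ring)
  have e5 : ∀ k, ∫ z, b k z * redPressure L α β π z * pd (xv k) ψ z
      = ∫ z, redPressure L α β π z * b k z * pd (xv k) ψ z := fun k =>
    integral_congr_ae (Eventually.of_forall fun z => by simp only; ring)
  -- The flux `∇E × A` contributes `-E b`, the pressure term another `-E b`, and `|b|² b = 2E b`
  -- compensates both. What remains is `∂ₜ(b·A) + div(N × A) + div(π b)`, where `π` may be replaced
  -- by its reduced form through `e7`.
  have e6 := w.flow.integral_grad_cross (isOpen_slab α β) lq (w.weakGrad_limGrad hh) hψ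
  have e7 := w.integral_mean_mul hψ
  rw [Flow.fluxC_zero, e1]
  simp only [e0, e2, e3, e4, e5, Finset.sum_add_distrib, Finset.sum_sub_distrib,
    ← Finset.mul_sum] at e6 ⊢
  linear_combination 2 * e6 + 2 * e7

/-- `div (b ⊗ b) = N + ∇ (½ |b|²)`. -/
lemma weakDiv_tensor (w : Window L α β M C b j N A π) (hh : EqOn h (energy b) (slab α β))
    (hψ : IsTest (slab α β) ψ) (i : Fin 3) :
    -∑ k, ∫ z, b k z * b i z * pd (xv k) ψ z
      = ∫ z, (N i z + (slab α β).indicator (limGrad h i) z) * ψ z := by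
  have h1 := w.weakLamb i ψ hψ
  have h2 := w.weakGrad_limGrad hh i ψ hψ
  have i1 := integrable_mul_test (w.li_N i) hψ.smooth.continuous hψ.compact
  have i2 := integrable_mul_test (w.li_limGrad hh i) hψ.smooth.continuous hψ.compact
  have e1 : ∫ z, energy b z * pd (xv i) ψ z = 1 / 2 * ∫ z, (∑ m, b m z * b m z) * pd (xv i) ψ z := by
    rw [← integral_const_mul]
    exact integral_congr_ae (Eventually.of_forall fun z => by simp only [energy]; ring)
  simp only [add_mul]
  rw [integral_add i1 i2]
  linarith

end Window

/-! ### Distributions given by functions -/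

section Dist

variable {T : ℝ} {f ψ : Z → ℝ}

lemma isTest_coe (ψ : 𝓓(spaceTime T, ℝ)) : IsTest (slab 0 T) ψ :=
  ⟨ψ.contDiff, ψ.hasCompactSupport, ψ.tsupport_subset⟩

/-- A test function on the slab as an element of `𝓓`. -/
def toTest (hψ : IsTest (slab 0 T) ψ) : 𝓓(spaceTime T, ℝ) :=
  ⟨ψ, hψ.smooth, hψ.compact, hψ.supp⟩

lemma coe_toTest (hψ : IsTest (slab 0 T) ψ) : (toTest hψ : Z → ℝ) = ψ := rfl

lemma toDist_apply (hf : LocInt T f) (ψ : 𝓓(spaceTime T, ℝ)) :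
    toDist T f ψ = ∫ z, f z * ψ z := by
  refine (TestFunction.integralAgainstBilinCLM_eq_integral hf).trans ?_
  simp only [ContinuousLinearMap.mul_apply', mul_comm]

lemma lineDerivOp_coe (ψ : 𝓓(spaceTime T, ℝ)) (v z : Z) :
    (-∂_{v} ψ : 𝓓(spaceTime T, ℝ)) z = -pd v ψ z := by
  have h : (∂_{v} ψ : 𝓓(spaceTime T, ℝ)) z = pd v ψ z := by
    rw [TestFunction.lineDerivOp_eq_lineDerivCLM (𝕜 := ℝ),
      TestFunction.lineDerivCLM_apply_of_le (by simp), pd,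
      ((isTest_coe ψ).smooth.differentiable' z).lineDeriv_eq_fderiv]
  rw [← h]; rfl

lemma lineDerivOp_toDist_apply (hf : LocInt T f) (v : Z) (ψ : 𝓓(spaceTime T, ℝ)) :
    (∂_{v} (toDist T f) : SpaceTimeDist T) ψ = -∫ z, f z * pd v ψ z := by
  rw [Distribution.lineDerivOp_apply_apply, toDist_apply hf]
  simp only [lineDerivOp_coe, mul_neg, integral_neg]

lemma dt_toDist_apply (hf : LocInt T f) (ψ : 𝓓(spaceTime T, ℝ)) :
    dt (toDist T f) ψ = -∫ z, f z * pd tv ψ z := lineDerivOp_toDist_apply hf tv ψ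

lemma dx_toDist_apply (hf : LocInt T f) (i : Fin 3) (ψ : 𝓓(spaceTime T, ℝ)) :
    dx i (toDist T f) ψ = -∫ z, f z * pd (xv i) ψ z := lineDerivOp_toDist_apply hf (xv i) ψ

lemma LocInt.apply {u : Z → E3} (hu : LocInt T u) (i : Fin 3) : LocInt T fun z => u z i :=
  fun z hz => by
    obtain ⟨s, hs, h⟩ := hu z hz
    exact ⟨s, hs, (EuclideanSpace.proj (𝕜 := ℝ) i : E3 →L[ℝ] ℝ).integrable_comp h⟩

lemma div_apply (F : Fin 3 → SpaceTimeDist T) (ψ : 𝓓(spaceTime T, ℝ)) :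
    div F ψ = ∑ i, dx i (F i) ψ := by
  simp [div, Fin.sum_univ_three]

lemma curl_apply (F : Fin 3 → SpaceTimeDist T) (n : Fin 3) (ψ : 𝓓(spaceTime T, ℝ)) :
    curl F n ψ = dx (n + 1) (F (n + 2)) ψ - dx (n + 2) (F (n + 1)) ψ := by
  fin_cases n <;> rfl

lemma div_toDistV_apply {u : Z → E3} (hu : LocInt T u) (ψ : 𝓓(spaceTime T, ℝ)) :
    div (toDistV T u) ψ = -∑ i, ∫ z, u z i * pd (xv i) ψ z := by
  rw [div_apply, ← Finset.sum_neg_distrib]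
  exact Finset.sum_congr rfl fun i _ => dx_toDist_apply (LocInt.apply hu i) i ψ

lemma curl_toDistV_apply {u : Z → E3} (hu : LocInt T u) (n : Fin 3) (ψ : 𝓓(spaceTime T, ℝ)) :
    curl (toDistV T u) n ψ = (∫ z, u z (n + 1) * pd (xv (n + 2)) ψ z)
      - ∫ z, u z (n + 2) * pd (xv (n + 1)) ψ z := by
  rw [curl_apply, toDistV, toDistV, dx_toDist_apply (LocInt.apply hu _),
    dx_toDist_apply (LocInt.apply hu _)]
  ring

end Dist

/-! ### Restriction to a window in time -/

lemma cross_apply (u v : E3) (n : Fin 3) :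
    cross u v n = u (n + 1) * v (n + 2) - u (n + 2) * v (n + 1) := by
  fin_cases n <;> simp [cross, crossProduct]

lemma integral_indicator_mul {W : Set Z} {χ : Z → ℝ} (hχ : IsTest W χ) (f : Z → ℝ) :
    ∫ z, W.indicator f z * χ z = ∫ z, f z * χ z := by
  refine integral_congr_ae (Eventually.of_forall fun z => ?_)
  simp only
  by_cases hz : z ∈ W
  · rw [indicator_of_mem hz]
  · rw [image_eq_zero_of_notMem_tsupport fun h => hz (hχ.supp h), mul_zero, mul_zero]

section Restrict

variable {T L α β : ℝ} {b j A u v : Z → E3} {π f : Z → ℝ}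

lemma weakDiv_cut (hα : 0 < α) (hβ : β < T) (hu : LocInt T u) (h : div (toDistV T u) = 0) :
    WeakDiv (slab α β) (cut (slab α β) u) := by
  intro ψ hψ
  have hs : slab α β ⊆ slab 0 T := prod_mono (Ioo_subset_Ioo hα.le hβ.le) le_rfl
  have h1 := div_toDistV_apply hu (toTest (hψ.mono hs))
  rw [h, coe_toTest] at h1
  simp only [cut, integral_indicator_mul (hψ.pd _)]
  simpa using h1.symm

lemma weakCurl_cut (hα : 0 < α) (hβ : β < T) (hu : LocInt T u) (hv : LocInt T v)
    (h : curl (toDistV T u) = toDistV T v) :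
    WeakCurl (slab α β) (cut (slab α β) u) (cut (slab α β) v) := by
  intro n ψ hψ
  have hs : slab α β ⊆ slab 0 T := prod_mono (Ioo_subset_Ioo hα.le hβ.le) le_rfl
  have h1 := curl_toDistV_apply hu n (toTest (hψ.mono hs))
  rw [h, toDistV, toDist_apply (LocInt.apply hv n), coe_toTest] at h1
  simpa only [cut, integral_indicator_mul (hψ.pd _), integral_indicator_mul hψ] using h1

lemma weakInduction_cut (hα : 0 < α) (hβ : β < T) (hu : LocInt T u) (hv : LocInt T v)
    (h : ∀ i, dt (toDistV T u i) + curl (toDistV T v) i = 0) :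
    WeakInduction (slab α β) (cut (slab α β) u) (cut (slab α β) v) := by
  intro n ψ hψ
  have hs : slab α β ⊆ slab 0 T := prod_mono (Ioo_subset_Ioo hα.le hβ.le) le_rfl
  have h1 := DFunLike.congr_fun (h n) (toTest (hψ.mono hs))
  rw [add_apply, curl_toDistV_apply hv, toDistV, dt_toDist_apply (LocInt.apply hu n), coe_toTest] at h1
  simp only [cut, integral_indicator_mul (hψ.pd _)]
  simp only [zero_apply] at h1
  linarith

lemma weakPotential_cut (hα : 0 < α) (hβ : β < T) (hu : LocInt T u) (hv : LocInt T v)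
    (hf : LocInt T f) (h : ∀ i, dt (toDistV T u i) + toDistV T v i + dx i (toDist T f) = 0) :
    WeakPotential (slab α β) (cut (slab α β) u) (cut (slab α β) v) ((slab α β).indicator f) := by
  intro n ψ hψ
  have hs : slab α β ⊆ slab 0 T := prod_mono (Ioo_subset_Ioo hα.le hβ.le) le_rfl
  have h1 := DFunLike.congr_fun (h n) (toTest (hψ.mono hs))
  rw [add_apply, add_apply, toDistV, toDistV, dt_toDist_apply (LocInt.apply hu n),
    toDist_apply (LocInt.apply hv n), dx_toDist_apply hf, coe_toTest] at h1
  simp only [cut, integral_indicator_mul (hψ.pd _), integral_indicator_mul hψ]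
  simp only [zero_apply] at h1
  linarith

/-- Since `[α, β]` lies inside the open interval `(0, T)`, local integrability there gives
integrability up to the ends of the slab, and extension by zero stays locally integrable. -/
lemma locallyIntegrable_indicator_slab (hα : 0 < α) (hβ : β < T) (hf : LocInt T f) :
    LocallyIntegrable ((slab α β).indicator f) := by
  intro z
  refine ⟨Metric.closedBall z 1, Metric.closedBall_mem_nhds z one_pos, ?_⟩
  have h1 : IsCompact (Metric.closedBall z 1 ∩ Icc α β ×ˢ (univ : Set E3)) :=
    (isCompact_closedBall z 1).inter_right (isClosed_Icc.prod isClosed_univ)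
  have h2 : IntegrableOn f (Metric.closedBall z 1 ∩ Icc α β ×ˢ (univ : Set E3)) :=
    LocallyIntegrableOn.integrableOn_compact_subset hf (fun y hy =>
      ⟨⟨hα.trans_le hy.2.1.1, hy.2.1.2.trans_lt hβ⟩, mem_univ _⟩) h1
  rw [IntegrableOn, integrable_indicator_iff (measurableSet_slab α β), IntegrableOn,
    Measure.restrict_restrict (measurableSet_slab α β)]
  exact h2.mono_set fun y hy => ⟨hy.2, Ioo_subset_Icc_self hy.1.1, mem_univ _⟩

lemma sPer_indicator (hα : 0 < α) (hβ : β < T) (hf : SpacePeriodic T L f) :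
    SPer L ((slab α β).indicator f) := by
  intro z k
  have h1 : (z + L • xv k).1 = z.1 := by simp [xv]
  by_cases hz : z ∈ slab α β
  · have hz' : z + L • xv k ∈ slab α β := by rwa [mem_slab, h1, ← mem_slab]
    rw [indicator_of_mem hz, indicator_of_mem hz']
    have h2 := mem_slab.1 hz
    have h3 := hf z.1 ⟨hα.trans h2.1, h2.2.trans hβ⟩ z.2 k
    rw [← h3]
    congr 1
    ext <;> simp [xv]
  · have hz' : z + L • xv k ∉ slab α β := by rwa [mem_slab, h1, ← mem_slab]
    rw [indicator_of_notMem hz, indicator_of_notMem hz']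

lemma sPer_cut (hα : 0 < α) (hβ : β < T) (hu : SpacePeriodic T L u) (i : Fin 3) :
    SPer L (cut (slab α β) u i) :=
  sPer_indicator hα hβ fun t ht x k => by rw [hu t ht x k]

lemma li_cut (hα : 0 < α) (hβ : β < T) (hu : LocInt T u) (i : Fin 3) :
    LocallyIntegrable (cut (slab α β) u i) :=
  locallyIntegrable_indicator_slab hα hβ (LocInt.apply hu i)

/-- Continuity bounds `A` on the compact set formed by `[α, β]` and a ball containing the cell;
periodicity extends the bound to all of space. No bound up to the times `0` and `T` is available,
which is why windows are used. -/
lemma exists_bound_cut (hL : 0 < L) (hα : 0 < α) (hβ : β < T) (hp : SpacePeriodic T L A)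
    (hA : ContinuousOn A (spaceTime T : Set Z)) :
    ∃ M, ∀ i z, |cut (slab α β) A i z| ≤ M := by
  have hc : IsCompact (Icc α β ×ˢ Metric.closedBall (0 : E3) (3 * |L|)) :=
    isCompact_Icc.prod (isCompact_closedBall _ _)
  obtain ⟨M, hM⟩ := hc.exists_bound_of_continuousOn (hA.mono fun z hz =>
    ⟨⟨hα.trans_le hz.1.1, hz.1.2.trans_lt hβ⟩, mem_univ _⟩)
  refine ⟨max M 0, fun i z => ?_⟩
  by_cases hz : z ∈ slab α β
  · have h1 := (sPer_cut hα hβ hp i).slice z.1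
    set y := ZSpan.fract (latticeBasis hL) z.2 with hy
    have hy' : y ∈ cell L := by
      rw [cell_eq_fundamentalDomain hL]; exact ZSpan.fract_mem_fundamentalDomain _ _
    have h2 : cut (slab α β) A i z = cut (slab α β) A i (z.1, y) := by
      have h3 := h1.vadd hL (ZSpan.floor (latticeBasis hL) z.2) y
      rw [hy, ZSpan.fract_apply, Submodule.vadd_def, vadd_eq_add, add_sub_cancel] at h3
      exact h3
    have hz' : (z.1, y) ∈ slab α β := by rw [mem_slab] at hz ⊢; exact hz
    rw [h2, cut, indicator_of_mem hz']
    have h4 := mem_slab.1 hz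
    have h5 := hM (z.1, y) ⟨Ioo_subset_Icc_self h4, cell_subset_closedBall L hy'⟩
    exact ((PiLp.norm_apply_le (A (z.1, y)) i).trans h5).trans (le_max_left _ _)
  · rw [cut, indicator_of_notMem hz, abs_zero]; exact le_max_right _ _

lemma exists_bound_slice (hu : MemLinftyLp T L (3 / 2) u) (hα : 0 < α) (hβ : β < T) :
    ∃ C : ℝ≥0∞, C ≠ ∞ ∧ ∀ i, ∀ᵐ t : ℝ,
      ∫⁻ x in cell L, ‖cut (slab α β) u i (t, x)‖ₑ ^ (3 / 2 : ℝ) ≤ C := by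
  obtain ⟨-, C, hC⟩ := hu
  refine ⟨(C : ℝ≥0∞) ^ (3 / 2 : ℝ), ENNReal.rpow_ne_top_of_nonneg (by norm_num) (by simp), fun i => ?_⟩
  rw [ae_restrict_iff' measurableSet_Ioo] at hC
  filter_upwards [hC] with t ht
  by_cases hI : t ∈ Ioo α β
  · have h1 := ht ⟨hα.trans hI.1, hI.2.trans hβ⟩
    have h32 : (3 / 2 : ℝ≥0∞).toReal = 3 / 2 := by rw [ENNReal.toReal_div]; norm_num
    rw [eLpNorm_eq_lintegral_rpow_enorm_toReal (by simp) three_half_ne_top, h32] at h1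
    have h2 := ENNReal.rpow_le_rpow h1 (show (0 : ℝ) ≤ 3 / 2 by norm_num)
    rw [← ENNReal.rpow_mul, show (1 / (3 / 2) * (3 / 2) : ℝ) = 1 by norm_num,
      ENNReal.rpow_one] at h2
    refine le_trans (lintegral_mono fun x => ?_) h2
    refine ENNReal.rpow_le_rpow ?_ (by norm_num)
    rw [cut, indicator_of_mem (by rwa [mem_slab])]
    rw [enorm_le_iff_norm_le]
    exact PiLp.norm_apply_le (u (t, x)) i
  · have : ∀ x, cut (slab α β) u i (t, x) = 0 := fun x => indicator_of_notMem (by rwa [mem_slab]) _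
    simp [this]

/-- The fields of a weak solution, restricted to a smaller interval of time. -/
lemma exists_window (hL : 0 < L) (hα : 0 < α) (hβ : β < T) (hb : IsWeakSolution T L b j)
    (hA : IsVectorPotential T L b j A π) (hj : MemLinftyLp T L (3 / 2) j)
    (hAc : ContinuousOn A (spaceTime T : Set Z)) :
    ∃ M C, Window L α β M C (cut (slab α β) b) (cut (slab α β) j)
      (cut (slab α β) fun z => cross (j z) (b z)) (cut (slab α β) A) ((slab α β).indicator π) := by
  obtain ⟨M, hM⟩ := exists_bound_cut hL hα hβ hA.periodic_A hAc
  obtain ⟨C, hC, hjC⟩ := exists_bound_slice hj hα hβ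
  refine ⟨M, C, ?_⟩
  exact
  { hL := hL
    C_ne := hC
    li_b := li_cut hα hβ hb.locInt_b
    li_j := li_cut hα hβ hb.locInt_j
    li_N := li_cut hα hβ hb.locInt_hall
    li_A := li_cut hα hβ hA.locInt_A
    li_π := locallyIntegrable_indicator_slab hα hβ hA.locInt_π
    per_b := sPer_cut hα hβ hb.periodic_b
    per_j := sPer_cut hα hβ hb.periodic_j
    per_A := sPer_cut hα hβ hA.periodic_A
    per_π := sPer_indicator hα hβ hA.periodic_π
    supp_b := fun i z hz => indicator_of_notMem hz _
    hN := fun n z => by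
      by_cases hz : z ∈ slab α β
      · simp only [cut, indicator_of_mem hz, cross_apply]
      · simp only [cut, indicator_of_notMem hz]; ring
    bound_A := hM
    bound_j := hjC
    div_b := weakDiv_cut hα hβ hb.locInt_b hb.div_free
    div_A := weakDiv_cut hα hβ hA.locInt_A hA.div_free
    curl_b := weakCurl_cut hα hβ hb.locInt_b hb.locInt_j hb.current
    curl_A := weakCurl_cut hα hβ hA.locInt_A hb.locInt_b hA.curl_eq
    induction := weakInduction_cut hα hβ hb.locInt_b hb.locInt_hall hb.equation
    potential := weakPotential_cut hα hβ hA.locInt_A hb.locInt_hall hA.locInt_π hA.equation }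

end Restrict

/-! ### The helicity balance -/

section Balance

variable {T L α β : ℝ} {b j A u : Z → E3} {π f g ψ : Z → ℝ}

/-- Every point of `(0, T) × ℝ³` has a neighbourhood inside a smaller slab, so estimates on windows
suffice. -/
lemma locInt_of_slab (h : ∀ α β, 0 < α → β < T → ∃ g, LocallyIntegrable g ∧ EqOn f g (slab α β)) :
    LocInt T f := by
  intro z hz
  have hz1 : z.1 ∈ Ioo 0 T := mem_slab.1 (show z ∈ slab 0 T from hz)
  obtain ⟨g, hg, hfg⟩ := h (z.1 / 2) ((z.1 + T) / 2) (by linarith [hz1.1]) (by linarith [hz1.2])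
  obtain ⟨s, hs, hi⟩ := hg z
  have hm : slab (z.1 / 2) ((z.1 + T) / 2) ∈ 𝓝 z := (isOpen_slab _ _).mem_nhds (by
    rw [mem_slab]; constructor <;> linarith [hz1.1, hz1.2])
  obtain ⟨O, hO, oO, zO⟩ := mem_nhds_iff.1 (inter_mem hs hm)
  refine ⟨O, mem_nhdsWithin_of_mem_nhds (oO.mem_nhds zO), ?_⟩
  exact (hi.mono_set (hO.trans inter_subset_left)).congr_fun
    (fun y hy => (hfg (hO hy).2).symm) oO.measurableSet

lemma locInt_of_apply (h : ∀ i, LocInt T fun z => u z i) : LocInt T u := by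
  have e : u = fun z => u z 0 • e 0 + u z 1 • e 1 + u z 2 • e 2 := by
    funext z
    ext i
    fin_cases i <;> simp [EMHD.e]
  have h1 : ∀ i, LocInt T fun z => u z i • EMHD.e i := fun i z hz => by
    obtain ⟨s, hs, hi⟩ := h i z hz
    exact ⟨s, hs, hi.smul_const _⟩
  rw [e]
  exact ((h1 0).add (h1 1)).add (h1 2)

/-- The support is at positive distance from the ends of the time interval, so each identity of
distributions can be checked inside one window. -/
lemma exists_slab_isTest (hψ : IsTest (slab 0 T) ψ) :
    ∃ α β, 0 < α ∧ β < T ∧ IsTest (slab α β) ψ := by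
  obtain ⟨η, hη, hm⟩ := exists_margin (isOpen_slab 0 T) hψ
  refine ⟨η / 2, T - η / 2, by linarith, by linarith, hψ.smooth, hψ.compact, fun z hz => ?_⟩
  have h1 : ∀ s : ℝ, |s| < η → z.1 - s ∈ Ioo 0 T := fun s hs => by
    have := hm z hz (s, 0) (by rw [Prod.norm_def]; simpa [abs_lt] using abs_lt.1 hs)
    rw [mem_slab] at this
    exact this
  have h2 := h1 (η / 2) (by rw [abs_of_pos (by linarith)]; linarith)
  have h3 := h1 (-(η / 2)) (by rw [abs_neg, abs_of_pos (by linarith)]; linarith)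
  rw [mem_slab]
  constructor <;> linarith [h2.1, h3.2]

lemma integral_mul_congr {W : Set Z} {χ : Z → ℝ} (hχ : IsTest W χ) (h : EqOn f g W) :
    ∫ z, f z * χ z = ∫ z, g z * χ z := by
  refine integral_congr_ae (Eventually.of_forall fun z => ?_)
  beta_reduce
  by_cases hz : z ∈ tsupport χ
  · rw [h (hχ.supp hz)]
  · rw [image_eq_zero_of_notMem_tsupport hz, mul_zero, mul_zero]

/-- On every compact interval of time, the fields form a window. -/
def HasWindows (T L : ℝ) (b j A : Z → E3) (π : Z → ℝ) : Prop :=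
  ∀ α β, 0 < α → β < T → ∃ M C, Window L α β M C (cut (slab α β) b) (cut (slab α β) j)
    (cut (slab α β) fun z => cross (j z) (b z)) (cut (slab α β) A) ((slab α β).indicator π)

/-- The density of the distribution `div (b ⊗ b)`. -/
def tensorDiv (b j : Z → E3) (z : Z) : E3 :=
  WithLp.toLp 2 fun i => cross (j z) (b z) i + limGrad (fun z => ‖b z‖ ^ 2 / 2) i z

/-- The density of `div (b ⊗ b)` on a window. -/
def cutTensorDiv (W : Set Z) (b j : Z → E3) (i : Fin 3) (z : Z) : ℝ :=
  cut W (fun z => cross (j z) (b z)) i z + W.indicator (limGrad (fun z => ‖b z‖ ^ 2 / 2) i) z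

lemma tensorDiv_eqOn (W : Set Z) (b j : Z → E3) (i : Fin 3) :
    EqOn (fun z => tensorDiv b j z i) (cutTensorDiv W b j i) W := fun z hz => by
  simp only [tensorDiv, cutTensorDiv, cut, indicator_of_mem hz]

lemma cut_eqOn (W : Set Z) (u : Z → E3) (i : Fin 3) : EqOn (fun z => u z i) (cut W u i) W :=
  fun z hz => by simp only [cut, indicator_of_mem hz]

lemma energy_eqOn (W : Set Z) (b : Z → E3) :
    EqOn (fun z => ‖b z‖ ^ 2 / 2) (energy (cut W b)) W := fun z hz => by
  simp only [energy, cut, indicator_of_mem hz, EuclideanSpace.norm_sq_eq, Real.norm_eq_abs, sq_abs]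
  simp only [pow_two]; ring

lemma inner_eqOn (W : Set Z) (b A : Z → E3) :
    EqOn (fun z => inner ℝ (b z) (A z)) (fun z => ∑ i, cut W b i z * cut W A i z) W := fun z hz => by
  simp only [cut, indicator_of_mem hz, PiLp.inner_apply, RCLike.inner_apply, conj_trivial, mul_comm]

lemma cross_eqOn (W : Set Z) (b j A : Z → E3) (k : Fin 3) :
    EqOn (fun z => cross (tensorDiv b j z) (A z) k)
      (fun z => cutTensorDiv W b j (k + 1) z * cut W A (k + 2) z
        - cutTensorDiv W b j (k + 2) z * cut W A (k + 1) z) W := fun z hz => by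
  simp only [cross_apply, ← tensorDiv_eqOn W b j _ hz, ← cut_eqOn W A _ hz]

lemma pressure_eqOn (W : Set Z) (b : Z → E3) (π : Z → ℝ) (k : Fin 3) :
    EqOn (fun z => ((π z - ‖b z‖ ^ 2 / 2) • b z) k)
      (fun z => (W.indicator π z - energy (cut W b) z) * cut W b k z) W := fun z hz => by
  simp only [PiLp.smul_apply, smul_eq_mul, ← energy_eqOn W b hz, ← cut_eqOn W b k hz,
    indicator_of_mem hz]

lemma cubic_eqOn (W : Set Z) (b : Z → E3) (k : Fin 3) :
    EqOn (fun z => (‖b z‖ ^ 2 • b z) k)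
      (fun z => 2 * energy (cut W b) z * cut W b k z) W := fun z hz => by
  simp only [PiLp.smul_apply, smul_eq_mul, ← energy_eqOn W b hz, ← cut_eqOn W b k hz]
  ring

namespace HasWindows

lemma locInt_mul (H : HasWindows T L b j A π) (k i : Fin 3) :
    LocInt T fun z => b z k * b z i := by
  refine locInt_of_slab fun α β hα hβ => ?_
  obtain ⟨M, C, w⟩ := H α β hα hβ
  exact ⟨_, w.flow.li_bb k i, fun z hz => by
    simp only [← cut_eqOn _ b _ hz]⟩

lemma li_cutTensorDiv {M : ℝ} {C : ℝ≥0∞} (w : Window L α β M C (cut (slab α β) b) (cut (slab α β) j)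
    (cut (slab α β) fun z => cross (j z) (b z)) (cut (slab α β) A) ((slab α β).indicator π))
    (i : Fin 3) : LocallyIntegrable (cutTensorDiv (slab α β) b j i) :=
  (w.li_N i).add (w.li_limGrad (energy_eqOn _ b) i)

lemma locInt_tensorDiv (H : HasWindows T L b j A π) : LocInt T (tensorDiv b j) := by
  refine locInt_of_apply fun i => locInt_of_slab fun α β hα hβ => ?_
  obtain ⟨M, C, w⟩ := H α β hα hβ
  exact ⟨_, li_cutTensorDiv w i, tensorDiv_eqOn _ b j i⟩

lemma locInt_inner (H : HasWindows T L b j A π) : LocInt T fun z => inner ℝ (b z) (A z) := by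
  refine locInt_of_slab fun α β hα hβ => ?_
  obtain ⟨M, C, w⟩ := H α β hα hβ
  exact ⟨_, locallyIntegrable_finsetSum _ fun i _ => w.li_mul_A (w.li_b i) i, inner_eqOn _ b A⟩

lemma locInt_cross (H : HasWindows T L b j A π) :
    LocInt T fun z => cross (tensorDiv b j z) (A z) := by
  refine locInt_of_apply fun i => locInt_of_slab fun α β hα hβ => ?_
  obtain ⟨M, C, w⟩ := H α β hα hβ
  exact ⟨_, (w.li_mul_A (li_cutTensorDiv w _) _).sub (w.li_mul_A (li_cutTensorDiv w _) _),
    cross_eqOn _ b j A i⟩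

lemma locInt_pressure (H : HasWindows T L b j A π) :
    LocInt T fun z => (π z - ‖b z‖ ^ 2 / 2) • b z := by
  refine locInt_of_apply fun i => locInt_of_slab fun α β hα hβ => ?_
  obtain ⟨M, C, w⟩ := H α β hα hβ
  refine ⟨_, ?_, pressure_eqOn _ b π i⟩
  simp only [sub_mul]
  exact (w.li_pressure_mul_b i).sub (w.li_energy_mul_b i)

lemma locInt_cubic (H : HasWindows T L b j A π) : LocInt T fun z => ‖b z‖ ^ 2 • b z := by
  refine locInt_of_apply fun i => locInt_of_slab fun α β hα hβ => ?_
  obtain ⟨M, C, w⟩ := H α β hα hβ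
  refine ⟨_, ?_, cubic_eqOn _ b i⟩
  simp only [mul_assoc]
  exact (w.li_energy_mul_b i).smul (2 : ℝ)

lemma isDivTensor (H : HasWindows T L b j A π) : IsDivTensor T b (tensorDiv b j) := by
  refine ⟨H.locInt_tensorDiv, fun i k => H.locInt_mul k i, fun i => ?_⟩
  ext ψ
  obtain ⟨α, β, hα, hβ, hψ⟩ := exists_slab_isTest (isTest_coe ψ)
  obtain ⟨M, C, w⟩ := H α β hα hβ
  rw [toDistV, toDist_apply (LocInt.apply H.locInt_tensorDiv i), div_apply,
    integral_mul_congr hψ (tensorDiv_eqOn _ b j i)]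
  simp only [dx_toDist_apply (H.locInt_mul _ i), Finset.sum_neg_distrib]
  refine (w.weakDiv_tensor (energy_eqOn _ b) hψ i).symm.trans ?_
  congr 1
  refine Finset.sum_congr rfl fun k _ => (integral_mul_congr (hψ.pd _) fun z hz => ?_).symm
  simp only [← cut_eqOn _ b _ hz]

/-- The value of the helicity balance on a test function. -/
lemma balance_apply (H : HasWindows T L b j A π) (ψ : 𝓓(spaceTime T, ℝ)) {M : ℝ} {C : ℝ≥0∞}
    (w : Window L α β M C (cut (slab α β) b) (cut (slab α β) j)
      (cut (slab α β) fun z => cross (j z) (b z)) (cut (slab α β) A) ((slab α β).indicator π))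
    (hψ : IsTest (slab α β) ψ) :
    (dt (toDist T (fun z => inner ℝ (b z) (A z)))
      + div (toDistV T (fun z => cross (tensorDiv b j z) (A z)))
      + div (toDistV T (fun z => (π z - ‖b z‖ ^ 2 / 2) • b z))
      + div (toDistV T (fun z => ‖b z‖ ^ 2 • b z)) : SpaceTimeDist T) ψ
      = w.flow.fluxC hψ 0 / 2 := by
  rw [add_apply, add_apply, add_apply, dt_toDist_apply H.locInt_inner,
    div_toDistV_apply H.locInt_cross, div_toDistV_apply H.locInt_pressure,
    div_toDistV_apply H.locInt_cubic,
    w.flux_eq (energy_eqOn _ b) hψ (G := cutTensorDiv (slab α β) b j) fun i => rfl,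
    integral_mul_congr (hψ.pd tv) (inner_eqOn _ b A)]
  simp only [fun k => integral_mul_congr (hψ.pd (xv k)) (cross_eqOn _ b j A k),
    fun k => integral_mul_congr (hψ.pd (xv k)) (pressure_eqOn _ b π k),
    fun k => integral_mul_congr (hψ.pd (xv k)) (cubic_eqOn _ b k)]
  ring

lemma locInt_dmh (H : HasWindows T L b j A π) {φ : E3 → ℝ} (hφ : IsMollifier φ) {ε : ℝ}
    (hε : 0 < ε) : LocInt T (Dmh φ b ε) := by
  refine locInt_of_slab fun α β hα hβ => ?_
  obtain ⟨M, C, w⟩ := H α β hα hβ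
  exact exists_locallyIntegrable_dmh hφ hε.ne' w.memLp_b

lemma locInt_sfun (H : HasWindows T L b j A π) (r : ℝ) : LocInt T (Sfun b r) := by
  refine locInt_of_slab fun α β hα hβ => ?_
  obtain ⟨M, C, w⟩ := H α β hα hβ
  exact exists_locallyIntegrable_sfun r w.memLp_b

end HasWindows

end Balance

end EMHD

end

/-! ### Assembly of the theorem. -/

theorem theorem1p2 (T L : ℝ) (hT : 0 < T) (hL : 0 < L)
    (b j A : ℝ × EMHD.E3 → EMHD.E3) (π : ℝ × EMHD.E3 → ℝ)
    (hb : EMHD.IsWeakSolution T L b j)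
    (hA : EMHD.IsVectorPotential T L b j A π)
    (hj : EMHD.MemLinftyLp T L (3 / 2) j)
    (hAc : ContinuousOn A (EMHD.spaceTime T : Set (ℝ × EMHD.E3))) :
    ∃ D S : EMHD.SpaceTimeDist T,
      (∀ φ : EMHD.E3 → ℝ, EMHD.IsMollifier φ → EMHD.TendstoDist (EMHD.Dmh φ b) D) ∧
      EMHD.HelicityBalance T b A π D ∧
      EMHD.TendstoDist (EMHD.Sfun b) (-S) ∧
      S = -(2 / 3 : ℝ) • D := by
  have H : EMHD.HasWindows T L b j A π := fun α β hα hβ =>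
    EMHD.exists_window hL hα hβ hb hA hj hAc
  -- The distribution `D` is taken to be the left side of the balance itself, fixed by the first
  -- `rfl`, and `S` to be `-(2/3) D`, fixed by the second. Only the two limits remain to be
  -- identified.
  refine ⟨_, _, fun φ hφ => ⟨fun ε hε => H.locInt_dmh hφ hε, fun ψ => ?_⟩,
    ⟨H.locInt_inner, H.locInt_pressure, H.locInt_cubic, EMHD.tensorDiv b j, H.isDivTensor,
      H.locInt_cross, rfl⟩, ⟨fun r _ => H.locInt_sfun r, fun ψ => ?_⟩, rfl⟩
  · obtain ⟨α, β, hα, hβ, hψ⟩ := EMHD.exists_slab_isTest (EMHD.isTest_coe ψ)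
    obtain ⟨M, C, w⟩ := H α β hα hβ
    rw [H.balance_apply ψ w hψ]
    refine (EMHD.tendsto_integral_dmh w.flow hψ hφ).congr' ?_
    filter_upwards [eventually_mem_nhdsWithin] with ε hε
    rw [EMHD.toDist_apply (H.locInt_dmh hφ hε)]
    exact integral_congr_ae (Eventually.of_forall fun z => mul_comm _ _)
  · obtain ⟨α, β, hα, hβ, hψ⟩ := EMHD.exists_slab_isTest (EMHD.isTest_coe ψ)
    obtain ⟨M, C, w⟩ := H α β hα hβ
    have h := EMHD.tendsto_integral_sfun w.flow hψ
    -- The spherical limit `H(0)/3` is `2/3` of the mollified limit `H(0)/2`; the minus sign in the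
    -- definition of `S` gives `-2/3`.
    rw [show w.flow.fluxC hψ 0 / 3 = 2 / 3 * (w.flow.fluxC hψ 0 / 2) by ring,
      ← H.balance_apply ψ w hψ] at h
    simp only [neg_smul, neg_neg]
    refine h.congr fun r => ?_
    rw [EMHD.toDist_apply (H.locInt_sfun r)]
    exact integral_congr_ae (Eventually.of_forall fun z => mul_comm _ _)
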